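/- **Setting.** Fix an integer $K\ge 1$ and integers $r_1,\dots,r_K\ge 1$. For $n\ge1$ and $p_1,\dots,p_K\ge 1$ let $p=\prod_k p_k$, $p_{-k}=p/p_k$, $[m]=\{1,\dots,m\}$, and consider tensors $$\mathcal X_t=\mathcal F_t\times_1\Lambda_1\times_2\cdots\times_K\Lambda_K+\xi_t\in\mathbb R^{p_1\times\cdots\times p_K},\qquad t\in[n],$$ with deterministic $\mathcal F_t\in\mathbb R^{r_1\times\cdots\times r_K}$, $\Lambda_k\in\mathbb R^{p_k\times r_k}$ and a centred random field $\xi=\{\xi_{\mathbf i,t}: \mathbf i\in\prod_k[p_k],\,t\in\mathbb Z\}$. The model may vary with $(n,p_1,\dots,p_K)$. $\mathsf{mat}_k$ is the mode-$k$ unfolding, $\|\cdot\|$ the spectral norm, $|\cdot|_2$ the Euclidean norm. There are constants $\epsilon\in(0,1)$, $\omega,\bar\lambda,c_0,c_\epsilon>0$ and $0<\alpha^{(k)}_j\le\beta_j^{(k)}$ with $\alpha_j^{(k)}>\beta^{(k)}_{j+1}$, not depending on $(n,p_1,\dots,p_K)$, such that for all sufficiently large $(n, p_1,\dots,p_K)$: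 1. $p_k^{-1}\Lambda_k^\top\Lambda_k=\mathbf I_{r_k}$ and all entries of $\Lambda_k$ are bounded by $\bar\lambda$ in absolute value, for every $k$. 2. For every $k$ the matrix $n^{-1}\sum_{t\in[n]}\mathsf{mat}_k(\mathcal F_t)\mathsf{mat}_k(\mathcal F_t)^\top$ is diagonal, with $j$-th diagonal entry in $[\alpha^{(k)}_j,\beta^{(k)}_j]$. 3. $\|\xi_{\mathbf i,t}\|_{L^{2+2\epsilon}}\le\omega$ for all $\mathbf i,t$; $n^{-1}\sum_{t\in[n]}|\mathcal F_t|_2^\nu\le\omega^\nu$ for $\nu\in\{1+\epsilon,2,2+2\epsilon\}$; $\max(\max_{t\in[n]}|\mathcal F_t|_2,\omega)\le M_n$. Write $\alpha(\mathcal A,\mathcal B)=\sup_{A\in\mathcal A,B\in\mathcal B}|\mathsf P(A\cap B)-\mathsf P(A)\mathsf P(B)|$ and $S(b)=n^{-1}\sum_{t,u\in[n]}|\mathcal F_t|_2^{1+\epsilon}|\mathcal F_u|_2^{1+\epsilon}e^{-b|t-u|}$. One of the following two assumptions holds. * (Ind) The time series $\{\xi_{\mathbf i,t}\}_{t\in\mathbb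 Z}$, $\mathbf i\in\prod_k[p_k]$, are mutually independent; $\alpha(\sigma\{\xi_{\mathbf i,u}:u\le t\},\sigma\{\xi_{\mathbf i,v}:v\ge t+m\})\le e^{-c_0m}$ for all $\mathbf i$, $t$ and $m\ge0$; and $S\big(\tfrac{c_0\epsilon}{1+\epsilon}\big)\le\omega^{2+2\epsilon}c_\epsilon$ and $S\big(\tfrac{c_0}{3\log(np_{-k})}\big)\le\omega^{2+2\epsilon}c_\epsilon\log(np_{-k})$ for all $k$. * (RF) For all $m\ge0$ and all sets $\mathcal E_1,\mathcal E_2$ of indices $(\mathbf i,t)$ such that $\max(\max_k|i_k-j_k|,|t-u|)\ge m$ for all $(\mathbf i,t)\in\mathcal E_1$, $(\mathbf j,u)\in\mathcal E_2$, the $\sigma$-algebras generated by $\xi$ on $\mathcal E_1$ and on $\mathcal E_2$ have $\alpha$-coefficient at most $e^{-c_0m}$; and $S\big(\tfrac{c_0\epsilon}{K(1+\epsilon)}\big)\le\omega^{2+2\epsilon}c_\epsilon K$ and $S\big(\tfrac{c_0}{3K\log(np)}\big)\le\omega^{2+2\epsilon}c_\epsilon K\log(np)$. Let $L_k=\log(np_{-k})$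 under (Ind) and $L_k=\log^K(np)$ under (RF), and put $$\tau^{(k)}_{n,p}=\omega\Big(\frac{np_{-k}}{L_k}\Big)^{\frac1{2+2\epsilon}},\quad \psi^{(k)}_{n,p}=\omega^2\Big(\frac{L_k}{np_{-k}}\Big)^{\frac{\epsilon}{1+\epsilon}},\quad \bar\psi^{(k)}_{n,p}=\sum_{k'\ne k}\psi^{(k')}_{n,p},\quad\bar\psi_{n,p}=\sum_{k}\psi^{(k)}_{n,p}.$$ Let the truncation parameters $\tau_k>0$ satisfy $\tau_k\asymp\tau^{(k)}_{n,p}$ for each $k$, and assume $M_n\max_k(\tau^{(k)}_{n,p})^{-1}\log^{1/(2\epsilon)}(np_{-k})=o(1)$. **Estimators.** Let $\mathcal X_t^{\mathrm{tr}}(\tau)$ have the entries $\mathrm{sign}(X_{\mathbf i,t})(|X_{\mathbf i,t}|\wedge\tau)$. The columns of $\widehat{\mathbf E}_k$ are orthonormal eigenvectors for the $r_k$ largest eigenvalues, in decreasing order, of $\frac1{np_{-k}}\sum_{t\in[n]}\mathsf{mat}_k(\mathcal X_t^{\mathrm{tr}}(\tau_k))\mathsf{mat}_k(\mathcal X_t^{\mathrm{tr}}(\tau_k))^\top$.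 With $\widehat{\mathbf D}_k=\widehat{\mathbf E}_K\otimes\cdots\otimes\widehat{\mathbf E}_{k+1}\otimes\widehat{\mathbf E}_{k-1}\otimes\cdots\otimes\widehat{\mathbf E}_1$, the columns of $\check{\mathbf E}^{[1]}_k$ are orthonormal eigenvectors for the $r_k$ largest eigenvalues, in decreasing order, of $\frac1{np_{-k}}\sum_{t\in[n]}\mathsf{mat}_k(\mathcal X_t^{\mathrm{tr}}(\tau_k))\widehat{\mathbf D}_k\widehat{\mathbf D}_k^\top\mathsf{mat}_k(\mathcal X_t^{\mathrm{tr}}(\tau_k))^\top$, and $\check\Lambda_k^{[1]}=\sqrt{p_k}\,\check{\mathbf E}^{[1]}_k$. **Theorem.** For each $k\in[K]$ there is a random matrix $\check{\mathbf H}_k^{[1]}\in\mathbb R^{r_k\times r_k}$ with $(\check{\mathbf H}^{[1]}_k)^\top\check{\mathbf H}^{[1]}_k=\mathbf I_{r_k}+o_P(1)$ (element-wise) such that, as $\min(n,p_1,\dots,p_K)\to\infty$, $$\frac1{\sqrt{p_k}}\big\|\check\Lambda_k^{[1]}-\Lambda_k\check{\mathbf H}_k^{[1]}\big\|=O_P\Big[\frac{M_n^{1-\epsilon}}{\sqrt{np_{-k}}}\vee\frac1p\vee\bar\psi^{(k)}_{n,p}\Big(\frac{\psi^{(k)}_{n,p}}{\sqrt{p_k}}+\frac{M_n^{1-\epsilon}}{\sqrt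 n}\Big)\vee\frac{\bar\psi_{n,p}}{\sqrt p}\Big]$$ under (Ind), and $$\frac1{\sqrt{p_k}}\big\|\check\Lambda_k^{[1]}-\Lambda_k\check{\mathbf H}_k^{[1]}\big\|=O_P\Big[\frac{M_n^{1-\epsilon}}{\sqrt{np_{-k}}}\vee\frac1p\vee\psi^{(k)}_{n,p}\vee\frac{M_n^{1-\epsilon}\bar\psi^{(k)}_{n,p}}{\sqrt n}\Big]$$ under (RF). -/

import Mathlib

open MeasureTheory ProbabilityTheory Filter Topology Asymptotics

noncomputable section

/-! ### Tensors, unfoldings, Kronecker products -/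

/-- Real tensors (multi-way arrays) of dimension `d 0 × ⋯ × d (K - 1)`. -/
abbrev Tensor {K : ℕ} (d : Fin K → ℕ) : Type := (∀ k, Fin (d k)) → ℝ

/-- Multi-indices for all modes but the `k`-th one. -/
abbrev OtherIndex {K : ℕ} (d : Fin K → ℕ) (k : Fin K) : Type :=
  ∀ l : {l : Fin K // l ≠ k}, Fin (d l)

/-- Mode-`k` unfolding: entry `(a, ℓ)` is the tensor entry whose `k`-th index is `a` and whose
other indices are `ℓ`. The columns are labelled by the multi-indices of the other modes. -/
def matUnfold {K : ℕ} {d : Fin K → ℕ} (k : Fin K) (X : Tensor d) :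
    Matrix (Fin (d k)) (OtherIndex d k) ℝ :=
  Matrix.of fun a ℓ => X ((Equiv.piSplitAt k fun l => Fin (d l)).symm (a, ℓ))

/-- Tucker product `F ×₁ Λ₁ ×₂ ⋯ ×_K Λ_K`. -/
def tucker {K : ℕ} {r d : Fin K → ℕ} (F : Tensor r)
    (Λ : ∀ k, Matrix (Fin (d k)) (Fin (r k)) ℝ) : Tensor d :=
  fun i => ∑ j : (∀ k, Fin (r k)), F j * ∏ k, Λ k (i k) (j k)

/-- Kronecker product of all matrices but the `k`-th one, with rows and columns labelled by the
multi-indices of the other modes. -/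
def kronExcept {K : ℕ} {d r : Fin K → ℕ} (k : Fin K)
    (E : ∀ l, Matrix (Fin (d l)) (Fin (r l)) ℝ) : Matrix (OtherIndex d k) (OtherIndex r k) ℝ :=
  Matrix.of fun ℓ q => ∏ l : {l : Fin K // l ≠ k}, E l (ℓ l) (q l)

/-- Euclidean (Frobenius) norm of a tensor. -/
def tensorNorm {K : ℕ} {d : Fin K → ℕ} (X : Tensor d) : ℝ := Real.sqrt (∑ i, X i ^ 2)

open scoped Matrix.Norms.L2Operator in
/-- Spectral norm (`ℓ²` operator norm) of a matrix. -/
def specNorm {m n : Type} [Fintype m] [Fintype n] [DecidableEq n] (A : Matrix m n ℝ) : ℝ := ‖A‖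

/-- The product of all dimensions. -/
def dimProd {K : ℕ} (p : Fin K → ℕ) : ℕ := ∏ l, p l

/-- The product of all dimensions but the `k`-th one. -/
def dimProdExcept {K : ℕ} (p : Fin K → ℕ) (k : Fin K) : ℕ := ∏ l ∈ Finset.univ.erase k, p l

/-! ### Truncation and leading eigenvectors -/

/-- Truncation `sign(x) (|x| ∧ τ)`. -/
def truncate (τ x : ℝ) : ℝ := Real.sign x * min |x| τ

/-- The columns of `E` are orthonormal eigenvectors of `S` belonging to its `r` largest
eigenvalues, in decreasing order: they are the first `r` columns of an orthogonal matrix of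
eigenvectors whose eigenvalues are listed in decreasing order. -/
def IsLeadingEigenvectors {m r : ℕ} (S : Matrix (Fin m) (Fin m) ℝ)
    (E : Matrix (Fin m) (Fin r) ℝ) : Prop :=
  ∃ (h : r ≤ m) (V : Matrix (Fin m) (Fin m) ℝ) (μ : Fin m → ℝ),
    Antitone μ ∧ V.transpose * V = 1 ∧ S * V = V * Matrix.diagonal μ ∧
    ∀ a j, E a j = V a (Fin.castLE h j)

/-! ### Mixing coefficients -/

/-- The `α`-mixing coefficient of two `σ`-algebras. -/
def alphaCoef {Ω : Type*} [MeasurableSpace Ω] (P : Measure Ω) (𝒜 ℬ : MeasurableSpace Ω) : ℝ :=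
  ⨆ S : {A : Set Ω // MeasurableSet[𝒜] A} × {B : Set Ω // MeasurableSet[ℬ] B},
    |P.real (S.1.1 ∩ S.2.1) - P.real S.1.1 * P.real S.2.1|

/-- Sup-norm distance of two space-time locations. -/
def siteDist {K : ℕ} {p : Fin K → ℕ} (x y : (∀ k, Fin (p k)) × ℤ) : ℕ :=
  max (Finset.univ.sup fun k => ((x.1 k : ℤ) - (y.1 k : ℤ)).natAbs) (x.2 - y.2).natAbs

/-- Distance of two sets of space-time locations (infinite if one of them is empty). -/
def siteSetDist {K : ℕ} {p : Fin K → ℕ} (E₁ E₂ : Set ((∀ k, Fin (p k)) × ℤ)) : ℕ∞ :=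
  ⨅ x ∈ E₁, ⨅ y ∈ E₂, (siteDist x y : ℕ∞)

/-! ### The Tucker factor model -/

/-- The ingredients of a tensor factor model with `K` modes and factor numbers `r`, at one sample
size: sample length `n`, dimensions `p`, loadings, (deterministic) factors `F t` for `t = 1, …, n`
(other values of `t` play no role) and a centred random field of idiosyncratic components. -/
structure TensorFactorModel (K : ℕ) (r : Fin K → ℕ) (Ω : Type*) [MeasurableSpace Ω] where
  n : ℕ
  p : Fin K → ℕ
  P : Measure Ω
  isProb : IsProbabilityMeasure P
  Λ : ∀ k, Matrix (Fin (p k)) (Fin (r k)) ℝ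
  F : ℕ → Tensor r
  ξ : (∀ k, Fin (p k)) → ℤ → Ω → ℝ
  measurable_ξ : ∀ i t, Measurable (ξ i t)
  integrable_ξ : ∀ i t, Integrable (ξ i t) P
  mean_ξ : ∀ i t, ∫ w, ξ i t w ∂P = 0

namespace TensorFactorModel

variable {K : ℕ} {r : Fin K → ℕ} {Ω : Type*} [MeasurableSpace Ω]

/-- The data `𝒳ₜ = Fₜ ×₁ Λ₁ ⋯ ×_K Λ_K + ξₜ`. -/
def X (m : TensorFactorModel K r Ω) (t : ℕ) (w : Ω) : Tensor m.p :=
  fun i => tucker (m.F t) m.Λ i + m.ξ i (t : ℤ) w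

/-- The element-wise truncated data. -/
def Xtrunc (m : TensorFactorModel K r Ω) (τ : ℝ) (t : ℕ) (w : Ω) : Tensor m.p :=
  fun i => truncate τ (m.X t w i)

/-- `n p₋ₖ`, as a real number. -/
def np (m : TensorFactorModel K r Ω) (k : Fin K) : ℝ := (m.n : ℝ) * (dimProdExcept m.p k : ℝ)

/-- `p`, as a real number. -/
def pTot (m : TensorFactorModel K r Ω) : ℝ := (dimProd m.p : ℝ)

/-- Mode-`k` second moment matrix of the truncated data. -/
def gammaHat (m : TensorFactorModel K r Ω) (τ : ℝ) (k : Fin K) (w : Ω) :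
    Matrix (Fin (m.p k)) (Fin (m.p k)) ℝ :=
  (m.np k)⁻¹ • ∑ t ∈ Finset.Icc 1 m.n,
    matUnfold k (m.Xtrunc τ t w) * (matUnfold k (m.Xtrunc τ t w)).transpose

/-- Mode-`k` second moment matrix of the truncated data projected onto the Kronecker product of
the matrices `E l`, `l ≠ k`. -/
def gammaCheck (m : TensorFactorModel K r Ω) (τ : ℝ) (k : Fin K)
    (E : ∀ l, Matrix (Fin (m.p l)) (Fin (r l)) ℝ) (w : Ω) :
    Matrix (Fin (m.p k)) (Fin (m.p k)) ℝ :=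
  (m.np k)⁻¹ • ∑ t ∈ Finset.Icc 1 m.n,
    matUnfold k (m.Xtrunc τ t w) * kronExcept k E * (kronExcept k E).transpose *
      (matUnfold k (m.Xtrunc τ t w)).transpose

/-- Mode-`k` second moment matrix of the factors. -/
def gammaF (m : TensorFactorModel K r Ω) (k : Fin K) : Matrix (Fin (r k)) (Fin (r k)) ℝ :=
  (m.n : ℝ)⁻¹ • ∑ t ∈ Finset.Icc 1 m.n,
    matUnfold k (m.F t) * (matUnfold k (m.F t)).transpose

/-! ### Assumptions -/

/-- Orthonormal (up to scale) and bounded loadings. -/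
def LoadingAssumption (m : TensorFactorModel K r Ω) (lam : ℝ) : Prop :=
  ∀ k, (m.p k : ℝ)⁻¹ • ((m.Λ k).transpose * m.Λ k) = 1 ∧ ∀ i j, |m.Λ k i j| ≤ lam

/-- `Γ_f^{(k)}` is diagonal and its `j`-th diagonal entry lies in `[α k j, β k j]`. -/
def FactorAssumption (m : TensorFactorModel K r Ω) (α β : ∀ k, Fin (r k) → ℝ) : Prop :=
  ∀ k, (m.gammaF k).IsDiag ∧ ∀ j, α k j ≤ m.gammaF k j j ∧ m.gammaF k j j ≤ β k j

/-- Moments of the idiosyncratic components and of the factors; bound `M` on the factors. -/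
def MomentAssumption (m : TensorFactorModel K r Ω) (ε ω M : ℝ) : Prop :=
  (∀ i t, eLpNorm (m.ξ i t) (ENNReal.ofReal (2 + 2 * ε)) m.P ≤ ENNReal.ofReal ω) ∧
  (∀ ν : ℝ, ν = 1 + ε ∨ ν = 2 ∨ ν = 2 + 2 * ε →
    (m.n : ℝ)⁻¹ * ∑ t ∈ Finset.Icc 1 m.n, tensorNorm (m.F t) ^ ν ≤ ω ^ ν) ∧
  (∀ t ∈ Finset.Icc 1 m.n, tensorNorm (m.F t) ≤ M) ∧ ω ≤ M

/-- `n⁻¹ ∑_{t,u} |F_t|^{1+ε} |F_u|^{1+ε} exp(- b |t - u|)`. -/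
def factorMixingSum (m : TensorFactorModel K r Ω) (ε b : ℝ) : ℝ :=
  (m.n : ℝ)⁻¹ * ∑ t ∈ Finset.Icc 1 m.n, ∑ u ∈ Finset.Icc 1 m.n,
    tensorNorm (m.F t) ^ (1 + ε) * tensorNorm (m.F u) ^ (1 + ε) *
      Real.exp (-(b * |(t : ℝ) - (u : ℝ)|))

/-- The `σ`-algebra generated by the idiosyncratic components at the locations in `E`. -/
@[reducible]
def sigmaField (m : TensorFactorModel K r Ω) (E : Set ((∀ k, Fin (m.p k)) × ℤ)) :
    MeasurableSpace Ω :=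
  ⨆ x ∈ E, MeasurableSpace.comap (m.ξ x.1 x.2) inferInstance

/-- Cross-sectional independence: the time series `{ξ_{i,t}}_t` are mutually independent over `i`,
each is `α`-mixing at an exponential rate, and the factors are weakly dependent. -/
def IndependenceAssumption (m : TensorFactorModel K r Ω) (ε ω c₀ cε : ℝ) : Prop :=
  iIndepFun (fun i : (∀ k, Fin (m.p k)) => fun w => fun t : ℤ => m.ξ i t w) m.P ∧
  (∀ (i : ∀ k, Fin (m.p k)) (t : ℤ) (h : ℕ),
    alphaCoef m.P (m.sigmaField {x | x.1 = i ∧ x.2 ≤ t})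
      (m.sigmaField {x | x.1 = i ∧ t + h ≤ x.2}) ≤ Real.exp (-(c₀ * h))) ∧
  ∀ k,
    m.factorMixingSum ε (c₀ * ε / (1 + ε)) ≤ ω ^ (2 + 2 * ε) * cε ∧
    m.factorMixingSum ε (c₀ / (3 * Real.log (m.np k))) ≤
      ω ^ (2 + 2 * ε) * cε * Real.log (m.np k)

/-- Random field mixing: the field `ξ` is strongly mixing at an exponential rate over space and
time, and the factors are weakly dependent. -/
def RandomFieldAssumption (m : TensorFactorModel K r Ω) (ε ω c₀ cε : ℝ) : Prop :=
  (∀ (h : ℕ) (E₁ E₂ : Set ((∀ k, Fin (m.p k)) × ℤ)), (h : ℕ∞) ≤ siteSetDist E₁ E₂ →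
    alphaCoef m.P (m.sigmaField E₁) (m.sigmaField E₂) ≤ Real.exp (-(c₀ * h))) ∧
  m.factorMixingSum ε (c₀ * ε / (K * (1 + ε))) ≤ ω ^ (2 + 2 * ε) * cε * K ∧
  m.factorMixingSum ε (c₀ / (3 * K * Real.log (m.n * m.pTot))) ≤
    ω ^ (2 + 2 * ε) * cε * K * Real.log (m.n * m.pTot)

end TensorFactorModel

/-- The two alternative dependence settings. -/
inductive DependenceSetting : Type
  | independent : DependenceSetting
  | randomField : DependenceSetting

namespace TensorFactorModel

variable {K : ℕ} {r : Fin K → ℕ} {Ω : Type*} [MeasurableSpace Ω]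

/-- The dependence assumption made in the setting `s`. -/
def DependenceAssumption (m : TensorFactorModel K r Ω) (s : DependenceSetting)
    (ε ω c₀ cε : ℝ) : Prop :=
  match s with
  | .independent => m.IndependenceAssumption ε ω c₀ cε
  | .randomField => m.RandomFieldAssumption ε ω c₀ cε

/-! ### Rates -/

/-- The logarithmic factor: `log(n p₋ₖ)` under independence, `log^K(n p)` for random fields. -/
def logFactor (m : TensorFactorModel K r Ω) (s : DependenceSetting) (k : Fin K) : ℝ :=
  match s with
  | .independent => Real.log (m.np k)
  | .randomField => Real.log (m.n * m.pTot) ^ K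

/-- The order `τ^{(k)}_{n,p}` of the truncation parameter. -/
def tauScale (m : TensorFactorModel K r Ω) (s : DependenceSetting) (ε ω : ℝ) (k : Fin K) : ℝ :=
  ω * (m.np k / m.logFactor s k) ^ (1 / (2 + 2 * ε))

/-- `ψ^{(k)}_{n,p}`. -/
def psi (m : TensorFactorModel K r Ω) (s : DependenceSetting) (ε ω : ℝ) (k : Fin K) : ℝ :=
  ω ^ 2 * (m.logFactor s k / m.np k) ^ (ε / (1 + ε))

/-- The sum of `ψ^{(l)}_{n,p}` over `l ≠ k`. -/
def psiBarExcept (m : TensorFactorModel K r Ω) (s : DependenceSetting) (ε ω : ℝ)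
    (k : Fin K) : ℝ :=
  ∑ l ∈ Finset.univ.erase k, m.psi s ε ω l

/-- The sum of all `ψ^{(l)}_{n,p}`. -/
def psiBar (m : TensorFactorModel K r Ω) (s : DependenceSetting) (ε ω : ℝ) : ℝ :=
  ∑ l, m.psi s ε ω l

/-- The rate of the first-iteration loading estimator. -/
def firstIterationRate (m : TensorFactorModel K r Ω) (s : DependenceSetting) (ε ω M : ℝ)
    (k : Fin K) : ℝ :=
  match s with
  | .independent =>
      max (max (max (M ^ (1 - ε) / Real.sqrt (m.np k)) (1 / m.pTot))
        (m.psiBarExcept .independent ε ω k *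
          (m.psi .independent ε ω k / Real.sqrt (m.p k) + M ^ (1 - ε) / Real.sqrt m.n)))
        (m.psiBar .independent ε ω / Real.sqrt m.pTot)
  | .randomField =>
      max (max (max (M ^ (1 - ε) / Real.sqrt (m.np k)) (1 / m.pTot))
        (m.psi .randomField ε ω k))
        (M ^ (1 - ε) * m.psiBarExcept .randomField ε ω k / Real.sqrt m.n)

end TensorFactorModel

/-! ### Stochastic order symbols along a filter -/

/-- `Y = O_P(a)` along the filter `l`; each `Y i` lives on its own probability space. -/
def IsBigOP {ι : Type*} (l : Filter ι) {Ω : ι → Type*} [∀ i, MeasurableSpace (Ω i)]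
    (P : ∀ i, Measure (Ω i)) (Y : ∀ i, Ω i → ℝ) (a : ι → ℝ) : Prop :=
  ∀ δ : ℝ, 0 < δ → ∃ C : ℝ, 0 < C ∧
    ∀ᶠ i in l, P i {w | C * a i < |Y i w|} ≤ ENNReal.ofReal δ

/-- `Y = o_P(1)` along the filter `l`. -/
def IsLittleOPOne {ι : Type*} (l : Filter ι) {Ω : ι → Type*} [∀ i, MeasurableSpace (Ω i)]
    (P : ∀ i, Measure (Ω i)) (Y : ∀ i, Ω i → ℝ) : Prop :=
  ∀ δ : ℝ, 0 < δ → Tendsto (fun i => P i {w | δ < |Y i w|}) l (𝓝 0)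

end

/-! Unfold the truncated data along mode `k`, write the unfoldings of all times side by side and
scale by `(n p)^(-1/2)`. The result is `U G + (B + N)`: `U = Λ_k / √p_k` is orthonormal, `G` carries
the factors, `B` is the deterministic truncation bias and `N` the centred truncated noise
(`dataMat_eq`). Up to the scalar `p_k`, both estimators consist of leading eigenvectors `E` of `(U G
+ B + N) Q (U G + B + N)ᵀ`, with `Q = 1` for the initial one and `Q = 1 ⊗ P̂` for the iterated one,
where `P̂` is the Kronecker projection built from the initial estimators of the other modes.
Multiplying the eigenvalue equation by `1 - U Uᵀ` annihilates the signal on the left. Once the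
leading eigenvalues are at least `κ`, the loss `‖(1 - U Uᵀ) E‖` is thus at most `κ⁻¹ ‖(B + N) Q (U G
+ B + N)ᵀ E‖` (`leading_loss_le`). With `H = Uᵀ E` this loss controls the normalized loading error
as well as `Hᵀ H - 1`. What remains is to bound `B`, `N Q Gᵀ` and `N Q Nᵀ`.

The difficulty is that `P̂` depends on the same noise. It is compared with a deterministic
projection `P₀`, built from the leading eigenvectors of the mean matrices `U G (U G)ᵀ + 𝔼 N Nᵀ` of
the other modes. Relative to the loadings themselves, the bound on the loss of an initial estimator
contains a term of order `1 / p_l` caused by `𝔼 N Nᵀ`; relative to the mean matrices this term is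
absent, so `‖P̂ - P₀‖ = O_P(ψ̄⁽ᵏ⁾)` (`leading_perturbation_le`, `frobenius_sq_kron_proj_sub_le`).
Now `N (1 ⊗ P) Nᵀ` is linear in `P`. Its mean part is of order `1 / p` in operator norm for every
projection of the given rank (`meanGram_bilinear_le`). Its centred part at `P₀` is a statistic whose
variance can be computed. Its centred part at `P̂ - P₀` is at most `‖P̂ - P₀‖` times the norm of all
centred sample covariances, by Cauchy–Schwarz (`frobenius_sq_fluctGram_le`). The term `N (1 ⊗ P) Gᵀ`
is treated alike. This produces the products with `ψ̄⁽ᵏ⁾` in the rate (`first_iteration_loss_le`).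

The probabilistic input consists of second moments and Markov's inequality (`exists_noiseStat`).
Correlations of the noise are summable by a Davydov-type inequality using the moments of order `2 +
2ε`. Products of noise variables have second moments of order `τ^(2-2ε)`, while the covariance
inequality for bounded variables gives `τ⁴ e^(-c₀ d)`. Interpolating with exponent `θ = 1 / log`
costs a constant and slows the decay by a logarithm (`le_of_moment_of_mixing`), which is the source
of the factors `L_k`. For independent series, products over different pairs of sites are
uncorrelated and only the diagonal pairs need fourth moments; for random fields a Schur test over
the other modes and time replaces orthogonality.

The resulting bound has no factor `M^(1-ε)`; since `M ≥ ω`, the stated rate dominates it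
(`exists_lossRate_le`). For random fields a surplus factor `√(log(n p) / p_k)` has to be absorbed
(`exists_psiBarExcept_mul_le`). -/

section LinearAlgebra

/-! ### Frobenius norms, projections and quadratic forms. -/

open scoped Matrix Matrix.Norms.Frobenius

variable {m n q : Type*} [Fintype m] [Fintype n] [Fintype q]

theorem frobenius_sq (A : Matrix m n ℝ) : ‖A‖ ^ 2 = ∑ i, ∑ j, A i j ^ 2 := by
  rw [Matrix.frobenius_norm_def, ← Real.sqrt_eq_rpow, Real.sq_sqrt (by positivity)]
  simp

theorem frobenius_sq_eq_trace (A : Matrix m n ℝ) : ‖A‖ ^ 2 = (Aᵀ * A).trace := by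
  rw [frobenius_sq, Matrix.trace, Finset.sum_comm]
  simp [Matrix.mul_apply, sq]

theorem frobenius_sq_eq_trace' (A : Matrix m n ℝ) : ‖A‖ ^ 2 = (A * Aᵀ).trace := by
  rw [frobenius_sq_eq_trace, Matrix.trace_mul_comm]

theorem frobenius_sq_of_orthonormal [DecidableEq n] {U : Matrix m n ℝ} (h : Uᵀ * U = 1) :
    ‖U‖ ^ 2 = Fintype.card n := by
  rw [frobenius_sq_eq_trace, h, Matrix.trace_one]

theorem frobenius_of_orthonormal [DecidableEq n] {U : Matrix m n ℝ} (h : Uᵀ * U = 1) :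
    ‖U‖ = Real.sqrt (Fintype.card n) := by
  rw [← frobenius_sq_of_orthonormal h, Real.sqrt_sq (norm_nonneg _)]

/-- The Frobenius norm does not increase under an orthogonal projection. -/
theorem frobenius_mul_proj_le [DecidableEq n] (X : Matrix m n ℝ) {Q : Matrix n n ℝ} (hs : Qᵀ = Q)
    (hi : Q * Q = Q) : ‖X * Q‖ ≤ ‖X‖ := by
  have key : ‖X‖ ^ 2 = ‖X * Q‖ ^ 2 + ‖X * (1 - Q)‖ ^ 2 := by
    have h1 : (X * Q) * (X * Q)ᵀ = X * Q * Xᵀ := by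
      rw [Matrix.transpose_mul, hs, Matrix.mul_assoc X Q, ← Matrix.mul_assoc Q Q, hi,
        Matrix.mul_assoc]
    have h2 : (X * (1 - Q)) * (X * (1 - Q))ᵀ = X * Xᵀ - X * Q * Xᵀ := by
      have : (1 - Q) * (1 - Q) = 1 - Q := by
        rw [sub_mul, mul_sub, mul_sub, hi]; simp
      rw [Matrix.transpose_mul, Matrix.transpose_sub, hs, Matrix.transpose_one, Matrix.mul_assoc X,
        ← Matrix.mul_assoc (1 - Q), this, ← Matrix.mul_assoc, Matrix.mul_sub, Matrix.sub_mul,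
        Matrix.mul_one]
    rw [frobenius_sq_eq_trace', frobenius_sq_eq_trace', frobenius_sq_eq_trace', h1, h2,
      Matrix.trace_sub]
    ring
  nlinarith [norm_nonneg X, norm_nonneg (X * Q), sq_nonneg ‖X * (1 - Q)‖]

theorem frobenius_proj_mul_le [DecidableEq n] (X : Matrix n m ℝ) {Q : Matrix n n ℝ} (hs : Qᵀ = Q)
    (hi : Q * Q = Q) : ‖Q * X‖ ≤ ‖X‖ := by
  rw [← Matrix.frobenius_norm_transpose, Matrix.transpose_mul, hs,
    ← Matrix.frobenius_norm_transpose X]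
  exact frobenius_mul_proj_le _ hs hi

/-- The matrices to be estimated have a fixed number of columns, so the Frobenius norm loses only a
constant. The whole proof works with it and returns to the spectral norm only at the end. -/
theorem specNorm_le_frobenius {m n : Type} [Fintype m] [Fintype n] [DecidableEq n]
    (A : Matrix m n ℝ) : specNorm A ≤ ‖A‖ := by
  unfold specNorm
  rw [Matrix.l2_opNorm_def]
  refine ContinuousLinearMap.opNorm_le_bound _ (norm_nonneg _) fun x => ?_
  have h1 : ((Matrix.toEuclideanLin (𝕜 := ℝ) (m := m) (n := n)).trans
      LinearMap.toContinuousLinearMap A) x = WithLp.toLp 2 (A *ᵥ x.ofLp) := rfl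
  rw [h1, ← Matrix.frobenius_norm_replicateCol (ι := Unit) (A *ᵥ x.ofLp)]
  have h2 : Matrix.replicateCol Unit (A *ᵥ x.ofLp) = A * Matrix.replicateCol Unit x.ofLp := by
    ext i j; simp [Matrix.mulVec, Matrix.mul_apply, dotProduct]
  rw [h2]
  refine (Matrix.frobenius_norm_mul _ _).trans ?_
  rw [Matrix.frobenius_norm_replicateCol]

theorem dotProduct_mulVec_self (A : Matrix m n ℝ) (v : n → ℝ) :
    (A *ᵥ v) ⬝ᵥ (A *ᵥ v) = v ⬝ᵥ ((Aᵀ * A) *ᵥ v) := by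
  rw [← Matrix.mulVec_mulVec, Matrix.dotProduct_mulVec v, Matrix.vecMul_transpose]

theorem dotProduct_self_nonneg' (v : n → ℝ) : 0 ≤ v ⬝ᵥ v := by
  exact Finset.sum_nonneg fun i _ => mul_self_nonneg (v i)

theorem dotProduct_mulVec_le_frobenius (A : Matrix n n ℝ) (v : n → ℝ) :
    v ⬝ᵥ (A *ᵥ v) ≤ ‖A‖ * (v ⬝ᵥ v) := by
  have h1 : v ⬝ᵥ (A *ᵥ v) = ∑ i, ∑ j, A i j * (v i * v j) := by
    simp only [dotProduct, Matrix.mulVec, Finset.mul_sum]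
    exact Finset.sum_congr rfl fun i _ => Finset.sum_congr rfl fun j _ => by ring
  have h2 : (∑ x : n × n, A x.1 x.2 * (v x.1 * v x.2)) ^ 2 ≤
      (∑ x : n × n, A x.1 x.2 ^ 2) * ∑ x : n × n, (v x.1 * v x.2) ^ 2 :=
    Finset.sum_mul_sq_le_sq_mul_sq _ _ _
  have h3 : ∑ x : n × n, (v x.1 * v x.2) ^ 2 = (v ⬝ᵥ v) ^ 2 := by
    rw [Fintype.sum_prod_type, sq, dotProduct, Finset.sum_mul_sum]
    exact Finset.sum_congr rfl fun i _ => Finset.sum_congr rfl fun j _ => by ring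
  rw [h3, Fintype.sum_prod_type, Fintype.sum_prod_type] at h2
  dsimp only at h2
  rw [← frobenius_sq, ← h1, ← mul_pow] at h2
  exact (abs_le_of_sq_le_sq' h2 (mul_nonneg (norm_nonneg _) (dotProduct_self_nonneg' v))).2

/-- Columnwise comparison of Frobenius norms. -/
theorem frobenius_sq_mul_le (A : Matrix m n ℝ) (E : Matrix n q ℝ) {c : ℝ}
    (h : ∀ v, (A *ᵥ v) ⬝ᵥ (A *ᵥ v) ≤ c * (v ⬝ᵥ v)) : ‖A * E‖ ^ 2 ≤ c * ‖E‖ ^ 2 := by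
  rw [frobenius_sq, frobenius_sq, Finset.sum_comm, Finset.sum_comm (f := fun i j => E i j ^ 2),
    Finset.mul_sum]
  refine Finset.sum_le_sum fun j _ => ?_
  have := h fun i => E i j
  simpa [dotProduct, Matrix.mulVec, Matrix.mul_apply, sq] using this

/-! ### Leading eigenvectors -/

section Eigen

variable {d r : ℕ}

theorem orthogonal_expansion {V S : Matrix (Fin d) (Fin d) ℝ} {μ : Fin d → ℝ}
    (hV : Vᵀ * V = 1) (hS : S * V = V * Matrix.diagonal μ) (c : Fin d → ℝ) :
    (V *ᵥ c) ⬝ᵥ (V *ᵥ c) = ∑ i, c i ^ 2 ∧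
      (V *ᵥ c) ⬝ᵥ (S *ᵥ (V *ᵥ c)) = ∑ i, μ i * c i ^ 2 := by
  constructor
  · rw [dotProduct_mulVec_self, hV, Matrix.one_mulVec]; simp [dotProduct, sq]
  · rw [Matrix.mulVec_mulVec, hS, ← Matrix.mulVec_mulVec, Matrix.dotProduct_mulVec,
      ← Matrix.mulVec_transpose, Matrix.mulVec_mulVec, hV, Matrix.one_mulVec]
    simp only [dotProduct, Matrix.mulVec_diagonal]
    exact Finset.sum_congr rfl fun i _ => by ring

theorem IsLeadingEigenvectors.orthonormal {S : Matrix (Fin d) (Fin d) ℝ}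
    {E : Matrix (Fin d) (Fin r) ℝ} (h : IsLeadingEigenvectors S E) : Eᵀ * E = 1 := by
  obtain ⟨h, V, μ, -, hV, -, hE⟩ := h
  ext i j
  have := congrFun (congrFun hV (Fin.castLE h i)) (Fin.castLE h j)
  simp only [Matrix.mul_apply, Matrix.transpose_apply, hE] at this ⊢
  rw [this]
  simp [Matrix.one_apply]

theorem IsLeadingEigenvectors.smul {S : Matrix (Fin d) (Fin d) ℝ}
    {E : Matrix (Fin d) (Fin r) ℝ} (h : IsLeadingEigenvectors S E) {c : ℝ} (hc : 0 ≤ c) :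
    IsLeadingEigenvectors (c • S) E := by
  obtain ⟨h, V, μ, hμ, hV, hS, hE⟩ := h
  refine ⟨h, V, c • μ, fun i j hij => mul_le_mul_of_nonneg_left (hμ hij) hc, hV, ?_, hE⟩
  rw [Matrix.smul_mul, hS, ← Matrix.mul_smul, Matrix.diagonal_smul]

theorem exists_isLeadingEigenvectors {S : Matrix (Fin d) (Fin d) ℝ} (hS : Sᵀ = S) (hr : r ≤ d) :
    ∃ E : Matrix (Fin d) (Fin r) ℝ, IsLeadingEigenvectors S E := by
  have hH : S.IsHermitian := by
    rw [Matrix.IsHermitian, Matrix.conjTranspose_eq_transpose_of_trivial, hS]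
  let e : Fin (Fintype.card (Fin d)) ≃ Fin d := Fintype.equivOfCardEq (Fintype.card_fin _)
  -- `eigenvalues` is the decreasing list `eigenvalues₀` reindexed by the inverse of the equivalence
  -- `e`. Composing with `f` undoes this and restores the decreasing order.
  let f : Fin d ≃ Fin d := (finCongr (Fintype.card_fin d).symm).trans e
  let V : Matrix (Fin d) (Fin d) ℝ := Matrix.of fun i j =>
    (hH.eigenvectorUnitary : Matrix _ _ ℝ) i (f j)
  refine ⟨fun a j => V a (Fin.castLE hr j), hr, V, fun j => hH.eigenvalues (f j), ?_, ?_, ?_,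
    fun _ _ => rfl⟩
  · intro i j hij
    simp only [Matrix.IsHermitian.eigenvalues]
    apply hH.eigenvalues₀_antitone
    simp only [f, e, Equiv.trans_apply]
    simpa using hij
  · have h1 := Matrix.mem_unitaryGroup_iff'.1 hH.eigenvectorUnitary.2
    ext i j
    have := congrFun (congrFun h1 (f i)) (f j)
    simp only [Matrix.mul_apply, Matrix.star_apply, star_trivial, Matrix.one_apply,
      EmbeddingLike.apply_eq_iff_eq] at this
    simpa [Matrix.mul_apply, V, Matrix.one_apply] using this
  · ext i j
    have := congrFun (hH.mulVec_eigenvectorBasis (f j)) i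
    rw [Matrix.mul_diagonal, mul_comm]
    simpa [Matrix.mul_apply, Matrix.mulVec, dotProduct, V] using this

theorem exists_ne_zero_mulVec_eq_zero {a b : ℕ} (A : Matrix (Fin a) (Fin b) ℝ) (h : a < b) :
    ∃ u : Fin b → ℝ, u ≠ 0 ∧ A *ᵥ u = 0 := by
  have := LinearMap.ker_ne_bot_of_finrank_lt (f := Matrix.mulVecLin A) (by simpa using h)
  obtain ⟨u, hu, hu0⟩ := (Submodule.ne_bot_iff _).1 this
  exact ⟨u, hu0, by simpa using hu⟩

theorem dotProduct_self_pos' {d : ℕ} {u : Fin d → ℝ} (hu : u ≠ 0) : 0 < u ⬝ᵥ u :=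
  lt_of_le_of_ne (dotProduct_self_nonneg' u) fun h => hu (dotProduct_self_eq_zero.1 h.symm)

/-- The leading eigenvalues are bounded below by a quadratic form on an `r`-dimensional space. -/
theorem IsLeadingEigenvectors.exists_eigenvalues {S : Matrix (Fin d) (Fin d) ℝ}
    {E : Matrix (Fin d) (Fin r) ℝ} (h : IsLeadingEigenvectors S E) :
    ∃ μ : Fin r → ℝ, S * E = E * Matrix.diagonal μ ∧
      ∀ (U : Matrix (Fin d) (Fin r) ℝ) (c : ℝ), Uᵀ * U = 1 →
        (∀ u, c * (u ⬝ᵥ u) ≤ (U *ᵥ u) ⬝ᵥ (S *ᵥ (U *ᵥ u))) → ∀ j, c ≤ μ j := by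
  obtain ⟨h, V, μ, hμ, hV, hS, hE⟩ := h
  refine ⟨fun j => μ (Fin.castLE h j), ?_, fun U c hU hc j => ?_⟩
  · ext a j
    have := congrFun (congrFun hS a) (Fin.castLE h j)
    rw [Matrix.mul_diagonal] at this ⊢
    simpa [Matrix.mul_apply, hE] using this
  -- Courant–Fischer by counting dimensions: since `j < r`, some nonzero `u` makes `U u` orthogonal
  -- to the first `j` eigenvectors, and on such vectors the form is at most `μ j`.
  · let A : Matrix (Fin j) (Fin r) ℝ :=
      Matrix.of fun i b => (Vᵀ * U) (Fin.castLE (j.2.le.trans h) i) b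
    obtain ⟨u, hu, hAu⟩ := exists_ne_zero_mulVec_eq_zero A j.2
    have hV' : V * Vᵀ = 1 := mul_eq_one_comm.1 hV
    set z := Vᵀ *ᵥ (U *ᵥ u) with hz
    have hVz : V *ᵥ z = U *ᵥ u := by rw [hz, Matrix.mulVec_mulVec, hV', Matrix.one_mulVec]
    obtain ⟨h1, h2⟩ := orthogonal_expansion hV hS z
    rw [hVz] at h1 h2
    have h3 := hc u
    have h4 : (U *ᵥ u) ⬝ᵥ (U *ᵥ u) = u ⬝ᵥ u := by
      rw [dotProduct_mulVec_self, hU, Matrix.one_mulVec]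
    have h5 : ∑ i, μ i * z i ^ 2 ≤ μ (Fin.castLE h j) * ∑ i, z i ^ 2 := by
      rw [Finset.mul_sum]
      refine Finset.sum_le_sum fun i _ => ?_
      by_cases hij : (i : ℕ) < j
      · have := congrFun hAu ⟨i, hij⟩
        have h0 : z i = 0 := by
          rw [hz, Matrix.mulVec_mulVec]
          exact this
        rw [h0]; simp
      · exact mul_le_mul_of_nonneg_right (hμ (by simpa [Fin.le_def] using hij)) (sq_nonneg _)
    rw [← h2, ← h1, h4] at h5
    exact le_of_mul_le_mul_right (h3.trans h5) (dotProduct_self_pos' hu)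

/-- A positive semidefinite matrix that is small on a subspace of codimension `r` is small on the
orthogonal complement of its leading eigenvectors. -/
theorem IsLeadingEigenvectors.mulVec_complement_le {S : Matrix (Fin d) (Fin d) ℝ}
    {E : Matrix (Fin d) (Fin r) ℝ} (h : IsLeadingEigenvectors S E)
    (hpsd : ∀ z, 0 ≤ z ⬝ᵥ (S *ᵥ z)) (U : Matrix (Fin d) (Fin r) ℝ) {ν : ℝ}
    (hU : ∀ z, Uᵀ *ᵥ z = 0 → z ⬝ᵥ (S *ᵥ z) ≤ ν * (z ⬝ᵥ z)) (z : Fin d → ℝ)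
    (hz : Eᵀ *ᵥ z = 0) : (S *ᵥ z) ⬝ᵥ (S *ᵥ z) ≤ ν ^ 2 * (z ⬝ᵥ z) := by
  obtain ⟨h, V, μ, hμ, hV, hS, hE⟩ := h
  have hV' : V * Vᵀ = 1 := mul_eq_one_comm.1 hV
  have hpos : ∀ i, 0 ≤ μ i := fun i => by
    obtain ⟨h1, h2⟩ := orthogonal_expansion hV hS (Pi.single i 1)
    have h3 := hpsd (V *ᵥ Pi.single i 1)
    rw [h2] at h3
    simpa [Pi.single_apply] using h3
  -- The span of the first `r + 1` eigenvectors contains a nonzero vector annihilated by `Uᵀ`, which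
  -- imposes only `r` conditions. On this span the form is at least `μ i` for every `i ≥ r`.
  have hsmall : ∀ i : Fin d, r ≤ i → μ i ≤ ν := by
    intro i hi
    have hrd : r < d := lt_of_le_of_lt hi i.2
    let A : Matrix (Fin r) (Fin (r + 1)) ℝ := Matrix.of fun b j => (Uᵀ * V) b (Fin.castLE hrd j)
    obtain ⟨u, hu, hAu⟩ := exists_ne_zero_mulVec_eq_zero A (Nat.lt_succ_self r)
    let c : Fin d → ℝ := fun i => if hi : (i : ℕ) < r + 1 then u ⟨i, hi⟩ else 0
    have hsum : ∀ f : Fin d → ℝ, ∑ i, f i * c i = ∑ j, f (Fin.castLE hrd j) * u j := by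
      intro f
      have : ∑ j, f (Fin.castLE hrd j) * u j =
          ∑ j, (fun i => f i * c i) (Fin.castLE hrd j) := by
        refine Finset.sum_congr rfl fun j _ => ?_
        have : (j : ℕ) < r + 1 := j.2
        simp only [c, Fin.val_castLE, this, dif_pos]
      rw [this, ← Finset.sum_image (f := fun i => f i * c i)
        (fun a _ b _ hab => (Fin.castLE_injective hrd) hab)]
      symm
      refine Finset.sum_subset (Finset.subset_univ _) fun i _ hi => ?_
      have : ¬ (i : ℕ) < r + 1 := fun hlt => hi (Finset.mem_image.2 ⟨⟨i, hlt⟩, Finset.mem_univ _, rfl⟩)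
      have hc0 : c i = 0 := dif_neg this
      rw [hc0, mul_zero]
    have hUc : Uᵀ *ᵥ (V *ᵥ c) = 0 := by
      rw [Matrix.mulVec_mulVec, ← hAu]
      ext b
      exact hsum fun i => (Uᵀ * V) b i
    obtain ⟨h1, h2⟩ := orthogonal_expansion hV hS c
    have h3 := hU _ hUc
    rw [h1, h2] at h3
    have h4 : μ i * ∑ i, c i ^ 2 ≤ ∑ i, μ i * c i ^ 2 := by
      rw [Finset.mul_sum]
      refine Finset.sum_le_sum fun l _ => ?_
      by_cases hl : (l : ℕ) < r + 1
      · by_cases hli : l ≤ i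
        · exact mul_le_mul_of_nonneg_right (hμ hli) (sq_nonneg _)
        · have : (l : ℕ) = i := by rw [Fin.le_def] at hli; omega
          rw [Fin.ext this]
      · have hc0 : c l = 0 := dif_neg hl
        simp [hc0]
    have h5 : 0 < ∑ i, c i ^ 2 := by
      obtain ⟨j, hj⟩ := Function.ne_iff.1 hu
      refine Finset.sum_pos' (fun i _ => sq_nonneg _) ⟨Fin.castLE hrd j, Finset.mem_univ _, ?_⟩
      have : c (Fin.castLE hrd j) = u j := by
        have : (j : ℕ) < r + 1 := j.2
        simp only [c, Fin.val_castLE, this, dif_pos]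
      rw [this]
      exact sq_pos_of_ne_zero hj
    exact le_of_mul_le_mul_right (h4.trans h3) h5
  -- A vector orthogonal to `E` has only eigencoordinates with index at least `r`, where `0 ≤ μ i ≤
  -- ν`. The lower bound is what allows squaring.
  set c := Vᵀ *ᵥ z with hc
  have hVc : V *ᵥ c = z := by rw [hc, Matrix.mulVec_mulVec, hV', Matrix.one_mulVec]
  have hc0 : ∀ i : Fin d, (i : ℕ) < r → c i = 0 := fun i hi => by
    have := congrFun hz ⟨i, hi⟩
    simpa [hc, Matrix.mulVec, dotProduct, hE] using this
  have hSz : S *ᵥ z = V *ᵥ (Matrix.diagonal μ *ᵥ c) := by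
    calc S *ᵥ z = S *ᵥ (V *ᵥ c) := by rw [hVc]
      _ = V *ᵥ (Matrix.diagonal μ *ᵥ c) := by
        rw [Matrix.mulVec_mulVec c S V, hS, ← Matrix.mulVec_mulVec]
  have h1 : z ⬝ᵥ z = ∑ i, c i ^ 2 := by
    rw [← (orthogonal_expansion hV hS c).1, hVc]
  rw [hSz, (orthogonal_expansion hV hS _).1, h1, Finset.mul_sum]
  refine Finset.sum_le_sum fun i _ => ?_
  rw [Matrix.mulVec_diagonal, mul_pow]
  by_cases hi : (i : ℕ) < r
  · simp [hc0 i hi]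
  · exact mul_le_mul_of_nonneg_right
      (pow_le_pow_left₀ (hpos i) (hsmall i (not_lt.1 hi)) 2) (sq_nonneg _)

end Eigen

end LinearAlgebra

/-! ### Eigenspace perturbation of signal-plus-noise Gram matrices. -/

section Perturbation

open scoped Matrix Matrix.Norms.Frobenius

variable {d r : ℕ} {c : Type*} [Fintype c]

theorem dotProduct_mulVec_conj {m : Type*} [Fintype m] (N : Matrix m c ℝ) {Q : Matrix c c ℝ}
    (hs : Qᵀ = Q) (hi : Q * Q = Q) (v : m → ℝ) :
    v ⬝ᵥ ((N * Q * Nᵀ) *ᵥ v) = (Q *ᵥ (Nᵀ *ᵥ v)) ⬝ᵥ (Q *ᵥ (Nᵀ *ᵥ v)) := by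
  rw [dotProduct_mulVec_self, hs, hi, ← Matrix.mulVec_mulVec, ← Matrix.mulVec_mulVec,
    Matrix.dotProduct_mulVec, ← Matrix.mulVec_transpose]

theorem dotProduct_mulVec_gram {m : Type*} [Fintype m] (N : Matrix m c ℝ) (v : m → ℝ) :
    v ⬝ᵥ ((N * Nᵀ) *ᵥ v) = (Nᵀ *ᵥ v) ⬝ᵥ (Nᵀ *ᵥ v) := by
  rw [dotProduct_mulVec_self, Matrix.transpose_transpose]

theorem proj_mulVec_le [DecidableEq c] {Q : Matrix c c ℝ} (hs : Qᵀ = Q) (hi : Q * Q = Q) (x : c → ℝ) :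
    (Q *ᵥ x) ⬝ᵥ (Q *ᵥ x) ≤ x ⬝ᵥ x := by
  have h := frobenius_proj_mul_le (Matrix.replicateCol Unit x) hs hi
  have h2 : ‖Q * Matrix.replicateCol Unit x‖ ^ 2 ≤ ‖Matrix.replicateCol Unit x‖ ^ 2 :=
    pow_le_pow_left₀ (norm_nonneg _) h 2
  rw [frobenius_sq, frobenius_sq] at h2
  simpa [dotProduct, Matrix.mulVec, Matrix.mul_apply, sq] using h2

theorem mulVec_le_frobenius {m n : Type*} [Fintype m] [Fintype n] (A : Matrix m n ℝ) (x : n → ℝ) :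
    (A *ᵥ x) ⬝ᵥ (A *ᵥ x) ≤ ‖A‖ ^ 2 * (x ⬝ᵥ x) := by
  have h := pow_le_pow_left₀ (norm_nonneg _)
    (Matrix.frobenius_norm_mul A (Matrix.replicateCol Unit x)) 2
  rw [mul_pow, frobenius_sq (A * _), frobenius_sq (Matrix.replicateCol Unit x)] at h
  simpa [dotProduct, Matrix.mulVec, Matrix.mul_apply, sq] using h

/-- The noise form with a projection is controlled by that of the centred noise. -/
theorem noise_form_le [DecidableEq c] {m : Type*} [Fintype m] (B N : Matrix m c ℝ) {Q : Matrix c c ℝ}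
    (hs : Qᵀ = Q) (hi : Q * Q = Q) {b ν : ℝ} (hB : ‖B‖ ≤ b)
    (hN : ∀ v, v ⬝ᵥ ((N * Nᵀ) *ᵥ v) ≤ ν * (v ⬝ᵥ v)) (v : m → ℝ) :
    v ⬝ᵥ (((B + N) * Q * (B + N)ᵀ) *ᵥ v) ≤ (2 * b ^ 2 + 2 * ν) * (v ⬝ᵥ v) := by
  rw [dotProduct_mulVec_conj _ hs hi]
  refine (proj_mulVec_le hs hi _).trans ?_
  have h1 : (Bᵀ *ᵥ v) ⬝ᵥ (Bᵀ *ᵥ v) ≤ b ^ 2 * (v ⬝ᵥ v) := by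
    refine (mulVec_le_frobenius _ _).trans ?_
    rw [Matrix.frobenius_norm_transpose]
    exact mul_le_mul_of_nonneg_right (pow_le_pow_left₀ (norm_nonneg _) hB 2)
      (dotProduct_self_nonneg' v)
  have h2 := hN v
  rw [dotProduct_mulVec_gram] at h2
  have h3 : ((B + N)ᵀ *ᵥ v) ⬝ᵥ ((B + N)ᵀ *ᵥ v) ≤
      2 * ((Bᵀ *ᵥ v) ⬝ᵥ (Bᵀ *ᵥ v)) + 2 * ((Nᵀ *ᵥ v) ⬝ᵥ (Nᵀ *ᵥ v)) := by
    rw [Matrix.transpose_add, Matrix.add_mulVec]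
    simp only [dotProduct, Finset.mul_sum, ← Finset.sum_add_distrib, Pi.add_apply]
    exact Finset.sum_le_sum fun i _ => by nlinarith [sq_nonneg ((Bᵀ *ᵥ v) i - (Nᵀ *ᵥ v) i)]
  linarith

/-- Along `U u` the projected data equal `Gᵀ u`, minus the part of it lost by the projection, plus
projected noise. The first vector has length at least `σ |u|`, the other two at most `σ |u| / 4`, so
the leading eigenvalues stay bounded away from zero. -/
theorem signal_form_ge [DecidableEq c] {U : Matrix (Fin d) (Fin r) ℝ} (hU : Uᵀ * U = 1)
    (G : Matrix (Fin r) c ℝ) (N : Matrix (Fin d) c ℝ) {Q : Matrix c c ℝ}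
    (hs : Qᵀ = Q) (hi : Q * Q = Q) {σ : ℝ}
    (hG : ∀ u, σ ^ 2 * (u ⬝ᵥ u) ≤ u ⬝ᵥ ((G * Gᵀ) *ᵥ u))
    (hQ : ‖G * (1 - Q)‖ ≤ σ / 4)
    (hN : ∀ v, v ⬝ᵥ ((N * Q * Nᵀ) *ᵥ v) ≤ (σ / 4) ^ 2 * (v ⬝ᵥ v)) (u : Fin r → ℝ) :
    σ ^ 2 / 4 * (u ⬝ᵥ u) ≤ (U *ᵥ u) ⬝ᵥ (((U * G + N) * Q * (U * G + N)ᵀ) *ᵥ (U *ᵥ u)) := by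
  have hUu : (U *ᵥ u) ⬝ᵥ (U *ᵥ u) = u ⬝ᵥ u := by
    rw [dotProduct_mulVec_self, hU, Matrix.one_mulVec]
  rw [dotProduct_mulVec_conj _ hs hi]
  set x := Gᵀ *ᵥ u with hx
  set y := (G * (1 - Q))ᵀ *ᵥ u with hy
  set z := Q *ᵥ (Nᵀ *ᵥ (U *ᵥ u)) with hz
  have hdec : Q *ᵥ ((U * G + N)ᵀ *ᵥ (U *ᵥ u)) = x - y + z := by
    rw [Matrix.transpose_add, Matrix.add_mulVec, Matrix.mulVec_add, Matrix.transpose_mul,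
      ← Matrix.mulVec_mulVec, Matrix.mulVec_mulVec u Uᵀ U, hU, Matrix.one_mulVec, hy,
      Matrix.transpose_mul, Matrix.transpose_sub, hs, Matrix.transpose_one, ← Matrix.mulVec_mulVec,
      Matrix.sub_mulVec, Matrix.one_mulVec]
    simp [hx, hz]
  have h1 : σ ^ 2 * (u ⬝ᵥ u) ≤ x ⬝ᵥ x := by
    have := hG u
    rwa [dotProduct_mulVec_gram] at this
  have h2 : y ⬝ᵥ y ≤ (σ / 4) ^ 2 * (u ⬝ᵥ u) := by
    refine (mulVec_le_frobenius _ _).trans ?_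
    rw [Matrix.frobenius_norm_transpose]
    exact mul_le_mul_of_nonneg_right (pow_le_pow_left₀ (norm_nonneg _) hQ 2)
      (dotProduct_self_nonneg' u)
  have h3 : z ⬝ᵥ z ≤ (σ / 4) ^ 2 * (u ⬝ᵥ u) := by
    have := hN (U *ᵥ u)
    rwa [dotProduct_mulVec_conj _ hs hi, hUu] at this
  -- With the three bounds above this leaves `σ² (1/2 - 2/16 - 2/16) = σ² / 4`.
  have h4 : (x ⬝ᵥ x) / 2 - 2 * (y ⬝ᵥ y) - 2 * (z ⬝ᵥ z) ≤ (x - y + z) ⬝ᵥ (x - y + z) := by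
    simp only [dotProduct, Finset.mul_sum, Finset.sum_div, ← Finset.sum_sub_distrib,
      Pi.add_apply, Pi.sub_apply]
    exact Finset.sum_le_sum fun i _ => by
      nlinarith [sq_nonneg (x i + 2 * (z i - y i)), sq_nonneg (y i + z i)]
  rw [hdec]
  nlinarith

theorem frobenius_mul_diagonal_ge {m : Type*} [Fintype m] (X : Matrix m (Fin r) ℝ)
    {μ : Fin r → ℝ} {κ : ℝ} (hκ : 0 ≤ κ) (hμ : ∀ j, κ ≤ μ j) :
    κ * ‖X‖ ≤ ‖X * Matrix.diagonal μ‖ := by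
  refine abs_le_of_sq_le_sq' ?_ (norm_nonneg _) |>.2
  rw [mul_pow, frobenius_sq, frobenius_sq, Finset.mul_sum]
  refine Finset.sum_le_sum fun i _ => ?_
  rw [Finset.mul_sum]
  refine Finset.sum_le_sum fun j _ => ?_
  rw [Matrix.mul_diagonal, mul_pow, mul_comm]
  exact mul_le_mul_of_nonneg_left (pow_le_pow_left₀ hκ (hμ j) 2) (sq_nonneg _)

theorem complement_proj {m : Type*} [Fintype m] [DecidableEq m] {U : Matrix m (Fin r) ℝ}
    (hU : Uᵀ * U = 1) :
    (1 - U * Uᵀ)ᵀ = 1 - U * Uᵀ ∧ (1 - U * Uᵀ) * (1 - U * Uᵀ) = 1 - U * Uᵀ ∧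
      (1 - U * Uᵀ) * U = 0 := by
  have h3 : (1 - U * Uᵀ) * U = 0 := by
    rw [Matrix.sub_mul, Matrix.mul_assoc, hU]; simp
  refine ⟨by simp [Matrix.transpose_mul], ?_, h3⟩
  conv_lhs => rw [Matrix.mul_sub, ← Matrix.mul_assoc, h3]
  simp

/-- Distance of the leading eigenspace of a projected signal-plus-noise Gram matrix to the signal
space. -/
theorem leading_loss_le {U : Matrix (Fin d) (Fin r) ℝ} (hU : Uᵀ * U = 1)
    (G : Matrix (Fin r) c ℝ) (N : Matrix (Fin d) c ℝ) {Q : Matrix c c ℝ}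
    {E : Matrix (Fin d) (Fin r) ℝ}
    (hE : IsLeadingEigenvectors ((U * G + N) * Q * (U * G + N)ᵀ) E) {κ : ℝ} (hκ : 0 < κ)
    (hlow : ∀ u, κ * (u ⬝ᵥ u) ≤
      (U *ᵥ u) ⬝ᵥ (((U * G + N) * Q * (U * G + N)ᵀ) *ᵥ (U *ᵥ u))) :
    ‖(1 - U * Uᵀ) * E‖ ≤ κ⁻¹ * ‖N * Q * (U * G + N)ᵀ * E‖ := by
  obtain ⟨μ, hSE, hμ⟩ := hE.exists_eigenvalues
  have hμ := hμ U κ hU hlow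
  obtain ⟨hs, hi, h0⟩ := complement_proj hU
  -- `(1 - U Uᵀ) U = 0`, so in the eigenvalue equation only the terms with the noise on the left
  -- survive.
  have h1 : (1 - U * Uᵀ) * E * Matrix.diagonal μ =
      (1 - U * Uᵀ) * (N * Q * (U * G + N)ᵀ * E) := by
    rw [Matrix.mul_assoc, ← hSE]
    simp only [Matrix.add_mul, Matrix.mul_add, ← Matrix.mul_assoc, h0, Matrix.zero_mul, zero_add]
  have h2 := frobenius_mul_diagonal_ge ((1 - U * Uᵀ) * E) hκ.le hμ
  rw [h1] at h2
  rw [le_inv_mul_iff₀ hκ]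
  exact h2.trans (frobenius_proj_mul_le _ hs hi)

/-- Davis–Kahan bound between the leading eigenspaces of `S` and of a nearby matrix `S₀`. -/
theorem leading_perturbation_le {U : Matrix (Fin d) (Fin r) ℝ} (hU : Uᵀ * U = 1)
    {S S₀ : Matrix (Fin d) (Fin d) ℝ} {E E₀ : Matrix (Fin d) (Fin r) ℝ}
    (hE : IsLeadingEigenvectors S E) (hE₀ : IsLeadingEigenvectors S₀ E₀)
    (hsymm : S₀ᵀ = S₀) {κ ν : ℝ} (hν : 0 ≤ ν) (hνκ : 2 * ν ≤ κ) (hκ : 0 < κ)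
    (hlow : ∀ u, κ * (u ⬝ᵥ u) ≤ (U *ᵥ u) ⬝ᵥ (S *ᵥ (U *ᵥ u)))
    (hpsd : ∀ z, 0 ≤ z ⬝ᵥ (S₀ *ᵥ z))
    (hperp : ∀ z, Uᵀ *ᵥ z = 0 → z ⬝ᵥ (S₀ *ᵥ z) ≤ ν * (z ⬝ᵥ z)) :
    ‖(1 - E₀ * E₀ᵀ) * E‖ ≤ 2 * κ⁻¹ * (‖S - S₀‖ * ‖E‖) := by
  obtain ⟨μ, hSE, hμ⟩ := hE.exists_eigenvalues
  have hμ := hμ U κ hU hlow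
  obtain ⟨μ₀, hSE₀, -⟩ := hE₀.exists_eigenvalues
  obtain ⟨hs, hi, h0⟩ := complement_proj hE₀.orthonormal
  set R := 1 - E₀ * E₀ᵀ with hR
  -- `E₀ E₀ᵀ` is a spectral projection of `S₀`.
  have hcomm : R * S₀ = S₀ * R := by
    have h1 : S₀ * (E₀ * E₀ᵀ) = E₀ * Matrix.diagonal μ₀ * E₀ᵀ := by
      rw [← Matrix.mul_assoc, hSE₀]
    have h2 : E₀ * E₀ᵀ * S₀ = E₀ * Matrix.diagonal μ₀ * E₀ᵀ := by
      have := congrArg Matrix.transpose h1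
      simpa [Matrix.transpose_mul, hsymm, Matrix.mul_assoc] using this
    rw [hR, Matrix.sub_mul, Matrix.mul_sub, h1, h2]; simp
  -- A Sylvester equation for `R E`: its eigenvalues on the right are at least `κ`, while `S₀` acts
  -- with norm at most `ν ≤ κ / 2` on the range of `R`. Half of `κ` survives.
  have h1 : R * E * Matrix.diagonal μ = S₀ * (R * E) + R * ((S - S₀) * E) := by
    rw [Matrix.mul_assoc, ← hSE, ← Matrix.mul_assoc S₀, ← hcomm, Matrix.mul_assoc, ← Matrix.mul_add,
      ← Matrix.add_mul, add_sub_cancel]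
  have h2 := frobenius_mul_diagonal_ge (R * E) hκ.le hμ
  have h3 : ‖S₀ * (R * E)‖ ≤ ν * ‖R * E‖ := by
    have h4 : S₀ * (R * E) = (S₀ * R) * (R * E) := by
      rw [Matrix.mul_assoc S₀, ← Matrix.mul_assoc R R, hi]
    have h5 := frobenius_sq_mul_le (S₀ * R) (R * E) (c := ν ^ 2) fun v => by
      have hz : E₀ᵀ *ᵥ (R *ᵥ v) = 0 := by
        have : E₀ᵀ * R = 0 := by
          have := congrArg Matrix.transpose h0
          simpa [Matrix.transpose_mul, hs] using this
        rw [Matrix.mulVec_mulVec, this, Matrix.zero_mulVec]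
      have := hE₀.mulVec_complement_le hpsd U hperp (R *ᵥ v) hz
      rw [← Matrix.mulVec_mulVec]
      exact this.trans (mul_le_mul_of_nonneg_left (proj_mulVec_le hs hi v) (sq_nonneg _))
    rw [← h4, ← mul_pow] at h5
    exact (abs_le_of_sq_le_sq' h5 (mul_nonneg hν (norm_nonneg _))).2
  have h4 : ‖R * ((S - S₀) * E)‖ ≤ ‖S - S₀‖ * ‖E‖ :=
    (frobenius_proj_mul_le _ hs hi).trans (Matrix.frobenius_norm_mul _ _)
  have h5 : κ * ‖R * E‖ ≤ ν * ‖R * E‖ + ‖S - S₀‖ * ‖E‖ := by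
    rw [h1] at h2
    exact h2.trans ((norm_add_le _ _).trans (add_le_add h3 h4))
  have h6 : κ / 2 * ‖R * E‖ ≤ ‖S - S₀‖ * ‖E‖ := by
    nlinarith [norm_nonneg (R * E)]
  rw [show 2 * κ⁻¹ * (‖S - S₀‖ * ‖E‖) = (κ / 2)⁻¹ * (‖S - S₀‖ * ‖E‖) by rw [inv_div]; ring,
    le_inv_mul_iff₀ (by positivity)]
  exact h6

/-- The bias is small in norm, so every term containing `B` is bounded crudely. The two pure noise
terms are kept, because their size comes from cancellation that norms do not see. -/
theorem noise_mul_le [DecidableEq c] {U E : Matrix (Fin d) (Fin r) ℝ} (hU : Uᵀ * U = 1) (hE : Eᵀ * E = 1)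
    (G : Matrix (Fin r) c ℝ) (B N : Matrix (Fin d) c ℝ) {Q : Matrix c c ℝ}
    (hs : Qᵀ = Q) (hi : Q * Q = Q) :
    ‖(B + N) * Q * (U * G + (B + N))ᵀ * E‖ ≤
      r * ‖N * Q * Gᵀ‖ + ‖N * Q * Nᵀ * E‖ +
        ‖B‖ * (r * (‖G‖ + ‖B‖ + 2 * ‖N‖)) := by
  have hr : (Real.sqrt r) * Real.sqrt r = r := Real.mul_self_sqrt (by positivity)
  have hnE : ‖E‖ = Real.sqrt r := by simpa using frobenius_of_orthonormal hE
  have hnU : ‖U‖ = Real.sqrt r := by simpa using frobenius_of_orthonormal hU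
  have hsr : Real.sqrt r ≤ r := by
    rcases Nat.eq_zero_or_pos r with h | h
    · simp [h]
    · have : (1 : ℝ) ≤ r := by exact_mod_cast h
      rw [Real.sqrt_le_left (by positivity)]
      nlinarith
  -- The mixed terms `N Q Bᵀ E` and `B Q Nᵀ E` together account for the `2 * ‖N‖`.
  have hdec : (B + N) * Q * (U * G + (B + N))ᵀ * E =
      N * Q * Gᵀ * (Uᵀ * E) + N * Q * Nᵀ * E + N * Q * (Bᵀ * E) +
        B * Q * (Gᵀ * (Uᵀ * E) + Bᵀ * E + Nᵀ * E) := by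
    simp only [Matrix.transpose_add, Matrix.transpose_mul, Matrix.mul_add, Matrix.add_mul,
      ← Matrix.mul_assoc]
    abel
  have hUE : ‖Uᵀ * E‖ ≤ r := by
    refine (Matrix.frobenius_norm_mul _ _).trans ?_
    rw [Matrix.frobenius_norm_transpose, hnU, hnE, hr]
  have hmE : ∀ X : Matrix (Fin d) c ℝ, ‖Xᵀ * E‖ ≤ r * ‖X‖ := fun X => by
    refine (Matrix.frobenius_norm_mul _ _).trans ?_
    rw [Matrix.frobenius_norm_transpose, hnE, mul_comm]
    exact mul_le_mul_of_nonneg_right hsr (norm_nonneg _)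
  have h1 : ‖N * Q * Gᵀ * (Uᵀ * E)‖ ≤ r * ‖N * Q * Gᵀ‖ := by
    refine (Matrix.frobenius_norm_mul _ _).trans ?_
    rw [mul_comm]
    exact mul_le_mul_of_nonneg_right hUE (norm_nonneg _)
  have h2 : ‖N * Q * (Bᵀ * E)‖ ≤ ‖N‖ * (r * ‖B‖) := by
    refine (Matrix.frobenius_norm_mul _ _).trans ?_
    exact mul_le_mul (frobenius_mul_proj_le _ hs hi) (hmE B) (norm_nonneg _) (norm_nonneg _)
  have h3 : ‖B * Q * (Gᵀ * (Uᵀ * E) + Bᵀ * E + Nᵀ * E)‖ ≤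
      ‖B‖ * (r * ‖G‖ + r * ‖B‖ + r * ‖N‖) := by
    refine (Matrix.frobenius_norm_mul _ _).trans ?_
    refine mul_le_mul (frobenius_mul_proj_le _ hs hi) ?_ (norm_nonneg _) (norm_nonneg _)
    refine norm_add₃_le.trans (add_le_add_three ?_ (hmE B) (hmE N))
    refine (Matrix.frobenius_norm_mul _ _).trans ?_
    rw [Matrix.frobenius_norm_transpose, mul_comm]
    exact mul_le_mul_of_nonneg_right hUE (norm_nonneg _)
  rw [hdec]
  calc _ ≤ ‖N * Q * Gᵀ * (Uᵀ * E)‖ + ‖N * Q * Nᵀ * E‖ + ‖N * Q * (Bᵀ * E)‖ +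
        ‖B * Q * (Gᵀ * (Uᵀ * E) + Bᵀ * E + Nᵀ * E)‖ := by
        refine (norm_add_le _ _).trans ?_
        gcongr
        exact norm_add₃_le
    _ ≤ _ := by nlinarith

/-- To be used with `S₁` the mean of `N Nᵀ`: only the centred part of the noise Gram matrix then
enters the distance. -/
theorem gram_perturbation_le {U : Matrix (Fin d) (Fin r) ℝ} (hU : Uᵀ * U = 1)
    (G : Matrix (Fin r) c ℝ) (B N : Matrix (Fin d) c ℝ) (S₁ : Matrix (Fin d) (Fin d) ℝ) :
    ‖(U * G + (B + N)) * (U * G + (B + N))ᵀ - (U * G * (U * G)ᵀ + S₁)‖ ≤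
      2 * r * ‖N * Gᵀ‖ + ‖N * Nᵀ - S₁‖ + ‖B‖ * (2 * (r * ‖G‖ + ‖B‖ + ‖N‖)) := by
  have hnU : ‖U‖ ≤ r := by
    have : ‖U‖ = Real.sqrt r := by simpa using frobenius_of_orthonormal hU
    rw [this]
    rcases Nat.eq_zero_or_pos r with h | h
    · simp [h]
    · have : (1 : ℝ) ≤ r := by exact_mod_cast h
      rw [Real.sqrt_le_left (by positivity)]
      nlinarith
  have hdec : (U * G + (B + N)) * (U * G + (B + N))ᵀ - (U * G * (U * G)ᵀ + S₁) =
      (U * (N * Gᵀ)ᵀ + N * Gᵀ * Uᵀ) + (N * Nᵀ - S₁) +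
        (B * (U * G + B + N)ᵀ + (U * G + N) * Bᵀ) := by
    simp only [Matrix.transpose_add, Matrix.transpose_mul, Matrix.mul_add, Matrix.add_mul,
      Matrix.transpose_transpose, ← Matrix.mul_assoc]
    abel
  have h1 : ‖U * (N * Gᵀ)ᵀ‖ ≤ r * ‖N * Gᵀ‖ := by
    refine (Matrix.frobenius_norm_mul _ _).trans ?_
    rw [Matrix.frobenius_norm_transpose]
    exact mul_le_mul_of_nonneg_right hnU (norm_nonneg _)
  have h2 : ‖N * Gᵀ * Uᵀ‖ ≤ r * ‖N * Gᵀ‖ := by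
    refine (Matrix.frobenius_norm_mul _ _).trans ?_
    rw [Matrix.frobenius_norm_transpose, mul_comm]
    exact mul_le_mul_of_nonneg_right hnU (norm_nonneg _)
  have h0 : ‖U * G‖ ≤ r * ‖G‖ :=
    (Matrix.frobenius_norm_mul _ _).trans (mul_le_mul_of_nonneg_right hnU (norm_nonneg _))
  have h3 : ‖B * (U * G + B + N)ᵀ‖ ≤ ‖B‖ * (r * ‖G‖ + ‖B‖ + ‖N‖) := by
    refine (Matrix.frobenius_norm_mul _ _).trans ?_
    rw [Matrix.frobenius_norm_transpose]
    refine mul_le_mul_of_nonneg_left (norm_add₃_le.trans ?_) (norm_nonneg _)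
    gcongr
  have h4 : ‖(U * G + N) * Bᵀ‖ ≤ (r * ‖G‖ + ‖N‖) * ‖B‖ := by
    refine (Matrix.frobenius_norm_mul _ _).trans ?_
    rw [Matrix.frobenius_norm_transpose]
    refine mul_le_mul_of_nonneg_right ((norm_add_le _ _).trans ?_) (norm_nonneg _)
    gcongr
  rw [hdec]
  have h5 := norm_add_le (U * (N * Gᵀ)ᵀ) (N * Gᵀ * Uᵀ)
  have h6 := norm_add_le (B * (U * G + B + N)ᵀ) ((U * G + N) * Bᵀ)
  refine norm_add₃_le.trans ?_
  nlinarith [norm_nonneg B, sq_nonneg ‖B‖]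

end Perturbation

/-! ### Kronecker products of projections, unfolded Tucker products, stacked matrices. -/

section Kronecker

open scoped Matrix Matrix.Norms.Frobenius Kronecker

theorem kronExcept_transpose_mul {K : ℕ} {d r r' : Fin K → ℕ} (k : Fin K)
    (A : ∀ l, Matrix (Fin (d l)) (Fin (r l)) ℝ) (B : ∀ l, Matrix (Fin (d l)) (Fin (r' l)) ℝ)
    (q : OtherIndex r k) (q' : OtherIndex r' k) :
    ((kronExcept k A)ᵀ * kronExcept k B) q q' =
      ∏ l : {l : Fin K // l ≠ k}, ((A l)ᵀ * B l) (q l) (q' l) := by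
  simp only [Matrix.mul_apply, Matrix.transpose_apply, kronExcept, Matrix.of_apply,
    ← Finset.prod_mul_distrib]
  rw [Fintype.prod_sum]

theorem kronExcept_orthonormal {K : ℕ} {d r : Fin K → ℕ} (k : Fin K)
    {E : ∀ l, Matrix (Fin (d l)) (Fin (r l)) ℝ} (hE : ∀ l, (E l)ᵀ * E l = 1) :
    (kronExcept k E)ᵀ * kronExcept k E = 1 := by
  ext q q'
  rw [kronExcept_transpose_mul]
  simp only [hE, Matrix.one_apply]
  split_ifs with h
  · subst h; simp
  · obtain ⟨l, hl⟩ := Function.ne_iff.1 h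
    exact Finset.prod_eq_zero (Finset.mem_univ l) (by simp [hl])

/-- Expanding the product of sums over entries recovers the sum over multi-indices: the squared
Frobenius norm is multiplicative under Kronecker products. -/
theorem frobenius_sq_kronExcept {K : ℕ} {d r r' : Fin K → ℕ} (k : Fin K)
    (A : ∀ l, Matrix (Fin (d l)) (Fin (r l)) ℝ) (B : ∀ l, Matrix (Fin (d l)) (Fin (r' l)) ℝ) :
    ‖(kronExcept k A)ᵀ * kronExcept k B‖ ^ 2 =
      ∏ l : {l : Fin K // l ≠ k}, ‖(A l)ᵀ * B l‖ ^ 2 := by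
  rw [frobenius_sq]
  simp only [kronExcept_transpose_mul, ← Finset.prod_pow, frobenius_sq]
  rw [Fintype.prod_sum]
  refine Finset.sum_congr rfl fun q _ => ?_
  rw [Fintype.prod_sum]

/-- Weierstrass' product inequality. It turns losses of the single modes into a loss of the
Kronecker product. -/
theorem one_sub_sum_le_prod {ι : Type*} (s : Finset ι) (a : ι → ℝ) (h0 : ∀ i, 0 ≤ a i)
    (h1 : ∀ i, a i ≤ 1) : 1 - ∑ i ∈ s, (1 - a i) ≤ ∏ i ∈ s, a i := by
  classical
  induction s using Finset.induction_on with
  | empty => simp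
  | insert i s hi ih =>
    rw [Finset.sum_insert hi, Finset.prod_insert hi]
    have h2 : ∏ i ∈ s, a i ≤ 1 := Finset.prod_le_one (fun i _ => h0 i) fun i _ => h1 i
    nlinarith [h0 i, h1 i]

theorem proj_of_orthonormal {m n : Type*} [Fintype m] [Fintype n] [DecidableEq n]
    {U : Matrix m n ℝ} (hU : Uᵀ * U = 1) :
    (U * Uᵀ)ᵀ = U * Uᵀ ∧ U * Uᵀ * (U * Uᵀ) = U * Uᵀ := by
  refine ⟨by simp [Matrix.transpose_mul], ?_⟩
  rw [Matrix.mul_assoc, ← Matrix.mul_assoc Uᵀ, hU, Matrix.one_mul]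

/-- `‖Uᵀ V‖²` is the sum of the squared cosines of the principal angles. In terms of it, distances
of projections and one-sided losses are the same quantity, and it is multiplicative under Kronecker
products. -/
theorem frobenius_sq_proj_sub {m n : Type*} [Fintype m] [Fintype n] [DecidableEq n]
    {U V : Matrix m n ℝ} (hU : Uᵀ * U = 1) (hV : Vᵀ * V = 1) :
    ‖U * Uᵀ - V * Vᵀ‖ ^ 2 = 2 * (Fintype.card n - ‖Uᵀ * V‖ ^ 2) := by
  obtain ⟨hUs, hUi⟩ := proj_of_orthonormal hU
  obtain ⟨hVs, hVi⟩ := proj_of_orthonormal hV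
  have htr : ∀ {W : Matrix m n ℝ}, Wᵀ * W = 1 → (W * Wᵀ).trace = Fintype.card n := fun h => by
    rw [Matrix.trace_mul_comm, h, Matrix.trace_one]
  have h1 : (U * Uᵀ * (V * Vᵀ)).trace = ‖Uᵀ * V‖ ^ 2 := by
    rw [frobenius_sq_eq_trace', Matrix.transpose_mul, Matrix.transpose_transpose, Matrix.mul_assoc,
      Matrix.trace_mul_comm]
    simp only [Matrix.mul_assoc]
  rw [frobenius_sq_eq_trace', Matrix.transpose_sub, hUs, hVs, Matrix.sub_mul, Matrix.mul_sub,
    Matrix.mul_sub, hUi, hVi, Matrix.trace_sub, Matrix.trace_sub, Matrix.trace_sub, htr hU, htr hV,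
    h1, Matrix.trace_mul_comm, h1]
  ring

theorem frobenius_sq_complement {m n q : Type*} [Fintype m] [Fintype n] [Fintype q]
    [DecidableEq n] [DecidableEq m] [DecidableEq q] {U : Matrix m n ℝ} {E : Matrix m q ℝ}
    (hU : Uᵀ * U = 1) (hE : Eᵀ * E = 1) :
    ‖(1 - U * Uᵀ) * E‖ ^ 2 = Fintype.card q - ‖Eᵀ * U‖ ^ 2 := by
  obtain ⟨hUs, hUi⟩ := proj_of_orthonormal hU
  have h2 : (1 - U * Uᵀ) * (1 - U * Uᵀ) = 1 - U * Uᵀ := by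
    rw [Matrix.sub_mul, Matrix.mul_sub, Matrix.mul_sub, hUi]; simp
  rw [frobenius_sq_eq_trace, Matrix.transpose_mul, Matrix.transpose_sub, hUs, Matrix.transpose_one,
    Matrix.mul_assoc, ← Matrix.mul_assoc (1 - U * Uᵀ), h2, Matrix.sub_mul, Matrix.mul_sub,
    Matrix.one_mul, hE, Matrix.trace_sub, Matrix.trace_one, frobenius_sq_eq_trace',
    Matrix.transpose_mul, Matrix.transpose_transpose]
  simp only [Matrix.mul_assoc]

/-- Kronecker products of projections are close if the factors are. -/
theorem frobenius_sq_kron_proj_sub_le {K : ℕ} {d r : Fin K → ℕ} (hr : ∀ l, 0 < r l) (k : Fin K)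
    {E V : ∀ l, Matrix (Fin (d l)) (Fin (r l)) ℝ} (hE : ∀ l, (E l)ᵀ * E l = 1)
    (hV : ∀ l, (V l)ᵀ * V l = 1) :
    ‖kronExcept k E * (kronExcept k E)ᵀ - kronExcept k V * (kronExcept k V)ᵀ‖ ^ 2 ≤
      2 * Fintype.card (OtherIndex r k) *
        ∑ l ∈ Finset.univ.erase k, ‖(1 - V l * (V l)ᵀ) * E l‖ ^ 2 := by
  rw [frobenius_sq_proj_sub (kronExcept_orthonormal k hE) (kronExcept_orthonormal k hV),
    frobenius_sq_kronExcept]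
  have hs : ∀ l, ‖(E l)ᵀ * V l‖ ^ 2 = r l - ‖(1 - V l * (V l)ᵀ) * E l‖ ^ 2 := fun l => by
    rw [frobenius_sq_complement (hV l) (hE l)]; simp
  have hr0 : ∀ l, (0 : ℝ) < r l := fun l => by exact_mod_cast hr l
  have hr1 : ∀ l, (1 : ℝ) ≤ r l := fun l => by exact_mod_cast hr l
  have hcard : (Fintype.card (OtherIndex r k) : ℝ) = ∏ l : {l : Fin K // l ≠ k}, (r l : ℝ) := by
    simp [OtherIndex]
  -- Dividing by `r l` normalizes the squared cosines to `[0, 1]`; the division is undone in `h2`,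
  -- where `r l ≥ 1` suffices.
  have h1 := one_sub_sum_le_prod (Finset.univ : Finset {l : Fin K // l ≠ k})
    (fun l => ‖(E l)ᵀ * V l‖ ^ 2 / r l) (fun l => by positivity) (fun l => by
      rw [div_le_one (hr0 l), hs]; nlinarith [sq_nonneg ‖(1 - V l * (V l)ᵀ) * E l‖])
  rw [Finset.prod_div_distrib, ← hcard] at h1
  have hc0 : (0 : ℝ) < Fintype.card (OtherIndex r k) := by
    rw [hcard]; exact Finset.prod_pos fun l _ => hr0 l
  rw [le_div_iff₀ hc0] at h1
  have h2 : ∑ l : {l : Fin K // l ≠ k}, (1 - ‖(E l)ᵀ * V l‖ ^ 2 / r l) ≤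
      ∑ l : {l : Fin K // l ≠ k}, ‖(1 - V l * (V l)ᵀ) * E l‖ ^ 2 := by
    refine Finset.sum_le_sum fun l _ => ?_
    rw [hs, sub_div, div_self (hr0 l).ne', sub_sub_cancel]
    exact div_le_self (sq_nonneg _) (hr1 l)
  have h3 : ∑ l ∈ Finset.univ.erase k, ‖(1 - V l * (V l)ᵀ) * E l‖ ^ 2 =
      ∑ l : {l : Fin K // l ≠ k}, ‖(1 - V l * (V l)ᵀ) * E l‖ ^ 2 :=
    Finset.sum_subtype _ (by simp) _
  rw [h3]
  nlinarith

theorem matUnfold_tucker {K : ℕ} {r d : Fin K → ℕ} (k : Fin K) (F : Tensor r)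
    (Λ : ∀ k, Matrix (Fin (d k)) (Fin (r k)) ℝ) :
    matUnfold k (tucker F Λ) = Λ k * matUnfold k F * (kronExcept k Λ)ᵀ := by
  ext a ℓ
  simp only [matUnfold, tucker, Matrix.of_apply, Matrix.mul_apply, Matrix.transpose_apply,
    kronExcept, Finset.sum_mul]
  rw [← (Equiv.piSplitAt k fun l => Fin (r l)).symm.sum_comp, Fintype.sum_prod_type,
    Finset.sum_comm]
  refine Finset.sum_congr rfl fun q _ => Finset.sum_congr rfl fun b _ => ?_
  rw [Fintype.prod_eq_mul_prod_subtype_ne _ k]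
  have h1 : ∀ (e : Fin K → ℕ) (x : Fin (e k)) (y : OtherIndex e k),
      (Equiv.piSplitAt k fun l => Fin (e l)).symm (x, y) k = x := fun e x y => by
    simp [Equiv.piSplitAt]
  have h2 : ∀ (e : Fin K → ℕ) (x : Fin (e k)) (y : OtherIndex e k) (l : {l : Fin K // l ≠ k}),
      (Equiv.piSplitAt k fun l => Fin (e l)).symm (x, y) l = y l := fun e x y l => by
    simp [Equiv.piSplitAt, l.2]
  rw [h1, h1]
  simp only [h2]
  ring

theorem frobenius_sq_matUnfold {K : ℕ} {d : Fin K → ℕ} (k : Fin K) (X : Tensor d) :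
    ‖matUnfold k X‖ ^ 2 = ∑ i, X i ^ 2 := by
  rw [frobenius_sq, ← (Equiv.piSplitAt k fun l => Fin (d l)).symm.sum_comp, Fintype.sum_prod_type]
  rfl

theorem sq_tensorNorm {K : ℕ} {d : Fin K → ℕ} (X : Tensor d) : tensorNorm X ^ 2 = ∑ i, X i ^ 2 :=
  Real.sq_sqrt (Finset.sum_nonneg fun _ _ => sq_nonneg _)

theorem kronExcept_smul {K : ℕ} {d r : Fin K → ℕ} (k : Fin K) (c : Fin K → ℝ)
    (A : ∀ l, Matrix (Fin (d l)) (Fin (r l)) ℝ) :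
    kronExcept k (fun l => c l • A l) =
      (∏ l : {l : Fin K // l ≠ k}, c l) • kronExcept k A := by
  ext ℓ q
  simp [kronExcept, Finset.prod_mul_distrib]

theorem prod_subtype_ne_eq {K : ℕ} (k : Fin K) (f : Fin K → ℝ) :
    ∏ l : {l : Fin K // l ≠ k}, f l = ∏ l ∈ Finset.univ.erase k, f l :=
  (Finset.prod_subtype _ (by simp) _).symm

/-! ### Stacking a family of matrices side by side -/

section Stack

variable {m q J T : Type*}

/-- The matrices `Y t` written next to each other. -/
def stack (Y : T → Matrix m J ℝ) : Matrix m (T × J) ℝ := Matrix.of fun a x => Y x.1 a x.2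

theorem stack_mul_transpose [Fintype J] [Fintype T] (Y : T → Matrix m J ℝ) (Z : T → Matrix q J ℝ) :
    stack Y * (stack Z)ᵀ = ∑ t, Y t * (Z t)ᵀ := by
  ext a b
  simp only [Matrix.mul_apply, Matrix.transpose_apply, stack, Matrix.of_apply, Matrix.sum_apply]
  rw [Fintype.sum_prod_type]

theorem stack_mul_kronecker [Fintype J] [Fintype T] [DecidableEq T] {J' : Type*} (Y : T → Matrix m J ℝ)
    (Θ : Matrix J J' ℝ) :
    stack Y * ((1 : Matrix T T ℝ) ⊗ₖ Θ) = stack fun t => Y t * Θ := by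
  ext a x
  simp only [Matrix.mul_apply, stack, Matrix.of_apply, Matrix.kroneckerMap_apply, Matrix.one_apply]
  rw [Fintype.sum_prod_type]
  rw [Finset.sum_eq_single x.1 (fun t _ ht => by simp [ht]) (by simp)]
  simp

theorem mul_stack [Fintype m] (A : Matrix q m ℝ) (Y : T → Matrix m J ℝ) :
    A * stack Y = stack fun t => A * Y t := by
  ext a x; simp [stack, Matrix.mul_apply]

theorem frobenius_sq_stack [Fintype m] [Fintype J] [Fintype T] (Y : T → Matrix m J ℝ) : ‖stack Y‖ ^ 2 = ∑ t, ‖Y t‖ ^ 2 := by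
  simp only [frobenius_sq, stack, Matrix.of_apply]
  rw [Finset.sum_comm]
  simp only [Fintype.sum_prod_type]
  refine Finset.sum_congr rfl fun t _ => Finset.sum_comm

theorem one_kronecker_proj [Fintype J] [Fintype T] [DecidableEq T] {Θ : Matrix J J ℝ} (hs : Θᵀ = Θ) (hi : Θ * Θ = Θ) :
    ((1 : Matrix T T ℝ) ⊗ₖ Θ)ᵀ = (1 : Matrix T T ℝ) ⊗ₖ Θ ∧
      ((1 : Matrix T T ℝ) ⊗ₖ Θ) * ((1 : Matrix T T ℝ) ⊗ₖ Θ) = (1 : Matrix T T ℝ) ⊗ₖ Θ := by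
  constructor
  · rw [← Matrix.kroneckerMap_transpose, hs, Matrix.transpose_one]
  · rw [← Matrix.mul_kronecker_mul, hi, Matrix.one_mul]

end Stack

end Kronecker

/-! ### Covariance inequalities for `α`-mixing `σ`-algebras. -/

section Covariance

variable {Ω : Type*} {𝒜 𝒜' ℬ ℬ' : MeasurableSpace Ω} [mΩ : MeasurableSpace Ω] {P : Measure Ω} [IsProbabilityMeasure P]

theorem integrable_of_bounded {f : Ω → ℝ} {A : ℝ} (hf : Measurable f) (hA : ∀ w, |f w| ≤ A) :
    Integrable f P :=
  Integrable.of_bound hf.aestronglyMeasurable A (Eventually.of_forall hA)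

/-- Splitting at `|y| = ω`: a moment of order `2 + 2ε` bounded by `ω^(2+2ε)` gives a second moment
of at most `2 ω²`. -/
theorem sq_le_add_rpow {ω ε : ℝ} (hω : 0 < ω) (hε : 0 < ε) (y : ℝ) :
    y ^ 2 ≤ ω ^ 2 + ω ^ (-(2 * ε)) * |y| ^ (2 + 2 * ε) := by
  rcases le_or_gt |y| ω with h | h
  · have h1 : y ^ 2 ≤ ω ^ 2 := by rw [← sq_abs]; exact pow_le_pow_left₀ (abs_nonneg _) h 2
    have h2 : 0 ≤ ω ^ (-(2 * ε)) * |y| ^ (2 + 2 * ε) := by positivity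
    linarith
  · have hy : 0 < |y| := hω.trans h
    have h1 : y ^ 2 = |y| ^ (-(2 * ε)) * |y| ^ (2 + 2 * ε) := by
      rw [← Real.rpow_add hy, show -(2 * ε) + (2 + 2 * ε) = (2 : ℕ) by push_cast; ring,
        Real.rpow_natCast, sq_abs]
    have h2 : |y| ^ (-(2 * ε)) ≤ ω ^ (-(2 * ε)) :=
      Real.rpow_le_rpow_of_nonpos hω h.le (by linarith)
    have h3 : |y| ^ (-(2 * ε)) * |y| ^ (2 + 2 * ε) ≤ ω ^ (-(2 * ε)) * |y| ^ (2 + 2 * ε) :=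
      mul_le_mul_of_nonneg_right h2 (by positivity)
    nlinarith [sq_nonneg ω]

theorem integrable_pow_of_bounded {f : Ω → ℝ} {A : ℝ} (hf : Measurable f) (hA : ∀ w, |f w| ≤ A)
    (n : ℕ) : Integrable (fun w => f w ^ n) P :=
  integrable_of_bounded (hf.pow_const n) (A := A ^ n) fun w => by
    rw [abs_pow]; exact pow_le_pow_left₀ (abs_nonneg _) (hA w) n

theorem abs_prob_le_alphaCoef {S T : Set Ω} (hS : MeasurableSet[𝒜] S)
    (hT : MeasurableSet[ℬ] T) :
    |P.real (S ∩ T) - P.real S * P.real T| ≤ alphaCoef P 𝒜 ℬ := by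
  refine le_ciSup (f := fun S : {A : Set Ω // MeasurableSet[𝒜] A} × {B : Set Ω // MeasurableSet[ℬ] B} =>
    |P.real (S.1.1 ∩ S.2.1) - P.real S.1.1 * P.real S.2.1|) ?_ (⟨S, hS⟩, ⟨T, hT⟩)
  -- The supremum defining the coefficient is taken in `ℝ`, so it bounds its terms only because the
  -- family is bounded above.
  refine ⟨1, ?_⟩
  rintro _ ⟨x, rfl⟩
  have h1 : P.real (x.1.1 ∩ x.2.1) ≤ 1 := measureReal_le_one
  have h2 : P.real x.1.1 ≤ 1 := measureReal_le_one
  have h3 : P.real x.2.1 ≤ 1 := measureReal_le_one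
  have h4 : 0 ≤ P.real (x.1.1 ∩ x.2.1) := measureReal_nonneg
  have h5 : 0 ≤ P.real x.1.1 := measureReal_nonneg
  have h6 : 0 ≤ P.real x.2.1 := measureReal_nonneg
  dsimp only
  rw [abs_le]
  constructor <;> nlinarith [mul_nonneg h5 h6]

theorem alphaCoef_mono (h𝒜 : 𝒜 ≤ 𝒜') (hℬ : ℬ ≤ ℬ') :
    alphaCoef P 𝒜 ℬ ≤ alphaCoef P 𝒜' ℬ' := by
  have : Nonempty ({A : Set Ω // MeasurableSet[𝒜] A} × {B : Set Ω // MeasurableSet[ℬ] B}) :=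
    ⟨(⟨∅, @MeasurableSet.empty Ω 𝒜⟩, ⟨∅, @MeasurableSet.empty Ω ℬ⟩)⟩
  exact ciSup_le fun x => abs_prob_le_alphaCoef (h𝒜 _ x.1.2) (hℬ _ x.2.2)

theorem alphaCoef_comm : alphaCoef P 𝒜 ℬ ≤ alphaCoef P ℬ 𝒜 := by
  have : Nonempty ({A : Set Ω // MeasurableSet[𝒜] A} × {B : Set Ω // MeasurableSet[ℬ] B}) :=
    ⟨(⟨∅, @MeasurableSet.empty Ω 𝒜⟩, ⟨∅, @MeasurableSet.empty Ω ℬ⟩)⟩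
  refine ciSup_le fun x => ?_
  rw [Set.inter_comm, mul_comm]
  exact abs_prob_le_alphaCoef x.2.2 x.1.2

/-- With `h = 𝔼[g | 𝒜] - 𝔼 g`, the covariance is `𝔼 f h`, hence at most `A 𝔼 |h|`. As `h` has mean
zero, `𝔼 |h|` is twice the integral of `h` over `{h ≥ 0}`, and that integral is again a covariance,
of `g` with the indicator of this set. -/
theorem exists_set_cov_le (h𝒜 : 𝒜 ≤ mΩ) {f g : Ω → ℝ} {A B : ℝ}
    (hf : Measurable[𝒜] f) (hg : Measurable g) (hA : ∀ w, |f w| ≤ A) (hB : ∀ w, |g w| ≤ B) :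
    ∃ S : Set Ω, MeasurableSet[𝒜] S ∧
      |∫ w, f w * g w ∂P - (∫ w, f w ∂P) * ∫ w, g w ∂P| ≤
        2 * A * |∫ w, S.indicator 1 w * g w ∂P - (∫ w, S.indicator 1 w ∂P) * ∫ w, g w ∂P| := by
  have hfm : Measurable f := hf.mono h𝒜 le_rfl
  have hgi : Integrable g P := integrable_of_bounded hg hB
  set c := ∫ w, g w ∂P with hc
  set h : Ω → ℝ := fun w => (P[g|𝒜]) w - c with hh
  have hhm : Measurable[𝒜] h := stronglyMeasurable_condExp.measurable.sub_const c
  have hhi : Integrable h P := integrable_condExp.sub (integrable_const c)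
  have key : ∀ φ : Ω → ℝ, Measurable[𝒜] φ → ∀ C : ℝ, (∀ w, |φ w| ≤ C) →
      ∫ w, φ w * g w ∂P - (∫ w, φ w ∂P) * c = ∫ w, φ w * h w ∂P := by
    intro φ hφ C hC
    have hφm : Measurable φ := hφ.mono h𝒜 le_rfl
    have hφi : Integrable φ P := integrable_of_bounded hφm hC
    have hφg : Integrable (φ * g) P :=
      hgi.bdd_mul hφm.aestronglyMeasurable (Eventually.of_forall hC)
    have hφe : Integrable (fun w => φ w * (P[g|𝒜]) w) P :=
      (integrable_condExp (m := 𝒜) (f := g) (μ := P)).bdd_mul hφm.aestronglyMeasurable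
        (Eventually.of_forall hC)
    have h1 : ∫ w, φ w * g w ∂P = ∫ w, φ w * (P[g|𝒜]) w ∂P := by
      rw [← integral_condExp h𝒜 (f := fun w => φ w * g w)]
      exact integral_congr_ae
        (condExp_mul_of_stronglyMeasurable_left hφ.stronglyMeasurable hφg hgi)
    rw [h1, ← integral_mul_const, ← integral_sub hφe (hφi.mul_const c)]
    exact integral_congr_ae (Eventually.of_forall fun w => by simp only [hh]; ring)
  refine ⟨{w | 0 ≤ h w}, hhm measurableSet_Ici, ?_⟩
  set S := {w | 0 ≤ h w} with hS
  have hSm : MeasurableSet[𝒜] S := hhm measurableSet_Ici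
  have hA0 : 0 ≤ A := by
    obtain ⟨w⟩ := P.nonempty_of_neZero
    exact (abs_nonneg _).trans (hA w)
  have hind : Measurable[𝒜] (S.indicator (1 : Ω → ℝ)) :=
    (measurable_const (a := (1 : ℝ))).indicator hSm
  have hindb : ∀ w, |S.indicator (1 : Ω → ℝ) w| ≤ 1 := fun w => by
    by_cases hw : w ∈ S <;> simp [hw]
  rw [key f hf A hA, key _ hind 1 hindb]
  have h0 : ∫ w, h w ∂P = 0 := by
    have := key (fun _ => 1) measurable_const 1 (by simp)
    simpa [hc] using this.symm
  have habs : ∀ w, |h w| = 2 * (S.indicator (1 : Ω → ℝ) w * h w) - h w := fun w => by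
    by_cases hw : w ∈ S
    · simp only [hw, Set.indicator_of_mem, Pi.one_apply]
      rw [abs_of_nonneg hw]; ring
    · simp only [hw, not_false_eq_true, Set.indicator_of_notMem]
      rw [abs_of_neg (not_le.1 hw)]; ring
  have hindh : Integrable (fun w => S.indicator (1 : Ω → ℝ) w * h w) P :=
    hhi.bdd_mul (hind.mono h𝒜 le_rfl).aestronglyMeasurable (Eventually.of_forall hindb)
  have h2 : ∫ w, |h w| ∂P = 2 * ∫ w, S.indicator (1 : Ω → ℝ) w * h w ∂P := by
    simp_rw [habs]
    rw [integral_sub (hindh.const_mul 2) hhi, h0, integral_const_mul, sub_zero]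
  calc |∫ w, f w * h w ∂P| ≤ ∫ w, |f w * h w| ∂P := abs_integral_le_integral_abs
    _ ≤ ∫ w, A * |h w| ∂P := by
        refine integral_mono (hhi.bdd_mul hfm.aestronglyMeasurable (Eventually.of_forall hA)).abs
          (hhi.abs.const_mul A) fun w => ?_
        dsimp only
        rw [abs_mul]
        exact mul_le_mul_of_nonneg_right (hA w) (abs_nonneg _)
    _ = 2 * A * ∫ w, S.indicator (1 : Ω → ℝ) w * h w ∂P := by
        rw [integral_const_mul, h2]; ring
    _ ≤ _ := mul_le_mul_of_nonneg_left (le_abs_self _) (by positivity)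

/-- Covariance inequality for bounded functions of `α`-mixing `σ`-algebras. -/
theorem abs_cov_le_of_bounded (h𝒜 : 𝒜 ≤ mΩ) (hℬ : ℬ ≤ mΩ)
    {f g : Ω → ℝ} {A B : ℝ} (hf : Measurable[𝒜] f) (hg : Measurable[ℬ] g)
    (hA : ∀ w, |f w| ≤ A) (hB : ∀ w, |g w| ≤ B) :
    |∫ w, f w * g w ∂P - (∫ w, f w ∂P) * ∫ w, g w ∂P| ≤ 4 * A * B * alphaCoef P 𝒜 ℬ := by
  obtain ⟨S, hS, h1⟩ := exists_set_cov_le (P := P) h𝒜 hf (hg.mono hℬ le_rfl) hA hB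
  have hindb : ∀ w, |S.indicator (1 : Ω → ℝ) w| ≤ 1 := fun w => by
    by_cases hw : w ∈ S <;> simp [hw]
  have hind : Measurable (S.indicator (1 : Ω → ℝ)) :=
    (measurable_const (a := (1 : ℝ))).indicator (h𝒜 _ hS)
  -- The reduction is applied once more with the roles exchanged, now to `g` and the indicator of
  -- `S`. Two sets remain, and the two factors `2` make up the `4`.
  obtain ⟨T, hT, h2⟩ := exists_set_cov_le (P := P) hℬ hg hind hB hindb
  have hA0 : 0 ≤ A := by
    obtain ⟨w⟩ := P.nonempty_of_neZero
    exact (abs_nonneg _).trans (hA w)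
  have hB0 : 0 ≤ B := by
    obtain ⟨w⟩ := P.nonempty_of_neZero
    exact (abs_nonneg _).trans (hB w)
  have h3 : ∫ w, T.indicator (1 : Ω → ℝ) w * S.indicator 1 w ∂P = P.real (S ∩ T) := by
    rw [← integral_indicator_one ((h𝒜 _ hS).inter (hℬ _ hT))]
    refine integral_congr_ae (Eventually.of_forall fun w => ?_)
    by_cases h1 : w ∈ S <;> by_cases h2 : w ∈ T <;> simp [h1, h2]
  rw [h3, integral_indicator_one (h𝒜 _ hS), integral_indicator_one (hℬ _ hT)] at h2
  have h4 : |P.real (S ∩ T) - P.real T * P.real S| ≤ alphaCoef P 𝒜 ℬ := by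
    rw [mul_comm (P.real T)]
    exact abs_prob_le_alphaCoef hS hT
  have h5 : ∫ w, S.indicator (1 : Ω → ℝ) w * g w ∂P = ∫ w, g w * S.indicator 1 w ∂P := by
    simp_rw [mul_comm]
  rw [h5, mul_comm (∫ w, S.indicator (1 : Ω → ℝ) w ∂P), integral_indicator_one (h𝒜 _ hS)] at h1
  calc _ ≤ _ := h1
    _ ≤ 2 * A * (2 * B * alphaCoef P 𝒜 ℬ) := by
        refine mul_le_mul_of_nonneg_left (h2.trans ?_) (by positivity)
        exact mul_le_mul_of_nonneg_left h4 (by positivity)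
    _ = _ := by ring

theorem sq_integral_le {f : Ω → ℝ} {A : ℝ} (hf : Measurable f) (hA : ∀ w, |f w| ≤ A) :
    (∫ w, f w ∂P) ^ 2 ≤ ∫ w, f w ^ 2 ∂P := by
  have hi : Integrable f P := integrable_of_bounded hf hA
  have hi2 : Integrable (fun w => f w ^ 2) P := integrable_pow_of_bounded hf hA 2
  set c := ∫ w, f w ∂P with hc
  have h1 : 0 ≤ ∫ w, (f w - c) ^ 2 ∂P := integral_nonneg fun w => sq_nonneg _
  have h2 : ∫ w, (f w - c) ^ 2 ∂P = ∫ w, f w ^ 2 ∂P - c ^ 2 := by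
    have : ∀ w, (f w - c) ^ 2 = f w ^ 2 - (2 * c * f w - c ^ 2) := fun w => by ring
    simp_rw [this]
    have h3 : Integrable (fun w => 2 * c * f w - c ^ 2) P :=
      (hi.const_mul _).sub (integrable_const _)
    rw [integral_sub hi2 h3, integral_sub (hi.const_mul _) (integrable_const _), integral_const_mul, ← hc]
    simp; ring
  linarith

/-- A covariance is at most a weighted sum of second moments. -/
theorem abs_cov_le_weighted {f g : Ω → ℝ} {A B x y lam : ℝ} (hf : Measurable f) (hg : Measurable g)
    (hA : ∀ w, |f w| ≤ A) (hB : ∀ w, |g w| ≤ B) (hx : ∫ w, f w ^ 2 ∂P ≤ x)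
    (hy : ∫ w, g w ^ 2 ∂P ≤ y) (hl : 0 < lam) :
    |∫ w, f w * g w ∂P - (∫ w, f w ∂P) * ∫ w, g w ∂P| ≤ lam * x + y / lam := by
  have amgm : ∀ a b : ℝ, |a * b| ≤ lam / 2 * a ^ 2 + 1 / (2 * lam) * b ^ 2 := fun a b => by
    rw [abs_mul]
    have h1 : 0 ≤ (lam * |a| - |b|) ^ 2 / (2 * lam) := by positivity
    have h2 : (lam * |a| - |b|) ^ 2 / (2 * lam) =
        lam / 2 * |a| ^ 2 + 1 / (2 * lam) * |b| ^ 2 - |a| * |b| := by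
      field_simp; ring
    rw [h2, sq_abs, sq_abs] at h1
    linarith
  have h1 : |∫ w, f w * g w ∂P| ≤ lam / 2 * x + 1 / (2 * lam) * y := by
    calc |∫ w, f w * g w ∂P| ≤ ∫ w, |f w * g w| ∂P := abs_integral_le_integral_abs
      _ ≤ ∫ w, (lam / 2 * f w ^ 2 + 1 / (2 * lam) * g w ^ 2) ∂P := by
          refine integral_mono_of_nonneg (Eventually.of_forall fun w => abs_nonneg _)
            (((integrable_pow_of_bounded hf hA 2).const_mul _).add ((integrable_pow_of_bounded hg hB 2).const_mul _))
            (Eventually.of_forall fun w => amgm _ _)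
      _ = lam / 2 * ∫ w, f w ^ 2 ∂P + 1 / (2 * lam) * ∫ w, g w ^ 2 ∂P := by
          rw [integral_add ((integrable_pow_of_bounded hf hA 2).const_mul _) ((integrable_pow_of_bounded hg hB 2).const_mul _),
            integral_const_mul, integral_const_mul]
      _ ≤ _ := by gcongr
  have h2 := amgm (∫ w, f w ∂P) (∫ w, g w ∂P)
  have h3 : (∫ w, f w ∂P) ^ 2 ≤ x := (sq_integral_le hf hA).trans hx
  have h4 : (∫ w, g w ∂P) ^ 2 ≤ y := (sq_integral_le hg hB).trans hy
  have h5 : lam / 2 * (∫ w, f w ∂P) ^ 2 + 1 / (2 * lam) * (∫ w, g w ∂P) ^ 2 ≤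
      lam / 2 * x + 1 / (2 * lam) * y := by gcongr
  have h6 : lam * x + y / lam = 2 * (lam / 2 * x + 1 / (2 * lam) * y) := by field_simp
  rw [h6]
  refine (abs_sub _ _).trans ?_
  linarith

/-- Davydov-type covariance inequality for functions with bounded moments of order `2 + 2ε`. -/
theorem abs_cov_le_of_moment (h𝒜 : 𝒜 ≤ mΩ) (hℬ : ℬ ≤ mΩ)
    {f g : Ω → ℝ} {A B ω ε x : ℝ} (hf : Measurable[𝒜] f) (hg : Measurable[ℬ] g)
    (hA : ∀ w, |f w| ≤ A) (hB : ∀ w, |g w| ≤ B) (hω : 0 < ω) (hε : 0 < ε) (hε1 : ε < 1)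
    (hx : 0 ≤ x) (hα : alphaCoef P 𝒜 ℬ ≤ Real.exp (-x))
    (hfm : ∫ w, |f w| ^ (2 + 2 * ε) ∂P ≤ ω ^ (2 + 2 * ε))
    (hgm : ∫ w, |g w| ^ (2 + 2 * ε) ∂P ≤ ω ^ (2 + 2 * ε)) :
    |∫ w, f w * g w ∂P - (∫ w, f w ∂P) * ∫ w, g w ∂P| ≤
      10 * ω ^ 2 * Real.exp (-(ε / 4 * x)) := by
  set lam := Real.exp (-(ε / 4 * x)) with hlam
  have hlam0 : 0 < lam := Real.exp_pos _
  -- Clipping level: the clipped parts contribute `4 C² e^(-x) = 4 ω² e^(-x/2)`, and the remainders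
  -- have second moment at most `C^(-2ε) ω^(2+2ε) = ω² lam²`.
  set C := ω * Real.exp (x / 4) with hC
  have hC0 : 0 < C := by positivity
  let cl : ℝ → ℝ := fun y => max (-C) (min y C)
  have hcl : Measurable cl := by fun_prop
  have hclb : ∀ y, |cl y| ≤ C := fun y => by
    simp only [cl, abs_le]
    exact ⟨le_max_left _ _, max_le (by linarith) (min_le_right _ _)⟩
  have hres : ∀ y, |y - cl y| ≤ |y| := fun y => by
    simp only [cl]
    rcases max_cases (-C) (min y C) with h | h <;> rcases min_cases y C with h' | h' <;>
      rw [abs_le] <;> constructor <;> cases abs_cases y <;> linarith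
  have hclle : ∀ y, |cl y| ≤ |y| := fun y => by
    simp only [cl]
    rcases max_cases (-C) (min y C) with h | h <;> rcases min_cases y C with h' | h' <;>
      rw [abs_le] <;> constructor <;> cases abs_cases y <;> linarith
  have hzero : ∀ y, |y| ≤ C → y - cl y = 0 := fun y hy => by
    simp only [cl]
    rw [abs_le] at hy
    rw [min_eq_left hy.2, max_eq_right hy.1, sub_self]
  have htail : ∀ y : ℝ, (y - cl y) ^ 2 ≤ C ^ (-(2 * ε)) * |y| ^ (2 + 2 * ε) := fun y => by
    rcases le_or_gt |y| C with h | h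
    · rw [hzero y h]; simp only [ne_eq, OfNat.ofNat_ne_zero, not_false_eq_true, zero_pow]; positivity
    · have hy : 0 < |y| := hC0.trans h
      have h0 : (y - cl y) ^ 2 ≤ |y| ^ 2 := by
        rw [← sq_abs (y - cl y)]; exact pow_le_pow_left₀ (abs_nonneg _) (hres y) 2
      have h1 : |y| ^ 2 = |y| ^ (-(2 * ε)) * |y| ^ (2 + 2 * ε) := by
        rw [← Real.rpow_add hy, show -(2 * ε) + (2 + 2 * ε) = (2 : ℕ) by push_cast; ring,
          Real.rpow_natCast]
      rw [h1] at h0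
      exact h0.trans (mul_le_mul_of_nonneg_right
        (Real.rpow_le_rpow_of_nonpos hC0 h.le (by linarith)) (by positivity))
  have hωω : ω ^ (-(2 * ε)) * ω ^ (2 + 2 * ε) = ω ^ 2 := by
    rw [← Real.rpow_add hω, show -(2 * ε) + (2 + 2 * ε) = (2 : ℕ) by push_cast; ring,
      Real.rpow_natCast]
  have hCω : C ^ (-(2 * ε)) * ω ^ (2 + 2 * ε) = ω ^ 2 * lam ^ 2 := by
    rw [hC, Real.mul_rpow hω.le (Real.exp_pos _).le, mul_right_comm, hωω, ← Real.exp_mul, hlam,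
      ← Real.exp_nat_mul]
    congr 2; push_cast; ring
  have hmi : ∀ {f : Ω → ℝ} {A : ℝ}, Measurable f → (∀ w, |f w| ≤ A) →
      Integrable (fun w => |f w| ^ (2 + 2 * ε)) P := fun {f A} hf hA =>
    integrable_of_bounded (hf.abs.pow_const _) (A := A ^ (2 + 2 * ε)) fun w => by
      rw [abs_of_nonneg (by positivity)]
      exact Real.rpow_le_rpow (abs_nonneg _) (hA w) (by linarith)
  have hfm' : Measurable f := hf.mono h𝒜 le_rfl
  have hgm' : Measurable g := hg.mono hℬ le_rfl
  have hsecond : ∀ {f : Ω → ℝ} {A : ℝ}, Measurable f → (∀ w, |f w| ≤ A) →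
      ∫ w, |f w| ^ (2 + 2 * ε) ∂P ≤ ω ^ (2 + 2 * ε) → ∫ w, f w ^ 2 ∂P ≤ 2 * ω ^ 2 ∧
        ∫ w, (cl (f w)) ^ 2 ∂P ≤ 2 * ω ^ 2 ∧
        ∫ w, (f w - cl (f w)) ^ 2 ∂P ≤ ω ^ 2 * lam ^ 2 := fun {f A} hf hA hm => by
    have hi := hmi hf hA
    have hdom : Integrable (fun w => ω ^ 2 + ω ^ (-(2 * ε)) * |f w| ^ (2 + 2 * ε)) P :=
      (integrable_const _).add (hi.const_mul _)
    have hval : ∫ w, (ω ^ 2 + ω ^ (-(2 * ε)) * |f w| ^ (2 + 2 * ε)) ∂P ≤ 2 * ω ^ 2 := by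
      rw [integral_add (integrable_const _) (hi.const_mul _), integral_const_mul]
      have := mul_le_mul_of_nonneg_left hm (by positivity : 0 ≤ ω ^ (-(2 * ε)))
      simp only [integral_const, probReal_univ, one_smul]
      linarith
    refine ⟨(integral_mono_of_nonneg (Eventually.of_forall fun w => sq_nonneg _) hdom
      (Eventually.of_forall fun w => sq_le_add_rpow hω hε _)).trans hval,
      (integral_mono_of_nonneg (Eventually.of_forall fun w => sq_nonneg _) hdom
      (Eventually.of_forall fun w => ?_)).trans hval, ?_⟩
    · refine le_trans ?_ (sq_le_add_rpow hω hε (f w))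
      rw [← sq_abs, ← sq_abs (f w)]
      exact pow_le_pow_left₀ (abs_nonneg _) (hclle _) 2
    · refine (integral_mono_of_nonneg (Eventually.of_forall fun w => sq_nonneg _)
        (hi.const_mul (C ^ (-(2 * ε)))) (Eventually.of_forall fun w => htail _)).trans ?_
      rw [integral_const_mul, ← hCω]
      exact mul_le_mul_of_nonneg_left hm (by positivity)
  obtain ⟨hf2, hfc2, hfr2⟩ := hsecond hfm' hA hfm
  obtain ⟨hg2, hgc2, hgr2⟩ := hsecond hgm' hB hgm
  have hfc : Measurable fun w => cl (f w) := hcl.comp hfm'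
  have hgc : Measurable fun w => cl (g w) := hcl.comp hgm'
  have c1 := abs_cov_le_of_bounded (P := P) h𝒜 hℬ (f := fun w => cl (f w))
    (g := fun w => cl (g w)) (hcl.comp hf) (hcl.comp hg) (fun w => hclb _) (fun w => hclb _)
  -- One factor has second moment at most `2 ω²`, the other at most `ω² lam²`. The weight `lam`
  -- balances them to `3 ω² lam`; two such terms and the clipped one give the constant `10`.
  have c2 := abs_cov_le_weighted (P := P) hfc (hgm'.sub hgc) (fun w => hclb _)
    (fun w => (hres (g w)).trans (hB w)) hfc2 hgr2 hlam0
  have c3 := abs_cov_le_weighted (P := P) hgm' (hfm'.sub hfc) hB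
    (fun w => (hres (f w)).trans (hA w)) hg2 hfr2 hlam0
  simp only [Pi.sub_apply] at c2 c3
  have hfi := integrable_of_bounded (P := P) hfm' hA
  have hgi := integrable_of_bounded (P := P) hgm' hB
  have hfci := integrable_of_bounded (P := P) hfc fun w => hclb _
  have hgci := integrable_of_bounded (P := P) hgc fun w => hclb _
  have m1 : Integrable (fun w => cl (f w) * g w) P :=
    hgi.bdd_mul hfc.aestronglyMeasurable (Eventually.of_forall fun w => hclb _)
  have m2 : Integrable (fun w => cl (f w) * cl (g w)) P :=
    hgci.bdd_mul hfc.aestronglyMeasurable (Eventually.of_forall fun w => hclb _)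
  have m3 : Integrable (fun w => f w * g w) P :=
    hgi.bdd_mul hfm'.aestronglyMeasurable (Eventually.of_forall hA)
  have m4 : Integrable (fun w => cl (f w) * (g w - cl (g w))) P := by
    simp_rw [mul_sub]; exact m1.sub m2
  have m5 : Integrable (fun w => g w * (f w - cl (f w))) P := by
    have : ∀ w, g w * (f w - cl (f w)) = f w * g w - cl (f w) * g w := fun w => by ring
    simp_rw [this]; exact m3.sub m1
  have hdec : ∫ w, f w * g w ∂P - (∫ w, f w ∂P) * ∫ w, g w ∂P =
      (∫ w, cl (f w) * cl (g w) ∂P - (∫ w, cl (f w) ∂P) * ∫ w, cl (g w) ∂P) +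
      (∫ w, cl (f w) * (g w - cl (g w)) ∂P - (∫ w, cl (f w) ∂P) * ∫ w, g w - cl (g w) ∂P) +
      (∫ w, g w * (f w - cl (f w)) ∂P - (∫ w, g w ∂P) * ∫ w, f w - cl (f w) ∂P) := by
    have m6 : Integrable (fun w => cl (f w) * cl (g w) + cl (f w) * (g w - cl (g w))) P :=
      m2.add m4
    rw [integral_sub hgi hgci, integral_sub hfi hfci]
    have : ∫ w, f w * g w ∂P = ∫ w, cl (f w) * cl (g w) ∂P +
        ∫ w, cl (f w) * (g w - cl (g w)) ∂P + ∫ w, g w * (f w - cl (f w)) ∂P := by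
      rw [← integral_add m2 m4, ← integral_add m6 m5]
      exact integral_congr_ae (Eventually.of_forall fun w => by ring)
    rw [this]; ring
  have hb : 4 * C * C * alphaCoef P 𝒜 ℬ ≤ 4 * ω ^ 2 * lam := by
    calc 4 * C * C * alphaCoef P 𝒜 ℬ ≤ 4 * C * C * Real.exp (-x) :=
          mul_le_mul_of_nonneg_left hα (by positivity)
      _ = 4 * ω ^ 2 * Real.exp (x / 4 + x / 4 + -x) := by
          rw [Real.exp_add, Real.exp_add, hC]; ring
      _ ≤ 4 * ω ^ 2 * lam := by
          refine mul_le_mul_of_nonneg_left (Real.exp_le_exp.2 ?_) (by positivity)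
          nlinarith
  have hw : lam * (2 * ω ^ 2) + ω ^ 2 * lam ^ 2 / lam = 3 * ω ^ 2 * lam := by
    field_simp; ring
  rw [hw] at c2 c3
  rw [hdec]
  refine (abs_add_three _ _ _).trans ?_
  linarith

end Covariance

/-! ### Elementary properties of the truncation. -/

section Truncation

theorem truncate_eq_clip {τ : ℝ} (hτ : 0 < τ) (x : ℝ) : truncate τ x = max (-τ) (min x τ) := by
  unfold truncate
  rcases lt_trichotomy x 0 with h | h | h
  · rw [Real.sign_of_neg h, abs_of_neg h, min_eq_left (h.le.trans hτ.le)]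
    rcases le_total (-x) τ with h' | h'
    · rw [min_eq_left h', max_eq_right (by linarith)]; ring
    · rw [min_eq_right h', max_eq_left (by linarith)]; ring
  · subst h; simp [hτ.le]
  · rw [Real.sign_of_pos h, abs_of_pos h, one_mul, max_eq_right]
    exact le_min (by linarith) (by linarith)

theorem abs_truncate_le {τ : ℝ} (hτ : 0 < τ) (x : ℝ) : |truncate τ x| ≤ τ := by
  rw [truncate_eq_clip hτ, abs_le]
  exact ⟨le_max_left _ _, max_le (by linarith) (min_le_right _ _)⟩

theorem measurable_truncate {τ : ℝ} (hτ : 0 < τ) : Measurable (truncate τ) := by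
  have : truncate τ = fun x => max (-τ) (min x τ) := funext (truncate_eq_clip hτ)
  rw [this]; fun_prop

/-- The truncation is 1-Lipschitz and fixes `c`. Truncated noise thus inherits all moments of the
original noise. -/
theorem abs_truncate_add_sub_le {τ c : ℝ} (hτ : 0 < τ) (hc : |c| ≤ τ) (x : ℝ) :
    |truncate τ (c + x) - c| ≤ |x| := by
  rw [truncate_eq_clip hτ]
  rw [abs_le] at hc
  rcases max_cases (-τ) (min (c + x) τ) with h | h <;>
    rcases min_cases (c + x) τ with h' | h' <;>
    rw [abs_le] <;> constructor <;> cases abs_cases x <;> linarith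

/-- When `|c|` and `|x|` are at most `τ / 2` nothing is truncated. The bias is therefore governed by
the tail of the noise beyond `τ / 2`. -/
theorem abs_truncate_add_sub_sub_le {τ c : ℝ} (hτ : 0 < τ) (hc : |c| ≤ τ / 2) (x : ℝ) :
    |truncate τ (c + x) - c - x| ≤ if τ / 2 < |x| then |x| else 0 := by
  rw [truncate_eq_clip hτ]
  rw [abs_le] at hc
  split_ifs with hx
  · rcases max_cases (-τ) (min (c + x) τ) with h | h <;>
      rcases min_cases (c + x) τ with h' | h' <;>
      rw [abs_le] <;> constructor <;> cases abs_cases x <;> linarith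
  · rw [not_lt, abs_le] at hx
    rw [min_eq_left (by linarith), max_eq_right (by linarith)]
    simp

end Truncation

/-! ### The truncated noise: bias and moments. -/

namespace TensorFactorModel

noncomputable section

variable {K : ℕ} {r : Fin K → ℕ} {Ω : Type*} [mΩ : MeasurableSpace Ω]

/-- The observation times. -/
abbrev Time (m : TensorFactorModel K r Ω) : Type := {t // t ∈ Finset.Icc 1 m.n}

/-- The multi-indices of the data. -/
abbrev Site (m : TensorFactorModel K r Ω) : Type := ∀ k, Fin (m.p k)

/-- Truncated data minus the common component. -/
def rawNoise (m : TensorFactorModel K r Ω) (τ : ℝ) (x : m.Site) (t : m.Time) (w : Ω) : ℝ :=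
  m.Xtrunc τ t w x - tucker (m.F t) m.Λ x

/-- The centred version of `rawNoise`. -/
def noise (m : TensorFactorModel K r Ω) (τ : ℝ) (x : m.Site) (t : m.Time) (w : Ω) : ℝ :=
  m.rawNoise τ x t w - ∫ w, m.rawNoise τ x t w ∂m.P

/-- The bias of the truncation is at most this. -/
def biasBound (ε ω τ : ℝ) : ℝ := ω ^ (2 + 2 * ε) * (τ / 2) ^ (-(1 + 2 * ε))

/-- A bound for the fourth moments of the noise. -/
def fourthBound (ε ω τ : ℝ) : ℝ := 16 * ((2 * τ) ^ (2 - 2 * ε) * ω ^ (2 + 2 * ε))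

/-- What is needed of a model and a truncation parameter to control the truncated noise. -/
structure NoiseSetup (m : TensorFactorModel K r Ω) (ε ω τ : ℝ) : Prop where
  ε_pos : 0 < ε
  ε_lt : ε < 1
  ω_pos : 0 < ω
  τ_pos : 0 < τ
  moment : ∀ i t, eLpNorm (m.ξ i t) (ENNReal.ofReal (2 + 2 * ε)) m.P ≤ ENNReal.ofReal ω
  common : ∀ (x : m.Site) (t : m.Time), |tucker (m.F t) m.Λ x| ≤ τ / 2

variable {m : TensorFactorModel K r Ω} {ε ω τ : ℝ}

theorem rawNoise_eq (x : m.Site) (t : m.Time) (w : Ω) :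
    m.rawNoise τ x t w =
      truncate τ (tucker (m.F t) m.Λ x + m.ξ x ((t : ℕ) : ℤ) w) - tucker (m.F t) m.Λ x := rfl

theorem sigmaField_le (E : Set (m.Site × ℤ)) : m.sigmaField E ≤ mΩ :=
  iSup₂_le fun x _ => (m.measurable_ξ x.1 x.2).comap_le

theorem sigmaField_mono {E E' : Set (m.Site × ℤ)} (h : E ⊆ E') :
    m.sigmaField E ≤ m.sigmaField E' :=
  biSup_mono h

theorem measurable_ξ_sigmaField {E : Set (m.Site × ℤ)} {x : m.Site} {t : ℤ} (h : (x, t) ∈ E) :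
    Measurable[m.sigmaField E] (m.ξ x t) := by
  rw [measurable_iff_comap_le]
  exact le_iSup₂_of_le (f := fun (y : m.Site × ℤ) (_ : y ∈ E) =>
    MeasurableSpace.comap (m.ξ y.1 y.2) inferInstance) (x, t) h le_rfl

namespace NoiseSetup

variable (h : m.NoiseSetup ε ω τ)
include h

theorem measurable_rawNoise_sigmaField {E : Set (m.Site × ℤ)} {x : m.Site} {t : m.Time}
    (hx : (x, ((t : ℕ) : ℤ)) ∈ E) : Measurable[m.sigmaField E] (m.rawNoise τ x t) :=
  ((measurable_truncate h.τ_pos).comp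
    ((measurable_ξ_sigmaField hx).const_add _)).sub_const _

theorem measurable_noise_sigmaField {E : Set (m.Site × ℤ)} {x : m.Site} {t : m.Time}
    (hx : (x, ((t : ℕ) : ℤ)) ∈ E) : Measurable[m.sigmaField E] (m.noise τ x t) :=
  (h.measurable_rawNoise_sigmaField hx).sub_const _

theorem measurable_rawNoise (x : m.Site) (t : m.Time) : Measurable (m.rawNoise τ x t) :=
  (h.measurable_rawNoise_sigmaField (Set.mem_univ _)).mono (sigmaField_le _) le_rfl

theorem measurable_noise (x : m.Site) (t : m.Time) : Measurable (m.noise τ x t) :=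
  (h.measurable_rawNoise x t).sub_const _

theorem abs_rawNoise_le (x : m.Site) (t : m.Time) (w : Ω) : |m.rawNoise τ x t w| ≤ 2 * τ := by
  rw [rawNoise_eq]
  have h1 := abs_truncate_le h.τ_pos (tucker (m.F t) m.Λ x + m.ξ x ((t : ℕ) : ℤ) w)
  have h2 := h.common x t
  have h3 := abs_sub (truncate τ (tucker (m.F t) m.Λ x + m.ξ x ((t : ℕ) : ℤ) w))
    (tucker (m.F t) m.Λ x)
  linarith [h.τ_pos]

theorem integrable_rawNoise (x : m.Site) (t : m.Time) : Integrable (m.rawNoise τ x t) m.P :=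
  have := m.isProb
  integrable_of_bounded (h.measurable_rawNoise x t) (h.abs_rawNoise_le x t)

theorem abs_noise_le (x : m.Site) (t : m.Time) (w : Ω) : |m.noise τ x t w| ≤ 4 * τ := by
  have := m.isProb
  have h1 := h.abs_rawNoise_le x t w
  have h2 : |∫ w, m.rawNoise τ x t w ∂m.P| ≤ 2 * τ := by
    have := norm_integral_le_of_norm_le_const (μ := m.P) (f := m.rawNoise τ x t) (C := 2 * τ)
      (Eventually.of_forall (h.abs_rawNoise_le x t))
    simpa using this
  have h3 := abs_sub (m.rawNoise τ x t w) (∫ w, m.rawNoise τ x t w ∂m.P)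
  unfold noise
  linarith

theorem integral_noise (x : m.Site) (t : m.Time) : ∫ w, m.noise τ x t w ∂m.P = 0 := by
  have := m.isProb
  unfold noise
  rw [integral_sub (h.integrable_rawNoise x t) (integrable_const _)]
  simp

theorem memLp_ξ (x : m.Site) (t : ℤ) : MemLp (m.ξ x t) (ENNReal.ofReal (2 + 2 * ε)) m.P :=
  ⟨(m.measurable_ξ x t).aestronglyMeasurable, (h.moment x t).trans_lt ENNReal.ofReal_lt_top⟩

theorem integrable_rpow_ξ (x : m.Site) (t : ℤ) :
    Integrable (fun w => |m.ξ x t w| ^ (2 + 2 * ε)) m.P := by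
  have h0 : 0 < 2 + 2 * ε := by linarith [h.ε_pos]
  have := (h.memLp_ξ x t).integrable_norm_rpow (by simpa using h0) ENNReal.ofReal_ne_top
  simpa [ENNReal.toReal_ofReal h0.le] using this

theorem integral_rpow_ξ_le (x : m.Site) (t : ℤ) :
    ∫ w, |m.ξ x t w| ^ (2 + 2 * ε) ∂m.P ≤ ω ^ (2 + 2 * ε) := by
  have h0 : 0 < 2 + 2 * ε := by linarith [h.ε_pos]
  have h1 := (h.memLp_ξ x t).eLpNorm_eq_integral_rpow_norm (by simpa using h0) ENNReal.ofReal_ne_top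
  have h2 := h.moment x t
  rw [h1, ENNReal.toReal_ofReal h0.le, ENNReal.ofReal_le_ofReal_iff h.ω_pos.le] at h2
  have h3 : 0 ≤ ∫ w, ‖m.ξ x t w‖ ^ (2 + 2 * ε) ∂m.P := integral_nonneg fun w => by positivity
  have h4 := Real.rpow_le_rpow (by positivity) h2 h0.le
  rwa [← Real.rpow_mul h3, inv_mul_cancel₀ h0.ne', Real.rpow_one] at h4

theorem abs_rawNoise_le_ξ (x : m.Site) (t : m.Time) (w : Ω) :
    |m.rawNoise τ x t w| ≤ |m.ξ x ((t : ℕ) : ℤ) w| := by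
  rw [rawNoise_eq]
  exact abs_truncate_add_sub_le h.τ_pos ((h.common x t).trans (by linarith [h.τ_pos])) _

theorem integral_rpow_rawNoise_le (x : m.Site) (t : m.Time) :
    ∫ w, |m.rawNoise τ x t w| ^ (2 + 2 * ε) ∂m.P ≤ ω ^ (2 + 2 * ε) := by
  refine le_trans ?_ (h.integral_rpow_ξ_le x ((t : ℕ) : ℤ))
  refine integral_mono_of_nonneg (Eventually.of_forall fun w => by positivity)
    (h.integrable_rpow_ξ _ _) (Eventually.of_forall fun w => ?_)
  exact Real.rpow_le_rpow (abs_nonneg _) (h.abs_rawNoise_le_ξ x t w) (by linarith [h.ε_pos])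

/-- The original noise is centred, so the bias is the mean of the truncation error. The latter lives
on `|ξ| > τ / 2`, where `|ξ| ≤ (τ / 2)^(-(1 + 2ε)) |ξ|^(2 + 2ε)`. -/
theorem abs_bias_le (x : m.Site) (t : m.Time) :
    |∫ w, m.rawNoise τ x t w ∂m.P| ≤ biasBound ε ω τ := by
  have := m.isProb
  have hτ := h.τ_pos
  have h1 : ∫ w, m.rawNoise τ x t w ∂m.P =
      ∫ w, (m.rawNoise τ x t w - m.ξ x ((t : ℕ) : ℤ) w) ∂m.P := by
    rw [integral_sub (h.integrable_rawNoise x t) (m.integrable_ξ _ _), m.mean_ξ, sub_zero]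
  rw [h1]
  refine abs_integral_le_integral_abs.trans ?_
  calc ∫ w, |m.rawNoise τ x t w - m.ξ x ((t : ℕ) : ℤ) w| ∂m.P
      ≤ ∫ w, (τ / 2) ^ (-(1 + 2 * ε)) * |m.ξ x ((t : ℕ) : ℤ) w| ^ (2 + 2 * ε) ∂m.P := by
        refine integral_mono_of_nonneg (Eventually.of_forall fun w => abs_nonneg _)
          ((h.integrable_rpow_ξ _ _).const_mul _) (Eventually.of_forall fun w => ?_)
        refine (abs_truncate_add_sub_sub_le hτ (h.common x t) _).trans ?_
        dsimp only
        split_ifs with hx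
        · have hx0 : 0 < |m.ξ x ((t : ℕ) : ℤ) w| := lt_trans (by positivity) hx
          have h2 : |m.ξ x ((t : ℕ) : ℤ) w| = |m.ξ x ((t : ℕ) : ℤ) w| ^ (-(1 + 2 * ε)) *
              |m.ξ x ((t : ℕ) : ℤ) w| ^ (2 + 2 * ε) := by
            rw [← Real.rpow_add hx0, show -(1 + 2 * ε) + (2 + 2 * ε) = 1 by ring, Real.rpow_one]
          conv_lhs => rw [h2]
          refine mul_le_mul_of_nonneg_right ?_ (by positivity)
          exact Real.rpow_le_rpow_of_nonpos (by positivity) hx.le (by linarith [h.ε_pos])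
        · positivity
    _ = (τ / 2) ^ (-(1 + 2 * ε)) * ∫ w, |m.ξ x ((t : ℕ) : ℤ) w| ^ (2 + 2 * ε) ∂m.P :=
        integral_const_mul _ _
    _ ≤ _ := by
        rw [biasBound, mul_comm]
        exact mul_le_mul_of_nonneg_right (h.integral_rpow_ξ_le _ _) (by positivity)

theorem integral_sq_noise_le (x : m.Site) (t : m.Time) :
    ∫ w, m.noise τ x t w ^ 2 ∂m.P ≤ 2 * ω ^ 2 := by
  have := m.isProb
  have hr := h.integrable_rawNoise x t
  have hr2 := integrable_pow_of_bounded (P := m.P) (h.measurable_rawNoise x t) (h.abs_rawNoise_le x t) 2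
  have h1 : ∫ w, m.noise τ x t w ^ 2 ∂m.P ≤ ∫ w, m.rawNoise τ x t w ^ 2 ∂m.P := by
    set c := ∫ w, m.rawNoise τ x t w ∂m.P with hc
    have h2 : ∀ w, m.noise τ x t w ^ 2 =
        m.rawNoise τ x t w ^ 2 - (2 * c * m.rawNoise τ x t w - c ^ 2) := fun w => by
      simp only [noise, ← hc]; ring
    have h3 : Integrable (fun w => 2 * c * m.rawNoise τ x t w - c ^ 2) m.P :=
      (hr.const_mul _).sub (integrable_const _)
    simp_rw [h2]
    rw [integral_sub hr2 h3, integral_sub (hr.const_mul _) (integrable_const _),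
      integral_const_mul, ← hc]
    simp only [integral_const, probReal_univ, one_smul]
    nlinarith [sq_nonneg c]
  refine h1.trans ?_
  have hω := h.ω_pos
  have hi := h.integrable_rpow_ξ x ((t : ℕ) : ℤ)
  calc ∫ w, m.rawNoise τ x t w ^ 2 ∂m.P
      ≤ ∫ w, (ω ^ 2 + ω ^ (-(2 * ε)) * |m.ξ x ((t : ℕ) : ℤ) w| ^ (2 + 2 * ε)) ∂m.P := by
        refine integral_mono hr2 ((integrable_const _).add (hi.const_mul _)) fun w => ?_
        refine le_trans ?_ (sq_le_add_rpow hω h.ε_pos _)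
        exact sq_le_sq.2 (h.abs_rawNoise_le_ξ x t w)
    _ = ω ^ 2 + ω ^ (-(2 * ε)) * ∫ w, |m.ξ x ((t : ℕ) : ℤ) w| ^ (2 + 2 * ε) ∂m.P := by
        rw [integral_add (integrable_const _) (hi.const_mul _), integral_const_mul]
        simp
    _ ≤ ω ^ 2 + ω ^ (-(2 * ε)) * ω ^ (2 + 2 * ε) := by
        gcongr
        exact h.integral_rpow_ξ_le _ _
    _ = 2 * ω ^ 2 := by
        rw [← Real.rpow_add hω, show -(2 * ε) + (2 + 2 * ε) = (2 : ℕ) by push_cast; ring,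
          Real.rpow_natCast]
        ring

/-- Of the four powers, `2 - 2ε` are bounded by the truncation level and `2 + 2ε` by the moment
assumption. Centring costs the factor `16`, through `(a - c)⁴ ≤ 8 a⁴ + 8 c⁴` and `c⁴ ≤ 𝔼 a⁴`. -/
theorem integral_noise_pow_four_le (x : m.Site) (t : m.Time) :
    ∫ w, m.noise τ x t w ^ 4 ∂m.P ≤ fourthBound ε ω τ := by
  have := m.isProb
  have hτ := h.τ_pos
  have hm := h.measurable_rawNoise x t
  have hb := h.abs_rawNoise_le x t
  have hr4 := integrable_pow_of_bounded (P := m.P) hm hb 4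
  have hr2 := integrable_pow_of_bounded (P := m.P) hm hb 2
  set c := ∫ w, m.rawNoise τ x t w ∂m.P with hc
  have hc4 : c ^ 4 ≤ ∫ w, m.rawNoise τ x t w ^ 4 ∂m.P := by
    have h1 := sq_integral_le (P := m.P) hm hb
    have h2 := sq_integral_le (P := m.P) (hm.pow_const 2) (A := (2 * τ) ^ 2) fun w => by
      rw [abs_pow]; exact pow_le_pow_left₀ (abs_nonneg _) (hb w) 2
    simp only [← pow_mul] at h2
    calc c ^ 4 = (c ^ 2) ^ 2 := by ring
      _ ≤ (∫ w, m.rawNoise τ x t w ^ 2 ∂m.P) ^ 2 := pow_le_pow_left₀ (sq_nonneg _) h1 2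
      _ ≤ _ := h2
  have h4 : ∫ w, m.rawNoise τ x t w ^ 4 ∂m.P ≤ (2 * τ) ^ (2 - 2 * ε) * ω ^ (2 + 2 * ε) := by
    calc ∫ w, m.rawNoise τ x t w ^ 4 ∂m.P
        ≤ ∫ w, (2 * τ) ^ (2 - 2 * ε) * |m.ξ x ((t : ℕ) : ℤ) w| ^ (2 + 2 * ε) ∂m.P := by
          refine integral_mono hr4 ((h.integrable_rpow_ξ _ _).const_mul _) fun w => ?_
          dsimp only
          rcases eq_or_ne (m.rawNoise τ x t w) 0 with h0 | h0
          · rw [h0]; simp only [ne_eq, OfNat.ofNat_ne_zero, not_false_eq_true, zero_pow]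
            positivity
          · have hpos : 0 < |m.rawNoise τ x t w| := abs_pos.2 h0
            have h5 : m.rawNoise τ x t w ^ 4 = |m.rawNoise τ x t w| ^ (2 - 2 * ε) *
                |m.rawNoise τ x t w| ^ (2 + 2 * ε) := by
              rw [← Real.rpow_add hpos, show 2 - 2 * ε + (2 + 2 * ε) = (4 : ℕ) by
                push_cast; ring, Real.rpow_natCast, Even.pow_abs (by decide)]
            rw [h5]
            exact mul_le_mul (Real.rpow_le_rpow hpos.le (hb w) (by linarith [h.ε_lt]))
              (Real.rpow_le_rpow hpos.le (h.abs_rawNoise_le_ξ x t w) (by linarith [h.ε_pos]))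
              (by positivity) (by positivity)
      _ = (2 * τ) ^ (2 - 2 * ε) * ∫ w, |m.ξ x ((t : ℕ) : ℤ) w| ^ (2 + 2 * ε) ∂m.P :=
          integral_const_mul _ _
      _ ≤ _ := mul_le_mul_of_nonneg_left (h.integral_rpow_ξ_le _ _) (by positivity)
  calc ∫ w, m.noise τ x t w ^ 4 ∂m.P ≤ ∫ w, (8 * m.rawNoise τ x t w ^ 4 + 8 * c ^ 4) ∂m.P := by
        refine integral_mono (integrable_pow_of_bounded (h.measurable_noise x t)
          (h.abs_noise_le x t) 4) ((hr4.const_mul _).add (integrable_const _)) fun w => ?_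
        simp only [noise, ← hc]
        nlinarith [sq_nonneg (m.rawNoise τ x t w + c), sq_nonneg (m.rawNoise τ x t w - c),
          sq_nonneg (m.rawNoise τ x t w ^ 2 - c ^ 2),
          sq_nonneg ((m.rawNoise τ x t w + c) ^ 2), sq_nonneg ((m.rawNoise τ x t w) * c),
          mul_nonneg (sq_nonneg (m.rawNoise τ x t w + c)) (sq_nonneg (m.rawNoise τ x t w - c)),
          sq_nonneg ((m.rawNoise τ x t w + c) * (m.rawNoise τ x t w - c)),
          mul_nonneg (sq_nonneg (m.rawNoise τ x t w)) (sq_nonneg (m.rawNoise τ x t w + c)),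
          mul_nonneg (sq_nonneg c) (sq_nonneg (m.rawNoise τ x t w + c))]
    _ = 8 * ∫ w, m.rawNoise τ x t w ^ 4 ∂m.P + 8 * c ^ 4 := by
        rw [integral_add (hr4.const_mul _) (integrable_const _), integral_const_mul]
        simp
    _ ≤ _ := by rw [fourthBound]; linarith

end NoiseSetup

end

end TensorFactorModel

/-! ### Interpolation, exponential sums over boxes, Schur test. -/

section Decay

/-- Interpolation between a moment bound and a mixing bound. -/
theorem le_interpolate {z W R E θ C : ℝ} (hW : 0 ≤ W) (hR : 0 ≤ R) (hE : 0 ≤ E)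
    (hθ0 : 0 ≤ θ) (hθ1 : θ ≤ 1) (hC : R ^ θ ≤ C) (h1 : z ≤ W) (h2 : z ≤ W * R * E) :
    z ≤ W * C * E ^ θ := by
  -- `min 1 y ≤ y ^ θ` for `y ≥ 0` and `0 ≤ θ ≤ 1`, applied to `y = R E`.
  have h3 : z ≤ W * (R * E) ^ θ := by
    rcases le_or_gt 1 (R * E) with h | h
    · exact h1.trans (le_mul_of_one_le_right hW (Real.one_le_rpow h hθ0))
    · rcases eq_or_lt_of_le (mul_nonneg hR hE) with h0 | h0
      · rw [mul_assoc, ← h0, mul_zero] at h2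
        exact h2.trans (by positivity)
      · rw [mul_assoc] at h2
        refine h2.trans (mul_le_mul_of_nonneg_left ?_ hW)
        conv_lhs => rw [← Real.rpow_one (R * E)]
        exact Real.rpow_le_rpow_of_exponent_ge h0 h.le hθ1
  rw [Real.mul_rpow hR hE, ← mul_assoc] at h3
  exact h3.trans (mul_le_mul_of_nonneg_right (mul_le_mul_of_nonneg_left hC hW) (by positivity))

/-- The geometric series sums to `1 / (e^a - 1)`. The bound has the right order for small `a`, which
matters because it is later used with `a` of order `1 / log`. -/
theorem sum_exp_neg_succ_le (s : Finset ℕ) {a : ℝ} (ha : 0 < a) :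
    ∑ h ∈ s, Real.exp (-(a * (h + 1 : ℕ))) ≤ 1 / a := by
  have hlt : Real.exp (-a) < 1 := by
    rw [← Real.exp_zero]; exact Real.exp_lt_exp.2 (by linarith)
  have hs := (hasSum_geometric_of_lt_one (Real.exp_pos (-a)).le hlt).mul_left (Real.exp (-a))
  have h1 : ∀ h : ℕ, Real.exp (-(a * (h + 1 : ℕ))) = Real.exp (-a) * Real.exp (-a) ^ h := fun h => by
    rw [← pow_succ', ← Real.exp_nat_mul]; congr 1; push_cast; ring
  calc ∑ h ∈ s, Real.exp (-(a * (h + 1 : ℕ))) = ∑ h ∈ s, Real.exp (-a) * Real.exp (-a) ^ h :=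
        Finset.sum_congr rfl fun h _ => h1 h
    _ ≤ Real.exp (-a) * (1 - Real.exp (-a))⁻¹ :=
        sum_le_hasSum s (fun h _ => by positivity) hs
    _ ≤ 1 / a := by
        rw [← div_eq_mul_inv, div_le_div_iff₀ (by linarith) ha]
        have h2 := Real.add_one_le_exp a
        have h3 : Real.exp (-a) * Real.exp a = 1 := by rw [← Real.exp_add]; simp
        nlinarith [Real.exp_pos (-a)]

theorem sum_exp_neg_natAbs_le (s : Finset ℤ) (v : ℤ) {a : ℝ} (ha : 0 < a) :
    ∑ u ∈ s, Real.exp (-(a * (v - u).natAbs)) ≤ 1 + 2 / a := by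
  classical
  have hsplit : s ⊆ {v} ∪ (s.filter (· < v) ∪ s.filter (v < ·)) := fun u hu => by
    rcases lt_trichotomy u v with h | h | h <;> simp [hu, h]
  have hpos : ∀ t : Finset ℤ, 0 ≤ ∑ u ∈ t, Real.exp (-(a * (v - u).natAbs)) :=
    fun t => Finset.sum_nonneg fun _ _ => (Real.exp_pos _).le
  have hhalf : ∀ t : Finset ℤ, (∀ u ∈ t, u ≠ v) →
      Set.InjOn (fun u : ℤ => (v - u).natAbs - 1) t →
      ∑ u ∈ t, Real.exp (-(a * (v - u).natAbs)) ≤ 1 / a := fun t ht hinj => by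
    have h1 : ∑ u ∈ t, Real.exp (-(a * (v - u).natAbs)) =
        ∑ u ∈ t, (fun h : ℕ => Real.exp (-(a * (h + 1 : ℕ)))) ((v - u).natAbs - 1) :=
      Finset.sum_congr rfl fun u hu => by
        have := ht u hu
        have h2 : (v - u).natAbs - 1 + 1 = (v - u).natAbs := by omega
        simp only [h2]
    rw [h1, ← Finset.sum_image (f := fun h : ℕ => Real.exp (-(a * (h + 1 : ℕ)))) hinj]
    exact sum_exp_neg_succ_le _ ha
  have h1 := hhalf (s.filter (· < v)) (fun u hu => by simp at hu; omega) fun x hx y hy hxy => by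
    simp at hx hy hxy; omega
  have h2 := hhalf (s.filter (v < ·)) (fun u hu => by simp at hu; omega) fun x hx y hy hxy => by
    simp at hx hy hxy; omega
  calc ∑ u ∈ s, Real.exp (-(a * (v - u).natAbs))
      ≤ ∑ u ∈ {v} ∪ (s.filter (· < v) ∪ s.filter (v < ·)), Real.exp (-(a * (v - u).natAbs)) :=
        Finset.sum_le_sum_of_subset_of_nonneg hsplit fun _ _ _ => (Real.exp_pos _).le
    _ ≤ ∑ u ∈ {v}, Real.exp (-(a * (v - u).natAbs)) +
        (∑ u ∈ s.filter (· < v), Real.exp (-(a * (v - u).natAbs)) +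
          ∑ u ∈ s.filter (v < ·), Real.exp (-(a * (v - u).natAbs))) := by
        have hun : ∀ A B : Finset ℤ, ∑ u ∈ A ∪ B, Real.exp (-(a * (v - u).natAbs)) ≤
            ∑ u ∈ A, Real.exp (-(a * (v - u).natAbs)) +
              ∑ u ∈ B, Real.exp (-(a * (v - u).natAbs)) := fun A B => by
          rw [← Finset.sum_union_inter]
          exact le_add_of_nonneg_right (hpos _)
        exact (hun _ _).trans (add_le_add_right (hun _ _) _)
    _ ≤ 1 + 2 / a := by
        have : ∑ u ∈ {v}, Real.exp (-(a * (v - u).natAbs)) = 1 := by simp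
        rw [this, show (2 : ℝ) / a = 1 / a + 1 / a by ring]
        linarith

theorem sum_exp_neg_natAbs_comp_le {T : Type*} [Fintype T] (f : T → ℤ)
    (hf : Function.Injective f) (v : ℤ) {a : ℝ} (ha : 0 < a) :
    ∑ u, Real.exp (-(a * (v - f u).natAbs)) ≤ 1 + 2 / a := by
  classical
  rw [← Finset.sum_image (f := fun u : ℤ => Real.exp (-(a * (v - u).natAbs)))
    (fun x _ y _ hxy => hf hxy)]
  exact sum_exp_neg_natAbs_le _ _ ha

/-- Sup-norm distance of two space-time points in a box. -/
def boxDist {κ : Type*} [Fintype κ] {p : κ → ℕ} (x y : ∀ l, Fin (p l)) (t u : ℤ) : ℕ :=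
  max (Finset.univ.sup fun l => ((x l : ℤ) - (y l : ℤ)).natAbs) (t - u).natAbs

/-- The exponential decay in the sup-norm distance is summable over a box. -/
theorem sum_exp_neg_boxDist_le {κ T : Type*} [Fintype κ] [DecidableEq κ] [Fintype T] {p : κ → ℕ}
    (x : ∀ l, Fin (p l)) (t : ℤ) (f : T → ℤ) (hf : Function.Injective f) {a : ℝ} (ha : 0 < a) :
    ∑ y : ∀ l, Fin (p l), ∑ u, Real.exp (-(a * boxDist x y t (f u))) ≤
      (1 + 2 * (Fintype.card κ + 1) / a) ^ (Fintype.card κ + 1) := by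
  -- A maximum of `card κ + 1` numbers is at least their average. Spreading the rate evenly makes
  -- the exponential factor over the coordinates and time.
  set b : ℝ := a / (Fintype.card κ + 1) with hb
  have hb0 : 0 < b := by positivity
  have hterm : ∀ (y : ∀ l, Fin (p l)) (u : T), Real.exp (-(a * boxDist x y t (f u))) ≤
      (∏ l, Real.exp (-(b * ((x l : ℤ) - (y l : ℤ)).natAbs))) *
        Real.exp (-(b * (t - f u).natAbs)) := fun y u => by
    rw [← Real.exp_sum, ← Real.exp_add, Real.exp_le_exp]
    have h1 : ∀ l, (((x l : ℤ) - (y l : ℤ)).natAbs : ℝ) ≤ boxDist x y t (f u) := fun l =>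
      Nat.cast_le.2 <| (Finset.le_sup (f := fun l => ((x l : ℤ) - (y l : ℤ)).natAbs)
        (Finset.mem_univ l)).trans (le_max_left _ _)
    have h2 : ((t - f u).natAbs : ℝ) ≤ boxDist x y t (f u) :=
      Nat.cast_le.2 (le_max_right _ _)
    have h3 : ∑ l, (((x l : ℤ) - (y l : ℤ)).natAbs : ℝ) ≤
        Fintype.card κ * boxDist x y t (f u) := by
      refine (Finset.sum_le_sum fun l _ => h1 l).trans ?_
      simp
    have h4 : a = b * (Fintype.card κ + 1) := by rw [hb]; field_simp
    rw [Finset.sum_neg_distrib, ← Finset.mul_sum, h4]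
    nlinarith
  have h1d : 1 + 2 / b = 1 + 2 * (Fintype.card κ + 1) / a := by rw [hb]; field_simp
  calc _ ≤ ∑ y : ∀ l, Fin (p l), ∑ u, (∏ l, Real.exp (-(b * ((x l : ℤ) - (y l : ℤ)).natAbs))) *
        Real.exp (-(b * (t - f u).natAbs)) :=
        Finset.sum_le_sum fun y _ => Finset.sum_le_sum fun u _ => hterm y u
    _ = (∏ l, ∑ v : Fin (p l), Real.exp (-(b * ((x l : ℤ) - (v : ℤ)).natAbs))) *
        ∑ u, Real.exp (-(b * (t - f u).natAbs)) := by
        rw [Fintype.prod_sum, Finset.sum_mul_sum]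
    _ ≤ (∏ _l : κ, (1 + 2 / b)) * (1 + 2 / b) := by
        refine mul_le_mul ?_ (sum_exp_neg_natAbs_comp_le f hf t hb0)
          (Finset.sum_nonneg fun _ _ => (Real.exp_pos _).le)
          (Finset.prod_nonneg fun _ _ => by positivity)
        refine Finset.prod_le_prod (fun l _ => Finset.sum_nonneg fun _ _ => (Real.exp_pos _).le)
          fun l _ => ?_
        exact sum_exp_neg_natAbs_comp_le (fun v : Fin (p l) => (v : ℤ))
          (fun a b h => Fin.ext (Int.ofNat_inj.1 h)) _ hb0
    _ = _ := by rw [h1d]; simp [pow_succ]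

/-- Schur test with a symmetric kernel. -/
theorem sum_sum_mul_kernel_le {ι : Type*} [Fintype ι] (W : ι → ℝ) (κ : ι → ι → ℝ)
    (h0 : ∀ i j, 0 ≤ κ i j) (hs : ∀ i j, κ i j = κ j i) {C : ℝ} (hC : ∀ i, ∑ j, κ i j ≤ C) :
    ∑ i, ∑ j, |W i| * |W j| * κ i j ≤ C * ∑ i, W i ^ 2 := by
  have h1 : ∑ i, ∑ j, |W i| * |W j| * κ i j ≤
      ∑ i, ∑ j, (W i ^ 2 * κ i j / 2 + W j ^ 2 * κ j i / 2) := by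
    refine Finset.sum_le_sum fun i _ => Finset.sum_le_sum fun j _ => ?_
    rw [hs j i]
    rw [← sq_abs (W i), ← sq_abs (W j)]
    nlinarith [mul_nonneg (sq_nonneg (|W i| - |W j|)) (h0 i j)]
  have h2 : ∀ i, ∑ j, W i ^ 2 * κ i j / 2 ≤ W i ^ 2 * C / 2 := fun i => by
    rw [← Finset.sum_div, ← Finset.mul_sum]
    have := mul_le_mul_of_nonneg_left (hC i) (sq_nonneg (W i))
    linarith
  have h3 : ∑ i, ∑ j, W j ^ 2 * κ j i / 2 = ∑ i, ∑ j, W i ^ 2 * κ i j / 2 := Finset.sum_comm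
  refine h1.trans ?_
  simp only [Finset.sum_add_distrib]
  rw [h3]
  have h4 : ∑ i, ∑ j, W i ^ 2 * κ i j / 2 ≤ ∑ i, W i ^ 2 * C / 2 :=
    Finset.sum_le_sum fun i _ => h2 i
  have h5 : ∑ i, W i ^ 2 * C / 2 = C * (∑ i, W i ^ 2) / 2 := by
    rw [Finset.mul_sum, Finset.sum_div]
    exact Finset.sum_congr rfl fun i _ => by ring
  linarith

end Decay

/-! ### Second moments of linear combinations. -/

section SecondMoments

variable {Ω : Type*} [MeasurableSpace Ω] {P : Measure Ω}

theorem integral_sq_sum_eq {ι : Type*} [Fintype ι] (f : ι → Ω → ℝ)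
    (hi : ∀ i j, Integrable (fun w => f i w * f j w) P) :
    ∫ w, (∑ i, f i w) ^ 2 ∂P = ∑ i, ∑ j, ∫ w, f i w * f j w ∂P := by
  simp_rw [sq, Finset.sum_mul_sum]
  rw [integral_finsetSum _ fun i _ => integrable_finsetSum _ fun j _ => hi i j]
  exact Finset.sum_congr rfl fun i _ => integral_finsetSum _ fun j _ => hi i j

theorem integral_sq_sum_le {ι : Type*} [Fintype ι] (W : ι → ℝ) (f : ι → Ω → ℝ)
    (hi : ∀ i j, Integrable (fun w => f i w * f j w) P) {C : ℝ}
    (hC : ∀ i, ∑ j, |∫ w, f i w * f j w ∂P| ≤ C) :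
    ∫ w, (∑ i, W i * f i w) ^ 2 ∂P ≤ C * ∑ i, W i ^ 2 := by
  have hi' : ∀ i j, Integrable (fun w => W i * f i w * (W j * f j w)) P := fun i j => by
    have : ∀ w, W i * f i w * (W j * f j w) = (W i * W j) * (f i w * f j w) := fun w => by ring
    simp_rw [this]
    exact (hi i j).const_mul _
  rw [integral_sq_sum_eq (fun i w => W i * f i w) hi']
  refine le_trans ?_ (sum_sum_mul_kernel_le W (fun i j => |∫ w, f i w * f j w ∂P|)
    (fun i j => abs_nonneg _) (fun i j => by simp_rw [mul_comm]) hC)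
  refine Finset.sum_le_sum fun i _ => Finset.sum_le_sum fun j _ => ?_
  have : ∀ w, W i * f i w * (W j * f j w) = (W i * W j) * (f i w * f j w) := fun w => by ring
  simp_rw [this]
  rw [integral_const_mul, ← abs_mul (W i), ← abs_mul]
  exact le_abs_self _

end SecondMoments

/-! ### Covariances of noise variables and of their products under mixing. -/

namespace TensorFactorModel

noncomputable section

variable {K : ℕ} {r : Fin K → ℕ} {Ω : Type*} [mΩ : MeasurableSpace Ω]
  {m : TensorFactorModel K r Ω} {ε ω τ : ℝ}

/-- Ratio of the mixing bound and the moment bound for products of four noise variables. -/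
def mixRatio (ε ω τ : ℝ) : ℝ := 128 * (τ / ω) ^ (2 + 2 * ε)

/-- Centred products of noise variables at the same time. -/
def noiseProd (m : TensorFactorModel K r Ω) (τ : ℝ) (x y : m.Site) (t : m.Time) (w : Ω) : ℝ :=
  m.noise τ x t w * m.noise τ y t w - ∫ w, m.noise τ x t w * m.noise τ y t w ∂m.P

/-- Time sums of centred products. -/
def noiseCov (m : TensorFactorModel K r Ω) (τ : ℝ) (x y : m.Site) (w : Ω) : ℝ :=
  ∑ t, m.noiseProd τ x y t w

theorem noiseCov_comm (x y : m.Site) (w : Ω) : m.noiseCov τ x y w = m.noiseCov τ y x w := by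
  simp only [noiseCov, noiseProd, mul_comm]

namespace NoiseSetup

variable (h : m.NoiseSetup ε ω τ)
include h

theorem fourthBound_nonneg : 0 ≤ fourthBound ε ω τ := by
  have := h.τ_pos; have := h.ω_pos
  unfold fourthBound; positivity

theorem mixRatio_nonneg : 0 ≤ mixRatio ε ω τ := by
  have := h.τ_pos; have := h.ω_pos
  unfold mixRatio; positivity

/-- Puts the moment bound and the mixing bound into the form needed for interpolation. The constants
fit since `2 · 16 · 128 = 4096`, and `4096 = 64²` also covers a product of two correlations, each at
most `64 τ² e^(-c₀ d)`. -/
theorem pow_four_le : 4096 * τ ^ 4 ≤ 2 * fourthBound ε ω τ * mixRatio ε ω τ := by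
  have hτ := h.τ_pos
  have hω := h.ω_pos
  unfold fourthBound mixRatio
  have h1 : ω ^ (2 + 2 * ε) * (τ / ω) ^ (2 + 2 * ε) = τ ^ (2 + 2 * ε) := by
    rw [← Real.mul_rpow hω.le (by positivity), mul_div_cancel₀ _ hω.ne']
  have h2 : τ ^ (2 - 2 * ε) ≤ (2 * τ) ^ (2 - 2 * ε) :=
    Real.rpow_le_rpow hτ.le (by linarith) (by linarith [h.ε_lt])
  have h3 : τ ^ (2 - 2 * ε) * τ ^ (2 + 2 * ε) = τ ^ 4 := by
    rw [← Real.rpow_add hτ, show 2 - 2 * ε + (2 + 2 * ε) = (4 : ℕ) by push_cast; ring,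
      Real.rpow_natCast]
  calc 4096 * τ ^ 4 = 4096 * (τ ^ (2 - 2 * ε) * τ ^ (2 + 2 * ε)) := by rw [h3]
    _ ≤ 4096 * ((2 * τ) ^ (2 - 2 * ε) * τ ^ (2 + 2 * ε)) := by gcongr
    _ = _ := by rw [← h1]; ring

theorem abs_mul_le (x y : m.Site) (t u : m.Time) (w : Ω) :
    |m.noise τ x t w * m.noise τ y u w| ≤ 16 * τ ^ 2 := by
  rw [abs_mul]
  have := h.τ_pos
  calc _ ≤ (4 * τ) * (4 * τ) :=
        mul_le_mul (h.abs_noise_le x t w) (h.abs_noise_le y u w) (abs_nonneg _) (by positivity)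
    _ = _ := by ring

theorem integrable_mul (x y : m.Site) (t u : m.Time) :
    Integrable (fun w => m.noise τ x t w * m.noise τ y u w) m.P :=
  have := m.isProb
  integrable_of_bounded ((h.measurable_noise x t).mul (h.measurable_noise y u))
    (h.abs_mul_le x y t u)

theorem integrable_mul_mul (x y z v : m.Site) (t u t' u' : m.Time) :
    Integrable (fun w => m.noise τ x t w * m.noise τ y u w *
      (m.noise τ z t' w * m.noise τ v u' w)) m.P :=
  (h.integrable_mul z v t' u').bdd_mul
    ((h.measurable_noise x t).mul (h.measurable_noise y u)).aestronglyMeasurable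
    (Eventually.of_forall (h.abs_mul_le x y t u))

theorem abs_integral_mul_mul_le (x y z v : m.Site) (t u t' u' : m.Time) :
    |∫ w, m.noise τ x t w * m.noise τ y u w * (m.noise τ z t' w * m.noise τ v u' w) ∂m.P| ≤
      fourthBound ε ω τ := by
  have := m.isProb
  have hi : ∀ x t, Integrable (fun w => m.noise τ x t w ^ 4) m.P := fun x t =>
    integrable_pow_of_bounded (h.measurable_noise x t) (h.abs_noise_le x t) 4
  have amgm : ∀ a b c d : ℝ, |a * b * (c * d)| ≤ 1 / 4 * (a ^ 4 + b ^ 4) + 1 / 4 * (c ^ 4 + d ^ 4) := by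
    intro a b c d
    rw [abs_le]
    constructor <;> nlinarith [sq_nonneg (a * b + c * d), sq_nonneg (a * b - c * d),
      sq_nonneg (a ^ 2 - b ^ 2), sq_nonneg (c ^ 2 - d ^ 2)]
  have h1 : Integrable (fun w => 1 / 4 * (m.noise τ x t w ^ 4 + m.noise τ y u w ^ 4)) m.P :=
    ((hi x t).add (hi y u)).const_mul _
  have h2 : Integrable (fun w => 1 / 4 * (m.noise τ z t' w ^ 4 + m.noise τ v u' w ^ 4)) m.P :=
    ((hi z t').add (hi v u')).const_mul _
  refine abs_integral_le_integral_abs.trans ((integral_mono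
    (h.integrable_mul_mul x y z v t u t' u').abs (h1.add h2) fun w => amgm _ _ _ _).trans ?_)
  simp only [Pi.add_apply]
  rw [integral_add h1 h2, integral_const_mul, integral_const_mul, integral_add (hi x t) (hi y u),
    integral_add (hi z t') (hi v u')]
  linarith [h.integral_noise_pow_four_le x t, h.integral_noise_pow_four_le y u,
    h.integral_noise_pow_four_le z t', h.integral_noise_pow_four_le v u']

theorem sq_integral_mul_le (x y : m.Site) (t u : m.Time) :
    (∫ w, m.noise τ x t w * m.noise τ y u w ∂m.P) ^ 2 ≤ fourthBound ε ω τ := by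
  have := m.isProb
  refine (sq_integral_le (P := m.P) ((h.measurable_noise x t).mul (h.measurable_noise y u))
    (h.abs_mul_le x y t u)).trans ?_
  refine le_trans (le_abs_self _) ?_
  have := h.abs_integral_mul_mul_le x y x y t u t u
  simp only [sq]
  exact this

theorem abs_integral_mul_mul_integral_le (x y z v : m.Site) (t u t' u' : m.Time) :
    |(∫ w, m.noise τ x t w * m.noise τ y u w ∂m.P) *
      ∫ w, m.noise τ z t' w * m.noise τ v u' w ∂m.P| ≤ fourthBound ε ω τ := by
  have h1 := h.sq_integral_mul_le x y t u
  have h2 := h.sq_integral_mul_le z v t' u'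
  rw [abs_le]
  constructor <;> nlinarith [sq_nonneg (∫ w, m.noise τ x t w * m.noise τ y u w ∂m.P +
      ∫ w, m.noise τ z t' w * m.noise τ v u' w ∂m.P),
    sq_nonneg (∫ w, m.noise τ x t w * m.noise τ y u w ∂m.P -
      ∫ w, m.noise τ z t' w * m.noise τ v u' w ∂m.P)]

theorem abs_integral_mul_le_two (x y : m.Site) (t u : m.Time) :
    |∫ w, m.noise τ x t w * m.noise τ y u w ∂m.P| ≤ 2 * ω ^ 2 := by
  have := m.isProb
  have hi : ∀ x t, Integrable (fun w => m.noise τ x t w ^ 2) m.P := fun x t =>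
    integrable_pow_of_bounded (h.measurable_noise x t) (h.abs_noise_le x t) 2
  have h1 : Integrable (fun w => 1 / 2 * (m.noise τ x t w ^ 2 + m.noise τ y u w ^ 2)) m.P :=
    ((hi x t).add (hi y u)).const_mul _
  refine abs_integral_le_integral_abs.trans ((integral_mono
    (h.integrable_mul x y t u).abs h1 fun w => ?_).trans ?_)
  · dsimp only
    rw [abs_le]
    constructor <;> nlinarith [sq_nonneg (m.noise τ x t w + m.noise τ y u w),
      sq_nonneg (m.noise τ x t w - m.noise τ y u w)]
  · rw [integral_const_mul, integral_add (hi x t) (hi y u)]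
    linarith [h.integral_sq_noise_le x t, h.integral_sq_noise_le y u]

/-- The moment bound does not decay and the mixing bound has a prefactor larger by a power of `τ`.
For `θ` of order `1 / log τ` the interpolated bound keeps the smaller prefactor up to a constant,
and only the decay is slower, by a logarithm. -/
theorem le_of_moment_of_mixing {c₀ θ C z : ℝ} {d : ℕ} (hθ0 : 0 ≤ θ) (hθ1 : θ ≤ 1)
    (hC : mixRatio ε ω τ ^ θ ≤ C) (h1 : z ≤ 2 * fourthBound ε ω τ)
    (h2 : z ≤ 4096 * τ ^ 4 * Real.exp (-(c₀ * d))) :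
    z ≤ 2 * fourthBound ε ω τ * C * Real.exp (-(c₀ * θ * d)) := by
  have h3 := le_interpolate (by linarith [h.fourthBound_nonneg]) h.mixRatio_nonneg
    (Real.exp_pos (-(c₀ * d))).le hθ0 hθ1 hC h1
    (h2.trans (mul_le_mul_of_nonneg_right h.pow_four_le (Real.exp_pos _).le))
  rwa [← Real.exp_mul, show -(c₀ * d) * θ = -(c₀ * θ * d) by ring] at h3

section Mixing

variable {A B : Set (m.Site × ℤ)} {c₀ : ℝ} {d : ℕ}
  (hα : alphaCoef m.P (m.sigmaField A) (m.sigmaField B) ≤ Real.exp (-(c₀ * d)))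
include hα

theorem abs_corr_le (hc₀ : 0 ≤ c₀) {x y : m.Site} {t u : m.Time} (hx : (x, ((t : ℕ) : ℤ)) ∈ A)
    (hy : (y, ((u : ℕ) : ℤ)) ∈ B) :
    |∫ w, m.noise τ x t w * m.noise τ y u w ∂m.P| ≤
      10 * ω ^ 2 * Real.exp (-(ε / 4 * c₀ * d)) := by
  have := m.isProb
  have h1 := abs_cov_le_of_moment (P := m.P) (sigmaField_le A) (sigmaField_le B)
    (h.measurable_rawNoise_sigmaField hx) (h.measurable_rawNoise_sigmaField hy)
    (h.abs_rawNoise_le x t) (h.abs_rawNoise_le y u) h.ω_pos h.ε_pos h.ε_lt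
    (by positivity) hα (h.integral_rpow_rawNoise_le x t) (h.integral_rpow_rawNoise_le y u)
  rw [show ε / 4 * c₀ * (d : ℝ) = ε / 4 * (c₀ * d) by ring]
  refine le_trans (le_of_eq ?_) h1
  congr 1
  have hx' := h.integrable_rawNoise x t
  have hy' := h.integrable_rawNoise y u
  have hxy : Integrable (fun w => m.rawNoise τ x t w * m.rawNoise τ y u w) m.P :=
    hy'.bdd_mul hx'.aestronglyMeasurable (Eventually.of_forall (h.abs_rawNoise_le x t))
  set a := ∫ w, m.rawNoise τ x t w ∂m.P with ha
  set b := ∫ w, m.rawNoise τ y u w ∂m.P with hb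
  have hdec : ∀ w, m.noise τ x t w * m.noise τ y u w =
      m.rawNoise τ x t w * m.rawNoise τ y u w - (a * m.rawNoise τ y u w +
        (b * m.rawNoise τ x t w - a * b)) := fun w => by
    simp only [noise, ← ha, ← hb]; ring
  have i1 : Integrable (fun w => b * m.rawNoise τ x t w - a * b) m.P :=
    (hx'.const_mul _).sub (integrable_const _)
  have i2 : Integrable (fun w => a * m.rawNoise τ y u w + (b * m.rawNoise τ x t w - a * b)) m.P :=
    (hy'.const_mul _).add i1
  simp_rw [hdec]
  rw [integral_sub hxy i2, integral_add (hy'.const_mul _) i1,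
    integral_sub (hx'.const_mul _) (integrable_const _), integral_const_mul, integral_const_mul,
    ← ha, ← hb]
  simp only [integral_const, probReal_univ, one_smul]
  ring

variable {θ C : ℝ} (hθ0 : 0 ≤ θ) (hθ1 : θ ≤ 1) (hC : mixRatio ε ω τ ^ θ ≤ C)
include hθ0 hθ1 hC

theorem abs_cov_mul_le {x x' y y' : m.Site} {t t' u u' : m.Time} (hx : (x, ((t : ℕ) : ℤ)) ∈ A)
    (hx' : (x', ((t' : ℕ) : ℤ)) ∈ A) (hy : (y, ((u : ℕ) : ℤ)) ∈ B)
    (hy' : (y', ((u' : ℕ) : ℤ)) ∈ B) :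
    |∫ w, m.noise τ x t w * m.noise τ x' t' w * (m.noise τ y u w * m.noise τ y' u' w) ∂m.P -
      (∫ w, m.noise τ x t w * m.noise τ x' t' w ∂m.P) *
        ∫ w, m.noise τ y u w * m.noise τ y' u' w ∂m.P| ≤
      2 * fourthBound ε ω τ * C * Real.exp (-(c₀ * θ * d)) := by
  have := m.isProb
  refine h.le_of_moment_of_mixing hθ0 hθ1 hC ?_ ?_
  · refine (abs_sub _ _).trans ?_
    linarith [h.abs_integral_mul_mul_le x x' y y' t t' u u',
      h.abs_integral_mul_mul_integral_le x x' y y' t t' u u']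
  · have h1 := abs_cov_le_of_bounded (P := m.P) (sigmaField_le A) (sigmaField_le B)
      (f := fun w => m.noise τ x t w * m.noise τ x' t' w)
      (g := fun w => m.noise τ y u w * m.noise τ y' u' w)
      ((h.measurable_noise_sigmaField hx).mul (h.measurable_noise_sigmaField hx'))
      ((h.measurable_noise_sigmaField hy).mul (h.measurable_noise_sigmaField hy'))
      (h.abs_mul_le x x' t t') (h.abs_mul_le y y' u u')
    refine h1.trans ?_
    calc _ ≤ 4 * (16 * τ ^ 2) * (16 * τ ^ 2) * Real.exp (-(c₀ * d)) :=
          mul_le_mul_of_nonneg_left hα (by positivity)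
      _ ≤ _ := mul_le_mul_of_nonneg_right (by nlinarith [sq_nonneg (τ ^ 2)]) (Real.exp_pos _).le

/-- Correction term needed when a covariance of two products is rewritten by pairing the four
variables by site instead of by time. -/
theorem abs_corr_mul_corr_le (hc₀ : 0 ≤ c₀) {x y : m.Site} {t u : m.Time} (hx : (x, ((t : ℕ) : ℤ)) ∈ A)
    (hy : (y, ((t : ℕ) : ℤ)) ∈ B) (hx' : (x, ((u : ℕ) : ℤ)) ∈ A) (hy' : (y, ((u : ℕ) : ℤ)) ∈ B) :
    |(∫ w, m.noise τ x t w * m.noise τ y t w ∂m.P) *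
      ∫ w, m.noise τ x u w * m.noise τ y u w ∂m.P| ≤
      2 * fourthBound ε ω τ * C * Real.exp (-(c₀ * θ * d)) := by
  have := m.isProb
  refine h.le_of_moment_of_mixing hθ0 hθ1 hC ?_ ?_
  · linarith [h.abs_integral_mul_mul_integral_le x y x y t t u u, h.fourthBound_nonneg]
  · have hτ := h.τ_pos
    have key : ∀ v : m.Time, (x, ((v : ℕ) : ℤ)) ∈ A → (y, ((v : ℕ) : ℤ)) ∈ B →
        |∫ w, m.noise τ x v w * m.noise τ y v w ∂m.P| ≤ 64 * τ ^ 2 * Real.exp (-(c₀ * d)) := by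
      intro v hv hv'
      have h1 := abs_cov_le_of_bounded (P := m.P) (sigmaField_le A) (sigmaField_le B)
        (h.measurable_noise_sigmaField hv) (h.measurable_noise_sigmaField hv')
        (h.abs_noise_le x v) (h.abs_noise_le y v)
      rw [h.integral_noise, zero_mul, sub_zero] at h1
      refine h1.trans ?_
      calc _ ≤ 4 * (4 * τ) * (4 * τ) * Real.exp (-(c₀ * d)) :=
            mul_le_mul_of_nonneg_left hα (by positivity)
        _ = _ := by ring
    rw [abs_mul]
    have hle1 : Real.exp (-(c₀ * d)) ≤ 1 := Real.exp_le_one_iff.2 (by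
      have : 0 ≤ c₀ * d := by positivity
      linarith)
    calc _ ≤ (64 * τ ^ 2 * Real.exp (-(c₀ * d))) * (64 * τ ^ 2 * Real.exp (-(c₀ * d))) :=
          mul_le_mul (key t hx hy) (key u hx' hy') (abs_nonneg _) (by positivity)
      _ = 4096 * τ ^ 4 * (Real.exp (-(c₀ * d)) * Real.exp (-(c₀ * d))) := by ring
      _ ≤ 4096 * τ ^ 4 * (Real.exp (-(c₀ * d)) * 1) := by gcongr
      _ = _ := by ring

end Mixing

theorem measurable_noiseProd (x y : m.Site) (t : m.Time) : Measurable (m.noiseProd τ x y t) :=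
  ((h.measurable_noise x t).mul (h.measurable_noise y t)).sub_const _

theorem abs_noiseProd_le (x y : m.Site) (t : m.Time) (w : Ω) :
    |m.noiseProd τ x y t w| ≤ 32 * τ ^ 2 := by
  have := m.isProb
  have h1 := h.abs_mul_le x y t t w
  have h2 : |∫ w, m.noise τ x t w * m.noise τ y t w ∂m.P| ≤ 16 * τ ^ 2 := by
    have := norm_integral_le_of_norm_le_const (μ := m.P)
      (f := fun w => m.noise τ x t w * m.noise τ y t w) (C := 16 * τ ^ 2)
      (Eventually.of_forall (h.abs_mul_le x y t t))
    simpa using this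
  have h3 := abs_sub (m.noise τ x t w * m.noise τ y t w)
    (∫ w, m.noise τ x t w * m.noise τ y t w ∂m.P)
  unfold noiseProd
  linarith

theorem integrable_noiseProd_mul (x y z v : m.Site) (t u : m.Time) :
    Integrable (fun w => m.noiseProd τ x y t w * m.noiseProd τ z v u w) m.P :=
  have := m.isProb
  (integrable_of_bounded (h.measurable_noiseProd z v u) (h.abs_noiseProd_le z v u)).bdd_mul
    (h.measurable_noiseProd x y t).aestronglyMeasurable
    (Eventually.of_forall (h.abs_noiseProd_le x y t))

theorem integral_noiseProd_mul (x y z v : m.Site) (t u : m.Time) :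
    ∫ w, m.noiseProd τ x y t w * m.noiseProd τ z v u w ∂m.P =
      ∫ w, m.noise τ x t w * m.noise τ y t w * (m.noise τ z u w * m.noise τ v u w) ∂m.P -
        (∫ w, m.noise τ x t w * m.noise τ y t w ∂m.P) *
          ∫ w, m.noise τ z u w * m.noise τ v u w ∂m.P := by
  have := m.isProb
  have hx' := h.integrable_mul x y t t
  have hy' := h.integrable_mul z v u u
  have hxy := h.integrable_mul_mul x y z v t t u u
  set a := ∫ w, m.noise τ x t w * m.noise τ y t w ∂m.P with ha
  set b := ∫ w, m.noise τ z u w * m.noise τ v u w ∂m.P with hb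
  have hdec : ∀ w, m.noiseProd τ x y t w * m.noiseProd τ z v u w =
      m.noise τ x t w * m.noise τ y t w * (m.noise τ z u w * m.noise τ v u w) -
        (a * (m.noise τ z u w * m.noise τ v u w) +
        (b * (m.noise τ x t w * m.noise τ y t w) - a * b)) := fun w => by
    simp only [noiseProd, ← ha, ← hb]; ring
  have i1 : Integrable (fun w => b * (m.noise τ x t w * m.noise τ y t w) - a * b) m.P :=
    (hx'.const_mul _).sub (integrable_const _)
  have i2 : Integrable (fun w => a * (m.noise τ z u w * m.noise τ v u w) +
      (b * (m.noise τ x t w * m.noise τ y t w) - a * b)) m.P :=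
    (hy'.const_mul _).add i1
  simp_rw [hdec]
  rw [integral_sub hxy i2, integral_add (hy'.const_mul _) i1,
    integral_sub (hx'.const_mul _) (integrable_const _), integral_const_mul, integral_const_mul,
    ← ha, ← hb]
  simp only [integral_const, probReal_univ, one_smul]
  ring

theorem integrable_noiseCov_mul (x y z v : m.Site) :
    Integrable (fun w => m.noiseCov τ x y w * m.noiseCov τ z v w) m.P := by
  simp_rw [noiseCov, Finset.sum_mul_sum]
  exact integrable_finsetSum _ fun t _ => integrable_finsetSum _ fun u _ =>
    h.integrable_noiseProd_mul x y z v t u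

theorem integral_noiseCov_mul (x y z v : m.Site) :
    ∫ w, m.noiseCov τ x y w * m.noiseCov τ z v w ∂m.P =
      ∑ t, ∑ u, ∫ w, m.noiseProd τ x y t w * m.noiseProd τ z v u w ∂m.P := by
  simp_rw [noiseCov, Finset.sum_mul_sum]
  rw [integral_finsetSum _ fun t _ => integrable_finsetSum _ fun u _ =>
    h.integrable_noiseProd_mul x y z v t u]
  exact Finset.sum_congr rfl fun t _ => integral_finsetSum _ fun u _ =>
    h.integrable_noiseProd_mul x y z v t u

theorem integral_sq_noiseCov (x y : m.Site) :
    ∫ w, m.noiseCov τ x y w ^ 2 ∂m.P =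
      ∑ t, ∑ u, ∫ w, m.noiseProd τ x y t w * m.noiseProd τ x y u w ∂m.P := by
  simp_rw [sq]
  exact h.integral_noiseCov_mul x y x y

end NoiseSetup

end

end TensorFactorModel

/-! ### Sample covariances for cross-sectionally independent series. -/

namespace TensorFactorModel

noncomputable section

variable {K : ℕ} {r : Fin K → ℕ} {Ω : Type*} [mΩ : MeasurableSpace Ω]
  {m : TensorFactorModel K r Ω} {ε ω τ c₀ : ℝ}

theorem time_injective : Function.Injective fun t : m.Time => ((t : ℕ) : ℤ) := fun _ _ htu =>
  Subtype.ext (Int.ofNat_inj.1 htu)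

theorem card_time : Fintype.card m.Time = m.n := by
  simp [Time]

/-- Cross-sectional independence and temporal mixing of each series. -/
def SeriesMixing (m : TensorFactorModel K r Ω) (c₀ : ℝ) : Prop :=
  iIndepFun (fun i : m.Site => fun w => fun t : ℤ => m.ξ i t w) m.P ∧
  ∀ (i : m.Site) (t : ℤ) (h : ℕ),
    alphaCoef m.P (m.sigmaField {x | x.1 = i ∧ x.2 ≤ t})
      (m.sigmaField {x | x.1 = i ∧ t + h ≤ x.2}) ≤ Real.exp (-(c₀ * h))

/-- Mutual independence of the series makes the `σ`-algebras of two complementary sets of sites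
independent. -/
theorem SeriesMixing.integral_mul (hs : m.SeriesMixing c₀) (S : Set m.Site) {f g : Ω → ℝ}
    (hf : Measurable[m.sigmaField {x | x.1 ∈ S}] f)
    (hg : Measurable[m.sigmaField {x | x.1 ∉ S}] g) :
    ∫ w, f w * g w ∂m.P = (∫ w, f w ∂m.P) * ∫ w, g w ∂m.P := by
  let G : m.Site → MeasurableSpace Ω := fun i =>
    MeasurableSpace.comap (fun w => fun t : ℤ => m.ξ i t w) inferInstance
  have hle : ∀ S : Set m.Site, m.sigmaField {x | x.1 ∈ S} ≤ ⨆ i ∈ S, G i := fun S => by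
    refine iSup₂_le fun x hx => le_trans ?_ (le_iSup₂_of_le (f := fun i (_ : i ∈ S) => G i)
      x.1 hx le_rfl)
    rw [← measurable_iff_comap_le]
    exact (measurable_pi_apply x.2).comp
      (comap_measurable (fun w => fun t : ℤ => m.ξ x.1 t w))
  have hG : ∀ i, G i ≤ mΩ := fun i =>
    (measurable_pi_iff.2 fun t => m.measurable_ξ i t).comap_le
  have hind := indep_iSup_of_disjoint (m := G) (μ := m.P) hG hs.1
    (disjoint_compl_right (a := S))
  have hfg : IndepFun f g m.P := by
    rw [IndepFun_iff_Indep]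
    exact indep_of_indep_of_le_left (indep_of_indep_of_le_right hind
      (hg.comap_le.trans (hle Sᶜ))) (hf.comap_le.trans (hle S))
  exact hfg.integral_mul_eq_mul_integral
    (hf.mono (sigmaField_le _) le_rfl).aestronglyMeasurable
    (hg.mono (sigmaField_le _) le_rfl).aestronglyMeasurable

theorem SeriesMixing.alpha_le (hs : m.SeriesMixing c₀) (x : m.Site) (t u : ℤ) :
    alphaCoef m.P (m.sigmaField {(x, t)}) (m.sigmaField {(x, u)}) ≤
      Real.exp (-(c₀ * (t - u).natAbs)) := by
  have := m.isProb
  have key : ∀ t u : ℤ, t ≤ u → alphaCoef m.P (m.sigmaField {(x, t)}) (m.sigmaField {(x, u)}) ≤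
      Real.exp (-(c₀ * (t - u).natAbs)) := fun t u htu => by
    refine le_trans (alphaCoef_mono (sigmaField_mono ?_) (sigmaField_mono ?_))
      (hs.2 x t (t - u).natAbs)
    · simp
    · simp only [Set.singleton_subset_iff, Set.mem_ofPred_eq, true_and]
      omega
  rcases le_total t u with htu | htu
  · exact key t u htu
  · refine alphaCoef_comm.trans ((key u t htu).trans (le_of_eq ?_))
    rw [← Int.natAbs_neg, neg_sub]

namespace NoiseSetup

variable (h : m.NoiseSetup ε ω τ) (hs : m.SeriesMixing c₀) (hc₀ : 0 < c₀)
include h hs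

/-- A noise variable is orthogonal to functions of the other series. -/
theorem integral_noise_mul_eq_zero {v : m.Site} (t : m.Time) {g : Ω → ℝ}
    (hg : Measurable[m.sigmaField {x | x.1 ∉ ({v} : Set m.Site)}] g) :
    ∫ w, m.noise τ v t w * g w ∂m.P = 0 := by
  rw [hs.integral_mul {v} (h.measurable_noise_sigmaField (by simp)) hg, h.integral_noise, zero_mul]

theorem integral_noise_mul_noise_of_ne {x y : m.Site} (hxy : x ≠ y) (t u : m.Time) :
    ∫ w, m.noise τ x t w * m.noise τ y u w ∂m.P = 0 :=
  h.integral_noise_mul_eq_zero hs t (h.measurable_noise_sigmaField (by simpa using hxy.symm))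

/-- The site `x` occurs exactly once among the four factors, so the centred variable there is
independent of all the rest. -/
theorem integral_noiseProd_mul_eq_zero {x y z v : m.Site} (hxy : x ≠ y)
    (hne : x ∉ ({z, v} : Set m.Site)) (t u : m.Time) :
    ∫ w, m.noiseProd τ x y t w * m.noiseProd τ z v u w ∂m.P = 0 := by
  simp only [Set.mem_insert_iff, Set.mem_singleton_iff, not_or] at hne
  have h1 : ∀ w, m.noiseProd τ x y t w * m.noiseProd τ z v u w =
      m.noise τ x t w * (m.noise τ y t w * m.noiseProd τ z v u w) := fun w => by
    simp only [noiseProd, h.integral_noise_mul_noise_of_ne hs hxy, sub_zero]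
    ring
  simp_rw [h1]
  refine h.integral_noise_mul_eq_zero hs t ?_
  refine (h.measurable_noise_sigmaField (by simpa using hxy.symm)).mul
    (Measurable.sub_const ((h.measurable_noise_sigmaField ?_).mul
      (h.measurable_noise_sigmaField ?_)) _)
  · simpa using Ne.symm hne.1
  · simpa using Ne.symm hne.2

/-- Products of noise variables are uncorrelated unless they involve the same pair of sites. -/
theorem integral_noiseProd_mul_eq_zero_of_ne {x y z v : m.Site} (h1 : ¬(x = z ∧ y = v))
    (h2 : ¬(x = v ∧ y = z)) (t u : m.Time) :
    ∫ w, m.noiseProd τ x y t w * m.noiseProd τ z v u w ∂m.P = 0 := by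
  have hsw : ∀ (x y : m.Site) (t : m.Time) (w : Ω), m.noiseProd τ x y t w = m.noiseProd τ y x t w :=
    fun x y t w => by simp only [noiseProd, mul_comm]
  by_cases hxy : x = y
  · subst hxy
    by_cases hzv : z = v
    · subst hzv
      have hxz : x ≠ z := fun hh => h1 ⟨hh, hh⟩
      have := m.isProb
      rw [hs.integral_mul {x} (f := m.noiseProd τ x x t) (g := m.noiseProd τ z z u)]
      · have : ∫ w, m.noiseProd τ x x t w ∂m.P = 0 := by
          unfold noiseProd
          rw [integral_sub (h.integrable_mul x x t t) (integrable_const _)]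
          simp
        rw [this, zero_mul]
      · exact Measurable.sub_const ((h.measurable_noise_sigmaField (by simp)).mul
          (h.measurable_noise_sigmaField (by simp))) _
      · exact Measurable.sub_const ((h.measurable_noise_sigmaField (by simpa using hxz.symm)).mul
          (h.measurable_noise_sigmaField (by simpa using hxz.symm))) _
    · by_cases hz : z = x
      · have hv : v ∉ ({x, x} : Set m.Site) := by
          subst hz; simpa using Ne.symm hzv
        have := h.integral_noiseProd_mul_eq_zero hs (Ne.symm hzv) hv u t
        simp_rw [hsw v z] at this
        simp_rw [mul_comm (m.noiseProd τ x x t _)]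
        exact this
      · have hz' : z ∉ ({x, x} : Set m.Site) := by simpa using hz
        have := h.integral_noiseProd_mul_eq_zero hs hzv hz' u t
        simp_rw [mul_comm (m.noiseProd τ x x t _)]
        exact this
  · by_cases hx : x ∈ ({z, v} : Set m.Site)
    · have hy : y ∉ ({z, v} : Set m.Site) := by
        simp only [Set.mem_insert_iff, Set.mem_singleton_iff] at hx ⊢
        rintro (hy | hy) <;> rcases hx with hx | hx
        · exact hxy (hx.trans hy.symm)
        · exact h2 ⟨hx, hy⟩
        · exact h1 ⟨hx, hy⟩
        · exact hxy (hx.trans hy.symm)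
      simp_rw [hsw x y]
      exact h.integral_noiseProd_mul_eq_zero hs (Ne.symm hxy) hy t u
    · exact h.integral_noiseProd_mul_eq_zero hs hxy hx t u

theorem integral_noiseCov_mul_eq_zero {x y z v : m.Site} (h1 : ¬(x = z ∧ y = v))
    (h2 : ¬(x = v ∧ y = z)) : ∫ w, m.noiseCov τ x y w * m.noiseCov τ z v w ∂m.P = 0 := by
  rw [h.integral_noiseCov_mul]
  exact Finset.sum_eq_zero fun t _ => Finset.sum_eq_zero fun u _ =>
    h.integral_noiseProd_mul_eq_zero_of_ne hs h1 h2 t u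

/-- By orthogonality a pair of sites correlates only with itself and with the swapped pair. Each row
of the covariance matrix has at most two nonzero entries, whence the factor `2`. -/
theorem integral_sq_sum_noiseCov_le (Θ : m.Site × m.Site → ℝ) :
    ∫ w, (∑ i, Θ i * m.noiseCov τ i.1 i.2 w) ^ 2 ∂m.P ≤
      2 * ∑ i, Θ i ^ 2 * ∫ w, m.noiseCov τ i.1 i.2 w ^ 2 ∂m.P := by
  classical
  have hmul : ∀ i j : m.Site × m.Site, ∀ w, Θ i * m.noiseCov τ i.1 i.2 w *
      (Θ j * m.noiseCov τ j.1 j.2 w) =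
      Θ i * Θ j * (m.noiseCov τ i.1 i.2 w * m.noiseCov τ j.1 j.2 w) := fun i j w => by ring
  rw [integral_sq_sum_eq (fun i w => Θ i * m.noiseCov τ i.1 i.2 w) fun i j => by
    simp_rw [hmul]; exact (h.integrable_noiseCov_mul _ _ _ _).const_mul _]
  simp_rw [hmul, integral_const_mul]
  set E : m.Site × m.Site → ℝ := fun i => ∫ w, m.noiseCov τ i.1 i.2 w ^ 2 ∂m.P with hE
  have hE0 : ∀ i, 0 ≤ E i := fun i => integral_nonneg fun w => sq_nonneg _
  have hEs : ∀ i, E i.swap = E i := fun i => by simp only [hE, Prod.fst_swap, Prod.snd_swap,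
    noiseCov_comm i.2 i.1]
  have hself : ∀ i : m.Site × m.Site,
      ∫ w, m.noiseCov τ i.1 i.2 w * m.noiseCov τ i.1 i.2 w ∂m.P = E i := fun i => by
    simp only [hE, sq]
  have hswap : ∀ i : m.Site × m.Site,
      ∫ w, m.noiseCov τ i.1 i.2 w * m.noiseCov τ i.swap.1 i.swap.2 w ∂m.P = E i := fun i => by
    simp only [hE, sq, Prod.fst_swap, Prod.snd_swap, noiseCov_comm i.2 i.1]
  -- The cross term `Θ i Θ i.swap` is split evenly; after summation the weights `3/2` and `1/2` add
  -- up to `2`.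
  have hrow : ∀ i : m.Site × m.Site, ∑ j : m.Site × m.Site, Θ i * Θ j *
      ∫ w, m.noiseCov τ i.1 i.2 w * m.noiseCov τ j.1 j.2 w ∂m.P ≤
      3 / 2 * (Θ i ^ 2 * E i) + 1 / 2 * (Θ i.swap ^ 2 * E i.swap) := fun i => by
    have hsub : ∑ j : m.Site × m.Site, Θ i * Θ j *
        ∫ w, m.noiseCov τ i.1 i.2 w * m.noiseCov τ j.1 j.2 w ∂m.P =
        ∑ j ∈ {i, i.swap}, Θ i * Θ j *
        ∫ w, m.noiseCov τ i.1 i.2 w * m.noiseCov τ j.1 j.2 w ∂m.P := by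
      symm
      refine Finset.sum_subset (Finset.subset_univ _) fun j _ hj => ?_
      simp only [Finset.mem_insert, Finset.mem_singleton, not_or] at hj
      rw [h.integral_noiseCov_mul_eq_zero hs, mul_zero]
      · exact fun hh => hj.1 (Prod.ext hh.1.symm hh.2.symm)
      · exact fun hh => hj.2 (Prod.ext hh.2.symm hh.1.symm)
    rw [hsub, hEs]
    by_cases hii : i = i.swap
    · rw [← hii]
      simp only [Finset.mem_singleton, Finset.insert_eq_of_mem, Finset.sum_singleton]
      rw [hself]
      nlinarith [mul_nonneg (sq_nonneg (Θ i)) (hE0 i)]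
    · rw [Finset.sum_pair hii, hself, hswap]
      nlinarith [mul_nonneg (sq_nonneg (Θ i - Θ i.swap)) (hE0 i)]
  have hre : ∑ i : m.Site × m.Site, Θ i.swap ^ 2 * E i.swap = ∑ i, Θ i ^ 2 * E i :=
    (Equiv.prodComm m.Site m.Site).sum_comp fun i => Θ i ^ 2 * E i
  refine (Finset.sum_le_sum fun i _ => hrow i).trans (le_of_eq ?_)
  rw [Finset.sum_add_distrib, ← Finset.mul_sum, ← Finset.mul_sum, hre]
  ring

include hc₀

theorem sum_abs_corr_le_series (x : m.Site) (t : m.Time) :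
    ∑ y, ∑ u, |∫ w, m.noise τ x t w * m.noise τ y u w ∂m.P| ≤
      10 * ω ^ 2 * (1 + 2 / (ε / 4 * c₀)) := by
  have hε := h.ε_pos
  rw [Finset.sum_eq_single x (fun y _ hy => Finset.sum_eq_zero fun u _ => by
    rw [h.integral_noise_mul_noise_of_ne hs (Ne.symm hy), abs_zero]) (by simp)]
  have hterm : ∀ u : m.Time, |∫ w, m.noise τ x t w * m.noise τ x u w ∂m.P| ≤
      10 * ω ^ 2 * Real.exp (-(ε / 4 * c₀ * (((t : ℕ) : ℤ) - ((u : ℕ) : ℤ)).natAbs)) := fun u =>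
    h.abs_corr_le (hs.alpha_le x ((t : ℕ) : ℤ) ((u : ℕ) : ℤ)) hc₀.le (by simp) (by simp)
  refine (Finset.sum_le_sum fun u _ => hterm u).trans ?_
  rw [← Finset.mul_sum]
  exact mul_le_mul_of_nonneg_left
    (sum_exp_neg_natAbs_comp_le _ time_injective _ (by positivity)) (by positivity)

/-- For distinct sites the fourth-order moment factors into two autocovariances. One decays in the
lag and the other is at most `2 ω²`, so neither fourth moments nor logarithms enter. -/
theorem integral_sq_noiseCov_le_of_ne {x y : m.Site} (hxy : x ≠ y) :
    ∫ w, m.noiseCov τ x y w ^ 2 ∂m.P ≤ m.n * (20 * ω ^ 4 * (1 + 2 / (ε / 4 * c₀))) := by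
  have hε := h.ε_pos
  have hω := h.ω_pos
  rw [h.integral_sq_noiseCov]
  have hterm : ∀ t u : m.Time, ∫ w, m.noiseProd τ x y t w * m.noiseProd τ x y u w ∂m.P ≤
      20 * ω ^ 4 * Real.exp (-(ε / 4 * c₀ * (((t : ℕ) : ℤ) - ((u : ℕ) : ℤ)).natAbs)) := fun t u => by
    rw [h.integral_noiseProd_mul, h.integral_noise_mul_noise_of_ne hs hxy, zero_mul, sub_zero]
    have h1 : ∀ w, m.noise τ x t w * m.noise τ y t w * (m.noise τ x u w * m.noise τ y u w) =
        m.noise τ x t w * m.noise τ x u w * (m.noise τ y t w * m.noise τ y u w) := fun w => by ring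
    simp_rw [h1]
    rw [hs.integral_mul {x} (f := fun w => m.noise τ x t w * m.noise τ x u w)
      (g := fun w => m.noise τ y t w * m.noise τ y u w)
      ((h.measurable_noise_sigmaField (by simp)).mul (h.measurable_noise_sigmaField (by simp)))
      ((h.measurable_noise_sigmaField (by simpa using hxy.symm)).mul
        (h.measurable_noise_sigmaField (by simpa using hxy.symm)))]
    refine (le_abs_self _).trans ?_
    rw [abs_mul]
    refine (mul_le_mul (h.abs_corr_le (hs.alpha_le x ((t : ℕ) : ℤ) ((u : ℕ) : ℤ)) hc₀.le
      (by simp) (by simp)) (h.abs_integral_mul_le_two y y t u) (abs_nonneg _)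
      (by positivity)).trans (le_of_eq (by ring))
  calc _ ≤ ∑ t : m.Time, ∑ u : m.Time,
        20 * ω ^ 4 * Real.exp (-(ε / 4 * c₀ * (((t : ℕ) : ℤ) - ((u : ℕ) : ℤ)).natAbs)) :=
        Finset.sum_le_sum fun t _ => Finset.sum_le_sum fun u _ => hterm t u
    _ ≤ ∑ _t : m.Time, 20 * ω ^ 4 * (1 + 2 / (ε / 4 * c₀)) := by
        refine Finset.sum_le_sum fun t _ => ?_
        rw [← Finset.mul_sum]
        exact mul_le_mul_of_nonneg_left
          (sum_exp_neg_natAbs_comp_le _ time_injective _ (by positivity)) (by positivity)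
    _ = _ := by rw [Finset.sum_const, Finset.card_univ, card_time, nsmul_eq_mul]

variable {θ C : ℝ} (hθ0 : 0 < θ) (hθ1 : θ ≤ 1) (hC : mixRatio ε ω τ ^ θ ≤ C)
include hθ0 hθ1 hC

/-- On the diagonal the products are squares, so fourth moments are unavoidable and the interpolated
mixing bound is used. -/
theorem integral_sq_noiseCov_self_le (x : m.Site) :
    ∫ w, m.noiseCov τ x x w ^ 2 ∂m.P ≤
      m.n * (2 * fourthBound ε ω τ * C * (1 + 2 / (c₀ * θ))) := by
  have hC0 : 0 ≤ C := le_trans (Real.rpow_nonneg h.mixRatio_nonneg _) hC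
  have hV := h.fourthBound_nonneg
  rw [h.integral_sq_noiseCov]
  calc _ ≤ ∑ t : m.Time, ∑ u : m.Time, 2 * fourthBound ε ω τ * C *
        Real.exp (-(c₀ * θ * (((t : ℕ) : ℤ) - ((u : ℕ) : ℤ)).natAbs)) :=
        Finset.sum_le_sum fun t _ => Finset.sum_le_sum fun u _ => by
          rw [h.integral_noiseProd_mul]
          exact (le_abs_self _).trans (h.abs_cov_mul_le
            (hs.alpha_le x ((t : ℕ) : ℤ) ((u : ℕ) : ℤ)) hθ0.le hθ1 hC (by simp) (by simp)
            (by simp) (by simp))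
    _ ≤ ∑ _t : m.Time, 2 * fourthBound ε ω τ * C * (1 + 2 / (c₀ * θ)) := by
        refine Finset.sum_le_sum fun t _ => ?_
        rw [← Finset.mul_sum]
        exact mul_le_mul_of_nonneg_left
          (sum_exp_neg_natAbs_comp_le _ time_injective _ (by positivity)) (by positivity)
    _ = _ := by rw [Finset.sum_const, Finset.card_univ, card_time, nsmul_eq_mul]

end NoiseSetup

end

end TensorFactorModel

/-! ### Sample covariances for random fields. -/

namespace TensorFactorModel

noncomputable section

variable {K : ℕ} {r : Fin K → ℕ} {Ω : Type*} [mΩ : MeasurableSpace Ω]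
  {m : TensorFactorModel K r Ω} {ε ω τ c₀ : ℝ}

/-- Exponential strong mixing over space and time. -/
def FieldMixing (m : TensorFactorModel K r Ω) (c₀ : ℝ) : Prop :=
  ∀ (h : ℕ) (E₁ E₂ : Set (m.Site × ℤ)), (h : ℕ∞) ≤ siteSetDist E₁ E₂ →
    alphaCoef m.P (m.sigmaField E₁) (m.sigmaField E₂) ≤ Real.exp (-(c₀ * h))

theorem FieldMixing.alpha_le (hf : m.FieldMixing c₀) {E₁ E₂ : Set (m.Site × ℤ)} {h : ℕ}
    (hE : ∀ x ∈ E₁, ∀ y ∈ E₂, h ≤ siteDist x y) :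
    alphaCoef m.P (m.sigmaField E₁) (m.sigmaField E₂) ≤ Real.exp (-(c₀ * h)) :=
  hf h E₁ E₂ (le_iInf₂ fun x hx => le_iInf₂ fun y hy => Nat.cast_le.2 (hE x hx y hy))

/-- The site with `k`-th index `a` and other indices `ℓ`. -/
def siteAt (m : TensorFactorModel K r Ω) (k : Fin K) (a : Fin (m.p k)) (ℓ : OtherIndex m.p k) :
    m.Site :=
  (Equiv.piSplitAt k fun l => Fin (m.p l)).symm (a, ℓ)

theorem siteAt_same (k : Fin K) (a : Fin (m.p k)) (ℓ : OtherIndex m.p k) :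
    m.siteAt k a ℓ k = a := by
  simp [siteAt, Equiv.piSplitAt]

theorem siteAt_other (k : Fin K) (a : Fin (m.p k)) (ℓ : OtherIndex m.p k)
    (l : {l : Fin K // l ≠ k}) : m.siteAt k a ℓ l = ℓ l := by
  simp [siteAt, Equiv.piSplitAt, l.2]

/-- Forgetting the coordinate of mode `k` only decreases distances. Sums then run over `K - 1` modes
and time, which yields the power `K` of the logarithm. -/
theorem boxDist_le_siteDist (k : Fin K) (a b : Fin (m.p k)) (ℓ ℓ' : OtherIndex m.p k) (t u : ℤ) :
    boxDist (p := fun l : {l : Fin K // l ≠ k} => m.p l) ℓ ℓ' t u ≤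
      siteDist (m.siteAt k a ℓ, t) (m.siteAt k b ℓ', u) := by
  refine max_le_max (Finset.sup_le fun l _ => ?_) le_rfl
  have := Finset.le_sup (f := fun l => ((m.siteAt k a ℓ l : ℤ) - (m.siteAt k b ℓ' l : ℤ)).natAbs)
    (Finset.mem_univ (l : Fin K))
  simpa only [siteAt_other] using this

theorem boxDist_comm {κ : Type*} [Fintype κ] {p : κ → ℕ} (x y : ∀ l, Fin (p l)) (t u : ℤ) :
    boxDist x y t u = boxDist y x u t := by
  unfold boxDist
  congr 1
  · congr 1; ext l; rw [← Int.natAbs_neg, neg_sub]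
  · rw [← Int.natAbs_neg, neg_sub]

namespace NoiseSetup

variable (h : m.NoiseSetup ε ω τ) (hf : m.FieldMixing c₀) (hc₀ : 0 < c₀)
include h hf hc₀

theorem sum_abs_corr_le_field (x : m.Site) (t : m.Time) :
    ∑ y, ∑ u, |∫ w, m.noise τ x t w * m.noise τ y u w ∂m.P| ≤
      10 * ω ^ 2 * (1 + 2 * (K + 1) / (ε / 4 * c₀)) ^ (K + 1) := by
  have hε := h.ε_pos
  have hterm : ∀ (y : m.Site) (u : m.Time), |∫ w, m.noise τ x t w * m.noise τ y u w ∂m.P| ≤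
      10 * ω ^ 2 * Real.exp (-(ε / 4 * c₀ * boxDist x y ((t : ℕ) : ℤ) ((u : ℕ) : ℤ))) := fun y u =>
    h.abs_corr_le (hf.alpha_le (E₁ := {(x, ((t : ℕ) : ℤ))}) (E₂ := {(y, ((u : ℕ) : ℤ))})
      (by rintro _ rfl _ rfl; exact le_rfl)) hc₀.le (by simp) (by simp)
  refine (Finset.sum_le_sum fun y _ => Finset.sum_le_sum fun u _ => hterm y u).trans ?_
  simp_rw [← Finset.mul_sum]
  refine mul_le_mul_of_nonneg_left ?_ (by positivity)
  have := sum_exp_neg_boxDist_le x ((t : ℕ) : ℤ) _ (time_injective (m := m))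
    (a := ε / 4 * c₀) (by positivity)
  rwa [Fintype.card_fin] at this

variable {θ C : ℝ} (hθ0 : 0 < θ) (hθ1 : θ ≤ 1) (hC : mixRatio ε ω τ ^ θ ≤ C)
include hθ0 hθ1 hC

/-- If the time lag is the larger separation, the products at the two times decorrelate directly. If
the spatial distance is larger, the four variables are regrouped by site: the covariance of the
regrouped products and the subtracted product of correlations across sites decay in space, while the
product of the two autocovariances decays in the lag, with a constant free of `τ`. -/
theorem integral_noiseProd_mul_le_field (x y : m.Site) (t u : m.Time) :
    ∫ w, m.noiseProd τ x y t w * m.noiseProd τ x y u w ∂m.P ≤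
      4 * fourthBound ε ω τ * C *
        Real.exp (-(c₀ * θ * boxDist x y ((t : ℕ) : ℤ) ((u : ℕ) : ℤ))) +
      20 * ω ^ 4 * Real.exp (-(ε / 4 * c₀ * (((t : ℕ) : ℤ) - ((u : ℕ) : ℤ)).natAbs)) := by
  have hC0 : 0 ≤ C := le_trans (Real.rpow_nonneg h.mixRatio_nonneg _) hC
  have hV := h.fourthBound_nonneg
  have hε := h.ε_pos
  have hω := h.ω_pos
  set T : ℤ := ((t : ℕ) : ℤ)
  set U : ℤ := ((u : ℕ) : ℤ)
  set D : ℕ := Finset.univ.sup fun l => ((x l : ℤ) - (y l : ℤ)).natAbs with hD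
  have hD' : D = Finset.univ.sup fun l => ((y l : ℤ) - (x l : ℤ)).natAbs := by
    rw [hD]; congr 1; ext l; rw [← Int.natAbs_neg, neg_sub]
  have hbox : boxDist x y T U = max D (T - U).natAbs := rfl
  rw [h.integral_noiseProd_mul, hbox]
  rcases le_total D (T - U).natAbs with hDT | hDT
  · rw [max_eq_right hDT]
    have h1 := h.abs_cov_mul_le (x := x) (x' := y) (y := x) (y' := y) (t := t) (t' := t)
      (u := u) (u' := u) (A := {(x, T), (y, T)}) (B := {(x, U), (y, U)}) (d := (T - U).natAbs)
      (hf.alpha_le (by rintro _ (rfl | rfl) _ (rfl | rfl) <;> simp [siteDist]))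
      hθ0.le hθ1 hC (by simp [T]) (by simp [T]) (by simp [U]) (by simp [U])
    have h2 := (le_abs_self _).trans h1
    have h3 : 0 ≤ fourthBound ε ω τ * C * Real.exp (-(c₀ * θ * ((T - U).natAbs : ℝ))) := by
      positivity
    have h4 : 0 ≤ 20 * ω ^ 4 * Real.exp (-(ε / 4 * c₀ * ((T - U).natAbs : ℝ))) := by positivity
    linarith
  · rw [max_eq_left hDT]
    have hα : alphaCoef m.P (m.sigmaField {(x, T), (x, U)}) (m.sigmaField {(y, T), (y, U)}) ≤
        Real.exp (-(c₀ * D)) := hf.alpha_le (by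
      rintro _ (rfl | rfl) _ (rfl | rfl) <;> exact le_max_left _ _)
    have h1 := h.abs_cov_mul_le (x := x) (x' := x) (y := y) (y' := y) (t := t) (t' := u)
      (u := t) (u' := u) hα hθ0.le hθ1 hC (by simp [T]) (by simp [U]) (by simp [T]) (by simp [U])
    have h2 := h.abs_corr_mul_corr_le hα (x := x) (y := y) (t := t) (u := u) hθ0.le hθ1 hC hc₀.le
      (by simp [T]) (by simp [T]) (by simp [U]) (by simp [U])
    have h3 : |∫ w, m.noise τ x t w * m.noise τ x u w ∂m.P| ≤
        10 * ω ^ 2 * Real.exp (-(ε / 4 * c₀ * (T - U).natAbs)) :=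
      h.abs_corr_le (hf.alpha_le (E₁ := {(x, T)}) (E₂ := {(x, U)}) (by simp [siteDist])) hc₀.le
        (by simp [T]) (by simp [U])
    have h4 := h.abs_integral_mul_le_two y y t u
    have h5 : |(∫ w, m.noise τ x t w * m.noise τ x u w ∂m.P) *
        ∫ w, m.noise τ y t w * m.noise τ y u w ∂m.P| ≤
        20 * ω ^ 4 * Real.exp (-(ε / 4 * c₀ * (T - U).natAbs)) := by
      rw [abs_mul]
      exact (mul_le_mul h3 h4 (abs_nonneg _) (by positivity)).trans (le_of_eq (by ring))
    have h6 : ∀ w, m.noise τ x t w * m.noise τ y t w * (m.noise τ x u w * m.noise τ y u w) =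
        m.noise τ x t w * m.noise τ x u w * (m.noise τ y t w * m.noise τ y u w) := fun w => by ring
    simp_rw [h6]
    have h7 := le_abs_self (∫ w, m.noise τ x t w * m.noise τ x u w *
      (m.noise τ y t w * m.noise τ y u w) ∂m.P - (∫ w, m.noise τ x t w * m.noise τ x u w ∂m.P) *
        ∫ w, m.noise τ y t w * m.noise τ y u w ∂m.P)
    have h8 := le_abs_self ((∫ w, m.noise τ x t w * m.noise τ x u w ∂m.P) *
        ∫ w, m.noise τ y t w * m.noise τ y u w ∂m.P)
    have h9 := neg_abs_le ((∫ w, m.noise τ x t w * m.noise τ y t w ∂m.P) *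
        ∫ w, m.noise τ x u w * m.noise τ y u w ∂m.P)
    linarith

theorem sum_integral_sq_noiseCov_le_field (x : m.Site) :
    ∑ y, ∫ w, m.noiseCov τ x y w ^ 2 ∂m.P ≤
      m.n * (4 * fourthBound ε ω τ * C * (1 + 2 * (K + 1) / (c₀ * θ)) ^ (K + 1) +
        m.pTot * (20 * ω ^ 4 * (1 + 2 / (ε / 4 * c₀)))) := by
  have hC0 : 0 ≤ C := le_trans (Real.rpow_nonneg h.mixRatio_nonneg _) hC
  have hV := h.fourthBound_nonneg
  have hε := h.ε_pos
  simp_rw [h.integral_sq_noiseCov]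
  rw [Finset.sum_comm]
  calc _ ≤ ∑ _t : m.Time, (4 * fourthBound ε ω τ * C * (1 + 2 * (K + 1) / (c₀ * θ)) ^ (K + 1) +
        m.pTot * (20 * ω ^ 4 * (1 + 2 / (ε / 4 * c₀)))) := by
        refine Finset.sum_le_sum fun t _ => ?_
        refine (Finset.sum_le_sum fun y _ => Finset.sum_le_sum fun u _ =>
          h.integral_noiseProd_mul_le_field hf hc₀ hθ0 hθ1 hC x y t u).trans ?_
        simp_rw [Finset.sum_add_distrib, ← Finset.mul_sum]
        refine add_le_add (mul_le_mul_of_nonneg_left ?_ (by positivity)) ?_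
        · have := sum_exp_neg_boxDist_le x ((t : ℕ) : ℤ) _ (time_injective (m := m))
            (a := c₀ * θ) (by positivity)
          rwa [Fintype.card_fin] at this
        · have hcard : (Fintype.card m.Site : ℝ) = m.pTot := by
            simp [Site, pTot, dimProd]
          rw [Finset.sum_const, Finset.card_univ, nsmul_eq_mul, hcard, mul_left_comm]
          have hp : 0 ≤ m.pTot := by unfold pTot; positivity
          gcongr
          exact sum_exp_neg_natAbs_comp_le _ time_injective _ (by positivity)
    _ = _ := by rw [Finset.sum_const, Finset.card_univ, card_time, nsmul_eq_mul]

omit hc₀ in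
-- The distance of two pairs of sites is at least the minimum of four distances, and the exponential
-- of that minimum is at most the sum of the four exponentials.
theorem abs_integral_noiseProd_mul_le_field (k : Fin K) (a b : Fin (m.p k))
    (ℓ₁ ℓ₂ ℓ₃ ℓ₄ : OtherIndex m.p k) (t u : m.Time) :
    |∫ w, m.noiseProd τ (m.siteAt k a ℓ₁) (m.siteAt k b ℓ₂) t w *
        m.noiseProd τ (m.siteAt k a ℓ₃) (m.siteAt k b ℓ₄) u w ∂m.P| ≤
      2 * fourthBound ε ω τ * C * (
        Real.exp (-(c₀ * θ * boxDist (p := fun l : {l : Fin K // l ≠ k} => m.p l)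
          ℓ₁ ℓ₃ ((t : ℕ) : ℤ) ((u : ℕ) : ℤ))) +
        Real.exp (-(c₀ * θ * boxDist (p := fun l : {l : Fin K // l ≠ k} => m.p l)
          ℓ₁ ℓ₄ ((t : ℕ) : ℤ) ((u : ℕ) : ℤ))) +
        Real.exp (-(c₀ * θ * boxDist (p := fun l : {l : Fin K // l ≠ k} => m.p l)
          ℓ₂ ℓ₃ ((t : ℕ) : ℤ) ((u : ℕ) : ℤ))) +
        Real.exp (-(c₀ * θ * boxDist (p := fun l : {l : Fin K // l ≠ k} => m.p l)
          ℓ₂ ℓ₄ ((t : ℕ) : ℤ) ((u : ℕ) : ℤ)))) := by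
  have hC0 : 0 ≤ C := le_trans (Real.rpow_nonneg h.mixRatio_nonneg _) hC
  have hV := h.fourthBound_nonneg
  set T : ℤ := ((t : ℕ) : ℤ)
  set U : ℤ := ((u : ℕ) : ℤ)
  set D : OtherIndex m.p k → OtherIndex m.p k → ℕ := fun ℓ ℓ' =>
    boxDist (p := fun l : {l : Fin K // l ≠ k} => m.p l) ℓ ℓ' T U with hD
  set d : ℕ := min (min (D ℓ₁ ℓ₃) (D ℓ₁ ℓ₄)) (min (D ℓ₂ ℓ₃) (D ℓ₂ ℓ₄)) with hd
  have hα : alphaCoef m.P (m.sigmaField {(m.siteAt k a ℓ₁, T), (m.siteAt k b ℓ₂, T)})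
      (m.sigmaField {(m.siteAt k a ℓ₃, U), (m.siteAt k b ℓ₄, U)}) ≤ Real.exp (-(c₀ * d)) :=
    hf.alpha_le (by
      rintro _ (rfl | rfl) _ (rfl | rfl) <;>
        refine le_trans ?_ (boxDist_le_siteDist k _ _ _ _ _ _) <;> simp [hd, hD])
  rw [h.integral_noiseProd_mul]
  refine (h.abs_cov_mul_le hα hθ0.le hθ1 hC (by simp [T]) (by simp [T]) (by simp [U])
    (by simp [U])).trans (mul_le_mul_of_nonneg_left ?_ (by positivity))
  have hpos := fun ℓ ℓ' => (Real.exp_pos (-(c₀ * θ * D ℓ ℓ'))).le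
  have hcases : d = D ℓ₁ ℓ₃ ∨ d = D ℓ₁ ℓ₄ ∨ d = D ℓ₂ ℓ₃ ∨ d = D ℓ₂ ℓ₄ := by
    rw [hd]
    rcases min_choice (min (D ℓ₁ ℓ₃) (D ℓ₁ ℓ₄)) (min (D ℓ₂ ℓ₃) (D ℓ₂ ℓ₄)) with h1 | h1 <;> rw [h1]
    · rcases min_choice (D ℓ₁ ℓ₃) (D ℓ₁ ℓ₄) with h2 | h2 <;> rw [h2] <;> simp
    · rcases min_choice (D ℓ₂ ℓ₃) (D ℓ₂ ℓ₄) with h2 | h2 <;> rw [h2] <;> simp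
  have h13 := hpos ℓ₁ ℓ₃
  have h14 := hpos ℓ₁ ℓ₄
  have h23 := hpos ℓ₂ ℓ₃
  have h24 := hpos ℓ₂ ℓ₄
  rcases hcases with h1 | h1 | h1 | h1 <;> rw [h1] <;> linarith

/-- Fluctuations of a quadratic form in the columns of the noise, under random field mixing. -/
theorem integral_sq_sum_noiseCov_le_field (k : Fin K) (a b : Fin (m.p k))
    (Θ : Matrix (OtherIndex m.p k) (OtherIndex m.p k) ℝ) (hΘ : Θ.transpose = Θ) :
    ∫ w, (∑ ℓ, ∑ ℓ', Θ ℓ ℓ' * m.noiseCov τ (m.siteAt k a ℓ) (m.siteAt k b ℓ') w) ^ 2 ∂m.P ≤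
      m.n * (8 * fourthBound ε ω τ * C * (1 + 2 * K / (c₀ * θ)) ^ K) *
        ∑ ℓ, (∑ ℓ', |Θ ℓ ℓ'|) ^ 2 := by
  have hC0 : 0 ≤ C := le_trans (Real.rpow_nonneg h.mixRatio_nonneg _) hC
  have hV := h.fourthBound_nonneg
  set W := 2 * fourthBound ε ω τ * C with hW
  have hW0 : 0 ≤ W := by positivity
  set e : OtherIndex m.p k × m.Time → OtherIndex m.p k × m.Time → ℝ := fun x y =>
    Real.exp (-(c₀ * θ * boxDist (p := fun l : {l : Fin K // l ≠ k} => m.p l)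
      x.1 y.1 ((x.2 : ℕ) : ℤ) ((y.2 : ℕ) : ℤ))) with he
  set ρ : OtherIndex m.p k → ℝ := fun ℓ => ∑ ℓ', |Θ ℓ ℓ'| with hρ
  have hρ' : ∀ ℓ', ∑ ℓ, |Θ ℓ ℓ'| = ρ ℓ' := fun ℓ' => Finset.sum_congr rfl fun ℓ _ => by
    conv_lhs => rw [← hΘ]
    rfl
  have hρ0 : ∀ ℓ, 0 ≤ ρ ℓ := fun ℓ => Finset.sum_nonneg fun _ _ => abs_nonneg _
  set G : ℝ := (1 + 2 * K / (c₀ * θ)) ^ K with hG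
  -- The box has `K - 1` spatial directions and one temporal direction, hence the exponent `K`.
  have hgeo : ∀ x, ∑ y, e x y ≤ G := fun x => by
    have h1 := sum_exp_neg_boxDist_le (κ := {l : Fin K // l ≠ k}) (p := fun l => m.p l) x.1
      ((x.2 : ℕ) : ℤ) _ (time_injective (m := m)) (a := c₀ * θ) (by positivity)
    have hcard : Fintype.card {l : Fin K // l ≠ k} + 1 = K := by
      have : 0 < K := Fin.pos k
      rw [Fintype.card_subtype_compl]
      simp
      omega
    have hcard' : (Fintype.card {l : Fin K // l ≠ k} : ℝ) + 1 = K := by exact_mod_cast hcard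
    rw [hcard', hcard] at h1
    rwa [Fintype.sum_prod_type]
  have hker : ∑ x : OtherIndex m.p k × m.Time, ∑ y : OtherIndex m.p k × m.Time,
      ρ x.1 * ρ y.1 * e x y ≤ m.n * G * ∑ ℓ, ρ ℓ ^ 2 := by
    have h1 := sum_sum_mul_kernel_le (fun x : OtherIndex m.p k × m.Time => ρ x.1) e
      (fun _ _ => (Real.exp_pos _).le)
      (fun x y => by simp only [he]; rw [boxDist_comm]) hgeo
    simp only [abs_of_nonneg (hρ0 _)] at h1
    refine h1.trans (le_of_eq ?_)
    rw [Fintype.sum_prod_type]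
    simp only [Finset.sum_const, Finset.card_univ, card_time, nsmul_eq_mul]
    rw [← Finset.mul_sum]
    ring
  set q : OtherIndex m.p k × OtherIndex m.p k → Ω → ℝ := fun i =>
    m.noiseCov τ (m.siteAt k a i.1) (m.siteAt k b i.2) with hq
  have hexp : ∀ w, ∑ ℓ, ∑ ℓ', Θ ℓ ℓ' * m.noiseCov τ (m.siteAt k a ℓ) (m.siteAt k b ℓ') w =
      ∑ i : OtherIndex m.p k × OtherIndex m.p k, Θ i.1 i.2 * q i w := fun w => by
    rw [Fintype.sum_prod_type]
  simp_rw [hexp]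
  have hmul : ∀ i j : OtherIndex m.p k × OtherIndex m.p k, ∀ w, Θ i.1 i.2 * q i w *
      (Θ j.1 j.2 * q j w) = Θ i.1 i.2 * Θ j.1 j.2 * (q i w * q j w) := fun i j w => by ring
  rw [integral_sq_sum_eq (fun i w => Θ i.1 i.2 * q i w) fun i j => by
    simp_rw [hmul]; exact (h.integrable_noiseCov_mul _ _ _ _).const_mul _]
  simp_rw [hmul, integral_const_mul]
  have hterm : ∀ i j : OtherIndex m.p k × OtherIndex m.p k,
      Θ i.1 i.2 * Θ j.1 j.2 * ∫ w, q i w * q j w ∂m.P ≤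
      ∑ t : m.Time, ∑ u : m.Time, |Θ i.1 i.2| * |Θ j.1 j.2| * (W * (
        e (i.1, t) (j.1, u) + e (i.1, t) (j.2, u) + e (i.2, t) (j.1, u) + e (i.2, t) (j.2, u))) :=
    fun i j => by
      rw [h.integral_noiseCov_mul, Finset.mul_sum]
      refine Finset.sum_le_sum fun t _ => ?_
      rw [Finset.mul_sum]
      refine Finset.sum_le_sum fun u _ => (le_abs_self _).trans ?_
      rw [abs_mul, abs_mul]
      exact mul_le_mul_of_nonneg_left (h.abs_integral_noiseProd_mul_le_field hf hθ0 hθ1 hC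
        k a b i.1 i.2 j.1 j.2 t u) (by positivity)
  refine (Finset.sum_le_sum fun i _ => Finset.sum_le_sum fun j _ => hterm i j).trans ?_
  -- Each of the four kernels involves one index of each pair. Summing out the other index leaves
  -- absolute row sums `ρ` of `Θ`, which by symmetry are also its column sums, so all four terms
  -- agree.
  have hsplit : ∀ F : OtherIndex m.p k → OtherIndex m.p k → ℝ,
      ∑ i : OtherIndex m.p k × OtherIndex m.p k, ∑ j : OtherIndex m.p k × OtherIndex m.p k,
        |Θ i.1 i.2| * |Θ j.1 j.2| * (W * (F i.1 j.1 + F i.1 j.2 + F i.2 j.1 + F i.2 j.2)) =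
      4 * W * ∑ ℓ, ∑ ℓ', ρ ℓ * ρ ℓ' * F ℓ ℓ' := fun F => by
    have e1 : ∀ f : OtherIndex m.p k → ℝ,
        ∑ i : OtherIndex m.p k × OtherIndex m.p k, |Θ i.1 i.2| * f i.1 = ∑ ℓ, ρ ℓ * f ℓ :=
      fun f => by
        rw [Fintype.sum_prod_type]
        exact Finset.sum_congr rfl fun ℓ _ => by simp only [hρ, Finset.sum_mul]
    have e2 : ∀ f : OtherIndex m.p k → ℝ,
        ∑ i : OtherIndex m.p k × OtherIndex m.p k, |Θ i.1 i.2| * f i.2 = ∑ ℓ, ρ ℓ * f ℓ :=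
      fun f => by
        rw [Fintype.sum_prod_type, Finset.sum_comm]
        exact Finset.sum_congr rfl fun ℓ _ => by simp only [← hρ' ℓ, Finset.sum_mul]
    have e3 : ∀ i : OtherIndex m.p k × OtherIndex m.p k,
        ∑ j : OtherIndex m.p k × OtherIndex m.p k,
        |Θ i.1 i.2| * |Θ j.1 j.2| * (W * (F i.1 j.1 + F i.1 j.2 + F i.2 j.1 + F i.2 j.2)) =
        |Θ i.1 i.2| * (W * (2 * ∑ ℓ', ρ ℓ' * F i.1 ℓ')) +
        |Θ i.1 i.2| * (W * (2 * ∑ ℓ', ρ ℓ' * F i.2 ℓ')) := fun i => by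
      have : ∀ j : OtherIndex m.p k × OtherIndex m.p k,
          |Θ i.1 i.2| * |Θ j.1 j.2| * (W * (F i.1 j.1 + F i.1 j.2 + F i.2 j.1 + F i.2 j.2)) =
          |Θ i.1 i.2| * W * (|Θ j.1 j.2| * F i.1 j.1 + |Θ j.1 j.2| * F i.1 j.2 +
            |Θ j.1 j.2| * F i.2 j.1 + |Θ j.1 j.2| * F i.2 j.2) := fun j => by ring
      simp_rw [this]
      rw [← Finset.mul_sum, Finset.sum_add_distrib, Finset.sum_add_distrib,
        Finset.sum_add_distrib, e1, e2, e1, e2]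
      ring
    simp_rw [e3]
    rw [Finset.sum_add_distrib, e1 fun ℓ => W * (2 * ∑ ℓ', ρ ℓ' * F ℓ ℓ'),
      e2 fun ℓ => W * (2 * ∑ ℓ', ρ ℓ' * F ℓ ℓ'), ← two_mul, Finset.mul_sum, Finset.mul_sum]
    refine Finset.sum_congr rfl fun ℓ _ => ?_
    simp_rw [mul_assoc (ρ ℓ)]
    rw [← Finset.mul_sum]
    ring
  have hcomm : ∀ f : OtherIndex m.p k × OtherIndex m.p k → OtherIndex m.p k × OtherIndex m.p k →
      m.Time → m.Time → ℝ, ∑ i, ∑ j, ∑ t, ∑ u, f i j t u = ∑ t, ∑ u, ∑ i, ∑ j, f i j t u := fun f => by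
    calc _ = ∑ i, ∑ t, ∑ u, ∑ j, f i j t u := Finset.sum_congr rfl fun i _ => by
          rw [Finset.sum_comm]; exact Finset.sum_congr rfl fun t _ => Finset.sum_comm
      _ = _ := by rw [Finset.sum_comm]; exact Finset.sum_congr rfl fun t _ => Finset.sum_comm
  calc _ = ∑ t : m.Time, ∑ u : m.Time, ∑ i : OtherIndex m.p k × OtherIndex m.p k,
        ∑ j : OtherIndex m.p k × OtherIndex m.p k, |Θ i.1 i.2| * |Θ j.1 j.2| * (W * (
        e (i.1, t) (j.1, u) + e (i.1, t) (j.2, u) + e (i.2, t) (j.1, u) + e (i.2, t) (j.2, u))) := by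
        exact hcomm fun i j t u => |Θ i.1 i.2| * |Θ j.1 j.2| * (W * (
          e (i.1, t) (j.1, u) + e (i.1, t) (j.2, u) + e (i.2, t) (j.1, u) + e (i.2, t) (j.2, u)))
    _ = 4 * W * ∑ t : m.Time, ∑ u : m.Time, ∑ ℓ, ∑ ℓ', ρ ℓ * ρ ℓ' * e (ℓ, t) (ℓ', u) := by
        simp_rw [fun t u => hsplit fun ℓ ℓ' => e (ℓ, t) (ℓ', u), ← Finset.mul_sum]
    _ = 4 * W * ∑ x : OtherIndex m.p k × m.Time, ∑ y : OtherIndex m.p k × m.Time,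
        ρ x.1 * ρ y.1 * e x y := by
        congr 1
        rw [Fintype.sum_prod_type_right]
        refine Finset.sum_congr rfl fun t _ => ?_
        rw [Finset.sum_comm]
        exact Finset.sum_congr rfl fun ℓ _ => (Fintype.sum_prod_type_right
          fun y : OtherIndex m.p k × m.Time => ρ ℓ * ρ y.1 * e (ℓ, t) y).symm
    _ ≤ 4 * W * (m.n * G * ∑ ℓ, ρ ℓ ^ 2) := mul_le_mul_of_nonneg_left hker (by positivity)
    _ = _ := by rw [hW]; ring

end NoiseSetup

end

end TensorFactorModel

/-! ### The noise bounds collected for both settings. -/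

namespace TensorFactorModel

noncomputable section

open scoped Matrix Matrix.Norms.Frobenius

variable {K : ℕ} {r : Fin K → ℕ} {Ω : Type*} [mΩ : MeasurableSpace Ω]
  {m : TensorFactorModel K r Ω} {ε ω τ c₀ : ℝ}

theorem sum_site (k : Fin K) (f : m.Site → ℝ) : ∑ x, f x = ∑ a, ∑ ℓ, f (m.siteAt k a ℓ) := by
  rw [← Fintype.sum_prod_type fun y : Fin (m.p k) × OtherIndex m.p k => f (m.siteAt k y.1 y.2)]
  exact (Equiv.sum_comp (Equiv.piSplitAt k fun l => Fin (m.p l)).symm f).symm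

theorem siteAt_injective (k : Fin K) {a b : Fin (m.p k)} {ℓ ℓ' : OtherIndex m.p k} :
    m.siteAt k a ℓ = m.siteAt k b ℓ' ↔ a = b ∧ ℓ = ℓ' := by
  unfold siteAt
  rw [Equiv.apply_eq_iff_eq, Prod.mk.injEq]

theorem card_site : (Fintype.card m.Site : ℝ) = m.pTot := by
  simp [Site, pTot, dimProd]

theorem card_otherIndex (k : Fin K) :
    (Fintype.card (OtherIndex m.p k) : ℝ) = dimProdExcept m.p k := by
  rw [Fintype.card_pi]
  simp only [Fintype.card_fin, dimProdExcept]
  push_cast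
  exact prod_subtype_ne_eq k fun l => (m.p l : ℝ)

theorem pTot_eq (k : Fin K) : m.pTot = m.p k * dimProdExcept m.p k := by
  unfold pTot dimProd dimProdExcept
  rw [← Finset.mul_prod_erase _ _ (Finset.mem_univ k)]
  push_cast
  ring

/-- Bounds on the second-order dependence of the noise: `C₁` for the correlations, `ν`, `φ` and `χ`
for the fluctuations of its quadratic forms. -/
structure NoiseBounds (m : TensorFactorModel K r Ω) (τ : ℝ) (k : Fin K) (C₁ ν φ χ : ℝ) : Prop where
  corr : ∀ x t, ∑ y, ∑ u, |∫ w, m.noise τ x t w * m.noise τ y u w ∂m.P| ≤ C₁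
  cov_one : ∑ a, ∑ b, ∫ w, (∑ ℓ, ∑ ℓ', (1 : Matrix (OtherIndex m.p k) (OtherIndex m.p k) ℝ) ℓ ℓ' *
    m.noiseCov τ (m.siteAt k a ℓ) (m.siteAt k b ℓ') w) ^ 2 ∂m.P ≤ (m.n * m.pTot) ^ 2 * ν ^ 2
  cov_proj : ∀ W : Matrix (OtherIndex m.p k) (OtherIndex r k) ℝ, Wᵀ * W = 1 →
    ∑ a, ∑ b, ∫ w, (∑ ℓ, ∑ ℓ', (W * Wᵀ) ℓ ℓ' *
      m.noiseCov τ (m.siteAt k a ℓ) (m.siteAt k b ℓ') w) ^ 2 ∂m.P ≤ (m.n * m.pTot) ^ 2 * φ ^ 2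
  cov_all : ∑ x, ∑ y, ∫ w, m.noiseCov τ x y w ^ 2 ∂m.P ≤ (m.n * m.pTot) ^ 2 * χ ^ 2

theorem frobenius_sq_one (k : Fin K) :
    ‖(1 : Matrix (OtherIndex m.p k) (OtherIndex m.p k) ℝ)‖ ^ 2 = dimProdExcept m.p k := by
  rw [frobenius_sq_of_orthonormal (by simp), card_otherIndex]

theorem frobenius_sq_proj {k : Fin K} {W : Matrix (OtherIndex m.p k) (OtherIndex r k) ℝ}
    (hW : Wᵀ * W = 1) : ‖W * Wᵀ‖ ^ 2 = Fintype.card (OtherIndex r k) := by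
  obtain ⟨h1, h2⟩ := proj_of_orthonormal hW
  rw [frobenius_sq_eq_trace, h1, h2, Matrix.trace_mul_comm, hW, Matrix.trace_one]

namespace NoiseSetup

variable (h : m.NoiseSetup ε ω τ)
include h

section Series

variable (hs : m.SeriesMixing c₀) (hc₀ : 0 < c₀)
  {θ C : ℝ} (hθ0 : 0 < θ) (hθ1 : θ ≤ 1) (hC : mixRatio ε ω τ ^ θ ≤ C)
include hs hc₀ hθ0 hθ1 hC

/-- By orthogonality only `Σ Θ²` enters. All `p_k²` pairs of rows carry the variance of products
over distinct sites, but only the `p_k` diagonal ones can meet a site paired with itself and carry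
the fourth-moment term. -/
theorem sum_integral_sq_noiseCov_le_series (k : Fin K)
    (Θ : Matrix (OtherIndex m.p k) (OtherIndex m.p k) ℝ) :
    ∑ a, ∑ b, ∫ w, (∑ ℓ, ∑ ℓ', Θ ℓ ℓ' *
      m.noiseCov τ (m.siteAt k a ℓ) (m.siteAt k b ℓ') w) ^ 2 ∂m.P ≤
    2 * m.n * m.p k * (m.p k * (20 * ω ^ 4 * (1 + 2 / (ε / 4 * c₀))) +
      2 * fourthBound ε ω τ * C * (1 + 2 / (c₀ * θ))) * ‖Θ‖ ^ 2 := by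
  classical
  have hC0 : 0 ≤ C := le_trans (Real.rpow_nonneg h.mixRatio_nonneg _) hC
  have hV := h.fourthBound_nonneg
  have hε := h.ε_pos
  set A := 20 * ω ^ 4 * (1 + 2 / (ε / 4 * c₀)) with hA
  set V := 2 * fourthBound ε ω τ * C * (1 + 2 / (c₀ * θ)) with hV'
  have hA0 : 0 ≤ A := by positivity
  have hV0 : 0 ≤ V := by positivity
  have hq : ∀ x y : m.Site, ∫ w, m.noiseCov τ x y w ^ 2 ∂m.P ≤
      m.n * A + if x = y then m.n * V else 0 := fun x y => by
    split_ifs with hxy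
    · subst hxy
      have := h.integral_sq_noiseCov_self_le hs hc₀ hθ0 hθ1 hC x
      have h0 : 0 ≤ (m.n : ℝ) * A := by positivity
      linarith
    · rw [add_zero]
      exact h.integral_sq_noiseCov_le_of_ne hs hc₀ hxy
  have hpair : ∀ a b : Fin (m.p k), ∫ w, (∑ ℓ, ∑ ℓ', Θ ℓ ℓ' *
      m.noiseCov τ (m.siteAt k a ℓ) (m.siteAt k b ℓ') w) ^ 2 ∂m.P ≤
      2 * ∑ ℓ, ∑ ℓ', Θ ℓ ℓ' ^ 2 * (m.n * A + if a = b then m.n * V else 0) := fun a b => by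
    -- `Θ` is extended by zero to all pairs of sites, supported on the fibres over `a` and `b`.
    set Ψ : m.Site × m.Site → ℝ := fun i => if i.1 k = a ∧ i.2 k = b then
      Θ (fun l => i.1 l) (fun l => i.2 l) else 0 with hΨ
    have hsum : ∀ f : m.Site → m.Site → ℝ → ℝ, (∀ x y, f x y 0 = 0) →
        ∑ i : m.Site × m.Site, f i.1 i.2 (Ψ i) =
        ∑ ℓ, ∑ ℓ', f (m.siteAt k a ℓ) (m.siteAt k b ℓ') (Θ ℓ ℓ') := fun f hf0 => by
      have hval : ∀ a' b' ℓ ℓ', Ψ (m.siteAt k a' ℓ, m.siteAt k b' ℓ') =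
          if a' = a ∧ b' = b then Θ ℓ ℓ' else 0 := fun a' b' ℓ ℓ' => by
        simp only [hΨ, siteAt_same, siteAt_other]
      rw [Fintype.sum_prod_type, sum_site k]
      simp_rw [sum_site k fun y => f _ y (Ψ (_, y)), hval]
      rw [Finset.sum_eq_single a]
      · refine Finset.sum_congr rfl fun ℓ _ => ?_
        rw [Finset.sum_eq_single b]
        · simp
        · intro b' _ hb'
          simp [hb', hf0]
        · simp
      · intro a' _ ha'
        simp [ha', hf0]
      · simp
    have h1 := h.integral_sq_sum_noiseCov_le hs Ψ
    have h2 : ∀ w, ∑ i : m.Site × m.Site, Ψ i * m.noiseCov τ i.1 i.2 w = ∑ ℓ, ∑ ℓ', Θ ℓ ℓ' *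
      m.noiseCov τ (m.siteAt k a ℓ) (m.siteAt k b ℓ') w := fun w =>
      hsum (fun x y z => z * m.noiseCov τ x y w) (by simp)
    simp_rw [h2] at h1
    refine h1.trans ?_
    rw [hsum (fun x y z => z ^ 2 * ∫ w, m.noiseCov τ x y w ^ 2 ∂m.P) (by simp)]
    refine mul_le_mul_of_nonneg_left ?_ (by norm_num)
    refine Finset.sum_le_sum fun ℓ _ => Finset.sum_le_sum fun ℓ' _ =>
      mul_le_mul_of_nonneg_left ?_ (sq_nonneg _)
    refine (hq _ _).trans (add_le_add le_rfl ?_)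
    have hnV : 0 ≤ (m.n : ℝ) * V := by positivity
    split_ifs with h3 h4 h4
    · exact le_rfl
    · exact absurd ((siteAt_injective k).1 h3).1 h4
    · exact hnV
    · exact le_rfl
  refine (Finset.sum_le_sum fun a _ => Finset.sum_le_sum fun b _ => hpair a b).trans ?_
  simp_rw [← Finset.sum_mul, ← frobenius_sq Θ, ← Finset.mul_sum, Finset.sum_add_distrib]
  simp only [Finset.sum_ite_eq, Finset.mem_univ, if_true, Finset.sum_const, Finset.card_univ,
    Fintype.card_fin, nsmul_eq_mul]
  refine le_of_eq (by ring)

theorem noiseBounds_series (k : Fin K) {C₁ ν φ χ : ℝ}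
    (hC₁ : 10 * ω ^ 2 * (1 + 2 / (ε / 4 * c₀)) ≤ C₁)
    (hν : 2 * m.n * m.pTot * (m.p k * (20 * ω ^ 4 * (1 + 2 / (ε / 4 * c₀))) +
      2 * fourthBound ε ω τ * C * (1 + 2 / (c₀ * θ))) ≤ (m.n * m.pTot) ^ 2 * ν ^ 2)
    (hφ : 2 * m.n * m.p k * (m.p k * (20 * ω ^ 4 * (1 + 2 / (ε / 4 * c₀))) +
      2 * fourthBound ε ω τ * C * (1 + 2 / (c₀ * θ))) * Fintype.card (OtherIndex r k) ≤
        (m.n * m.pTot) ^ 2 * φ ^ 2)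
    (hχ : m.n * m.pTot * (m.pTot * (20 * ω ^ 4 * (1 + 2 / (ε / 4 * c₀))) +
      2 * fourthBound ε ω τ * C * (1 + 2 / (c₀ * θ))) ≤ (m.n * m.pTot) ^ 2 * χ ^ 2) :
    m.NoiseBounds τ k C₁ ν φ χ where
  corr x t := (h.sum_abs_corr_le_series hs hc₀ x t).trans hC₁
  cov_one := (h.sum_integral_sq_noiseCov_le_series hs hc₀ hθ0 hθ1 hC k 1).trans <| by
    refine le_trans (le_of_eq ?_) hν
    rw [frobenius_sq_one, pTot_eq k]
    ring
  cov_proj W hW := (h.sum_integral_sq_noiseCov_le_series hs hc₀ hθ0 hθ1 hC k _).trans <| by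
    rw [frobenius_sq_proj hW]
    exact hφ
  cov_all := by
    classical
    have hC0 : 0 ≤ C := le_trans (Real.rpow_nonneg h.mixRatio_nonneg _) hC
    have hV := h.fourthBound_nonneg
    have hε := h.ε_pos
    refine le_trans ?_ hχ
    set A := 20 * ω ^ 4 * (1 + 2 / (ε / 4 * c₀)) with hA
    set V := 2 * fourthBound ε ω τ * C * (1 + 2 / (c₀ * θ)) with hV'
    have hA0 : 0 ≤ A := by positivity
    have hq : ∀ x y : m.Site, ∫ w, m.noiseCov τ x y w ^ 2 ∂m.P ≤
        m.n * A + if x = y then m.n * V else 0 := fun x y => by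
      split_ifs with hxy
      · subst hxy
        have := h.integral_sq_noiseCov_self_le hs hc₀ hθ0 hθ1 hC x
        have h0 : 0 ≤ (m.n : ℝ) * A := by positivity
        linarith
      · rw [add_zero]
        exact h.integral_sq_noiseCov_le_of_ne hs hc₀ hxy
    refine (Finset.sum_le_sum fun x _ => Finset.sum_le_sum fun y _ => hq x y).trans ?_
    simp_rw [Finset.sum_add_distrib]
    simp only [Finset.sum_ite_eq, Finset.mem_univ, if_true, Finset.sum_const, Finset.card_univ,
      nsmul_eq_mul, card_site]
    refine le_of_eq (by ring)

end Series

section Field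

variable (hf : m.FieldMixing c₀) (hc₀ : 0 < c₀)
  {θ C : ℝ} (hθ0 : 0 < θ) (hθ1 : θ ≤ 1) (hC : mixRatio ε ω τ ^ θ ≤ C)
include hf hc₀ hθ0 hθ1 hC

theorem noiseBounds_field (k : Fin K) {C₁ ν φ χ : ℝ}
    (hC₁ : 10 * ω ^ 2 * (1 + 2 * (K + 1) / (ε / 4 * c₀)) ^ (K + 1) ≤ C₁)
    (hν : m.n * m.pTot * m.p k * (8 * fourthBound ε ω τ * C * (1 + 2 * K / (c₀ * θ)) ^ K) ≤
      (m.n * m.pTot) ^ 2 * ν ^ 2)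
    (hφ : m.n * m.pTot * m.p k * (8 * fourthBound ε ω τ * C * (1 + 2 * K / (c₀ * θ)) ^ K) *
      Fintype.card (OtherIndex r k) ≤ (m.n * m.pTot) ^ 2 * φ ^ 2)
    (hχ : m.n * m.pTot * (4 * fourthBound ε ω τ * C * (1 + 2 * (K + 1) / (c₀ * θ)) ^ (K + 1) +
        m.pTot * (20 * ω ^ 4 * (1 + 2 / (ε / 4 * c₀)))) ≤ (m.n * m.pTot) ^ 2 * χ ^ 2) :
    m.NoiseBounds τ k C₁ ν φ χ where
  corr x t := (h.sum_abs_corr_le_field hf hc₀ x t).trans hC₁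
  cov_one := by
    refine (Finset.sum_le_sum fun a _ => Finset.sum_le_sum fun b _ =>
      h.integral_sq_sum_noiseCov_le_field hf hc₀ hθ0 hθ1 hC k a b 1 (by simp)).trans ?_
    refine le_trans (le_of_eq ?_) hν
    have h1 : ∀ ℓ : OtherIndex m.p k,
        ∑ ℓ', |(1 : Matrix (OtherIndex m.p k) (OtherIndex m.p k) ℝ) ℓ ℓ'| = 1 := fun ℓ => by
      rw [Finset.sum_eq_single ℓ] <;> simp +contextual [eq_comm]
    simp_rw [h1]
    simp only [one_pow, Finset.sum_const, Finset.card_univ, nsmul_eq_mul, Fintype.card_fin,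
      card_otherIndex, mul_one]
    rw [pTot_eq k]
    ring
  cov_proj W hW := by
    have hC0 : 0 ≤ C := le_trans (Real.rpow_nonneg h.mixRatio_nonneg _) hC
    have hV := h.fourthBound_nonneg
    refine (Finset.sum_le_sum fun a _ => Finset.sum_le_sum fun b _ =>
      h.integral_sq_sum_noiseCov_le_field hf hc₀ hθ0 hθ1 hC k a b (W * Wᵀ)
        (proj_of_orthonormal hW).1).trans ?_
    refine le_trans ?_ hφ
    -- Row sums are turned into the Frobenius norm at the cost of a factor `p₋ₖ`. For random fields
    -- a low-rank projection therefore brings no gain in this bound over the identity, up to its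
    -- rank.
    have h1 : ∑ ℓ, (∑ ℓ', |(W * Wᵀ) ℓ ℓ'|) ^ 2 ≤
        dimProdExcept m.p k * Fintype.card (OtherIndex r k) := by
      rw [← frobenius_sq_proj hW, frobenius_sq, Finset.mul_sum]
      refine Finset.sum_le_sum fun ℓ _ => ?_
      have := sq_sum_le_card_mul_sum_sq (s := Finset.univ) (f := fun ℓ' => |(W * Wᵀ) ℓ ℓ'|)
      rw [Finset.card_univ, card_otherIndex] at this
      simpa only [sq_abs] using this
    simp only [Finset.sum_const, Finset.card_univ, nsmul_eq_mul, Fintype.card_fin]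
    set Z := 8 * fourthBound ε ω τ * C * (1 + 2 * K / (c₀ * θ)) ^ K with hZ
    have hZ0 : 0 ≤ Z := by positivity
    calc _ ≤ (m.p k : ℝ) * (m.p k * (m.n * Z *
          (dimProdExcept m.p k * Fintype.card (OtherIndex r k)))) := by gcongr
      _ = _ := by rw [pTot_eq k]; ring
  cov_all := by
    refine (Finset.sum_le_sum fun x _ =>
      h.sum_integral_sq_noiseCov_le_field hf hc₀ hθ0 hθ1 hC x).trans ?_
    refine le_trans (le_of_eq ?_) hχ
    simp only [Finset.sum_const, Finset.card_univ, nsmul_eq_mul, card_site]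
    ring

end Field

end NoiseSetup

end

end TensorFactorModel

/-! ### Auxiliary bounds for stacked matrices and bilinear forms. -/

section Aux

open scoped Matrix Matrix.Norms.Frobenius Kronecker

theorem integrable_sq_sum {Ω : Type*} [MeasurableSpace Ω] {P : Measure Ω} {ι : Type*} [Fintype ι]
    (f : ι → Ω → ℝ) (hi : ∀ i j, Integrable (fun w => f i w * f j w) P) :
    Integrable (fun w => (∑ i, f i w) ^ 2) P := by
  simp_rw [sq, Finset.sum_mul_sum]
  exact integrable_finsetSum _ fun i _ => integrable_finsetSum _ fun j _ => hi i j

theorem frobenius_stack_mul_kronecker_le {T J J' m : Type*} [Fintype T] [DecidableEq T] [Fintype J]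
    [Fintype J'] [Fintype m] (Y : Matrix m (T × J) ℝ) (Θ : Matrix J J' ℝ) :
    ‖Y * ((1 : Matrix T T ℝ) ⊗ₖ Θ)‖ ≤ ‖Y‖ * ‖Θ‖ := by
  have hY : Y = stack fun t => Matrix.of fun a j => Y a (t, j) := by ext a ⟨t, j⟩; rfl
  rw [hY, stack_mul_kronecker]
  refine abs_le_of_sq_le_sq' ?_ (by positivity) |>.2
  rw [mul_pow, frobenius_sq_stack, frobenius_sq_stack, Finset.sum_mul]
  refine Finset.sum_le_sum fun t _ => ?_
  rw [← mul_pow]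
  exact pow_le_pow_left₀ (norm_nonneg _) (Matrix.frobenius_norm_mul _ _) 2

theorem sum_sum_bilinear_le {ι : Type*} [Fintype ι] (a b : ι → ℝ) (κ : ι → ι → ℝ)
    (hs : ∀ i j, κ i j = κ j i) {C : ℝ} (hC : ∀ i, ∑ j, |κ i j| ≤ C) :
    |∑ i, ∑ j, a i * b j * κ i j| ≤ C * ((∑ i, a i ^ 2 + ∑ i, b i ^ 2) / 2) := by
  have h1 : ∑ i, ∑ j, |a i * b j * κ i j| ≤
      ∑ i, ∑ j, (a i ^ 2 * |κ i j| / 2 + b j ^ 2 * |κ j i| / 2) := by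
    refine Finset.sum_le_sum fun i _ => Finset.sum_le_sum fun j _ => ?_
    rw [hs j i, abs_mul, abs_mul, ← sq_abs (a i), ← sq_abs (b j)]
    nlinarith [mul_nonneg (sq_nonneg (|a i| - |b j|)) (abs_nonneg (κ i j))]
  have h2 : ∀ c : ι → ℝ, ∑ i, ∑ j, c i ^ 2 * |κ i j| / 2 ≤ C * (∑ i, c i ^ 2) / 2 := fun c => by
    rw [Finset.mul_sum, Finset.sum_div]
    refine Finset.sum_le_sum fun i _ => ?_
    rw [← Finset.sum_div, ← Finset.mul_sum]
    have := mul_le_mul_of_nonneg_left (hC i) (sq_nonneg (c i))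
    linarith
  have h3 : ∑ i, ∑ j, b j ^ 2 * |κ j i| / 2 = ∑ i, ∑ j, b i ^ 2 * |κ i j| / 2 := Finset.sum_comm
  have h4 : |∑ i, ∑ j, a i * b j * κ i j| ≤ ∑ i, ∑ j, |a i * b j * κ i j| :=
    (Finset.abs_sum_le_sum_abs _ _).trans
      (Finset.sum_le_sum fun i _ => Finset.abs_sum_le_sum_abs _ _)
  simp_rw [Finset.sum_add_distrib] at h1
  rw [h3] at h1
  have := h2 a
  have := h2 b
  linarith

/-- A bound on the bilinear form of a matrix bounds its action. -/
theorem mulVec_sq_le_of_bilinear {m : Type*} [Fintype m] (A : Matrix m m ℝ) {c : ℝ} (hc : 0 ≤ c)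
    (h : ∀ u v : m → ℝ, u ⬝ᵥ (A *ᵥ v) ≤ c * ((u ⬝ᵥ u + v ⬝ᵥ v) / 2)) (v : m → ℝ) :
    (A *ᵥ v) ⬝ᵥ (A *ᵥ v) ≤ c ^ 2 * (v ⬝ᵥ v) := by
  rcases hc.eq_or_lt with rfl | hc
  · have := h (A *ᵥ v) v
    simpa using this
  · have h1 := h (c⁻¹ • (A *ᵥ v)) v
    rw [smul_dotProduct, smul_dotProduct, dotProduct_smul] at h1
    simp only [smul_eq_mul] at h1
    set x := (A *ᵥ v) ⬝ᵥ (A *ᵥ v)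
    have h2 : c * ((c⁻¹ * (c⁻¹ * x) + v ⬝ᵥ v) / 2) = c⁻¹ * x / 2 + c * (v ⬝ᵥ v) / 2 := by
      field_simp
    rw [h2] at h1
    have h3 : c⁻¹ * x ≤ c * (v ⬝ᵥ v) := by linarith
    have h4 := mul_le_mul_of_nonneg_left h3 hc.le
    rw [← mul_assoc, mul_inv_cancel₀ hc.ne', one_mul] at h4
    linarith

end Aux

/-! ### The stacked matrices and the noise Gram matrix. -/

namespace TensorFactorModel

noncomputable section

open scoped Matrix Matrix.Norms.Frobenius Kronecker

variable {K : ℕ} {r : Fin K → ℕ} {Ω : Type*} [mΩ : MeasurableSpace Ω]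
  {m : TensorFactorModel K r Ω} {ε ω τ c₀ : ℝ}

/-- Normalized loadings. -/
def loadMat (m : TensorFactorModel K r Ω) (k : Fin K) : Matrix (Fin (m.p k)) (Fin (r k)) ℝ :=
  (Real.sqrt (m.p k))⁻¹ • m.Λ k

/-- Scaled mode-`k` unfoldings of a tensor-valued time series, side by side. -/
def stackUnfold (m : TensorFactorModel K r Ω) (k : Fin K) (Y : m.Time → Tensor m.p) :
    Matrix (Fin (m.p k)) (m.Time × OtherIndex m.p k) ℝ :=
  (Real.sqrt (m.n * m.pTot))⁻¹ • stack fun t => matUnfold k (Y t)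

def dataMat (m : TensorFactorModel K r Ω) (τ : ℝ) (k : Fin K) (w : Ω) :
    Matrix (Fin (m.p k)) (m.Time × OtherIndex m.p k) ℝ :=
  m.stackUnfold k fun t => m.Xtrunc τ t w

def noiseMat (m : TensorFactorModel K r Ω) (τ : ℝ) (k : Fin K) (w : Ω) :
    Matrix (Fin (m.p k)) (m.Time × OtherIndex m.p k) ℝ :=
  m.stackUnfold k fun t x => m.noise τ x t w

def biasMat (m : TensorFactorModel K r Ω) (τ : ℝ) (k : Fin K) :
    Matrix (Fin (m.p k)) (m.Time × OtherIndex m.p k) ℝ :=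
  m.stackUnfold k fun t x => ∫ w, m.rawNoise τ x t w ∂m.P

/-- Only `√n` is divided out here: the factor `√p` cancels against the norms of the loadings, so
that `loadMat` times this matrix is the stacked common component. -/
def factorMat (m : TensorFactorModel K r Ω) (k : Fin K) :
    Matrix (Fin (r k)) (m.Time × OtherIndex m.p k) ℝ :=
  (Real.sqrt m.n)⁻¹ • stack fun t : m.Time => matUnfold k (m.F t) * (kronExcept k m.loadMat)ᵀ

/-- Centred part of `N (1 ⊗ Θ) Nᵀ`, `N` being the stacked noise. -/
def fluctGram (m : TensorFactorModel K r Ω) (τ : ℝ) (k : Fin K)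
    (Θ : Matrix (OtherIndex m.p k) (OtherIndex m.p k) ℝ) (w : Ω) :
    Matrix (Fin (m.p k)) (Fin (m.p k)) ℝ :=
  Matrix.of fun a b => (m.n * m.pTot)⁻¹ * ∑ ℓ, ∑ ℓ', Θ ℓ ℓ' *
    m.noiseCov τ (m.siteAt k a ℓ) (m.siteAt k b ℓ') w

/-- Mean of `N (1 ⊗ Θ) Nᵀ`, `N` being the stacked noise. -/
def meanGram (m : TensorFactorModel K r Ω) (τ : ℝ) (k : Fin K)
    (Θ : Matrix (OtherIndex m.p k) (OtherIndex m.p k) ℝ) :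
    Matrix (Fin (m.p k)) (Fin (m.p k)) ℝ :=
  Matrix.of fun a b => (m.n * m.pTot)⁻¹ * ∑ ℓ, ∑ ℓ', Θ ℓ ℓ' *
    ∑ t, ∫ w, m.noise τ (m.siteAt k a ℓ) t w * m.noise τ (m.siteAt k b ℓ') t w ∂m.P

theorem stackUnfold_apply (k : Fin K) (Y : m.Time → Tensor m.p) (a : Fin (m.p k))
    (x : m.Time × OtherIndex m.p k) :
    m.stackUnfold k Y a x = (Real.sqrt (m.n * m.pTot))⁻¹ * Y x.1 (m.siteAt k a x.2) := rfl

theorem pTot_nonneg : 0 ≤ m.pTot := by unfold pTot; positivity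

theorem inv_sqrt_mul_inv_sqrt {x : ℝ} (hx : 0 ≤ x) : (Real.sqrt x)⁻¹ * (Real.sqrt x)⁻¹ = x⁻¹ := by
  rw [← mul_inv, Real.mul_self_sqrt hx]

theorem n_mul_pTot_nonneg : 0 ≤ m.n * m.pTot := by have := m.pTot_nonneg; positivity

theorem frobenius_sq_stackUnfold (k : Fin K) (Y : m.Time → Tensor m.p) :
    ‖m.stackUnfold k Y‖ ^ 2 = (m.n * m.pTot)⁻¹ * ∑ t, ∑ x, Y t x ^ 2 := by
  rw [stackUnfold, norm_smul, mul_pow, frobenius_sq_stack]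
  simp_rw [frobenius_sq_matUnfold]
  rw [Real.norm_eq_abs, sq_abs, sq, inv_sqrt_mul_inv_sqrt n_mul_pTot_nonneg]

/-- An identity at each sample point, with both parts linear in `Θ`. It remains available when `Θ`
is a random projection, although the second part is then no longer a mean. -/
theorem noise_gram (k : Fin K) (Θ : Matrix (OtherIndex m.p k) (OtherIndex m.p k) ℝ) (w : Ω) :
    m.noiseMat τ k w * ((1 : Matrix m.Time m.Time ℝ) ⊗ₖ Θ) * (m.noiseMat τ k w)ᵀ =
      m.fluctGram τ k Θ w + m.meanGram τ k Θ := by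
  unfold noiseMat stackUnfold
  rw [Matrix.smul_mul, Matrix.transpose_smul, Matrix.smul_mul, Matrix.mul_smul, smul_smul,
    inv_sqrt_mul_inv_sqrt n_mul_pTot_nonneg, stack_mul_kronecker, stack_mul_transpose]
  ext a b
  simp only [fluctGram, meanGram, Matrix.smul_apply, Matrix.add_apply, Matrix.of_apply,
    smul_eq_mul, Matrix.sum_apply, Matrix.mul_apply, Matrix.transpose_apply]
  rw [← mul_add, ← Finset.sum_add_distrib]
  congr 1
  simp_rw [← Finset.sum_add_distrib, ← mul_add, noiseCov, noiseProd, ← Finset.sum_add_distrib,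
    sub_add_cancel, Finset.sum_mul, Finset.mul_sum]
  calc _ = ∑ t, ∑ ℓ, ∑ ℓ', Θ ℓ ℓ' *
        (m.noise τ (m.siteAt k a ℓ) t w * m.noise τ (m.siteAt k b ℓ') t w) :=
        Finset.sum_congr rfl fun t _ => by
          rw [Finset.sum_comm]
          refine Finset.sum_congr rfl fun ℓ _ => Finset.sum_congr rfl fun ℓ' _ => ?_
          rw [mul_comm (Θ ℓ ℓ'), mul_right_comm]
          rfl
    _ = _ := by
        rw [Finset.sum_comm]
        exact Finset.sum_congr rfl fun ℓ _ => Finset.sum_comm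

theorem noise_gram_one (k : Fin K) (w : Ω) :
    m.noiseMat τ k w * (m.noiseMat τ k w)ᵀ = m.fluctGram τ k 1 w + m.meanGram τ k 1 := by
  rw [← noise_gram, Matrix.one_kronecker_one, Matrix.mul_one]

theorem fluctGram_add (k : Fin K) (Θ Θ' : Matrix (OtherIndex m.p k) (OtherIndex m.p k) ℝ) (w : Ω) :
    m.fluctGram τ k (Θ + Θ') w = m.fluctGram τ k Θ w + m.fluctGram τ k Θ' w := by
  ext a b
  simp only [fluctGram, Matrix.add_apply, Matrix.of_apply, add_mul, Finset.sum_add_distrib, mul_add]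

/-- Mean square of all time sums of centred products of noise variables. -/
def covStat (m : TensorFactorModel K r Ω) (τ : ℝ) (w : Ω) : ℝ :=
  ((m.n * m.pTot)⁻¹) ^ 2 * ∑ x, ∑ y, m.noiseCov τ x y w ^ 2

/-- Cauchy–Schwarz over the entries of `Θ`, uniformly in `Θ` at a fixed sample point. This decouples
the random projection from the noise it was computed from. -/
theorem frobenius_sq_fluctGram_le (k : Fin K)
    (Θ : Matrix (OtherIndex m.p k) (OtherIndex m.p k) ℝ) (w : Ω) :
    ‖m.fluctGram τ k Θ w‖ ^ 2 ≤ ‖Θ‖ ^ 2 * m.covStat τ w := by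
  rw [frobenius_sq, covStat]
  simp only [fluctGram, Matrix.of_apply, mul_pow]
  simp_rw [← Finset.mul_sum]
  rw [mul_left_comm]
  refine mul_le_mul_of_nonneg_left ?_ (sq_nonneg _)
  have h1 : ∑ x, ∑ y, m.noiseCov τ x y w ^ 2 =
      ∑ a, ∑ b, ∑ ℓ, ∑ ℓ', m.noiseCov τ (m.siteAt k a ℓ) (m.siteAt k b ℓ') w ^ 2 := by
    rw [sum_site k]
    simp_rw [sum_site k fun y => m.noiseCov τ _ y w ^ 2]
    exact Finset.sum_congr rfl fun a _ => Finset.sum_comm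
  rw [h1, Finset.mul_sum]
  refine Finset.sum_le_sum fun a _ => ?_
  rw [Finset.mul_sum]
  refine Finset.sum_le_sum fun b _ => ?_
  rw [frobenius_sq]
  have := Finset.sum_mul_sq_le_sq_mul_sq Finset.univ
    (fun i : OtherIndex m.p k × OtherIndex m.p k => Θ i.1 i.2)
    (fun i => m.noiseCov τ (m.siteAt k a i.1) (m.siteAt k b i.2) w)
  simpa only [Fintype.sum_prod_type] using this

theorem meanGram_bilinear (k : Fin K) {q : Type*} [Fintype q] (W : Matrix (OtherIndex m.p k) q ℝ)
    (u v : Fin (m.p k) → ℝ) :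
    u ⬝ᵥ (m.meanGram τ k (W * Wᵀ) *ᵥ v) = (m.n * m.pTot)⁻¹ * ∑ t, ∑ z,
      ∑ x : Fin (m.p k) × OtherIndex m.p k, ∑ y : Fin (m.p k) × OtherIndex m.p k,
        u x.1 * W x.2 z * (v y.1 * W y.2 z) *
        ∫ w, m.noise τ (m.siteAt k x.1 x.2) t w * m.noise τ (m.siteAt k y.1 y.2) t w ∂m.P := by
  simp only [dotProduct, Matrix.mulVec, meanGram, Matrix.of_apply, Matrix.mul_apply,
    Matrix.transpose_apply, Fintype.sum_prod_type, Finset.mul_sum, Finset.sum_mul]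
  set N := fun a ℓ b ℓ' t =>
    ∫ w, m.noise τ (m.siteAt k a ℓ) t w * m.noise τ (m.siteAt k b ℓ') t w ∂m.P with hN
  have hsw : ∀ f : m.Time → q → Fin (m.p k) → OtherIndex m.p k → Fin (m.p k) → OtherIndex m.p k → ℝ,
      ∑ t, ∑ z, ∑ a, ∑ ℓ, ∑ b, ∑ ℓ', f t z a ℓ b ℓ' =
      ∑ a, ∑ b, ∑ ℓ, ∑ ℓ', ∑ t, ∑ z, f t z a ℓ b ℓ' := fun f => by
    calc _ = ∑ t, ∑ a, ∑ z, ∑ ℓ, ∑ b, ∑ ℓ', f t z a ℓ b ℓ' :=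
          Finset.sum_congr rfl fun t _ => Finset.sum_comm
      _ = ∑ a, ∑ t, ∑ z, ∑ ℓ, ∑ b, ∑ ℓ', f t z a ℓ b ℓ' := Finset.sum_comm
      _ = ∑ a, ∑ t, ∑ z, ∑ b, ∑ ℓ, ∑ ℓ', f t z a ℓ b ℓ' :=
          Finset.sum_congr rfl fun a _ => Finset.sum_congr rfl fun t _ =>
            Finset.sum_congr rfl fun z _ => Finset.sum_comm
      _ = ∑ a, ∑ t, ∑ b, ∑ z, ∑ ℓ, ∑ ℓ', f t z a ℓ b ℓ' :=
          Finset.sum_congr rfl fun a _ => Finset.sum_congr rfl fun t _ => Finset.sum_comm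
      _ = ∑ a, ∑ b, ∑ t, ∑ z, ∑ ℓ, ∑ ℓ', f t z a ℓ b ℓ' :=
          Finset.sum_congr rfl fun a _ => Finset.sum_comm
      _ = ∑ a, ∑ b, ∑ t, ∑ ℓ, ∑ ℓ', ∑ z, f t z a ℓ b ℓ' :=
          Finset.sum_congr rfl fun a _ => Finset.sum_congr rfl fun b _ =>
            Finset.sum_congr rfl fun t _ => by
              rw [Finset.sum_comm]; exact Finset.sum_congr rfl fun ℓ _ => Finset.sum_comm
      _ = _ := Finset.sum_congr rfl fun a _ => Finset.sum_congr rfl fun b _ => by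
          rw [Finset.sum_comm]; exact Finset.sum_congr rfl fun ℓ _ => Finset.sum_comm
  rw [hsw]
  refine Finset.sum_congr rfl fun a _ => Finset.sum_congr rfl fun b _ =>
    Finset.sum_congr rfl fun ℓ _ => Finset.sum_congr rfl fun ℓ' _ => ?_
  refine Finset.sum_congr rfl fun t _ => Finset.sum_congr rfl fun z _ => ?_
  ring

theorem sum_sq_mul (k : Fin K) (u : Fin (m.p k) → ℝ) (f : OtherIndex m.p k → ℝ) :
    ∑ x : Fin (m.p k) × OtherIndex m.p k, (u x.1 * f x.2) ^ 2 = (u ⬝ᵥ u) * ∑ ℓ, f ℓ ^ 2 := by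
  rw [Fintype.sum_prod_type, dotProduct, Finset.sum_mul_sum]
  exact Finset.sum_congr rfl fun a _ => Finset.sum_congr rfl fun ℓ _ => by ring

/-- Schur test for the summable correlations. With `‖W‖² = p₋ₖ` for the identity the bound is `C₁ /
p_k`; for orthonormal `W` with boundedly many columns it is of order `1 / p`, the origin of that
term in the rate. -/
theorem meanGram_bilinear_le {C₁ : ℝ}
    (hcorr : ∀ x t, ∑ y, ∑ u, |∫ w, m.noise τ x t w * m.noise τ y u w ∂m.P| ≤ C₁) (hC₁ : 0 ≤ C₁)
    (k : Fin K) {q : Type*} [Fintype q] (W : Matrix (OtherIndex m.p k) q ℝ)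
    (u v : Fin (m.p k) → ℝ) :
    u ⬝ᵥ (m.meanGram τ k (W * Wᵀ) *ᵥ v) ≤
      (C₁ * ‖W‖ ^ 2 / m.pTot) * ((u ⬝ᵥ u + v ⬝ᵥ v) / 2) := by
  rw [meanGram_bilinear]
  have hrow : ∀ (t : m.Time) (x : Fin (m.p k) × OtherIndex m.p k),
      ∑ y : Fin (m.p k) × OtherIndex m.p k, |∫ w, m.noise τ (m.siteAt k x.1 x.2) t w *
        m.noise τ (m.siteAt k y.1 y.2) t w ∂m.P| ≤ C₁ := fun t x => by
    refine le_trans ?_ (hcorr (m.siteAt k x.1 x.2) t)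
    rw [sum_site k, Fintype.sum_prod_type]
    exact Finset.sum_le_sum fun a _ => Finset.sum_le_sum fun ℓ _ =>
      Finset.single_le_sum (f := fun u => |∫ w, m.noise τ (m.siteAt k x.1 x.2) t w *
        m.noise τ (m.siteAt k a ℓ) u w ∂m.P|) (fun _ _ => abs_nonneg _) (Finset.mem_univ t)
  have hterm : ∀ t z, ∑ x : Fin (m.p k) × OtherIndex m.p k,
      ∑ y : Fin (m.p k) × OtherIndex m.p k, u x.1 * W x.2 z * (v y.1 * W y.2 z) *
        ∫ w, m.noise τ (m.siteAt k x.1 x.2) t w * m.noise τ (m.siteAt k y.1 y.2) t w ∂m.P ≤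
      C₁ * ((u ⬝ᵥ u + v ⬝ᵥ v) / 2) * ∑ ℓ, W ℓ z ^ 2 := fun t z => by
    refine (le_abs_self _).trans ((sum_sum_bilinear_le _ _ _
      (fun x y => by simp_rw [mul_comm]) (hrow t)).trans (le_of_eq ?_))
    rw [sum_sq_mul k u fun ℓ => W ℓ z, sum_sq_mul k v fun ℓ => W ℓ z]
    ring
  have hnp := m.n_mul_pTot_nonneg
  have hD : 0 ≤ (u ⬝ᵥ u + v ⬝ᵥ v) / 2 := by
    have := dotProduct_self_nonneg' u
    have := dotProduct_self_nonneg' v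
    positivity
  calc _ ≤ (m.n * m.pTot)⁻¹ * ∑ _t : m.Time, ∑ z,
        C₁ * ((u ⬝ᵥ u + v ⬝ᵥ v) / 2) * ∑ ℓ, W ℓ z ^ 2 :=
        mul_le_mul_of_nonneg_left (Finset.sum_le_sum fun t _ => Finset.sum_le_sum fun z _ =>
          hterm t z) (by positivity)
    _ = (m.n * m.pTot)⁻¹ * (m.n * (C₁ * ((u ⬝ᵥ u + v ⬝ᵥ v) / 2) * ‖W‖ ^ 2)) := by
        rw [Finset.sum_const, Finset.card_univ, card_time, nsmul_eq_mul, ← Finset.mul_sum,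
          frobenius_sq, Finset.sum_comm]
    _ = ((m.n : ℝ) / m.n) * ((C₁ * ‖W‖ ^ 2 / m.pTot) * ((u ⬝ᵥ u + v ⬝ᵥ v) / 2)) := by
        rw [mul_inv]; ring
    _ ≤ _ := by
        have := m.pTot_nonneg
        exact mul_le_of_le_one_left (by positivity) (div_self_le_one _)

theorem meanGram_transpose (k : Fin K) {Θ : Matrix (OtherIndex m.p k) (OtherIndex m.p k) ℝ}
    (hΘ : Θᵀ = Θ) : (m.meanGram τ k Θ)ᵀ = m.meanGram τ k Θ := by
  have h1 : ∀ ℓ ℓ', Θ ℓ' ℓ = Θ ℓ ℓ' := fun ℓ ℓ' => congrFun (congrFun hΘ ℓ) ℓ'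
  ext a b
  rw [Matrix.transpose_apply, meanGram, Matrix.of_apply, Matrix.of_apply, Finset.sum_comm]
  simp_rw [h1]
  simp_rw [fun ℓ ℓ' t w => mul_comm (m.noise τ (m.siteAt k b ℓ) t w)
    (m.noise τ (m.siteAt k a ℓ') t w)]

end

end TensorFactorModel

theorem inv_sq_mul_le {x y z : ℝ} (hxy : y ≤ x ^ 2 * z) (hz : 0 ≤ z) : x⁻¹ ^ 2 * y ≤ z := by
  rcases eq_or_ne x 0 with rfl | hx
  · simpa using hz
  · rw [inv_pow, inv_mul_le_iff₀ (by positivity)]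
    exact hxy

namespace TensorFactorModel

noncomputable section

open scoped Matrix Matrix.Norms.Frobenius Kronecker

variable {K : ℕ} {r : Fin K → ℕ} {Ω : Type*} [mΩ : MeasurableSpace Ω]
  {m : TensorFactorModel K r Ω} {ε ω τ c₀ : ℝ}

/-! ### Second moments of the stacked noise -/

theorem noiseMat_mul_apply {k : Fin K} {q : Type*} [Fintype q] (Z : Matrix q (m.Time × OtherIndex m.p k) ℝ)
    (w : Ω) (a : Fin (m.p k)) (j : q) :
    (m.noiseMat τ k w * Zᵀ) a j = ∑ x : m.Time × OtherIndex m.p k,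
      ((Real.sqrt (m.n * m.pTot))⁻¹ * Z j x) * m.noise τ (m.siteAt k a x.2) x.1 w := by
  rw [Matrix.mul_apply]
  refine Finset.sum_congr rfl fun x _ => ?_
  rw [noiseMat, stackUnfold_apply, Matrix.transpose_apply]
  ring

namespace NoiseSetup

variable (h : m.NoiseSetup ε ω τ)
include h

/-- The quadratic form is a nonnegative multiple of a sum of second moments of linear combinations
of the noise. -/
theorem meanGram_nonneg (k : Fin K) {q : Type*} [Fintype q] (W : Matrix (OtherIndex m.p k) q ℝ)
    (u : Fin (m.p k) → ℝ) : 0 ≤ u ⬝ᵥ (m.meanGram τ k (W * Wᵀ) *ᵥ u) := by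
  rw [meanGram_bilinear]
  refine mul_nonneg (inv_nonneg.2 n_mul_pTot_nonneg) (Finset.sum_nonneg fun t _ =>
    Finset.sum_nonneg fun z _ => ?_)
  have hmul : ∀ x y : Fin (m.p k) × OtherIndex m.p k, ∀ w,
      u x.1 * W x.2 z * m.noise τ (m.siteAt k x.1 x.2) t w *
        (u y.1 * W y.2 z * m.noise τ (m.siteAt k y.1 y.2) t w) =
      u x.1 * W x.2 z * (u y.1 * W y.2 z) *
        (m.noise τ (m.siteAt k x.1 x.2) t w * m.noise τ (m.siteAt k y.1 y.2) t w) :=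
    fun x y w => by ring
  have h1 := integral_sq_sum_eq (P := m.P) (fun (x : Fin (m.p k) × OtherIndex m.p k) w =>
    u x.1 * W x.2 z * m.noise τ (m.siteAt k x.1 x.2) t w) fun x y => by
      simp_rw [hmul]; exact (h.integrable_mul _ _ _ _).const_mul _
  simp_rw [hmul, integral_const_mul] at h1
  rw [← h1]
  exact integral_nonneg fun w => sq_nonneg _

theorem integrable_sq_linear {ι : Type*} [Fintype ι] (g : ι → m.Site × m.Time) (W : ι → ℝ) :
    Integrable (fun w => (∑ i, W i * m.noise τ (g i).1 (g i).2 w) ^ 2) m.P :=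
  integrable_sq_sum _ fun i j => by
    have : ∀ w, W i * m.noise τ (g i).1 (g i).2 w * (W j * m.noise τ (g j).1 (g j).2 w) =
      W i * W j * (m.noise τ (g i).1 (g i).2 w * m.noise τ (g j).1 (g j).2 w) := fun w => by ring
    simp_rw [this]
    exact (h.integrable_mul _ _ _ _).const_mul _

theorem integrable_sq_linear_cov {ι : Type*} [Fintype ι] (g : ι → m.Site × m.Site) (W : ι → ℝ) :
    Integrable (fun w => (∑ i, W i * m.noiseCov τ (g i).1 (g i).2 w) ^ 2) m.P :=
  integrable_sq_sum _ fun i j => by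
    have : ∀ w, W i * m.noiseCov τ (g i).1 (g i).2 w * (W j * m.noiseCov τ (g j).1 (g j).2 w) =
      W i * W j * (m.noiseCov τ (g i).1 (g i).2 w * m.noiseCov τ (g j).1 (g j).2 w) :=
      fun w => by ring
    simp_rw [this]
    exact (h.integrable_noiseCov_mul _ _ _ _).const_mul _

theorem integrable_sq_noise (x : m.Site) (t : m.Time) :
    Integrable (fun w => m.noise τ x t w ^ 2) m.P := by
  simp_rw [sq]
  exact h.integrable_mul x x t t

theorem integrable_frobenius_noiseMat (k : Fin K) :
    Integrable (fun w => ‖m.noiseMat τ k w‖ ^ 2) m.P := by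
  unfold noiseMat
  simp_rw [frobenius_sq_stackUnfold]
  exact (integrable_finsetSum _ fun t _ => integrable_finsetSum _ fun x _ =>
    h.integrable_sq_noise x t).const_mul _

theorem integral_frobenius_noiseMat_le (k : Fin K) :
    ∫ w, ‖m.noiseMat τ k w‖ ^ 2 ∂m.P ≤ 2 * ω ^ 2 := by
  unfold noiseMat
  simp_rw [frobenius_sq_stackUnfold]
  rw [integral_const_mul, integral_finsetSum _ fun t _ => integrable_finsetSum _ fun x _ =>
    h.integrable_sq_noise x t]
  simp_rw [fun t => integral_finsetSum (μ := m.P) (Finset.univ : Finset m.Site)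
    fun x _ => h.integrable_sq_noise x t]
  have hnp := m.n_mul_pTot_nonneg
  calc _ ≤ (m.n * m.pTot)⁻¹ * ∑ _t : m.Time, ∑ _x : m.Site, 2 * ω ^ 2 :=
        mul_le_mul_of_nonneg_left (Finset.sum_le_sum fun t _ => Finset.sum_le_sum fun x _ =>
          h.integral_sq_noise_le x t) (by positivity)
    _ = (m.n * m.pTot)⁻¹ * (m.n * m.pTot) * (2 * ω ^ 2) := by
        simp only [Finset.sum_const, Finset.card_univ, nsmul_eq_mul, card_site, card_time]
        ring
    _ ≤ _ := mul_le_of_le_one_left (by positivity) (inv_mul_le_one)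

variable {k : Fin K} {C₁ ν φ χ : ℝ}

theorem integral_sq_linear_le
    (hcorr : ∀ x t, ∑ y, ∑ u, |∫ w, m.noise τ x t w * m.noise τ y u w ∂m.P| ≤ C₁)
    {ι : Type*} [Fintype ι] (g : ι → m.Site × m.Time) (hg : Function.Injective g) (W : ι → ℝ) :
    ∫ w, (∑ i, W i * m.noise τ (g i).1 (g i).2 w) ^ 2 ∂m.P ≤ C₁ * ∑ i, W i ^ 2 := by
  refine integral_sq_sum_le W (fun i => m.noise τ (g i).1 (g i).2)
    (fun i j => h.integrable_mul _ _ _ _) fun i => ?_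
  refine le_trans ?_ (hcorr (g i).1 (g i).2)
  rw [← Fintype.sum_prod_type fun y : m.Site × m.Time =>
    |∫ w, m.noise τ (g i).1 (g i).2 w * m.noise τ y.1 y.2 w ∂m.P|]
  refine (Finset.sum_map Finset.univ ⟨g, hg⟩ fun y : m.Site × m.Time =>
    |∫ w, m.noise τ (g i).1 (g i).2 w * m.noise τ y.1 y.2 w ∂m.P|).symm.le.trans ?_
  exact Finset.sum_le_sum_of_subset_of_nonneg (Finset.subset_univ _) fun _ _ _ => abs_nonneg _

theorem integrable_frobenius_noiseMat_mul {q : Type*} [Fintype q]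
    (Z : Matrix q (m.Time × OtherIndex m.p k) ℝ) :
    Integrable (fun w => ‖m.noiseMat τ k w * Zᵀ‖ ^ 2) m.P := by
  simp_rw [frobenius_sq, noiseMat_mul_apply]
  exact integrable_finsetSum _ fun a _ => integrable_finsetSum _ fun j _ =>
    h.integrable_sq_linear (fun x : m.Time × OtherIndex m.p k => (m.siteAt k a x.2, x.1)) _

/-- Every entry is a linear statistic of variance `O(1 / (n p))`, and there are `p_k` rows, which
gives the parametric order `1 / (n p₋ₖ)`. -/
theorem integral_frobenius_noiseMat_mul_le
    (hcorr : ∀ x t, ∑ y, ∑ u, |∫ w, m.noise τ x t w * m.noise τ y u w ∂m.P| ≤ C₁)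
    {q : Type*} [Fintype q] (Z : Matrix q (m.Time × OtherIndex m.p k) ℝ) :
    ∫ w, ‖m.noiseMat τ k w * Zᵀ‖ ^ 2 ∂m.P ≤ m.p k * (m.n * m.pTot)⁻¹ * (C₁ * ‖Z‖ ^ 2) := by
  have hint := fun (a : Fin (m.p k)) (j : q) => h.integrable_sq_linear
    (fun x : m.Time × OtherIndex m.p k => (m.siteAt k a x.2, x.1))
    (fun x => (Real.sqrt (m.n * m.pTot))⁻¹ * Z j x)
  simp_rw [frobenius_sq (_ * _), noiseMat_mul_apply]
  rw [integral_finsetSum _ fun a _ => integrable_finsetSum _ fun j _ => hint a j]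
  simp_rw [fun a => integral_finsetSum (μ := m.P) (Finset.univ : Finset q) fun j _ => hint a j]
  have hterm : ∀ (a : Fin (m.p k)) (j : q),
      ∫ w, (∑ x : m.Time × OtherIndex m.p k, ((Real.sqrt (m.n * m.pTot))⁻¹ * Z j x) *
        m.noise τ (m.siteAt k a x.2) x.1 w) ^ 2 ∂m.P ≤
      (m.n * m.pTot)⁻¹ * (C₁ * ∑ x, Z j x ^ 2) := fun a j => by
    refine (h.integral_sq_linear_le hcorr
      (fun x : m.Time × OtherIndex m.p k => (m.siteAt k a x.2, x.1)) ?_ _).trans (le_of_eq ?_)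
    · intro x y hxy
      rw [Prod.mk.injEq, siteAt_injective] at hxy
      exact Prod.ext hxy.2 hxy.1.2
    · simp_rw [mul_pow]
      rw [← Finset.mul_sum, sq, inv_sqrt_mul_inv_sqrt n_mul_pTot_nonneg]
      ring
  refine (Finset.sum_le_sum fun a _ => Finset.sum_le_sum fun j _ => hterm a j).trans (le_of_eq ?_)
  rw [Finset.sum_const, Finset.card_univ, Fintype.card_fin, nsmul_eq_mul, ← Finset.mul_sum,
    ← Finset.mul_sum, ← frobenius_sq]
  ring

end NoiseSetup

/-- Sum of the squares of all time averages of products of noise variables and entries of `Z`. -/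
def crossStat (m : TensorFactorModel K r Ω) (τ : ℝ) (k : Fin K) {q : Type*} [Fintype q]
    (Z : Matrix q (m.Time × OtherIndex m.p k) ℝ) (w : Ω) : ℝ :=
  ∑ a, ∑ j, ∑ ℓ, ∑ ℓ', (∑ t, ((Real.sqrt (m.n * m.pTot))⁻¹ * Z j (t, ℓ')) *
    m.noise τ (m.siteAt k a ℓ) t w) ^ 2

/-- The decoupling for the cross term: again Cauchy–Schwarz in `Θ` at a fixed sample point. The
price is that `crossStat` has mean of order `1 / n` instead of `1 / (n p₋ₖ)`. -/
theorem frobenius_noiseMat_mul_kronecker_le (k : Fin K) {q : Type*} [Fintype q]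
    (Z : Matrix q (m.Time × OtherIndex m.p k) ℝ)
    (Θ : Matrix (OtherIndex m.p k) (OtherIndex m.p k) ℝ) (w : Ω) :
    ‖m.noiseMat τ k w * ((1 : Matrix m.Time m.Time ℝ) ⊗ₖ Θ) * Zᵀ‖ ^ 2 ≤
      ‖Θ‖ ^ 2 * m.crossStat τ k Z w := by
  have hN : m.noiseMat τ k w = stack fun t => Matrix.of fun a ℓ =>
      (Real.sqrt (m.n * m.pTot))⁻¹ * m.noise τ (m.siteAt k a ℓ) t w := rfl
  have hZ : Z = stack fun t => Matrix.of fun j ℓ => Z j (t, ℓ) := by ext j ⟨t, ℓ⟩; rfl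
  have hentry : ∀ a j, (m.noiseMat τ k w * ((1 : Matrix m.Time m.Time ℝ) ⊗ₖ Θ) * Zᵀ) a j =
      ∑ i : OtherIndex m.p k × OtherIndex m.p k, Θ i.1 i.2 *
        ∑ t, ((Real.sqrt (m.n * m.pTot))⁻¹ * Z j (t, i.2)) *
          m.noise τ (m.siteAt k a i.1) t w := fun a j => by
    conv_lhs => rw [hN, hZ, stack_mul_kronecker, stack_mul_transpose]
    simp only [Matrix.sum_apply, Matrix.mul_apply, Matrix.of_apply, Matrix.transpose_apply,
      Fintype.sum_prod_type, Finset.mul_sum, Finset.sum_mul]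
    rw [Finset.sum_comm]
    rw [Finset.sum_comm (γ := OtherIndex m.p k)]
    simp_rw [Finset.sum_comm (s := (Finset.univ : Finset m.Time))]
    rw [Finset.sum_comm]
    refine Finset.sum_congr rfl fun ℓ _ => Finset.sum_congr rfl fun ℓ' _ =>
      Finset.sum_congr rfl fun t _ => ?_
    ring
  rw [frobenius_sq, crossStat]
  simp_rw [hentry]
  rw [Finset.mul_sum]
  refine Finset.sum_le_sum fun a _ => ?_
  rw [Finset.mul_sum]
  refine Finset.sum_le_sum fun j _ => ?_
  have := Finset.sum_mul_sq_le_sq_mul_sq Finset.univ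
    (fun i : OtherIndex m.p k × OtherIndex m.p k => Θ i.1 i.2)
    (fun i => ∑ t, ((Real.sqrt (m.n * m.pTot))⁻¹ * Z j (t, i.2)) *
          m.noise τ (m.siteAt k a i.1) t w)
  rw [frobenius_sq]
  simpa only [Fintype.sum_prod_type] using this

namespace NoiseSetup

variable (h : m.NoiseSetup ε ω τ)
include h

variable {k : Fin K} {C₁ ν φ χ : ℝ}

theorem integrable_crossStat {q : Type*} [Fintype q]
    (Z : Matrix q (m.Time × OtherIndex m.p k) ℝ) : Integrable (m.crossStat τ k Z) m.P :=
  integrable_finsetSum _ fun a _ => integrable_finsetSum _ fun _ _ =>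
    integrable_finsetSum _ fun ℓ _ => integrable_finsetSum _ fun _ _ =>
      h.integrable_sq_linear (fun t : m.Time => (m.siteAt k a ℓ, t)) _

theorem integral_crossStat_le
    (hcorr : ∀ x t, ∑ y, ∑ u, |∫ w, m.noise τ x t w * m.noise τ y u w ∂m.P| ≤ C₁)
    {q : Type*} [Fintype q] (Z : Matrix q (m.Time × OtherIndex m.p k) ℝ) :
    ∫ w, m.crossStat τ k Z w ∂m.P ≤ m.pTot * (m.n * m.pTot)⁻¹ * (C₁ * ‖Z‖ ^ 2) := by
  have hint := fun (a : Fin (m.p k)) (j : q) (ℓ ℓ' : OtherIndex m.p k) => h.integrable_sq_linear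
    (fun t : m.Time => (m.siteAt k a ℓ, t))
    (fun t => (Real.sqrt (m.n * m.pTot))⁻¹ * Z j (t, ℓ'))
  unfold crossStat
  rw [integral_finsetSum _ fun a _ => integrable_finsetSum _ fun j _ =>
    integrable_finsetSum _ fun ℓ _ => integrable_finsetSum _ fun ℓ' _ => hint a j ℓ ℓ']
  have hterm : ∀ (a : Fin (m.p k)) (j : q) (ℓ ℓ' : OtherIndex m.p k),
      ∫ w, (∑ t, ((Real.sqrt (m.n * m.pTot))⁻¹ * Z j (t, ℓ')) *
        m.noise τ (m.siteAt k a ℓ) t w) ^ 2 ∂m.P ≤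
      (m.n * m.pTot)⁻¹ * (C₁ * ∑ t, Z j (t, ℓ') ^ 2) := fun a j ℓ ℓ' => by
    refine (h.integral_sq_linear_le hcorr
      (fun t : m.Time => (m.siteAt k a ℓ, t)) ?_
      (fun t => (Real.sqrt (m.n * m.pTot))⁻¹ * Z j (t, ℓ'))).trans (le_of_eq ?_)
    · intro x y hxy
      exact (Prod.mk.inj hxy).2
    · simp_rw [mul_pow]
      rw [← Finset.mul_sum, sq, inv_sqrt_mul_inv_sqrt n_mul_pTot_nonneg]
      ring
  have hsum : ∀ a, ∫ w, ∑ j, ∑ ℓ, ∑ ℓ', (∑ t, ((Real.sqrt (m.n * m.pTot))⁻¹ * Z j (t, ℓ')) *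
        m.noise τ (m.siteAt k a ℓ) t w) ^ 2 ∂m.P ≤
      ∑ j, ∑ _ℓ : OtherIndex m.p k, ∑ ℓ',
        (m.n * m.pTot)⁻¹ * (C₁ * ∑ t, Z j (t, ℓ') ^ 2) := fun a => by
    rw [integral_finsetSum _ fun j _ =>
      integrable_finsetSum _ fun ℓ _ => integrable_finsetSum _ fun ℓ' _ => hint a j ℓ ℓ']
    refine Finset.sum_le_sum fun j _ => ?_
    rw [integral_finsetSum _ fun ℓ _ => integrable_finsetSum _ fun ℓ' _ => hint a j ℓ ℓ']
    refine Finset.sum_le_sum fun ℓ _ => ?_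
    rw [integral_finsetSum _ fun ℓ' _ => hint a j ℓ ℓ']
    exact Finset.sum_le_sum fun ℓ' _ => hterm a j ℓ ℓ'
  refine (Finset.sum_le_sum fun a _ => hsum a).trans (le_of_eq ?_)
  have hZ : ‖Z‖ ^ 2 = ∑ j, ∑ ℓ', ∑ t, Z j (t, ℓ') ^ 2 := by
    rw [frobenius_sq]
    exact Finset.sum_congr rfl fun j _ => Fintype.sum_prod_type_right _
  simp only [← Finset.mul_sum, Finset.sum_const, Finset.card_univ, nsmul_eq_mul]
  rw [← hZ, Fintype.card_fin, card_otherIndex, pTot_eq k]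
  ring

theorem integrable_frobenius_fluctGram (Θ : Matrix (OtherIndex m.p k) (OtherIndex m.p k) ℝ) :
    Integrable (fun w => ‖m.fluctGram τ k Θ w‖ ^ 2) m.P := by
  simp_rw [frobenius_sq, fluctGram, Matrix.of_apply, mul_pow]
  refine integrable_finsetSum _ fun a _ => integrable_finsetSum _ fun b _ =>
    Integrable.const_mul ?_ _
  have := h.integrable_sq_linear_cov (fun i : OtherIndex m.p k × OtherIndex m.p k =>
    (m.siteAt k a i.1, m.siteAt k b i.2)) (fun i => Θ i.1 i.2)
  simpa only [Fintype.sum_prod_type] using this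

theorem integral_frobenius_fluctGram (Θ : Matrix (OtherIndex m.p k) (OtherIndex m.p k) ℝ) :
    ∫ w, ‖m.fluctGram τ k Θ w‖ ^ 2 ∂m.P = ((m.n * m.pTot)⁻¹) ^ 2 *
      ∑ a, ∑ b, ∫ w, (∑ ℓ, ∑ ℓ', Θ ℓ ℓ' *
        m.noiseCov τ (m.siteAt k a ℓ) (m.siteAt k b ℓ') w) ^ 2 ∂m.P := by
  have hint : ∀ a b, Integrable (fun w => (∑ ℓ, ∑ ℓ', Θ ℓ ℓ' *
        m.noiseCov τ (m.siteAt k a ℓ) (m.siteAt k b ℓ') w) ^ 2) m.P := fun a b => by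
    have := h.integrable_sq_linear_cov (fun i : OtherIndex m.p k × OtherIndex m.p k =>
      (m.siteAt k a i.1, m.siteAt k b i.2)) (fun i => Θ i.1 i.2)
    simpa only [Fintype.sum_prod_type] using this
  simp_rw [frobenius_sq, fluctGram, Matrix.of_apply, mul_pow, ← Finset.mul_sum]
  rw [integral_const_mul, integral_finsetSum _ fun a _ => integrable_finsetSum _ fun b _ => hint a b]
  simp_rw [fun a => integral_finsetSum (μ := m.P) (Finset.univ : Finset (Fin (m.p k)))
    fun b _ => hint a b]

theorem integrable_covStat : Integrable (m.covStat τ) m.P :=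
  (integrable_finsetSum _ fun x _ => integrable_finsetSum _ fun y _ => by
    simp_rw [sq]; exact h.integrable_noiseCov_mul x y x y).const_mul _

theorem integral_covStat_le (hb : m.NoiseBounds τ k C₁ ν φ χ) :
    ∫ w, m.covStat τ w ∂m.P ≤ χ ^ 2 := by
  have hint : ∀ x y, Integrable (fun w => m.noiseCov τ x y w ^ 2) m.P := fun x y => by
    simp_rw [sq]; exact h.integrable_noiseCov_mul x y x y
  unfold covStat
  rw [integral_const_mul, integral_finsetSum _ fun a _ => integrable_finsetSum _ fun b _ => hint a b]
  simp_rw [fun a => integral_finsetSum (μ := m.P) (Finset.univ : Finset m.Site)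
    fun b _ => hint a b]
  exact inv_sq_mul_le hb.cov_all (sq_nonneg _)

theorem integral_frobenius_fluctGram_one_le (hb : m.NoiseBounds τ k C₁ ν φ χ) :
    ∫ w, ‖m.fluctGram τ k 1 w‖ ^ 2 ∂m.P ≤ ν ^ 2 := by
  rw [h.integral_frobenius_fluctGram]
  exact inv_sq_mul_le hb.cov_one (sq_nonneg _)

theorem integral_frobenius_fluctGram_proj_le (hb : m.NoiseBounds τ k C₁ ν φ χ)
    {W : Matrix (OtherIndex m.p k) (OtherIndex r k) ℝ} (hW : Wᵀ * W = 1) :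
    ∫ w, ‖m.fluctGram τ k (W * Wᵀ) w‖ ^ 2 ∂m.P ≤ φ ^ 2 := by
  rw [h.integral_frobenius_fluctGram]
  exact inv_sq_mul_le (hb.cov_proj W hW) (sq_nonneg _)

theorem frobenius_biasMat_le (k : Fin K) : ‖m.biasMat τ k‖ ≤ biasBound ε ω τ := by
  have hτ := h.τ_pos
  have hω := h.ω_pos
  have hb : 0 ≤ biasBound ε ω τ := by unfold biasBound; positivity
  refine abs_le_of_sq_le_sq' ?_ hb |>.2
  rw [biasMat, frobenius_sq_stackUnfold]
  have hnp := m.n_mul_pTot_nonneg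
  calc _ ≤ (m.n * m.pTot)⁻¹ * ∑ _t : m.Time, ∑ _x : m.Site, biasBound ε ω τ ^ 2 :=
        mul_le_mul_of_nonneg_left (Finset.sum_le_sum fun t _ => Finset.sum_le_sum fun x _ => by
          rw [← sq_abs]; exact pow_le_pow_left₀ (abs_nonneg _) (h.abs_bias_le x t) 2) (by positivity)
    _ = (m.n * m.pTot)⁻¹ * (m.n * m.pTot) * biasBound ε ω τ ^ 2 := by
        simp only [Finset.sum_const, Finset.card_univ, nsmul_eq_mul, card_site, card_time]
        ring
    _ ≤ _ := mul_le_of_le_one_left (by positivity) (inv_mul_le_one)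

end NoiseSetup

end

end TensorFactorModel

namespace TensorFactorModel

noncomputable section

open scoped Matrix Matrix.Norms.Frobenius Kronecker

variable {K : ℕ} {r : Fin K → ℕ} {Ω : Type*} [mΩ : MeasurableSpace Ω]
  {m : TensorFactorModel K r Ω} {ε ω τ : ℝ}

/-! ### The factor structure of the stacked data -/

theorem loadMat_orthonormal {lam : ℝ} (hload : m.LoadingAssumption lam) (k : Fin K) :
    (m.loadMat k)ᵀ * m.loadMat k = 1 := by
  rw [loadMat, Matrix.transpose_smul, Matrix.smul_mul, Matrix.mul_smul, smul_smul,
    inv_sqrt_mul_inv_sqrt (Nat.cast_nonneg _)]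
  exact (hload k).1

theorem smul_loadMat (hp : ∀ k, 0 < m.p k) (k : Fin K) :
    Real.sqrt (m.p k) • m.loadMat k = m.Λ k := by
  have : (0 : ℝ) < m.p k := Nat.cast_pos.2 (hp k)
  rw [loadMat, smul_smul, mul_inv_cancel₀ (Real.sqrt_pos.2 this).ne', one_smul]

theorem sqrt_n_mul_pTot (k : Fin K) : Real.sqrt (m.n * m.pTot) =
    Real.sqrt m.n * (Real.sqrt (m.p k) * ∏ l : {l : Fin K // l ≠ k}, Real.sqrt (m.p l)) := by
  rw [pTot_eq k, Real.sqrt_mul (Nat.cast_nonneg _), Real.sqrt_mul (Nat.cast_nonneg _)]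
  congr 2
  rw [dimProdExcept, prod_subtype_ne_eq k fun l => Real.sqrt (m.p l)]
  push_cast
  exact Real.sqrt_eq_iff_eq_sq (Finset.prod_nonneg fun _ _ => Nat.cast_nonneg _)
    (Finset.prod_nonneg fun _ _ => Real.sqrt_nonneg _) |>.2 (by
      rw [← Finset.prod_pow]
      exact Finset.prod_congr rfl fun l _ => (Real.sq_sqrt (Nat.cast_nonneg _)).symm)

theorem pTot_pos (hp : ∀ k, 0 < m.p k) : 0 < m.pTot := by
  unfold pTot dimProd
  exact Nat.cast_pos.2 (Finset.prod_pos fun l _ => hp l)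

theorem stackUnfold_tucker (hp : ∀ k, 0 < m.p k) (hn : 0 < m.n) (k : Fin K) :
    (m.stackUnfold k fun t => tucker (m.F t) m.Λ) = m.loadMat k * m.factorMat k := by
  have hk : (0 : ℝ) < m.p k := Nat.cast_pos.2 (hp k)
  have hnR : (0 : ℝ) < m.n := Nat.cast_pos.2 hn
  have hΛ : m.Λ = fun l => Real.sqrt (m.p l) • m.loadMat l := funext fun l => (smul_loadMat hp l).symm
  set c : ℝ := ∏ l : {l : Fin K // l ≠ k}, Real.sqrt (m.p l) with hc
  have hc0 : 0 < c := Finset.prod_pos fun l _ => Real.sqrt_pos.2 (Nat.cast_pos.2 (hp l))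
  have hunf : ∀ t : m.Time, matUnfold k (tucker (m.F t) m.Λ) = (Real.sqrt (m.p k) * c) •
      (m.loadMat k * (matUnfold k (m.F t) * (kronExcept k m.loadMat)ᵀ)) := fun t => by
    rw [matUnfold_tucker]
    conv_lhs => rw [hΛ]
    rw [kronExcept_smul, Matrix.transpose_smul, Matrix.smul_mul, Matrix.smul_mul, Matrix.mul_smul,
      smul_smul, Matrix.mul_assoc]
  unfold stackUnfold factorMat
  simp_rw [hunf]
  rw [Matrix.mul_smul, mul_stack, sqrt_n_mul_pTot k, ← hc]
  ext a x
  simp only [Matrix.smul_apply, stack, Matrix.of_apply, smul_eq_mul]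
  have h1 := (Real.sqrt_pos.2 hk).ne'
  have h2 := (Real.sqrt_pos.2 hnR).ne'
  field_simp

theorem dataMat_eq (hp : ∀ k, 0 < m.p k) (hn : 0 < m.n) (k : Fin K) (w : Ω) :
    m.dataMat τ k w =
      m.loadMat k * m.factorMat k + (m.biasMat τ k + m.noiseMat τ k w) := by
  rw [← stackUnfold_tucker hp hn]
  ext a x
  simp only [dataMat, biasMat, noiseMat, stackUnfold_apply, Matrix.add_apply, ← mul_add]
  congr 1
  simp only [Xtrunc, X, noise, rawNoise]
  ring

theorem sum_time {β : Type*} [AddCommMonoid β] (f : ℕ → β) :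
    ∑ t : m.Time, f t = ∑ t ∈ Finset.Icc 1 m.n, f t :=
  Finset.sum_coe_sort (Finset.Icc 1 m.n) f

theorem p_mul_inv (hp : ∀ k, 0 < m.p k) (k : Fin K) :
    (m.p k : ℝ) * (m.n * m.pTot)⁻¹ = (m.np k)⁻¹ := by
  have hk : (m.p k : ℝ) ≠ 0 := Nat.cast_ne_zero.2 (hp k).ne'
  rw [pTot_eq k, np, mul_inv, mul_inv, mul_inv]
  field_simp

theorem gammaCheck_eq (hp : ∀ k, 0 < m.p k) (k : Fin K)
    (E : ∀ l, Matrix (Fin (m.p l)) (Fin (r l)) ℝ) (w : Ω) :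
    m.gammaCheck τ k E w = (m.p k : ℝ) • (m.dataMat τ k w *
      ((1 : Matrix m.Time m.Time ℝ) ⊗ₖ (kronExcept k E * (kronExcept k E)ᵀ)) *
        (m.dataMat τ k w)ᵀ) := by
  unfold dataMat stackUnfold gammaCheck
  rw [Matrix.smul_mul, Matrix.transpose_smul, Matrix.smul_mul, Matrix.mul_smul, smul_smul,
    smul_smul, mul_assoc, inv_sqrt_mul_inv_sqrt n_mul_pTot_nonneg, stack_mul_kronecker,
    stack_mul_transpose, p_mul_inv hp, sum_time fun t => matUnfold k (m.Xtrunc τ t w) *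
      (kronExcept k E * (kronExcept k E)ᵀ) * (matUnfold k (m.Xtrunc τ t w))ᵀ]
  simp_rw [Matrix.mul_assoc]

theorem gammaHat_eq (hp : ∀ k, 0 < m.p k) (k : Fin K) (w : Ω) :
    m.gammaHat τ k w = (m.p k : ℝ) • (m.dataMat τ k w * (m.dataMat τ k w)ᵀ) := by
  unfold dataMat stackUnfold gammaHat
  rw [Matrix.smul_mul, Matrix.transpose_smul, Matrix.mul_smul, smul_smul,
    smul_smul, mul_assoc, inv_sqrt_mul_inv_sqrt n_mul_pTot_nonneg, stack_mul_transpose,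
    p_mul_inv hp, sum_time fun t => matUnfold k (m.Xtrunc τ t w) * (matUnfold k (m.Xtrunc τ t w))ᵀ]

theorem factorMat_mul_transpose (hU : ∀ l, (m.loadMat l)ᵀ * m.loadMat l = 1) (k : Fin K) :
    m.factorMat k * (m.factorMat k)ᵀ = m.gammaF k := by
  unfold factorMat gammaF
  rw [Matrix.smul_mul, Matrix.transpose_smul, Matrix.mul_smul, smul_smul,
    inv_sqrt_mul_inv_sqrt (Nat.cast_nonneg _), stack_mul_transpose,
    ← sum_time fun t => matUnfold k (m.F t) * (matUnfold k (m.F t))ᵀ]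
  congr 1
  refine Finset.sum_congr rfl fun t _ => ?_
  rw [Matrix.transpose_mul, Matrix.transpose_transpose, Matrix.mul_assoc,
    ← Matrix.mul_assoc (kronExcept k m.loadMat)ᵀ, kronExcept_orthonormal k hU, Matrix.one_mul]

/-- The rows of the signal lie in the range of the oracle projection, so an estimated projection
loses signal only through its distance to the oracle. -/
theorem factorMat_mul_kronecker (hU : ∀ l, (m.loadMat l)ᵀ * m.loadMat l = 1) (k : Fin K) :
    m.factorMat k * ((1 : Matrix m.Time m.Time ℝ) ⊗ₖ
      (kronExcept k m.loadMat * (kronExcept k m.loadMat)ᵀ)) = m.factorMat k := by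
  unfold factorMat
  rw [Matrix.smul_mul, stack_mul_kronecker]
  congr 2
  funext t
  rw [Matrix.mul_assoc, ← Matrix.mul_assoc (kronExcept k m.loadMat)ᵀ, kronExcept_orthonormal k hU,
    Matrix.one_mul]

theorem frobenius_sq_factorMat_le {M : ℝ} (hU : ∀ l, (m.loadMat l)ᵀ * m.loadMat l = 1)
    (hmom : m.MomentAssumption ε ω M) (k : Fin K) : ‖m.factorMat k‖ ^ 2 ≤ ω ^ 2 := by
  rw [frobenius_sq_eq_trace', factorMat_mul_transpose hU, gammaF, Matrix.trace_smul,
    Matrix.trace_sum]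
  have h1 := hmom.2.1 2 (Or.inr (Or.inl rfl))
  simp only [Real.rpow_two] at h1
  refine le_trans (le_of_eq ?_) h1
  rw [smul_eq_mul]
  congr 1
  refine Finset.sum_congr rfl fun t _ => ?_
  rw [← frobenius_sq_eq_trace', frobenius_sq_matUnfold, sq_tensorNorm]

theorem factorMat_form_ge {α β : ∀ k, Fin (r k) → ℝ}
    (hU : ∀ l, (m.loadMat l)ᵀ * m.loadMat l = 1) (hfac : m.FactorAssumption α β) {c : ℝ}
    (hc : ∀ k j, c ≤ α k j) (k : Fin K) (u : Fin (r k) → ℝ) :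
    c * (u ⬝ᵥ u) ≤ u ⬝ᵥ ((m.factorMat k * (m.factorMat k)ᵀ) *ᵥ u) := by
  rw [factorMat_mul_transpose hU]
  obtain ⟨hd, hj⟩ := hfac k
  rw [← hd.diagonal_diag]
  simp only [dotProduct, Matrix.mulVec_diagonal, Matrix.diag_apply, Finset.mul_sum]
  refine Finset.sum_le_sum fun j _ => ?_
  have := mul_le_mul_of_nonneg_right ((hc k j).trans (hj j).1) (mul_self_nonneg (u j))
  linarith

end

end TensorFactorModel

/-! ### Deterministic loss bounds for signal, bias and noise. -/

section Perturbation

open scoped Matrix Matrix.Norms.Frobenius Kronecker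

variable {d r : ℕ} {c : Type*} [Fintype c] [DecidableEq c]

theorem frobenius_le_of_orthonormal {m : Type*} [Fintype m] {E : Matrix m (Fin r) ℝ}
    (hE : Eᵀ * E = 1) : ‖E‖ ≤ r := by
  refine abs_le_of_sq_le_sq' ?_ (Nat.cast_nonneg _) |>.2
  rw [frobenius_sq_of_orthonormal hE, Fintype.card_fin]
  rcases Nat.eq_zero_or_pos r with rfl | h
  · simp
  · have : (1 : ℝ) ≤ r := by exact_mod_cast h
    nlinarith

/-- The hypotheses on the noise under which leading eigenvectors estimate `U` well. -/
structure NoiseSplit (G : Matrix (Fin r) c ℝ) (B N : Matrix (Fin d) c ℝ)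
    (Φ S₁ : Matrix (Fin d) (Fin d) ℝ) (σ b xN x₁ x₂ μ : ℝ) : Prop where
  gram : N * Nᵀ = Φ + S₁
  bias : ‖B‖ ≤ b
  norm : ‖N‖ ≤ xN
  cross : ‖N * Gᵀ‖ ≤ x₁
  fluct : ‖Φ‖ ≤ x₂
  mean : ∀ u v : Fin d → ℝ, u ⬝ᵥ (S₁ *ᵥ v) ≤ μ * ((u ⬝ᵥ u + v ⬝ᵥ v) / 2)
  mean_nonneg : ∀ u : Fin d → ℝ, 0 ≤ u ⬝ᵥ (S₁ *ᵥ u)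
  mean_symm : S₁ᵀ = S₁
  σ_pos : 0 < σ
  μ_nonneg : 0 ≤ μ
  signal : ∀ u, σ ^ 2 * (u ⬝ᵥ u) ≤ u ⬝ᵥ ((G * Gᵀ) *ᵥ u)
  small : 2 * b ^ 2 + 2 * (x₂ + μ) ≤ (σ / 4) ^ 2

namespace NoiseSplit

variable {G : Matrix (Fin r) c ℝ} {B N : Matrix (Fin d) c ℝ} {Φ S₁ : Matrix (Fin d) (Fin d) ℝ}
  {σ b xN x₁ x₂ μ : ℝ} (h : NoiseSplit G B N Φ S₁ σ b xN x₁ x₂ μ)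
include h

theorem form_ge {U : Matrix (Fin d) (Fin r) ℝ} (hU : Uᵀ * U = 1) {Q : Matrix c c ℝ} (hs : Qᵀ = Q)
    (hi : Q * Q = Q) (hQ : ‖G * (1 - Q)‖ ≤ σ / 4) (u : Fin r → ℝ) :
    σ ^ 2 / 4 * (u ⬝ᵥ u) ≤
      (U *ᵥ u) ⬝ᵥ (((U * G + (B + N)) * Q * (U * G + (B + N))ᵀ) *ᵥ (U *ᵥ u)) := by
  refine signal_form_ge hU G (B + N) hs hi h.signal hQ (fun v => ?_) u
  refine (noise_form_le B N hs hi h.bias (ν := x₂ + μ) (fun v => ?_) v).trans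
    (mul_le_mul_of_nonneg_right h.small (dotProduct_self_nonneg' v))
  rw [h.gram, Matrix.add_mulVec, dotProduct_add]
  have h1 := dotProduct_mulVec_le_frobenius Φ v
  have h2 := mul_le_mul_of_nonneg_right h.fluct (dotProduct_self_nonneg' v)
  have h3 := h.mean v v
  linarith

omit [DecidableEq c] in
theorem mean_mul_le {E : Matrix (Fin d) (Fin r) ℝ} (hE : Eᵀ * E = 1) : ‖S₁ * E‖ ≤ μ * r := by
  have h1 := frobenius_sq_mul_le S₁ E (mulVec_sq_le_of_bilinear S₁ h.μ_nonneg h.mean)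
  rw [← mul_pow] at h1
  refine (abs_le_of_sq_le_sq' h1 (mul_nonneg h.μ_nonneg (norm_nonneg _))).2.trans
    (mul_le_mul_of_nonneg_left (frobenius_le_of_orthonormal hE) h.μ_nonneg)

/-- Loss relative to the true loadings. The bound contains the mean `μ` of the noise Gram matrix, so
it serves only to show that the projection of the first iteration keeps the signal. -/
theorem loss_le {U E : Matrix (Fin d) (Fin r) ℝ} (hU : Uᵀ * U = 1)
    (hE : IsLeadingEigenvectors ((U * G + (B + N)) * (U * G + (B + N))ᵀ) E) :
    ‖(1 - U * Uᵀ) * E‖ ≤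
      (σ ^ 2 / 4)⁻¹ * (r * x₁ + r * (x₂ + μ) + b * (r * (‖G‖ + b + 2 * xN))) := by
  have hσ := h.σ_pos
  have hE1 := hE.orthonormal
  have hs : (1 : Matrix c c ℝ)ᵀ = 1 := Matrix.transpose_one
  have hi : (1 : Matrix c c ℝ) * 1 = 1 := Matrix.mul_one 1
  have h1 := leading_loss_le hU G (B + N) (Q := 1) (E := E) (by rwa [Matrix.mul_one])
    (by positivity : 0 < σ ^ 2 / 4) (h.form_ge hU hs hi (by rw [sub_self, Matrix.mul_zero, norm_zero]; positivity))
  refine h1.trans (mul_le_mul_of_nonneg_left ?_ (by positivity))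
  refine (noise_mul_le hU hE1 G B N hs hi).trans ?_
  rw [Matrix.mul_one]
  have h2 : ‖N * Nᵀ * E‖ ≤ r * (x₂ + μ) := by
    rw [h.gram, Matrix.add_mul]
    refine (norm_add_le _ _).trans ?_
    have h3 := h.mean_mul_le hE1
    have h4 := (Matrix.frobenius_norm_mul Φ E).trans
      (mul_le_mul h.fluct (frobenius_le_of_orthonormal hE1) (norm_nonneg _)
        ((norm_nonneg _).trans h.fluct))
    linarith
  have hb0 := (norm_nonneg _).trans h.bias
  have h5 := h.cross
  have h6 := h.bias
  have h7 := h.norm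
  gcongr

/-- Relative to the eigenvectors of signal plus mean noise, `μ` is absent from the bound: only
fluctuations and bias remain. This is the reason for comparing with `E₀` instead of `U`. -/
theorem perturbation_le {U E E₀ : Matrix (Fin d) (Fin r) ℝ} (hU : Uᵀ * U = 1)
    (hE : IsLeadingEigenvectors ((U * G + (B + N)) * (U * G + (B + N))ᵀ) E)
    (hE₀ : IsLeadingEigenvectors (U * G * (U * G)ᵀ + S₁) E₀) :
    ‖(1 - E₀ * E₀ᵀ) * E‖ ≤
      2 * (σ ^ 2 / 4)⁻¹ * ((2 * r * x₁ + x₂ + b * (2 * (r * ‖G‖ + b + xN))) * r) := by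
  have hσ := h.σ_pos
  have hs : (1 : Matrix c c ℝ)ᵀ = 1 := Matrix.transpose_one
  have hi : (1 : Matrix c c ℝ) * 1 = 1 := Matrix.mul_one 1
  have hlow := h.form_ge hU hs hi (by rw [sub_self, Matrix.mul_zero, norm_zero]; positivity)
  rw [Matrix.mul_one] at hlow
  have hsm := h.small
  have hx2 := (norm_nonneg _).trans h.fluct
  have hquad : ∀ z : Fin d → ℝ, z ⬝ᵥ ((U * G * (U * G)ᵀ) *ᵥ z) =
      ((U * G)ᵀ *ᵥ z) ⬝ᵥ ((U * G)ᵀ *ᵥ z) := fun z => dotProduct_mulVec_gram (U * G) z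
  have h1 := leading_perturbation_le hU hE hE₀
    (by rw [Matrix.transpose_add, Matrix.transpose_mul, Matrix.transpose_transpose, h.mean_symm])
    h.μ_nonneg (by nlinarith [sq_nonneg b, sq_nonneg σ]) (by positivity : 0 < σ ^ 2 / 4) hlow
    (fun z => by
      rw [Matrix.add_mulVec, dotProduct_add, hquad]
      exact add_nonneg (dotProduct_self_nonneg' _) (h.mean_nonneg z))
    (fun z hz => by
      rw [Matrix.add_mulVec, dotProduct_add, hquad, Matrix.transpose_mul, ← Matrix.mulVec_mulVec,
        hz, Matrix.mulVec_zero, zero_dotProduct, zero_add]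
      have := h.mean z z
      linarith)
  refine h1.trans (mul_le_mul_of_nonneg_left ?_ (by positivity))
  have hg := gram_perturbation_le hU G B N S₁
  have h4 : N * Nᵀ - S₁ = Φ := by rw [h.gram, add_sub_cancel_right]
  rw [h4] at hg
  have hb0 := (norm_nonneg _).trans h.bias
  have h5 := h.cross
  have h6 := h.bias
  have h7 := h.norm
  have h8 := h.fluct
  refine mul_le_mul (hg.trans ?_) (frobenius_le_of_orthonormal hE.orthonormal) (norm_nonneg _)
    (by have := (norm_nonneg _).trans h5; have := (norm_nonneg _).trans h7; positivity)
  gcongr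

/-- The loss of leading eigenvectors after a projection. -/
theorem projected_loss_le {U E : Matrix (Fin d) (Fin r) ℝ} (hU : Uᵀ * U = 1) {Q : Matrix c c ℝ}
    (hs : Qᵀ = Q) (hi : Q * Q = Q) (hQ : ‖G * (1 - Q)‖ ≤ σ / 4)
    (hE : IsLeadingEigenvectors ((U * G + (B + N)) * Q * (U * G + (B + N))ᵀ) E) {y₁ y₂ y₃ : ℝ}
    {Φ' S' : Matrix (Fin d) (Fin d) ℝ} (hgram : N * Q * Nᵀ = Φ' + S') (hΦ' : ‖Φ'‖ ≤ y₂)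
    (hS' : ∀ u v : Fin d → ℝ, u ⬝ᵥ (S' *ᵥ v) ≤ y₃ * ((u ⬝ᵥ u + v ⬝ᵥ v) / 2)) (hy₃ : 0 ≤ y₃)
    (hcross : ‖N * Q * Gᵀ‖ ≤ y₁) :
    ‖(1 - U * Uᵀ) * E‖ ≤
      (σ ^ 2 / 4)⁻¹ * (r * y₁ + r * (y₂ + y₃) + b * (r * (‖G‖ + b + 2 * xN))) := by
  have hσ := h.σ_pos
  have hE1 := hE.orthonormal
  have h1 := leading_loss_le hU G (B + N) hE (by positivity : 0 < σ ^ 2 / 4)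
    (h.form_ge hU hs hi hQ)
  refine h1.trans (mul_le_mul_of_nonneg_left ?_ (by positivity))
  refine (noise_mul_le hU hE1 G B N hs hi).trans ?_
  have h2 : ‖N * Q * Nᵀ * E‖ ≤ r * (y₂ + y₃) := by
    rw [hgram, Matrix.add_mul]
    refine (norm_add_le _ _).trans ?_
    have h1 := frobenius_sq_mul_le S' E (mulVec_sq_le_of_bilinear S' hy₃ hS')
    rw [← mul_pow] at h1
    have h3 := (abs_le_of_sq_le_sq' h1 (mul_nonneg hy₃ (norm_nonneg _))).2.trans
      (mul_le_mul_of_nonneg_left (frobenius_le_of_orthonormal hE1) hy₃)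
    have h4 := (Matrix.frobenius_norm_mul Φ' E).trans
      (mul_le_mul hΦ' (frobenius_le_of_orthonormal hE1) (norm_nonneg _)
        ((norm_nonneg _).trans hΦ'))
    linarith
  have hb0 := (norm_nonneg _).trans h.bias
  have h6 := h.bias
  have h7 := h.norm
  gcongr

end NoiseSplit

theorem sqrt_two_mul_sum_sq_le {ι : Type*} (s : Finset ι) (x : ι → ℝ) (hx : ∀ i, 0 ≤ x i) {R y : ℝ}
    (hR : 1 ≤ R) (hy : y ^ 2 ≤ 2 * R * ∑ i ∈ s, x i ^ 2) : y ≤ 2 * R * ∑ i ∈ s, x i := by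
  have h0 : 0 ≤ ∑ i ∈ s, x i := Finset.sum_nonneg fun i _ => hx i
  have h1 : ∑ i ∈ s, x i ^ 2 ≤ (∑ i ∈ s, x i) ^ 2 := Finset.sum_sq_le_sq_sum_of_nonneg fun i _ => hx i
  refine abs_le_of_sq_le_sq' (hy.trans ?_) (by positivity) |>.2
  nlinarith [mul_nonneg (sq_nonneg (∑ i ∈ s, x i)) (by linarith : (0:ℝ) ≤ R - 1)]

end Perturbation

/-! ### The event on which all noise statistics are of their typical order. -/

namespace TensorFactorModel

noncomputable section

open scoped Matrix Matrix.Norms.Frobenius Kronecker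

variable {K : ℕ} {r : Fin K → ℕ} {Ω : Type*} [mΩ : MeasurableSpace Ω]
  {m : TensorFactorModel K r Ω}

/-- Bounds on the noise statistics at one point of the sample space, up to the factor `t`. The
scale of the linear statistics is `D`. -/
structure NoiseEvent (m : TensorFactorModel K r Ω) (τ : Fin K → ℝ) (k : Fin K) (ω D : ℝ)
    (ν : Fin K → ℝ) (φ χ : ℝ) (Θ₀ : Matrix (OtherIndex m.p k) (OtherIndex m.p k) ℝ) (t : ℝ)
    (w : Ω) : Prop where
  norm : ∀ l, ‖m.noiseMat (τ l) l w‖ ≤ t * (2 * ω)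
  cross : ∀ l, ‖m.noiseMat (τ l) l w * (m.factorMat l)ᵀ‖ ≤ t * (D * (Real.sqrt (m.np l))⁻¹)
  fluct : ∀ l, ‖m.fluctGram (τ l) l 1 w‖ ≤ t * ν l
  cross_proj : ‖m.noiseMat (τ k) k w * (m.factorMat k * ((1 : Matrix m.Time m.Time ℝ) ⊗ₖ Θ₀))ᵀ‖ ≤
    t * (D * (Real.sqrt (m.np k))⁻¹)
  fluct_proj : ‖m.fluctGram (τ k) k Θ₀ w‖ ≤ t * φ
  cov : Real.sqrt (m.covStat (τ k) w) ≤ t * χ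
  cross_all : Real.sqrt (m.crossStat (τ k) k (m.factorMat k) w) ≤ t * (D * (Real.sqrt m.n)⁻¹)

section Markov

theorem le_of_normalized {x s T : ℝ} (hs : 0 < s) (hx : x / s ≤ T) : x ≤ T * s :=
  (div_le_iff₀ hs).1 hx

theorem le_mul_of_sq_le {x s t : ℝ} (ht : 0 ≤ t) (hs : 0 ≤ s) (hx : x ^ 2 ≤ t ^ 2 * s ^ 2) :
    x ≤ t * s := by
  rw [← mul_pow] at hx
  exact (abs_le_of_sq_le_sq' hx (mul_nonneg ht hs)).2

theorem integral_div_le_one {P : Measure Ω} {Y : Ω → ℝ} {s : ℝ} (hs : 0 < s)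
    (hY : ∫ w, Y w ∂P ≤ s) : ∫ w, Y w / s ∂P ≤ 1 := by
  rw [integral_div]
  exact (div_le_one hs).2 hY

set_option maxHeartbeats 1000000 in
/-- The noise statistics are bounded with high probability. -/
theorem exists_noiseStat {ε ω C₁ : ℝ} {τ : Fin K → ℝ} {k : Fin K} {ν φ χ : Fin K → ℝ}
    (hC₁ : 0 < C₁) (hν : ∀ l, 0 < ν l) (hφ : 0 < φ k) (hχ : 0 < χ k)
    (h : ∀ l, m.NoiseSetup ε ω (τ l)) (hb : ∀ l, m.NoiseBounds (τ l) l C₁ (ν l) (φ l) (χ l))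
    (hp : ∀ l, 0 < m.p l) (hn : 0 < m.n) (hG : ∀ l, ‖m.factorMat l‖ ^ 2 ≤ ω ^ 2)
    {W : Matrix (OtherIndex m.p k) (OtherIndex r k) ℝ} (hW : Wᵀ * W = 1) :
    ∃ Z : Ω → ℝ, Integrable Z m.P ∧ (∀ w, 0 ≤ Z w) ∧ ∫ w, Z w ∂m.P ≤ 3 * K + 4 ∧
      ∀ t w, 0 ≤ t → Z w ≤ t ^ 2 →
        m.NoiseEvent τ k ω (Real.sqrt C₁ * ω) ν (φ k) (χ k) (W * Wᵀ) t w := by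
  have hω := (h k).ω_pos
  have hnR : (0 : ℝ) < m.n := Nat.cast_pos.2 hn
  have hpT := pTot_pos hp
  have hnp : ∀ l, 0 < m.np l := fun l => by
    have h1 := p_mul_inv hp l
    have h2 : (0 : ℝ) < m.p l := Nat.cast_pos.2 (hp l)
    have h3 : 0 < (m.p l : ℝ) * (m.n * m.pTot)⁻¹ := by positivity
    rw [h1] at h3
    exact inv_pos.1 h3
  set η : Fin K → ℝ := fun l => (Real.sqrt (m.np l))⁻¹ with hη
  have hη0 : ∀ l, 0 < η l := fun l => inv_pos.2 (Real.sqrt_pos.2 (hnp l))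
  have hη2 : ∀ l, η l ^ 2 = (m.np l)⁻¹ := fun l => by
    rw [sq, inv_sqrt_mul_inv_sqrt (hnp l).le]
  set D := Real.sqrt C₁ * ω with hD
  have hD0 : 0 < D := mul_pos (Real.sqrt_pos.2 hC₁) hω
  have hD2 : D ^ 2 = C₁ * ω ^ 2 := by rw [hD, mul_pow, Real.sq_sqrt hC₁.le]
  set κ := (Real.sqrt m.n)⁻¹ with hκ
  have hκ0 : 0 < κ := inv_pos.2 (Real.sqrt_pos.2 hnR)
  have hκ2 : κ ^ 2 = (m.n : ℝ)⁻¹ := by rw [sq, inv_sqrt_mul_inv_sqrt hnR.le]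
  set Gp := m.factorMat k * ((1 : Matrix m.Time m.Time ℝ) ⊗ₖ (W * Wᵀ)) with hGp
  have hGp2 : ‖Gp‖ ^ 2 ≤ ω ^ 2 := by
    obtain ⟨h1, h2⟩ := proj_of_orthonormal hW
    obtain ⟨h3, h4⟩ := one_kronecker_proj (T := m.Time) h1 h2
    exact (pow_le_pow_left₀ (norm_nonneg _) (frobenius_mul_proj_le _ h3 h4) 2).trans (hG k)
  -- the normalized statistics
  have s1 : ∀ l, ∫ w, ‖m.noiseMat (τ l) l w‖ ^ 2 / (2 * ω) ^ 2 ∂m.P ≤ 1 := fun l =>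
    integral_div_le_one (by positivity) (((h l).integral_frobenius_noiseMat_le l).trans (by nlinarith))
  have s2' : ∀ l {q : Type} [Fintype q] (Z : Matrix q (m.Time × OtherIndex m.p l) ℝ),
      ‖Z‖ ^ 2 ≤ ω ^ 2 → ∫ w, ‖m.noiseMat (τ l) l w * Zᵀ‖ ^ 2 / (D * η l) ^ 2 ∂m.P ≤ 1 :=
    fun l q _ Z hZ => by
      have := hη0 l
      refine integral_div_le_one (by positivity)
        (((h l).integral_frobenius_noiseMat_mul_le (hb l).corr Z).trans ?_)
      rw [mul_pow, hη2, hD2, p_mul_inv hp, mul_comm]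
      have := hnp l
      gcongr
  have s3 : ∀ l, ∫ w, ‖m.fluctGram (τ l) l 1 w‖ ^ 2 / ν l ^ 2 ∂m.P ≤ 1 := fun l =>
    integral_div_le_one (pow_pos (hν l) 2) ((h l).integral_frobenius_fluctGram_one_le (hb l))
  have s5 : ∫ w, ‖m.fluctGram (τ k) k (W * Wᵀ) w‖ ^ 2 / φ k ^ 2 ∂m.P ≤ 1 :=
    integral_div_le_one (pow_pos hφ 2) ((h k).integral_frobenius_fluctGram_proj_le (hb k) hW)
  have s6 : ∫ w, m.covStat (τ k) w / χ k ^ 2 ∂m.P ≤ 1 :=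
    integral_div_le_one (pow_pos hχ 2) ((h k).integral_covStat_le (hb k))
  have s7 : ∫ w, m.crossStat (τ k) k (m.factorMat k) w / (D * κ) ^ 2 ∂m.P ≤ 1 := by
    refine integral_div_le_one (by positivity)
      (((h k).integral_crossStat_le (hb k).corr _).trans ?_)
    rw [mul_pow, hκ2, hD2]
    have : m.pTot * (m.n * m.pTot)⁻¹ = (m.n : ℝ)⁻¹ := by field_simp
    rw [this, mul_comm]
    have := hG k
    gcongr
  have i1 := fun l => ((h l).integrable_frobenius_noiseMat l).div_const ((2 * ω) ^ 2)
  have i2 := fun l => ((h l).integrable_frobenius_noiseMat_mul (m.factorMat l)).div_const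
    ((D * η l) ^ 2)
  have i3 := fun l => ((h l).integrable_frobenius_fluctGram (k := l) 1).div_const (ν l ^ 2)
  have i4 := ((h k).integrable_frobenius_noiseMat_mul Gp).div_const ((D * η k) ^ 2)
  have i5 := ((h k).integrable_frobenius_fluctGram (k := k) (W * Wᵀ)).div_const (φ k ^ 2)
  have i6 := (h k).integrable_covStat.div_const (χ k ^ 2)
  have i7 := ((h k).integrable_crossStat (m.factorMat k)).div_const ((D * κ) ^ 2)
  set Y1 : Fin K → Ω → ℝ := fun l w => ‖m.noiseMat (τ l) l w‖ ^ 2 / (2 * ω) ^ 2 with hY1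
  set Y2 : Fin K → Ω → ℝ := fun l w =>
    ‖m.noiseMat (τ l) l w * (m.factorMat l)ᵀ‖ ^ 2 / (D * η l) ^ 2 with hY2
  set Y3 : Fin K → Ω → ℝ := fun l w => ‖m.fluctGram (τ l) l 1 w‖ ^ 2 / ν l ^ 2 with hY3
  set Y4 : Ω → ℝ := fun w => ‖m.noiseMat (τ k) k w * Gpᵀ‖ ^ 2 / (D * η k) ^ 2 with hY4
  set Y5 : Ω → ℝ := fun w => ‖m.fluctGram (τ k) k (W * Wᵀ) w‖ ^ 2 / φ k ^ 2 with hY5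
  set Y6 : Ω → ℝ := fun w => m.covStat (τ k) w / χ k ^ 2 with hY6
  set Y7 : Ω → ℝ := fun w => m.crossStat (τ k) k (m.factorMat k) w / (D * κ) ^ 2 with hY7
  have n1 : ∀ l w, 0 ≤ Y1 l w := fun l w => div_nonneg (sq_nonneg _) (sq_nonneg _)
  have n2 : ∀ l w, 0 ≤ Y2 l w := fun l w => div_nonneg (sq_nonneg _) (sq_nonneg _)
  have n3 : ∀ l w, 0 ≤ Y3 l w := fun l w => div_nonneg (sq_nonneg _) (sq_nonneg _)
  have n4 : ∀ w, 0 ≤ Y4 w := fun w => div_nonneg (sq_nonneg _) (sq_nonneg _)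
  have n5 : ∀ w, 0 ≤ Y5 w := fun w => div_nonneg (sq_nonneg _) (sq_nonneg _)
  have hcov0 : ∀ w, 0 ≤ m.covStat (τ k) w := fun w => by unfold covStat; positivity
  have hcr0 : ∀ w, 0 ≤ m.crossStat (τ k) k (m.factorMat k) w := fun w => by
    unfold crossStat; positivity
  have n6 : ∀ w, 0 ≤ Y6 w := fun w => div_nonneg (hcov0 w) (sq_nonneg _)
  have n7 : ∀ w, 0 ≤ Y7 w := fun w => div_nonneg (hcr0 w) (sq_nonneg _)
  have iS : Integrable (fun w => ∑ l, (Y1 l w + Y2 l w + Y3 l w)) m.P :=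
    integrable_finsetSum _ fun l _ => ((i1 l).add (i2 l)).add (i3 l)
  have iT : Integrable (fun w => Y4 w + Y5 w + Y6 w + Y7 w) m.P := ((i4.add i5).add i6).add i7
  have nS : ∀ w, 0 ≤ ∑ l, (Y1 l w + Y2 l w + Y3 l w) := fun w => Finset.sum_nonneg fun l _ => by
    exact add_nonneg (add_nonneg (n1 l w) (n2 l w)) (n3 l w)
  -- One variable controls everything: three squared statistics for each mode and four for mode `k`,
  -- each divided by its scale and so of mean at most `1`.
  refine ⟨fun w => ∑ l, (Y1 l w + Y2 l w + Y3 l w) + (Y4 w + Y5 w + Y6 w + Y7 w), iS.add iT,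
    fun w => ?_, ?_, fun t w ht hZ => ?_⟩
  · exact add_nonneg (nS w) (add_nonneg (add_nonneg (add_nonneg (n4 w) (n5 w)) (n6 w)) (n7 w))
  · have e1 : ∫ w, (∑ l, (Y1 l w + Y2 l w + Y3 l w) + (Y4 w + Y5 w + Y6 w + Y7 w)) ∂m.P =
        ∫ w, ∑ l, (Y1 l w + Y2 l w + Y3 l w) ∂m.P + ∫ w, (Y4 w + Y5 w + Y6 w + Y7 w) ∂m.P :=
      integral_add iS iT
    have e2 : ∫ w, ∑ l, (Y1 l w + Y2 l w + Y3 l w) ∂m.P =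
        ∑ l, ∫ w, (Y1 l w + Y2 l w + Y3 l w) ∂m.P :=
      integral_finsetSum _ fun l _ => ((i1 l).add (i2 l)).add (i3 l)
    have e3 : ∫ w, (Y4 w + Y5 w + Y6 w + Y7 w) ∂m.P =
        ∫ w, (Y4 w + Y5 w + Y6 w) ∂m.P + ∫ w, Y7 w ∂m.P := integral_add ((i4.add i5).add i6) i7
    have e4 : ∫ w, (Y4 w + Y5 w + Y6 w) ∂m.P =
        ∫ w, (Y4 w + Y5 w) ∂m.P + ∫ w, Y6 w ∂m.P := integral_add (i4.add i5) i6
    have e5 : ∫ w, (Y4 w + Y5 w) ∂m.P = ∫ w, Y4 w ∂m.P + ∫ w, Y5 w ∂m.P := integral_add i4 i5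
    have hl : ∀ l, ∫ w, (Y1 l w + Y2 l w + Y3 l w) ∂m.P ≤ 3 := fun l => by
      have e6 : ∫ w, (Y1 l w + Y2 l w + Y3 l w) ∂m.P =
          ∫ w, (Y1 l w + Y2 l w) ∂m.P + ∫ w, Y3 l w ∂m.P := integral_add ((i1 l).add (i2 l)) (i3 l)
      have e7 : ∫ w, (Y1 l w + Y2 l w) ∂m.P = ∫ w, Y1 l w ∂m.P + ∫ w, Y2 l w ∂m.P :=
        integral_add (i1 l) (i2 l)
      have a1 : ∫ w, Y1 l w ∂m.P ≤ 1 := s1 l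
      have a2 : ∫ w, Y2 l w ∂m.P ≤ 1 := s2' l _ (hG l)
      have a3 : ∫ w, Y3 l w ∂m.P ≤ 1 := s3 l
      linarith
    have h1 : ∑ l, ∫ w, (Y1 l w + Y2 l w + Y3 l w) ∂m.P ≤ ∑ _l : Fin K, (3 : ℝ) :=
      Finset.sum_le_sum fun l _ => hl l
    rw [Finset.sum_const, Finset.card_univ, Fintype.card_fin, nsmul_eq_mul] at h1
    have a4 : ∫ w, Y4 w ∂m.P ≤ 1 := s2' k Gp hGp2
    have a5 : ∫ w, Y5 w ∂m.P ≤ 1 := s5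
    have a6 : ∫ w, Y6 w ∂m.P ≤ 1 := s6
    have a7 : ∫ w, Y7 w ∂m.P ≤ 1 := s7
    linarith
  · have hnS := nS w
    have h4 := n4 w; have h5 := n5 w; have h6 := n6 w; have h7 := n7 w
    have hl : ∀ l, Y1 l w + Y2 l w + Y3 l w ≤ t ^ 2 := fun l => by
      have : Y1 l w + Y2 l w + Y3 l w ≤ ∑ l, (Y1 l w + Y2 l w + Y3 l w) :=
        Finset.single_le_sum (f := fun l => Y1 l w + Y2 l w + Y3 l w) (fun l _ =>
          add_nonneg (add_nonneg (n1 l w) (n2 l w)) (n3 l w)) (Finset.mem_univ l)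
      linarith
    constructor
    · intro l
      have := n1 l w; have := n2 l w; have := n3 l w
      have h2 : 0 < 2 * ω := by linarith
      exact le_mul_of_sq_le ht h2.le
        (le_of_normalized (pow_pos h2 2) (by linarith [hl l] : Y1 l w ≤ t ^ 2))
    · intro l
      have := n1 l w; have := n2 l w; have := n3 l w; have h2 := mul_pos hD0 (hη0 l)
      exact le_mul_of_sq_le ht h2.le
        (le_of_normalized (pow_pos h2 2) (by linarith [hl l] : Y2 l w ≤ t ^ 2))
    · intro l
      have := n1 l w; have := n2 l w; have := n3 l w
      exact le_mul_of_sq_le ht (hν l).le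
        (le_of_normalized (pow_pos (hν l) 2) (by linarith [hl l] : Y3 l w ≤ t ^ 2))
    · have h2 := mul_pos hD0 (hη0 k)
      exact le_mul_of_sq_le ht h2.le
        (le_of_normalized (pow_pos h2 2) (by linarith : Y4 w ≤ t ^ 2))
    · exact le_mul_of_sq_le ht hφ.le
        (le_of_normalized (pow_pos hφ 2) (by linarith : Y5 w ≤ t ^ 2))
    · refine le_mul_of_sq_le ht hχ.le ?_
      rw [Real.sq_sqrt (hcov0 w)]
      exact le_of_normalized (pow_pos hχ 2) (by linarith : Y6 w ≤ t ^ 2)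
    · have h2 := mul_pos hD0 hκ0
      refine le_mul_of_sq_le ht h2.le ?_
      rw [Real.sq_sqrt (hcr0 w)]
      exact le_of_normalized (pow_pos h2 2) (by linarith : Y7 w ≤ t ^ 2)

end Markov

end

end TensorFactorModel

/-! ### The loss of the first iteration on this event. -/

namespace TensorFactorModel

noncomputable section

open scoped Matrix Matrix.Norms.Frobenius Kronecker

variable {K : ℕ} {r : Fin K → ℕ} {Ω : Type*} [mΩ : MeasurableSpace Ω]
  {m : TensorFactorModel K r Ω}

/-- Bound on the loss of the initial estimator of mode `l`, in terms of the rates `η`, `ν` of the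
noise statistics, the bound `b` on the bias and the bound `μ` on the noise covariance. -/
def initialLossBound (r : ℕ) (σ ω D t η ν b μ : ℝ) : ℝ :=
  (σ ^ 2 / 4)⁻¹ * (r * (t * (D * η)) + r * (t * ν + μ) + b * (r * (ω + 1 + 2 * (t * (2 * ω)))))

def perturbationConst (r : ℕ) (σ ω D t : ℝ) : ℝ :=
  2 * (σ ^ 2 / 4)⁻¹ * ((2 * r * (t * D) + t + 2 * (r * ω + 1 + t * (2 * ω))) * r)

def lossConst (r : Fin K → ℕ) (k : Fin K) (σ ω D C₁ t : ℝ) : ℝ :=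
  (σ ^ 2 / 4)⁻¹ * (r k * (t * D +
    2 * Fintype.card (OtherIndex r k) * (∑ l, perturbationConst (r l) σ ω D t) * (t * D + t) + t +
    C₁ * Fintype.card (OtherIndex r k) + (ω + 1 + 2 * (t * (2 * ω)))))

theorem perturbationConst_nonneg (r : ℕ) {σ ω D t : ℝ} (hω : 0 ≤ ω) (hD : 0 ≤ D) (ht : 0 ≤ t) :
    0 ≤ perturbationConst r σ ω D t := by
  unfold perturbationConst; positivity

section

variable {ε ω C₁ σ D t : ℝ} {τ b : Fin K → ℝ} {k : Fin K} {ν : Fin K → ℝ} {φ χ : ℝ}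
  {E₀ : ∀ l, Matrix (Fin (m.p l)) (Fin (r l)) ℝ} {w : Ω}

theorem noiseSplit_of_event (l : Fin K) (h : m.NoiseSetup ε ω (τ l))
    (hcorr : ∀ x t, ∑ y, ∑ u, |∫ w, m.noise (τ l) x t w * m.noise (τ l) y u w ∂m.P| ≤ C₁)
    (hC₁ : 0 ≤ C₁) (hp : ∀ l, 0 < m.p l) (hσ : 0 < σ)
    (hsignal : ∀ u, σ ^ 2 * (u ⬝ᵥ u) ≤ u ⬝ᵥ ((m.factorMat l * (m.factorMat l)ᵀ) *ᵥ u))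
    (hb : biasBound ε ω (τ l) ≤ b l)
    (hsmall : 2 * b l ^ 2 + 2 * (t * ν l + C₁ / m.p l) ≤ (σ / 4) ^ 2)
    {Θ₀ : Matrix (OtherIndex m.p k) (OtherIndex m.p k) ℝ}
    (hev : m.NoiseEvent τ k ω D ν φ χ Θ₀ t w) :
    NoiseSplit (m.factorMat l) (m.biasMat (τ l) l) (m.noiseMat (τ l) l w)
      (m.fluctGram (τ l) l 1 w) (m.meanGram (τ l) l 1) σ (b l) (t * (2 * ω))
      (t * (D * (Real.sqrt (m.np l))⁻¹)) (t * ν l) (C₁ / m.p l) where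
  gram := noise_gram_one l w
  bias := (h.frobenius_biasMat_le l).trans hb
  norm := hev.norm l
  cross := hev.cross l
  fluct := hev.fluct l
  mean u v := by
    have h1 := meanGram_bilinear_le hcorr hC₁ l (1 : Matrix (OtherIndex m.p l) (OtherIndex m.p l) ℝ)
      u v
    rw [Matrix.transpose_one, Matrix.mul_one, frobenius_sq_one, pTot_eq l] at h1
    have hpl : (m.p l : ℝ) ≠ 0 := Nat.cast_ne_zero.2 (hp l).ne'
    have hpe : (dimProdExcept m.p l : ℝ) ≠ 0 :=
      Nat.cast_ne_zero.2 (Finset.prod_pos fun l _ => hp l).ne'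
    rwa [mul_div_mul_right _ _ hpe] at h1
  mean_nonneg u := by
    have h1 := h.meanGram_nonneg l (1 : Matrix (OtherIndex m.p l) (OtherIndex m.p l) ℝ) u
    rwa [Matrix.transpose_one, Matrix.mul_one] at h1
  mean_symm := meanGram_transpose l Matrix.transpose_one
  σ_pos := hσ
  μ_nonneg := by positivity
  signal := hsignal
  small := hsmall

theorem isLeadingEigenvectors_dataMat (hp : ∀ l, 0 < m.p l) (hn : 0 < m.n) {l : Fin K} {τ : ℝ}
    {E : Matrix (Fin (m.p l)) (Fin (r l)) ℝ} (hE : IsLeadingEigenvectors (m.gammaHat τ l w) E) :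
    IsLeadingEigenvectors ((m.loadMat l * m.factorMat l + (m.biasMat τ l + m.noiseMat τ l w)) *
      (m.loadMat l * m.factorMat l + (m.biasMat τ l + m.noiseMat τ l w))ᵀ) E := by
  have h1 := hE.smul (c := (m.p l : ℝ)⁻¹) (by positivity)
  have hpl : (m.p l : ℝ) ≠ 0 := Nat.cast_ne_zero.2 (hp l).ne'
  rwa [gammaHat_eq hp, smul_smul, inv_mul_cancel₀ hpl, one_smul, dataMat_eq hp hn] at h1

theorem isLeadingEigenvectors_dataMat_proj (hp : ∀ l, 0 < m.p l) (hn : 0 < m.n) {l : Fin K} {τ : ℝ}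
    {F : ∀ l, Matrix (Fin (m.p l)) (Fin (r l)) ℝ}
    {E : Matrix (Fin (m.p l)) (Fin (r l)) ℝ} (hE : IsLeadingEigenvectors (m.gammaCheck τ l F w) E) :
    IsLeadingEigenvectors ((m.loadMat l * m.factorMat l + (m.biasMat τ l + m.noiseMat τ l w)) *
      ((1 : Matrix m.Time m.Time ℝ) ⊗ₖ (kronExcept l F * (kronExcept l F)ᵀ)) *
      (m.loadMat l * m.factorMat l + (m.biasMat τ l + m.noiseMat τ l w))ᵀ) E := by
  have h1 := hE.smul (c := (m.p l : ℝ)⁻¹) (by positivity)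
  have hpl : (m.p l : ℝ) ≠ 0 := Nat.cast_ne_zero.2 (hp l).ne'
  rwa [gammaCheck_eq hp, smul_smul, inv_mul_cancel₀ hpl, one_smul, dataMat_eq hp hn] at h1

/-- The loss of the first-iteration estimator on the event that the noise statistics are bounded. -/
theorem first_iteration_loss_le (hr : ∀ l, 0 < r l) (h : ∀ l, m.NoiseSetup ε ω (τ l))
    (hcorr : ∀ l x t, ∑ y, ∑ u, |∫ w, m.noise (τ l) x t w * m.noise (τ l) y u w ∂m.P| ≤ C₁)
    (hC₁ : 0 ≤ C₁) (hp : ∀ l, 0 < m.p l) (hn : 0 < m.n) (hσ : 0 < σ) (ht : 0 ≤ t) (hD : 0 ≤ D)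
    (hU : ∀ l, (m.loadMat l)ᵀ * m.loadMat l = 1) (hG : ∀ l, ‖m.factorMat l‖ ^ 2 ≤ ω ^ 2)
    (hsignal : ∀ l u, σ ^ 2 * (u ⬝ᵥ u) ≤ u ⬝ᵥ ((m.factorMat l * (m.factorMat l)ᵀ) *ᵥ u))
    (hb : ∀ l, biasBound ε ω (τ l) ≤ b l) (hb1 : ∀ l, b l ≤ 1)
    (hν : ∀ l, 0 ≤ ν l) (hφ : 0 ≤ φ) (hχ : 0 ≤ χ)
    (hsmall : ∀ l, 2 * b l ^ 2 + 2 * (t * ν l + C₁ / m.p l) ≤ (σ / 4) ^ 2)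
    (hinit : ω * (2 * Fintype.card (OtherIndex r k) * ∑ l ∈ Finset.univ.erase k,
      initialLossBound (r l) σ ω D t (Real.sqrt (m.np l))⁻¹ (ν l) (b l) (C₁ / m.p l)) ≤ σ / 4)
    (hE₀ : ∀ l, IsLeadingEigenvectors
      (m.loadMat l * m.factorMat l * (m.loadMat l * m.factorMat l)ᵀ + m.meanGram (τ l) l 1) (E₀ l))
    (hev : m.NoiseEvent τ k ω D ν φ χ (kronExcept k E₀ * (kronExcept k E₀)ᵀ) t w)
    {F : ∀ l, Matrix (Fin (m.p l)) (Fin (r l)) ℝ}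
    (hF : ∀ l, IsLeadingEigenvectors (m.gammaHat (τ l) l w) (F l))
    {E : Matrix (Fin (m.p k)) (Fin (r k)) ℝ}
    (hE : IsLeadingEigenvectors (m.gammaCheck (τ k) k F w) E) :
    ‖(1 - m.loadMat k * (m.loadMat k)ᵀ) * E‖ ≤ lossConst r k σ ω D C₁ t *
      ((Real.sqrt (m.np k))⁻¹ + b k + 1 / m.pTot + φ +
        (∑ l ∈ Finset.univ.erase k, ((Real.sqrt (m.np l))⁻¹ + ν l + b l)) *
          ((Real.sqrt m.n)⁻¹ + χ)) := by
  have hω := (h k).ω_pos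
  have hsplit := fun l => noiseSplit_of_event (D := D) (k := k) (φ := φ) (χ := χ) l (h l) (hcorr l)
    hC₁ hp hσ (hsignal l) (hb l) (hsmall l) hev
  have hG' : ∀ l, ‖m.factorMat l‖ ≤ ω := fun l => (abs_le_of_sq_le_sq' (hG l) hω.le).2
  have hb0 : ∀ l, 0 ≤ b l := fun l => (norm_nonneg _).trans (hsplit l).bias
  have hFo : ∀ l, (F l)ᵀ * F l = 1 := fun l => (hF l).orthonormal
  have hE₀o : ∀ l, (E₀ l)ᵀ * E₀ l = 1 := fun l => (hE₀ l).orthonormal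
  set R : ℝ := ((Fintype.card (OtherIndex r k) : ℕ) : ℝ) with hR
  have hR1 : 1 ≤ R := by
    rw [hR]
    have : 0 < Fintype.card (OtherIndex r k) := by
      rw [Fintype.card_pi]
      exact Finset.prod_pos fun l _ => by rw [Fintype.card_fin]; exact hr l
    exact_mod_cast this
  set η : Fin K → ℝ := fun l => (Real.sqrt (m.np l))⁻¹ with hη
  have hη0 : ∀ l, 0 ≤ η l := fun l => by positivity
  -- the initial estimators
  have hinit1 : ∀ l, ‖(1 - m.loadMat l * (m.loadMat l)ᵀ) * F l‖ ≤
      initialLossBound (r l) σ ω D t (η l) (ν l) (b l) (C₁ / m.p l) := fun l => by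
    refine ((hsplit l).loss_le (hU l) (isLeadingEigenvectors_dataMat hp hn (hF l))).trans ?_
    unfold initialLossBound
    have := hG' l
    have := hb1 l
    have := hb0 l
    gcongr
  -- In contrast to `hinit1`, no term `C₁ / p_l` appears.
  have hpert : ∀ l, ‖(1 - E₀ l * (E₀ l)ᵀ) * F l‖ ≤
      perturbationConst (r l) σ ω D t * (η l + ν l + b l) := fun l => by
    refine ((hsplit l).perturbation_le (hU l) (isLeadingEigenvectors_dataMat hp hn (hF l))
      (hE₀ l)).trans ?_
    unfold perturbationConst
    rw [mul_assoc (2 * (σ ^ 2 / 4)⁻¹)]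
    refine mul_le_mul_of_nonneg_left ?_ (by positivity)
    have h1 := hG' l
    have h2 := hb1 l
    have h3 := hb0 l
    have h4 := hν l
    have h5 := hη0 l
    have h6 : b l * (2 * (r l * ‖m.factorMat l‖ + b l + t * (2 * ω))) ≤
        b l * (2 * (r l * ω + 1 + t * (2 * ω))) := by gcongr
    rw [mul_right_comm _ (r l : ℝ) (η l + ν l + b l)]
    refine mul_le_mul_of_nonneg_right ?_ (Nat.cast_nonneg (r l))
    have h7 : 0 ≤ 2 * (r l : ℝ) * (t * D) := by positivity
    have h8 : 0 ≤ 2 * ((r l : ℝ) * ω + 1 + t * (2 * ω)) := by positivity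
    have e1 : 2 * (r l : ℝ) * (t * (D * η l)) = 2 * (r l : ℝ) * (t * D) * η l := by ring
    have e2 : b l * (2 * (r l * ω + 1 + t * (2 * ω))) =
      2 * ((r l : ℝ) * ω + 1 + t * (2 * ω)) * b l := by ring
    change 2 * (r l : ℝ) * (t * (D * η l)) + t * ν l + _ ≤ _
    rw [e1]
    rw [e2] at h6
    nlinarith [mul_nonneg h7 h4, mul_nonneg h7 h3, mul_nonneg ht h5, mul_nonneg ht h3,
      mul_nonneg h8 h5, mul_nonneg h8 h4]
  -- the projections
  set PF := kronExcept k F * (kronExcept k F)ᵀ with hPF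
  set PU := kronExcept k m.loadMat * (kronExcept k m.loadMat)ᵀ with hPU
  set PE := kronExcept k E₀ * (kronExcept k E₀)ᵀ with hPE
  have hFk := kronExcept_orthonormal k hFo
  obtain ⟨hs, hi⟩ := proj_of_orthonormal hFk
  obtain ⟨hQs, hQi⟩ := one_kronecker_proj (T := m.Time) hs hi
  have hΔU : ‖PF - PU‖ ≤ 2 * R * ∑ l ∈ Finset.univ.erase k,
      initialLossBound (r l) σ ω D t (η l) (ν l) (b l) (C₁ / m.p l) :=
    (sqrt_two_mul_sum_sq_le (Finset.univ.erase k)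
      (fun l => ‖(1 - m.loadMat l * (m.loadMat l)ᵀ) * F l‖) (fun _ => norm_nonneg _) hR1
      (frobenius_sq_kron_proj_sub_le hr k hFo hU)).trans
      (mul_le_mul_of_nonneg_left (Finset.sum_le_sum fun l _ => hinit1 l) (by positivity))
  set A : ℝ := ∑ l, perturbationConst (r l) σ ω D t with hA
  have hpc := fun l => perturbationConst_nonneg (r l) (σ := σ) hω.le hD ht
  have hA0 : 0 ≤ A := Finset.sum_nonneg fun l _ => hpc l
  set g : ℝ := ∑ l ∈ Finset.univ.erase k, (η l + ν l + b l) with hg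
  have hg0 : 0 ≤ g := Finset.sum_nonneg fun l _ => by
    have := hη0 l; have := hν l; have := hb0 l; positivity
  have hΔE : ‖PF - PE‖ ≤ 2 * R * (A * g) := by
    refine (sqrt_two_mul_sum_sq_le (Finset.univ.erase k)
      (fun l => ‖(1 - E₀ l * (E₀ l)ᵀ) * F l‖) (fun _ => norm_nonneg _) hR1
      (frobenius_sq_kron_proj_sub_le hr k hFo hE₀o)).trans
      (mul_le_mul_of_nonneg_left ?_ (by positivity))
    rw [hg, Finset.mul_sum]
    refine Finset.sum_le_sum fun l _ => (hpert l).trans (mul_le_mul_of_nonneg_right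
      (Finset.single_le_sum (f := fun l => perturbationConst (r l) σ ω D t)
        (fun l _ => hpc l) (Finset.mem_univ l)) ?_)
    have := hη0 l; have := hν l; have := hb0 l; positivity
  set Q := (1 : Matrix m.Time m.Time ℝ) ⊗ₖ PF with hQ
  -- Here the distance to the oracle projection is used, and it only has to be small; its rate does
  -- not enter the final bound.
  have hGQ : ‖m.factorMat k * (1 - Q)‖ ≤ σ / 4 := by
    have h1 : m.factorMat k * (1 - Q) =
        -(m.factorMat k * ((1 : Matrix m.Time m.Time ℝ) ⊗ₖ (PF - PU))) := by
      have h2 : (1 : Matrix m.Time m.Time ℝ) ⊗ₖ PF = (1 : Matrix m.Time m.Time ℝ) ⊗ₖ PU +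
          (1 : Matrix m.Time m.Time ℝ) ⊗ₖ (PF - PU) := by
        rw [← Matrix.kronecker_add, add_sub_cancel]
      rw [Matrix.mul_sub, Matrix.mul_one, hQ, h2, Matrix.mul_add, factorMat_mul_kronecker hU]
      abel
    rw [h1, norm_neg]
    refine (frobenius_stack_mul_kronecker_le _ _).trans (le_trans ?_ hinit)
    exact mul_le_mul (hG' k) hΔU (norm_nonneg _) hω.le
  have hsplitP : PF = PE + (PF - PE) := by rw [add_sub_cancel]
  -- The random projection is the deterministic `PE` plus a small difference: the first part is
  -- covered by the event, the second by Cauchy–Schwarz.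
  have hcrossQ : ‖m.noiseMat (τ k) k w * Q * (m.factorMat k)ᵀ‖ ≤
      t * (D * η k) + 2 * R * (A * g) * (t * (D * (Real.sqrt m.n)⁻¹)) := by
    have h2 : Q = (1 : Matrix m.Time m.Time ℝ) ⊗ₖ PE +
        (1 : Matrix m.Time m.Time ℝ) ⊗ₖ (PF - PE) := by
      rw [← Matrix.kronecker_add, ← hsplitP]
    rw [h2, Matrix.mul_add, Matrix.add_mul]
    refine (norm_add_le _ _).trans (add_le_add ?_ ?_)
    · have h3 := hev.cross_proj
      obtain ⟨h4, h5⟩ := proj_of_orthonormal (kronExcept_orthonormal k hE₀o)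
      rwa [Matrix.transpose_mul, (one_kronecker_proj (T := m.Time) h4 h5).1,
        ← Matrix.mul_assoc] at h3
    · have h3 := frobenius_noiseMat_mul_kronecker_le (τ := τ k) k (m.factorMat k) (PF - PE) w
      have h4 := Real.abs_le_sqrt h3
      rw [abs_norm, Real.sqrt_mul (sq_nonneg _), Real.sqrt_sq (norm_nonneg _)] at h4
      exact h4.trans (mul_le_mul hΔE hev.cross_all (Real.sqrt_nonneg _) (by positivity))
  have hgram : m.noiseMat (τ k) k w * Q * (m.noiseMat (τ k) k w)ᵀ =
      m.fluctGram (τ k) k PF w + m.meanGram (τ k) k PF := noise_gram k PF w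
  have hfl : ‖m.fluctGram (τ k) k PF w‖ ≤ t * φ + 2 * R * (A * g) * (t * χ) := by
    rw [hsplitP, fluctGram_add]
    refine (norm_add_le _ _).trans (add_le_add hev.fluct_proj ?_)
    have h3 := frobenius_sq_fluctGram_le (τ := τ k) k (PF - PE) w
    have h4 := Real.abs_le_sqrt h3
    rw [abs_norm, Real.sqrt_mul (sq_nonneg _), Real.sqrt_sq (norm_nonneg _)] at h4
    exact h4.trans (mul_le_mul hΔE hev.cov (Real.sqrt_nonneg _) (by positivity))
  -- The mean part needs no decoupling, as the bound holds for every orthonormal matrix with this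
  -- number of columns.
  have hmean : ∀ u v : Fin (m.p k) → ℝ, u ⬝ᵥ (m.meanGram (τ k) k PF *ᵥ v) ≤
      (C₁ * R / m.pTot) * ((u ⬝ᵥ u + v ⬝ᵥ v) / 2) := fun u v => by
    have h1 := meanGram_bilinear_le (hcorr k) hC₁ k (kronExcept k F) u v
    rwa [frobenius_sq_of_orthonormal hFk] at h1
  have hpT := pTot_pos hp
  have hfin := (hsplit k).projected_loss_le (hU k) hQs hQi hGQ
    (isLeadingEigenvectors_dataMat_proj hp hn hE) hgram hfl hmean (by positivity) hcrossQ
  refine hfin.trans ?_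
  unfold lossConst
  rw [← hA, ← hR, mul_assoc (σ ^ 2 / 4)⁻¹]
  refine mul_le_mul_of_nonneg_left ?_ (by positivity)
  have h1 : b k * (r k * (‖m.factorMat k‖ + b k + 2 * (t * (2 * ω)))) ≤
      b k * (r k * (ω + 1 + 2 * (t * (2 * ω)))) := by
    have := hG' k
    have := hb1 k
    have := hb0 k
    gcongr
  refine (add_le_add le_rfl h1).trans ?_
  set s : ℝ := (Real.sqrt m.n)⁻¹ with hs'
  have hs0 : 0 ≤ s := by positivity
  set H : ℝ := ω + 1 + 2 * (t * (2 * ω)) with hH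
  have hH0 : 0 ≤ H := by positivity
  set q : ℝ := 1 / m.pTot with hq
  have hq0 : 0 ≤ q := by positivity
  have hCq : C₁ * R / m.pTot = C₁ * R * q := by rw [hq]; ring
  rw [hCq]
  have hbk := hb0 k
  have hηk := hη0 k
  set X := η k + b k + q + φ + g * (s + χ) with hX
  have hX1 : η k ≤ X := by rw [hX]; have := mul_nonneg hg0 (add_nonneg hs0 hχ); linarith
  have hX2 : b k ≤ X := by rw [hX]; have := mul_nonneg hg0 (add_nonneg hs0 hχ); linarith
  have hX3 : q ≤ X := by rw [hX]; have := mul_nonneg hg0 (add_nonneg hs0 hχ); linarith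
  have hX4 : φ ≤ X := by rw [hX]; have := mul_nonneg hg0 (add_nonneg hs0 hχ); linarith
  have hX5 : g * s ≤ X := by rw [hX]; have := mul_nonneg hg0 hχ; linarith
  have hX6 : g * χ ≤ X := by rw [hX]; have := mul_nonneg hg0 hs0; linarith
  have y1 : t * (D * η k) ≤ t * D * X := by
    rw [← mul_assoc]; gcongr
  have y2 : 2 * R * (A * g) * (t * (D * s)) ≤ 2 * R * A * (t * D) * X := by
    calc _ = 2 * R * A * (t * D) * (g * s) := by ring
      _ ≤ _ := by gcongr
  have y3 : t * φ ≤ t * X := by gcongr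
  have y4 : 2 * R * (A * g) * (t * χ) ≤ 2 * R * A * t * X := by
    calc _ = 2 * R * A * t * (g * χ) := by ring
      _ ≤ _ := by gcongr
  have y5 : C₁ * R * q ≤ C₁ * R * X := by gcongr
  have y6 : b k * H ≤ H * X := by rw [mul_comm]; gcongr
  have y7 : (t * (D * η k) + 2 * R * (A * g) * (t * (D * s))) +
      (t * φ + 2 * R * (A * g) * (t * χ) + C₁ * R * q) + b k * H ≤
      (t * D + 2 * R * A * (t * D + t) + t + C₁ * R + H) * X := by linarith
  have y8 := mul_le_mul_of_nonneg_left y7 (Nat.cast_nonneg (α := ℝ) (r k))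
  linarith

end

end

end TensorFactorModel

namespace TensorFactorModel

noncomputable section

/-! ### Elementary bounds on the rates -/

theorem exists_rpow_le_exp (a : ℝ) {δ : ℝ} (hδ : 0 < δ) :
    ∃ C : ℝ, 0 < C ∧ ∀ x : ℝ, 1 ≤ x → x ^ a ≤ C * Real.exp (δ * x) := by
  obtain ⟨N, hN⟩ := exists_nat_ge a
  refine ⟨N.factorial / δ ^ N, by positivity, fun x hx => ?_⟩
  have h1 := Real.pow_div_factorial_le_exp (δ * x) (by positivity) N
  have h2 : x ^ a ≤ x ^ N := by
    rw [← Real.rpow_natCast]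
    exact Real.rpow_le_rpow_of_exponent_le hx hN
  refine h2.trans ?_
  rw [div_le_iff₀ (by positivity), mul_pow] at h1
  rw [div_mul_eq_mul_div, le_div_iff₀ (by positivity)]
  linarith

section

variable {ε ω : ℝ} (hε : 0 < ε) (hω : 0 < ω)
include hε hω

theorem exists_biasBound_le {c : ℝ} (hc : 0 < c) : ∃ C : ℝ, 0 < C ∧ ∀ u τ : ℝ, 1 ≤ u →
    ω * u ^ (1 / (2 + 2 * ε)) ≤ c * τ →
    biasBound ε ω τ ≤ C * u ^ (-((1 + 2 * ε) / (2 + 2 * ε))) := by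
  refine ⟨ω ^ (2 + 2 * ε) * (ω / (2 * c)) ^ (-(1 + 2 * ε)), by positivity, fun u τ hu hτ => ?_⟩
  have hu0 : 0 < u := by linarith
  have h1 : ω / (2 * c) * u ^ (1 / (2 + 2 * ε)) ≤ τ / 2 := by
    rw [div_mul_eq_mul_div, div_le_iff₀ (by positivity)]
    linarith
  have h2 := Real.rpow_le_rpow_of_nonpos (by positivity) h1 (by linarith : -(1 + 2 * ε) ≤ 0)
  unfold biasBound
  refine (mul_le_mul_of_nonneg_left h2 (by positivity)).trans (le_of_eq ?_)
  rw [Real.mul_rpow (by positivity) (by positivity), ← Real.rpow_mul hu0.le, mul_assoc]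
  congr 3
  ring

/-- `(2 - 2ε) / (2 + 2ε) = 1 - 2ε / (1 + ε)`: with `τ` of order `u^(1/(2+2ε))` and `u = n p₋ₖ /
L_k`, the fourth moment is of order `u ψ²`. The choice of `τ` aims at this. -/
theorem exists_fourthBound_le (hε1 : ε < 1) {c : ℝ} (hc : 0 < c) :
    ∃ C : ℝ, 0 < C ∧ ∀ u τ : ℝ, 1 ≤ u → 0 < τ →
    τ ≤ c * (ω * u ^ (1 / (2 + 2 * ε))) →
    fourthBound ε ω τ ≤ C * (u * (u ^ (-(ε / (1 + ε)))) ^ 2) := by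
  refine ⟨16 * ((2 * c * ω) ^ (2 - 2 * ε) * ω ^ (2 + 2 * ε)), by positivity,
    fun u τ hu hτ0 hτ => ?_⟩
  have hu0 : 0 < u := by linarith
  have h1 : 2 * τ ≤ 2 * c * ω * u ^ (1 / (2 + 2 * ε)) := by linarith
  have h2 := Real.rpow_le_rpow (by positivity) h1 (by linarith : 0 ≤ 2 - 2 * ε)
  have h3 : (u ^ (1 / (2 + 2 * ε))) ^ (2 - 2 * ε) = u * (u ^ (-(ε / (1 + ε)))) ^ 2 := by
    rw [← Real.rpow_mul hu0.le, ← Real.rpow_natCast, ← Real.rpow_mul hu0.le]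
    nth_rewrite 2 [← Real.rpow_one u]
    rw [← Real.rpow_add hu0]
    congr 1
    push_cast
    field_simp
    ring
  rw [Real.mul_rpow (x := 2 * c * ω) (by positivity) (by positivity), h3] at h2
  unfold fourthBound
  calc _ ≤ 16 * ((2 * c * ω) ^ (2 - 2 * ε) * (u * (u ^ (-(ε / (1 + ε)))) ^ 2) * ω ^ (2 + 2 * ε)) := by
        gcongr
    _ = _ := by ring

/-- The ratio is `O(u)` and `u ≤ e^x`, so its power `1 / x` is bounded. This justifies `θ = 1 / log`
in the interpolation. -/
theorem exists_mixRatio_le {c : ℝ} (hc : 0 < c) :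
    ∃ C : ℝ, 0 < C ∧ ∀ u τ x : ℝ, 1 ≤ u → 0 < τ →
    τ ≤ c * (ω * u ^ (1 / (2 + 2 * ε))) → u ≤ Real.exp x → 1 ≤ x →
    mixRatio ε ω τ ^ (1 / x) ≤ C := by
  set B : ℝ := max 1 (128 * c ^ (2 + 2 * ε)) with hB
  have hB1 : 1 ≤ B := le_max_left _ _
  refine ⟨B * Real.exp 1, by positivity, fun u τ x hu hτ0 hτ hux hx => ?_⟩
  have hu0 : 0 < u := by linarith
  have hx0 : 0 < x := by linarith
  have h1 : τ / ω ≤ c * u ^ (1 / (2 + 2 * ε)) := by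
    rw [div_le_iff₀ hω]; linarith
  have h2 := Real.rpow_le_rpow (by positivity) h1 (by linarith : 0 ≤ 2 + 2 * ε)
  rw [Real.mul_rpow (by positivity) (by positivity), ← Real.rpow_mul hu0.le,
    one_div_mul_cancel (by positivity), Real.rpow_one] at h2
  have h3 : mixRatio ε ω τ ≤ B * Real.exp x := by
    unfold mixRatio
    calc _ ≤ 128 * (c ^ (2 + 2 * ε) * u) := by gcongr
      _ = 128 * c ^ (2 + 2 * ε) * u := by ring
      _ ≤ B * Real.exp x := mul_le_mul (le_max_right _ _) hux hu0.le (by linarith)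
  have h4 : 0 ≤ mixRatio ε ω τ := by unfold mixRatio; positivity
  refine (Real.rpow_le_rpow h4 h3 (by positivity)).trans ?_
  rw [Real.mul_rpow (by linarith) (Real.exp_pos _).le, ← Real.exp_mul, mul_one_div_cancel hx0.ne']
  refine mul_le_mul_of_nonneg_right ?_ (Real.exp_pos _).le
  conv_rhs => rw [← Real.rpow_one B]
  exact Real.rpow_le_rpow_of_exponent_le hB1 ((div_le_one hx0).2 hx)

omit hω in
theorem rpow_bias_le {u : ℝ} (hu : 1 ≤ u) :
    u ^ (-((1 + 2 * ε) / (2 + 2 * ε))) ≤ u ^ (-(ε / (1 + ε))) := by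
  refine Real.rpow_le_rpow_of_exponent_le hu (neg_le_neg ?_)
  rw [div_le_div_iff₀ (by positivity) (by positivity)]
  nlinarith

omit hω in
-- The exponent is `1/2 + ε / (2 + 2ε)`; the surplus over `1/2` absorbs the power of the logarithm.
theorem exists_rpow_bias_le : ∃ C : ℝ, 0 < C ∧ ∀ x : ℝ, 0 < x → 1 ≤ Real.log x →
    (x / Real.log x) ^ (-((1 + 2 * ε) / (2 + 2 * ε))) ≤ C * (Real.sqrt x)⁻¹ := by
  obtain ⟨C, hC, h⟩ := exists_rpow_le_exp ((1 + 2 * ε) / (2 + 2 * ε))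
    (by positivity : 0 < ε / (2 + 2 * ε))
  refine ⟨C, hC, fun x hx hL => ?_⟩
  have hL0 : 0 < Real.log x := by linarith
  have h1 := h _ hL
  rw [Real.rpow_neg (by positivity), ← Real.inv_rpow (by positivity), inv_div,
    Real.div_rpow hL0.le hx.le, div_le_iff₀ (by positivity)]
  refine h1.trans (le_of_eq ?_)
  rw [mul_assoc]
  congr 1
  rw [Real.sqrt_eq_rpow, ← Real.rpow_neg hx.le, ← Real.rpow_add hx, mul_comm, Real.exp_mul,
    Real.exp_log hx]
  congr 1
  field_simp
  ring

omit hω in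
theorem inv_sqrt_le_rpow (hε1 : ε < 1) {x L : ℝ} (hx : 1 ≤ x) (hL : 1 ≤ L) :
    (Real.sqrt x)⁻¹ ≤ (x / L) ^ (-(ε / (1 + ε))) := by
  have hx0 : 0 < x := by linarith
  have hL0 : 0 < L := by linarith
  rw [Real.sqrt_eq_rpow, ← Real.rpow_neg hx0.le]
  calc x ^ (-(1 / 2 : ℝ)) ≤ x ^ (-(ε / (1 + ε))) := by
        refine Real.rpow_le_rpow_of_exponent_le hx (neg_le_neg ?_)
        rw [div_le_div_iff₀ (by positivity) (by positivity)]
        linarith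
    _ ≤ (x / L) ^ (-(ε / (1 + ε))) := by
        refine Real.rpow_le_rpow_of_nonpos (by positivity) (div_le_self hx0.le hL) ?_
        have : 0 < ε / (1 + ε) := by positivity
        linarith

end

end

end TensorFactorModel

/-! ### Noise bounds in terms of the rates: independent series. -/

namespace TensorFactorModel

noncomputable section

variable {K : ℕ} {r : Fin K → ℕ}

/-- The sample size is large and the truncation parameters are of the right order. -/
structure Regime {Ω : Type*} [MeasurableSpace Ω] (m : TensorFactorModel K r Ω)
    (s : DependenceSetting) (ε ω c₁ c₂ : ℝ) (τ : Fin K → ℝ) : Prop where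
  p_pos : ∀ l, 0 < m.p l
  n_pos : 0 < m.n
  one_le_log : ∀ l, 1 ≤ Real.log (m.np l)
  tau_ge : ∀ l, m.tauScale s ε ω l ≤ c₁ * τ l
  tau_le : ∀ l, τ l ≤ c₂ * m.tauScale s ε ω l
  ratio : ∀ l, 1 ≤ m.np l / m.logFactor s l

/-- The rate of the fluctuations of the projected noise covariance. -/
def fluctRate {Ω : Type*} [MeasurableSpace Ω] (m : TensorFactorModel K r Ω)
    (s : DependenceSetting) (ε ω : ℝ) (k : Fin K) : ℝ :=
  match s with
  | .independent => (Real.sqrt (m.np k))⁻¹ + m.psi .independent ε ω k / Real.sqrt m.pTot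
  | .randomField => m.psi .randomField ε ω k

/-- The rate of the sum of squares of all fluctuations of the noise covariance. -/
def totalRate {Ω : Type*} [MeasurableSpace Ω] (m : TensorFactorModel K r Ω)
    (s : DependenceSetting) (ε ω : ℝ) (k : Fin K) : ℝ :=
  match s with
  | .independent => (Real.sqrt m.n)⁻¹ + m.psi .independent ε ω k / Real.sqrt (m.p k)
  | .randomField => (Real.sqrt m.n)⁻¹ +
      m.psi .randomField ε ω k * Real.sqrt (Real.log (m.n * m.pTot) / m.p k)

/-- The mixing part of the dependence assumption. -/
def Mixing {Ω : Type*} [MeasurableSpace Ω] (m : TensorFactorModel K r Ω)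
    (s : DependenceSetting) (c₀ : ℝ) : Prop :=
  match s with
  | .independent => m.SeriesMixing c₀
  | .randomField => m.FieldMixing c₀

namespace Regime

variable {Ω : Type*} [MeasurableSpace Ω] {m : TensorFactorModel K r Ω}
  {s : DependenceSetting} {ε ω c₁ c₂ : ℝ} {τ : Fin K → ℝ} (h : m.Regime s ε ω c₁ c₂ τ)
include h

theorem np_pos (l : Fin K) : 0 < m.np l := by
  refine lt_of_le_of_ne (by unfold np; positivity) fun h0 => ?_
  have := h.one_le_log l
  rw [← h0, Real.log_zero] at this
  linarith

theorem pTot_pos : 0 < m.pTot := TensorFactorModel.pTot_pos h.p_pos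

theorem one_le_p (l : Fin K) : (1 : ℝ) ≤ m.p l := by exact_mod_cast h.p_pos l

theorem one_le_n : (1 : ℝ) ≤ m.n := by exact_mod_cast h.n_pos

theorem one_le_except (l : Fin K) : (1 : ℝ) ≤ dimProdExcept m.p l := by
  have : 0 < dimProdExcept m.p l := Finset.prod_pos fun l _ => h.p_pos l
  exact_mod_cast this

omit h in
theorem n_mul_pTot (l : Fin K) : m.n * m.pTot = m.p l * m.np l := by
  rw [pTot_eq l, np]; ring

theorem np_le (l : Fin K) : m.np l ≤ m.n * m.pTot := by
  rw [n_mul_pTot l]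
  exact le_mul_of_one_le_left (h.np_pos l).le (h.one_le_p l)

theorem one_le_np (l : Fin K) : 1 ≤ m.np l := by
  rw [← Real.log_nonneg_iff (h.np_pos l)]
  linarith [h.one_le_log l]

theorem one_le_log_all (l : Fin K) : 1 ≤ Real.log (m.n * m.pTot) :=
  (h.one_le_log l).trans (Real.log_le_log (h.np_pos l) (h.np_le l))

theorem one_le_logFactor (l : Fin K) : 1 ≤ m.logFactor s l := by
  cases s with
  | independent => exact h.one_le_log l
  | randomField => exact one_le_pow₀ (h.one_le_log_all l)

theorem psi_eq (l : Fin K) :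
    m.psi s ε ω l = ω ^ 2 * (m.np l / m.logFactor s l) ^ (-(ε / (1 + ε))) := by
  have h1 := h.one_le_logFactor l
  have h2 := h.np_pos l
  rw [psi, Real.rpow_neg (by positivity), ← Real.inv_rpow (by positivity), inv_div]

theorem psi_pos (hω : 0 < ω) (l : Fin K) : 0 < m.psi s ε ω l := by
  have h1 := h.one_le_logFactor l
  have h2 := h.np_pos l
  rw [h.psi_eq]
  positivity

theorem inv_sqrt_np_le (hε : 0 < ε) (hε1 : ε < 1) (hω : 0 < ω) (l : Fin K) :
    (Real.sqrt (m.np l))⁻¹ ≤ (ω ^ 2)⁻¹ * m.psi s ε ω l := by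
  rw [h.psi_eq, ← mul_assoc, inv_mul_cancel₀ (by positivity), one_mul]
  exact inv_sqrt_le_rpow hε hε1 (h.one_le_np l) (h.one_le_logFactor l)

theorem psi_le (hε : 0 < ε) (l : Fin K) : m.psi s ε ω l ≤ ω ^ 2 := by
  rw [h.psi_eq]
  refine mul_le_of_le_one_right (sq_nonneg _) (Real.rpow_le_one_of_one_le_of_nonpos (h.ratio l) ?_)
  have : 0 < ε / (1 + ε) := by positivity
  linarith

end Regime

section Constants

variable {ε ω c₀ c₁ c₂ : ℝ} (hε : 0 < ε) (hε1 : ε < 1) (hω : 0 < ω)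
include hε hε1 hω

set_option maxHeartbeats 1000000 in
-- With `θ = 1 / log(n p₋ₖ)` the time sum of the interpolated covariances is of order `log(n p₋ₖ)`.
-- Multiplied by the fourth moment this gives `ψ² n p₋ₖ`; the contribution of distinct sites is free
-- of logarithms.
theorem exists_noiseBounds_series (r : Fin K → ℕ) (hc₀ : 0 < c₀) (hc₂ : 0 < c₂) :
    ∃ C₁ C : ℝ, 0 < C₁ ∧ 0 < C ∧ ∀ {Ω : Type*} [MeasurableSpace Ω] (m : TensorFactorModel K r Ω)
      (τ : Fin K → ℝ), m.Regime .independent ε ω c₁ c₂ τ → m.SeriesMixing c₀ →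
      ∀ k, m.NoiseSetup ε ω (τ k) → m.NoiseBounds (τ k) k C₁ (C * m.psi .independent ε ω k)
        (C * m.fluctRate .independent ε ω k) (C * m.totalRate .independent ε ω k) := by
  obtain ⟨CV, hCV, hV⟩ := exists_fourthBound_le hε hω hε1 hc₂
  obtain ⟨CR, hCR, hR⟩ := exists_mixRatio_le hε hω hc₂
  set A : ℝ := 20 * ω ^ 4 * (1 + 2 / (ε / 4 * c₀)) with hA
  have hA0 : 0 < A := by positivity
  set B : ℝ := 2 * CV * CR * (1 + 2 / c₀) / ω ^ 4 with hB
  have hB0 : 0 < B := by positivity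
  set R : ℝ := ∑ k, (Fintype.card (OtherIndex r k) : ℝ) with hRdef
  have hR0 : 0 ≤ R := Finset.sum_nonneg fun _ _ => Nat.cast_nonneg _
  obtain ⟨C, hC⟩ : ∃ C : ℝ, C = 1 + 2 * (A * (ω ^ 2)⁻¹ ^ 2 + A + B) * (1 + R) := ⟨_, rfl⟩
  have hC1 : 1 ≤ C := by
    have : 0 ≤ 2 * (A * (ω ^ 2)⁻¹ ^ 2 + A + B) * (1 + R) := by positivity
    linarith
  have hCC : C ≤ C ^ 2 := by nlinarith
  refine ⟨10 * ω ^ 2 * (1 + 2 / (ε / 4 * c₀)), C, by positivity, by linarith,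
    fun {Ω} _ m τ hreg hmix k hset => ?_⟩
  set x := m.np k with hx
  set Lg := Real.log x with hLg
  have hL1 : 1 ≤ Lg := hreg.one_le_log k
  have hL0 : 0 < Lg := by linarith
  have hx0 : 0 < x := hreg.np_pos k
  set ψ := m.psi .independent ε ω k with hψ
  have hψ0 : 0 < ψ := hreg.psi_pos hω k
  have hψe : ψ = ω ^ 2 * (x / Lg) ^ (-(ε / (1 + ε))) := hreg.psi_eq k
  have hu : 1 ≤ x / Lg := hreg.ratio k
  have hτ : τ k ≤ c₂ * (ω * (x / Lg) ^ (1 / (2 + 2 * ε))) := hreg.tau_le k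
  have hV1 := hV _ _ hu hset.τ_pos hτ
  have hR1 := hR (x / Lg) (τ k) Lg hu hset.τ_pos hτ
    (by rw [hLg, Real.exp_log hx0]; exact div_le_self hx0.le hL1) hL1
  have hVt : 2 * fourthBound ε ω (τ k) * CR * (1 + 2 / (c₀ * (1 / Lg))) ≤ B * (ψ ^ 2 * x) := by
    have h1 : 1 + 2 / (c₀ * (1 / Lg)) ≤ (1 + 2 / c₀) * Lg := by
      have : 2 / (c₀ * (1 / Lg)) = 2 / c₀ * Lg := by field_simp
      rw [this, add_mul, one_mul]
      linarith
    calc _ ≤ 2 * (CV * (x / Lg * ((x / Lg) ^ (-(ε / (1 + ε)))) ^ 2)) * CR * ((1 + 2 / c₀) * Lg) := by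
          gcongr
      _ = B * (ψ ^ 2 * x) := by rw [hB, hψe]; field_simp
  have hA1 : A ≤ A * (ω ^ 2)⁻¹ ^ 2 * (ψ ^ 2 * x) := by
    have h1 := hreg.inv_sqrt_np_le hε hε1 hω k
    have h2 := pow_le_pow_left₀ (by positivity) h1 2
    rw [inv_pow, Real.sq_sqrt hx0.le, mul_pow, inv_le_iff_one_le_mul₀ hx0] at h2
    calc A = A * 1 := (mul_one _).symm
      _ ≤ A * ((ω ^ 2)⁻¹ ^ 2 * ψ ^ 2 * x) := mul_le_mul_of_nonneg_left h2 hA0.le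
      _ = _ := by ring
  set Vt := 2 * fourthBound ε ω (τ k) * CR * (1 + 2 / (c₀ * (1 / Lg))) with hVtdef
  have hp1 := hreg.one_le_p k
  have hp0 : (0 : ℝ) < m.p k := by linarith
  have hn1 := hreg.one_le_n
  have hn0 : (0 : ℝ) < m.n := by linarith
  have hpe := hreg.one_le_except k
  have hpT := hreg.pTot_pos
  have hnpT := Regime.n_mul_pTot (m := m) k
  have hψx : 0 ≤ ψ ^ 2 * x := by positivity
  have hRk : (Fintype.card (OtherIndex r k) : ℝ) ≤ R :=
    Finset.single_le_sum (f := fun k => (Fintype.card (OtherIndex r k) : ℝ))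
      (fun _ _ => Nat.cast_nonneg _) (Finset.mem_univ k)
  set A' : ℝ := A * (ω ^ 2)⁻¹ ^ 2 with hA'
  have hA'0 : 0 ≤ A' := by positivity
  have hS0 : 0 ≤ (A' + A + B) * R := by positivity
  have hCe : C = 1 + 2 * (A' + A + B) + 2 * ((A' + A + B) * R) := by rw [hC]; ring
  have hCbig1 : 2 * (A' + B) ≤ C ^ 2 := by linarith
  have hCbig2 : 2 * (A + B) * R ≤ C ^ 2 := by
    have : (A + B) * R ≤ (A' + A + B) * R := by gcongr; linarith
    linarith
  have hCbig3 : A + B ≤ C ^ 2 := by linarith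
  have hsqx : (Real.sqrt x)⁻¹ ^ 2 = x⁻¹ := by rw [inv_pow, Real.sq_sqrt hx0.le]
  refine hset.noiseBounds_series hmix hc₀ (θ := 1 / Lg) (C := CR) (by positivity)
    ((div_le_one hL0).2 hL1) hR1 k le_rfl ?_ ?_ ?_
  · -- the fluctuations of the noise covariance
    rw [mul_assoc 2 (m.n : ℝ), hnpT]
    calc 2 * (m.p k * x) * (m.p k * A + Vt)
        ≤ 2 * (m.p k * x) * (m.p k * (A' * (ψ ^ 2 * x)) + m.p k * (B * (ψ ^ 2 * x))) := by
          gcongr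
          exact hVt.trans (le_mul_of_one_le_left (by positivity) hp1)
      _ = (m.p k * x) ^ 2 * (2 * (A' + B) * ψ ^ 2) := by ring
      _ ≤ (m.p k * x) ^ 2 * (C ^ 2 * ψ ^ 2) := by gcongr
      _ = _ := by ring
  · -- the fluctuations after a projection
    have hq : (Real.sqrt x)⁻¹ ^ 2 + (ψ / Real.sqrt m.pTot) ^ 2 ≤
        ((Real.sqrt x)⁻¹ + ψ / Real.sqrt m.pTot) ^ 2 := by
      have : 0 ≤ (Real.sqrt x)⁻¹ * (ψ / Real.sqrt m.pTot) := by positivity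
      nlinarith
    rw [hsqx, div_pow, Real.sq_sqrt hpT.le] at hq
    have hxn : (m.n : ℝ) ≤ x := by
      rw [hx, np]; exact le_mul_of_one_le_right hn0.le hpe
    change _ ≤ (m.n * m.pTot) ^ 2 * (C * ((Real.sqrt x)⁻¹ + ψ / Real.sqrt m.pTot)) ^ 2
    rw [mul_pow C]
    have e1 : (m.n : ℝ) * m.p k * (m.p k * A) ≤ A * ((m.n * m.pTot) ^ 2 * x⁻¹) := by
      rw [hnpT]
      calc (m.n : ℝ) * m.p k * (m.p k * A) ≤ x * m.p k * (m.p k * A) := by gcongr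
        _ = A * ((m.p k * x) ^ 2 * x⁻¹) := by field_simp
    have e2 : (m.n : ℝ) * m.p k * Vt ≤ B * ((m.n * m.pTot) ^ 2 * (ψ ^ 2 / m.pTot)) := by
      calc (m.n : ℝ) * m.p k * Vt ≤ m.n * m.p k * (B * (ψ ^ 2 * x)) := by gcongr
        _ = B * (m.n * (m.p k * x) * ψ ^ 2) := by ring
        _ = B * (m.n * (m.n * m.pTot) * ψ ^ 2) := by rw [hnpT]
        _ = _ := by field_simp
    have hx' : 0 ≤ (m.n * m.pTot) ^ 2 * x⁻¹ := by positivity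
    have hy' : 0 ≤ (m.n * m.pTot) ^ 2 * (ψ ^ 2 / m.pTot) := by positivity
    calc 2 * (m.n : ℝ) * m.p k * (m.p k * A + Vt) * Fintype.card (OtherIndex r k)
        = 2 * (m.n * m.p k * (m.p k * A) + m.n * m.p k * Vt) * Fintype.card (OtherIndex r k) := by
          ring
      _ ≤ 2 * (A * ((m.n * m.pTot) ^ 2 * x⁻¹) + B * ((m.n * m.pTot) ^ 2 * (ψ ^ 2 / m.pTot))) * R := by
          gcongr
      _ ≤ 2 * ((A + B) * ((m.n * m.pTot) ^ 2 * x⁻¹) +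
          (A + B) * ((m.n * m.pTot) ^ 2 * (ψ ^ 2 / m.pTot))) * R := by
          gcongr <;> linarith
      _ = (m.n * m.pTot) ^ 2 * ((2 * (A + B) * R) * (x⁻¹ + ψ ^ 2 / m.pTot)) := by ring
      _ ≤ (m.n * m.pTot) ^ 2 * (C ^ 2 * ((Real.sqrt x)⁻¹ + ψ / Real.sqrt m.pTot) ^ 2) := by
          gcongr
  -- Over all pairs of sites, the distinct ones produce the `1 / n` and the diagonal ones the `ψ² /
  -- p_k`.
  · have hq : (Real.sqrt m.n)⁻¹ ^ 2 + (ψ / Real.sqrt (m.p k)) ^ 2 ≤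
        ((Real.sqrt m.n)⁻¹ + ψ / Real.sqrt (m.p k)) ^ 2 := by
      have : 0 ≤ (Real.sqrt m.n)⁻¹ * (ψ / Real.sqrt (m.p k)) := by positivity
      nlinarith
    rw [inv_pow, Real.sq_sqrt hn0.le, div_pow, Real.sq_sqrt hp0.le] at hq
    change _ ≤ (m.n * m.pTot) ^ 2 * (C * ((Real.sqrt m.n)⁻¹ + ψ / Real.sqrt (m.p k))) ^ 2
    rw [mul_pow C]
    have e1 : m.n * m.pTot * (m.pTot * A) = A * ((m.n * m.pTot) ^ 2 * (m.n : ℝ)⁻¹) := by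
      field_simp
    have e2 : m.n * m.pTot * Vt ≤ B * ((m.n * m.pTot) ^ 2 * (ψ ^ 2 / m.p k)) := by
      calc m.n * m.pTot * Vt ≤ m.n * m.pTot * (B * (ψ ^ 2 * x)) := by gcongr
        _ = B * ((m.n * m.pTot) * (m.p k * x) * (ψ ^ 2 / m.p k)) := by field_simp
        _ = _ := by rw [← hnpT]; ring
    have hx' : 0 ≤ (m.n * m.pTot) ^ 2 * (m.n : ℝ)⁻¹ := by positivity
    have hy' : 0 ≤ (m.n * m.pTot) ^ 2 * (ψ ^ 2 / m.p k) := by positivity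
    calc m.n * m.pTot * (m.pTot * A + Vt) = m.n * m.pTot * (m.pTot * A) + m.n * m.pTot * Vt := by ring
      _ ≤ A * ((m.n * m.pTot) ^ 2 * (m.n : ℝ)⁻¹) + B * ((m.n * m.pTot) ^ 2 * (ψ ^ 2 / m.p k)) := by
          rw [e1]; gcongr
      _ ≤ (A + B) * ((m.n * m.pTot) ^ 2 * (m.n : ℝ)⁻¹) +
          (A + B) * ((m.n * m.pTot) ^ 2 * (ψ ^ 2 / m.p k)) := by
          gcongr <;> linarith
      _ = (m.n * m.pTot) ^ 2 * ((A + B) * ((m.n : ℝ)⁻¹ + ψ ^ 2 / m.p k)) := by ring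
      _ ≤ _ := by gcongr

end Constants

end

end TensorFactorModel

/-! ### Noise bounds in terms of the rates: random fields. -/

namespace TensorFactorModel

noncomputable section

section Constants

variable {K : ℕ} {ε ω c₀ c₁ c₂ : ℝ} (hε : 0 < ε) (hε1 : ε < 1) (hω : 0 < ω)
include hε hε1 hω

set_option maxHeartbeats 1000000 in
-- A kernel sum over `K - 1` modes and time costs `log^K`, which is exactly the logarithmic factor
-- in `ψ`. The sum of all squared covariances also runs over mode `k` and costs one logarithm more,
-- which is the extra one in `totalRate`.
theorem exists_noiseBounds_field (r : Fin K → ℕ) (hc₀ : 0 < c₀) (hc₂ : 0 < c₂) :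
    ∃ C₁ C : ℝ, 0 < C₁ ∧ 0 < C ∧ ∀ {Ω : Type*} [MeasurableSpace Ω] (m : TensorFactorModel K r Ω)
      (τ : Fin K → ℝ), m.Regime .randomField ε ω c₁ c₂ τ → m.FieldMixing c₀ →
      ∀ k, m.NoiseSetup ε ω (τ k) → m.NoiseBounds (τ k) k C₁ (C * m.psi .randomField ε ω k)
        (C * m.fluctRate .randomField ε ω k) (C * m.totalRate .randomField ε ω k) := by
  obtain ⟨CV, hCV, hV⟩ := exists_fourthBound_le hε hω hε1 hc₂
  obtain ⟨CR, hCR, hR⟩ := exists_mixRatio_le hε hω hc₂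
  set A : ℝ := 20 * ω ^ 4 * (1 + 2 / (ε / 4 * c₀)) with hA
  have hA0 : 0 < A := by positivity
  set B₁ : ℝ := 8 * CV * CR * (1 + 2 * K / c₀) ^ K / ω ^ 4 with hB₁
  have hB₁0 : 0 < B₁ := by positivity
  set B₂ : ℝ := 4 * CV * CR * (1 + 2 * (K + 1) / c₀) ^ (K + 1) / ω ^ 4 with hB₂
  have hB₂0 : 0 < B₂ := by positivity
  set R : ℝ := ∑ k, (Fintype.card (OtherIndex r k) : ℝ) with hRdef
  have hR0 : 0 ≤ R := Finset.sum_nonneg fun _ _ => Nat.cast_nonneg _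
  obtain ⟨C, hC⟩ : ∃ C : ℝ, C = 1 + B₁ + B₁ * R + A + B₂ := ⟨_, rfl⟩
  have hBR : 0 ≤ B₁ * R := by positivity
  have hC1 : 1 ≤ C := by linarith
  have hCC : C ≤ C ^ 2 := by nlinarith
  refine ⟨10 * ω ^ 2 * (1 + 2 * (K + 1) / (ε / 4 * c₀)) ^ (K + 1), C, by positivity, by linarith,
    fun {Ω} _ m τ hreg hmix k hset => ?_⟩
  set x := m.np k with hx
  set Lg := Real.log (m.n * m.pTot) with hLg
  have hL1 : 1 ≤ Lg := hreg.one_le_log_all k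
  have hL0 : 0 < Lg := by linarith
  have hx0 : 0 < x := hreg.np_pos k
  have hpT := hreg.pTot_pos
  have hn1 := hreg.one_le_n
  have hn0 : (0 : ℝ) < m.n := by linarith
  have hp1 := hreg.one_le_p k
  have hp0 : (0 : ℝ) < m.p k := by linarith
  set ψ := m.psi .randomField ε ω k with hψ
  have hψ0 : 0 < ψ := hreg.psi_pos hω k
  have hψe : ψ = ω ^ 2 * (x / Lg ^ K) ^ (-(ε / (1 + ε))) := hreg.psi_eq k
  have hu : 1 ≤ x / Lg ^ K := hreg.ratio k
  have hτ : τ k ≤ c₂ * (ω * (x / Lg ^ K) ^ (1 / (2 + 2 * ε))) := hreg.tau_le k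
  have hV1 := hV _ _ hu hset.τ_pos hτ
  have hR1 := hR (x / Lg ^ K) (τ k) Lg hu hset.τ_pos hτ
    (by
      rw [hLg, Real.exp_log (by positivity)]
      exact (div_le_self hx0.le (one_le_pow₀ hL1)).trans (hreg.np_le k)) hL1
  have hgeo : ∀ a : ℝ, 0 ≤ a → 1 + a / (c₀ * (1 / Lg)) ≤ (1 + a / c₀) * Lg := fun a ha => by
    have : a / (c₀ * (1 / Lg)) = a / c₀ * Lg := by field_simp
    rw [this, add_mul, one_mul]
    linarith
  have hV0 := hset.fourthBound_nonneg
  have hVt₁ : 8 * fourthBound ε ω (τ k) * CR * (1 + 2 * K / (c₀ * (1 / Lg))) ^ K ≤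
      B₁ * (ψ ^ 2 * x) := by
    calc _ ≤ 8 * (CV * (x / Lg ^ K * ((x / Lg ^ K) ^ (-(ε / (1 + ε)))) ^ 2)) * CR *
          ((1 + 2 * K / c₀) * Lg) ^ K := by
          gcongr
          exact hgeo _ (by positivity)
      _ = B₁ * (ψ ^ 2 * x) := by rw [hB₁, hψe, mul_pow]; field_simp
  have hVt₂ : 4 * fourthBound ε ω (τ k) * CR * (1 + 2 * (K + 1) / (c₀ * (1 / Lg))) ^ (K + 1) ≤
      B₂ * (ψ ^ 2 * x * Lg) := by
    calc _ ≤ 4 * (CV * (x / Lg ^ K * ((x / Lg ^ K) ^ (-(ε / (1 + ε)))) ^ 2)) * CR *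
          ((1 + 2 * (K + 1) / c₀) * Lg) ^ (K + 1) := by
          gcongr
          exact hgeo _ (by positivity)
      _ = B₂ * (ψ ^ 2 * x * Lg) := by rw [hB₂, hψe, mul_pow, pow_succ Lg]; field_simp
  have hnpT := Regime.n_mul_pTot (m := m) k
  have hRk : (Fintype.card (OtherIndex r k) : ℝ) ≤ R :=
    Finset.single_le_sum (f := fun k => (Fintype.card (OtherIndex r k) : ℝ))
      (fun _ _ => Nat.cast_nonneg _) (Finset.mem_univ k)
  have hν : m.n * m.pTot * m.p k *
      (8 * fourthBound ε ω (τ k) * CR * (1 + 2 * K / (c₀ * (1 / Lg))) ^ K) ≤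
      (m.n * m.pTot) ^ 2 * (B₁ * ψ ^ 2) := by
    calc _ ≤ m.n * m.pTot * m.p k * (B₁ * (ψ ^ 2 * x)) := by gcongr
      _ = m.n * m.pTot * (m.p k * x) * (B₁ * ψ ^ 2) := by ring
      _ = _ := by rw [← hnpT]; ring
  refine hset.noiseBounds_field hmix hc₀ (θ := 1 / Lg) (C := CR) (by positivity)
    ((div_le_one hL0).2 hL1) hR1 k le_rfl ?_ ?_ ?_
  · refine hν.trans ?_
    rw [mul_pow C]
    gcongr
    linarith
  · change _ ≤ (m.n * m.pTot) ^ 2 * (C * ψ) ^ 2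
    calc _ ≤ (m.n * m.pTot) ^ 2 * (B₁ * ψ ^ 2) * R := by gcongr
      _ = (m.n * m.pTot) ^ 2 * (B₁ * R * ψ ^ 2) := by ring
      _ ≤ (m.n * m.pTot) ^ 2 * (C ^ 2 * ψ ^ 2) := by gcongr; linarith
      _ = _ := by ring
  · have hq : (Real.sqrt m.n)⁻¹ ^ 2 + (ψ * Real.sqrt (Lg / m.p k)) ^ 2 ≤
        ((Real.sqrt m.n)⁻¹ + ψ * Real.sqrt (Lg / m.p k)) ^ 2 := by
      have : 0 ≤ (Real.sqrt m.n)⁻¹ * (ψ * Real.sqrt (Lg / m.p k)) := by positivity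
      nlinarith
    rw [inv_pow, Real.sq_sqrt hn0.le, mul_pow, Real.sq_sqrt (by positivity)] at hq
    change _ ≤ (m.n * m.pTot) ^ 2 * (C * ((Real.sqrt m.n)⁻¹ + ψ * Real.sqrt (Lg / m.p k))) ^ 2
    rw [mul_pow C]
    have e1 : m.n * m.pTot * (m.pTot * A) = A * ((m.n * m.pTot) ^ 2 * (m.n : ℝ)⁻¹) := by
      field_simp
    have e2 : m.n * m.pTot * (B₂ * (ψ ^ 2 * x * Lg)) =
        B₂ * ((m.n * m.pTot) ^ 2 * (ψ ^ 2 * (Lg / m.p k))) := by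
      calc m.n * m.pTot * (B₂ * (ψ ^ 2 * x * Lg))
          = B₂ * ((m.n * m.pTot) * (m.p k * x) * (ψ ^ 2 * (Lg / m.p k))) := by field_simp
        _ = _ := by rw [← hnpT]; ring
    have hx' : 0 ≤ (m.n * m.pTot) ^ 2 * (m.n : ℝ)⁻¹ := by positivity
    have hy' : 0 ≤ (m.n * m.pTot) ^ 2 * (ψ ^ 2 * (Lg / m.p k)) := by positivity
    calc _ ≤ m.n * m.pTot * (B₂ * (ψ ^ 2 * x * Lg) + m.pTot * A) := by gcongr
      _ = B₂ * ((m.n * m.pTot) ^ 2 * (ψ ^ 2 * (Lg / m.p k))) +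
          A * ((m.n * m.pTot) ^ 2 * (m.n : ℝ)⁻¹) := by rw [mul_add, e1, e2]
      _ ≤ C * ((m.n * m.pTot) ^ 2 * (ψ ^ 2 * (Lg / m.p k))) +
          C * ((m.n * m.pTot) ^ 2 * (m.n : ℝ)⁻¹) := by
          gcongr <;> linarith
      _ = (m.n * m.pTot) ^ 2 * (C * ((m.n : ℝ)⁻¹ + ψ ^ 2 * (Lg / m.p k))) := by ring
      _ ≤ _ := by gcongr

theorem exists_noiseBounds (s : DependenceSetting) (r : Fin K → ℕ) (hc₀ : 0 < c₀) (hc₂ : 0 < c₂) :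
    ∃ C₁ C : ℝ, 0 < C₁ ∧ 0 < C ∧ ∀ {Ω : Type*} [MeasurableSpace Ω] (m : TensorFactorModel K r Ω)
      (τ : Fin K → ℝ), m.Regime s ε ω c₁ c₂ τ → m.Mixing s c₀ →
      ∀ k, m.NoiseSetup ε ω (τ k) → m.NoiseBounds (τ k) k C₁ (C * m.psi s ε ω k)
        (C * m.fluctRate s ε ω k) (C * m.totalRate s ε ω k) := by
  cases s with
  | independent => exact exists_noiseBounds_series hε hε1 hω r hc₀ hc₂
  | randomField => exact exists_noiseBounds_field hε hε1 hω r hc₀ hc₂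

end Constants

end

end TensorFactorModel

/-! ### Comparison of the derived rate with the stated one. -/

namespace TensorFactorModel

noncomputable section

/-- A negative power of an almost exponentially large quantity beats a square root. -/
theorem exists_rpow_neg_mul_sqrt_le (N : ℕ) {γ c : ℝ} (hγ : 0 < γ) (hc : 0 < c) :
    ∃ C : ℝ, 0 < C ∧ ∀ x y : ℝ, 1 ≤ x → Real.exp (c * x) / x ^ N ≤ y →
      y ^ (-γ) * Real.sqrt x ≤ C * Real.exp (-(γ * c / 2 * x)) := by
  obtain ⟨C, hC, h⟩ := exists_rpow_le_exp (N * γ + 1 / 2) (by positivity : 0 < γ * c / 2)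
  refine ⟨C, hC, fun x y hx hy => ?_⟩
  have hx0 : 0 < x := by linarith
  have h1 : y ^ (-γ) ≤ Real.exp (-(γ * c * x)) * x ^ (N * γ) := by
    refine (Real.rpow_le_rpow_of_nonpos (by positivity) hy (by linarith)).trans (le_of_eq ?_)
    rw [Real.div_rpow (Real.exp_pos _).le (by positivity), ← Real.exp_mul,
      Real.rpow_neg (by positivity : (0 : ℝ) ≤ x ^ N), div_inv_eq_mul, ← Real.rpow_natCast,
      ← Real.rpow_mul hx0.le]
    congr 2
    ring
  calc y ^ (-γ) * Real.sqrt x ≤ Real.exp (-(γ * c * x)) * x ^ (N * γ) * x ^ (1 / 2 : ℝ) := by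
        rw [Real.sqrt_eq_rpow]; gcongr
    _ = Real.exp (-(γ * c * x)) * x ^ (N * γ + 1 / 2) := by rw [mul_assoc, ← Real.rpow_add hx0]
    _ ≤ Real.exp (-(γ * c * x)) * (C * Real.exp (γ * c / 2 * x)) := by gcongr; exact h x hx
    _ = C * (Real.exp (-(γ * c * x)) * Real.exp (γ * c / 2 * x)) := by ring
    _ = _ := by rw [← Real.exp_add]; congr 2; ring

section Constants

variable {K : ℕ} {r : Fin K → ℕ} {ε ω c₁ : ℝ} (hε : 0 < ε) (hε1 : ε < 1) (hω : 0 < ω)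

include hε hω in
theorem exists_biasBound_le_psi (r : Fin K → ℕ) (hc₁ : 0 < c₁) :
    ∃ C : ℝ, 0 < C ∧ ∀ {Ω : Type*} [MeasurableSpace Ω]
      (m : TensorFactorModel K r Ω) (s : DependenceSetting) (c₂ : ℝ)
      (τ : Fin K → ℝ), m.Regime s ε ω c₁ c₂ τ → ∀ l, biasBound ε ω (τ l) ≤ C * m.psi s ε ω l := by
  obtain ⟨C, hC, h⟩ := exists_biasBound_le hε hω hc₁
  refine ⟨C / ω ^ 2, by positivity, fun m s c₂ τ hreg l => ?_⟩
  refine (h _ _ (hreg.ratio l) (hreg.tau_ge l)).trans ?_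
  refine (mul_le_mul_of_nonneg_left (rpow_bias_le hε (hreg.ratio l)) hC.le).trans (le_of_eq ?_)
  rw [hreg.psi_eq]
  field_simp

include hε hω in
theorem exists_biasBound_le_inv_sqrt (r : Fin K → ℕ) (hc₁ : 0 < c₁) :
    ∃ C : ℝ, 0 < C ∧ ∀ {Ω : Type*} [MeasurableSpace Ω]
      (m : TensorFactorModel K r Ω) (c₂ : ℝ)
      (τ : Fin K → ℝ), m.Regime .independent ε ω c₁ c₂ τ →
      ∀ l, biasBound ε ω (τ l) ≤ C * (Real.sqrt (m.np l))⁻¹ := by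
  obtain ⟨C, hC, h⟩ := exists_biasBound_le hε hω hc₁
  obtain ⟨C', hC', h'⟩ := exists_rpow_bias_le hε
  refine ⟨C * C', by positivity, fun m c₂ τ hreg l => ?_⟩
  refine (h _ _ (hreg.ratio l) (hreg.tau_ge l)).trans ?_
  rw [mul_assoc]
  exact mul_le_mul_of_nonneg_left (h' _ (hreg.np_pos l) (hreg.one_le_log l)) hC.le

/-- The upper bound for the estimation error of the first iteration, up to constants. -/
def lossRate {Ω : Type*} [MeasurableSpace Ω] (m : TensorFactorModel K r Ω)
    (s : DependenceSetting) (ε ω C : ℝ) (τ : Fin K → ℝ) (k : Fin K) : ℝ :=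
  (Real.sqrt (m.np k))⁻¹ + biasBound ε ω (τ k) + 1 / m.pTot + C * m.fluctRate s ε ω k +
    (∑ l ∈ Finset.univ.erase k,
      ((Real.sqrt (m.np l))⁻¹ + C * m.psi s ε ω l + biasBound ε ω (τ l))) *
      ((Real.sqrt m.n)⁻¹ + C * m.totalRate s ε ω k)

include hε hε1 hω in
theorem exists_sum_erase_le (r : Fin K → ℕ) (hc₁ : 0 < c₁) {C : ℝ} (hC : 0 < C) :
    ∃ D : ℝ, 0 < D ∧ ∀ {Ω : Type*} [MeasurableSpace Ω]
      (m : TensorFactorModel K r Ω) (s : DependenceSetting) (c₂ : ℝ)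
      (τ : Fin K → ℝ), m.Regime s ε ω c₁ c₂ τ → ∀ k,
      ∑ l ∈ Finset.univ.erase k,
        ((Real.sqrt (m.np l))⁻¹ + C * m.psi s ε ω l + biasBound ε ω (τ l)) ≤
        D * m.psiBarExcept s ε ω k := by
  obtain ⟨Cb, hCb, h⟩ := exists_biasBound_le_psi hε hω r hc₁
  refine ⟨(ω ^ 2)⁻¹ + C + Cb, by positivity, fun m s c₂ τ hreg k => ?_⟩
  rw [psiBarExcept, Finset.mul_sum]
  refine Finset.sum_le_sum fun l _ => ?_
  have h1 := hreg.inv_sqrt_np_le hε hε1 hω l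
  have h2 := h m s c₂ τ hreg l
  linarith

theorem Regime.psiBarExcept_nonneg {Ω : Type*} [MeasurableSpace Ω] {m : TensorFactorModel K r Ω}
    {s : DependenceSetting} {c₂ : ℝ} {τ : Fin K → ℝ} (h : m.Regime s ε ω c₁ c₂ τ)
    (hω : 0 < ω) (k : Fin K) : 0 ≤ m.psiBarExcept s ε ω k :=
  Finset.sum_nonneg fun l _ => (h.psi_pos hω l).le

include hε in
/-- For random fields, the largest fluctuations are negligible in the product with the error of
the initial estimators. -/
theorem exists_psiBarExcept_mul_le (r : Fin K → ℕ) (hω : 0 < ω) :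
    ∃ C : ℝ, 0 < C ∧ ∀ {Ω : Type*} [MeasurableSpace Ω]
      (m : TensorFactorModel K r Ω) (c₂ : ℝ)
      (τ : Fin K → ℝ), m.Regime .randomField ε ω c₁ c₂ τ → ∀ k,
      m.psiBarExcept .randomField ε ω k * (m.psi .randomField ε ω k *
        Real.sqrt (Real.log (m.n * m.pTot) / m.p k)) ≤
      C * (m.psi .randomField ε ω k + m.psiBarExcept .randomField ε ω k / Real.sqrt m.n) := by
  obtain ⟨γ, hγ⟩ : ∃ γ : ℝ, γ = ε / (1 + ε) := ⟨_, rfl⟩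
  have hγ0 : 0 < γ := by rw [hγ]; positivity
  obtain ⟨D₁, hD₁, h₁⟩ := exists_rpow_neg_mul_sqrt_le K hγ0 hγ0
  obtain ⟨D₂, hD₂, h₂⟩ := exists_rpow_neg_mul_sqrt_le (K + 1) hγ0 one_pos
  refine ⟨K * ω ^ 2 + K * (ω ^ 2 * D₁) + ω ^ 2 * D₂, by positivity,
    fun m c₂ τ hreg k => ?_⟩
  obtain ⟨x, hx⟩ : ∃ x : ℝ, x = Real.log (m.n * m.pTot) := ⟨_, rfl⟩
  have hx1 : 1 ≤ x := hx ▸ hreg.one_le_log_all k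
  have hx0 : 0 < x := by linarith
  have hn1 := hreg.one_le_n
  have hn0 : (0 : ℝ) < m.n := by linarith
  have hp1 := hreg.one_le_p k
  have hp0 : (0 : ℝ) < m.p k := by linarith
  have hψ := hreg.psi_pos hω
  have hB := hreg.psiBarExcept_nonneg hω k
  set ψ := m.psi .randomField ε ω k with hψdef
  set B := m.psiBarExcept .randomField ε ω k with hBdef
  have hexp : Real.exp x = m.n * m.pTot := by
    rw [hx, Real.exp_log (mul_pos hn0 hreg.pTot_pos)]
  have hψe : ∀ l, m.psi .randomField ε ω l = ω ^ 2 * (m.np l / x ^ K) ^ (-γ) := fun l => by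
    rw [hγ, hx]; exact hreg.psi_eq l
  have hBn : 0 ≤ B / Real.sqrt m.n := by positivity
  have hψ0 : 0 < ψ := hψ k
  have hsum : ∀ c : ℝ, 0 ≤ c → (∀ l, m.psi .randomField ε ω l ≤ c) → B ≤ K * c := fun c hc hl => by
    calc B ≤ ∑ l ∈ Finset.univ.erase k, c := Finset.sum_le_sum fun l _ => hl l
      _ ≤ ∑ l : Fin K, c :=
          Finset.sum_le_sum_of_subset_of_nonneg (Finset.erase_subset _ _) fun _ _ _ => hc
      _ = K * c := by simp
  rw [← hx, Real.sqrt_div hx0.le]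
  have hsp : 1 ≤ Real.sqrt (m.p k) := Real.one_le_sqrt.2 hp1
  have hsx : 0 ≤ Real.sqrt x := Real.sqrt_nonneg x
  -- Three regimes, with `x = log(n p)`. If `p_k ≥ x`, the extra root is at most `1`. If `p_k < x`
  -- but `log n ≥ γ x`, every `ψ⁽ˡ⁾` is exponentially small in `x` and beats `√x`. Otherwise `ψ⁽ᵏ⁾`
  -- itself is small enough.
  rcases le_total x (m.p k) with hxp | hxp
  · have h3 : Real.sqrt x / Real.sqrt (m.p k) ≤ 1 :=
      (div_le_one (by positivity)).2 (Real.sqrt_le_sqrt hxp)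
    calc B * (ψ * (Real.sqrt x / Real.sqrt (m.p k))) ≤ K * ω ^ 2 * (ψ * 1) := by
          gcongr
          exact hsum _ (sq_nonneg _) fun l => hreg.psi_le hε l
      _ ≤ (K * ω ^ 2 + K * (ω ^ 2 * D₁) + ω ^ 2 * D₂) * (ψ + B / Real.sqrt m.n) := by
          gcongr
          · have : 0 ≤ K * (ω ^ 2 * D₁) + ω ^ 2 * D₂ := by positivity
            linarith
          · linarith
  · have hdiv : Real.sqrt x / Real.sqrt (m.p k) ≤ Real.sqrt x := div_le_self hsx hsp
    rcases le_total (γ * x) (Real.log m.n) with hxn | hxn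
    · have h3 : ∀ l, m.psi .randomField ε ω l ≤ ω ^ 2 * D₁ / Real.sqrt x := fun l => by
        rw [le_div_iff₀ (by positivity), hψe, mul_assoc]
        gcongr
        have hnp : Real.exp (γ * x) ≤ m.np l := by
          calc Real.exp (γ * x) ≤ Real.exp (Real.log m.n) := Real.exp_le_exp.2 hxn
            _ = m.n := Real.exp_log hn0
            _ ≤ _ := le_mul_of_one_le_right hn0.le (hreg.one_le_except l)
        refine (h₁ x _ hx1 (div_le_div_of_nonneg_right hnp (by positivity))).trans ?_
        refine mul_le_of_le_one_right hD₁.le (Real.exp_le_one_iff.2 ?_)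
        have : 0 ≤ γ * γ / 2 * x := by positivity
        linarith
      calc B * (ψ * (Real.sqrt x / Real.sqrt (m.p k)))
          ≤ K * (ω ^ 2 * D₁ / Real.sqrt x) * (ψ * Real.sqrt x) := by
            gcongr
            exact hsum _ (by positivity) h3
        _ = K * (ω ^ 2 * D₁) * ψ := by field_simp
        _ ≤ (K * ω ^ 2 + K * (ω ^ 2 * D₁) + ω ^ 2 * D₂) * (ψ + B / Real.sqrt m.n) := by
            gcongr
            · have : 0 ≤ K * ω ^ 2 := by positivity
              have : 0 ≤ ω ^ 2 * D₂ := by positivity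
              linarith
            · linarith
    -- As `p_k ≤ x`, the product `n p₋ₖ = e^x / p_k` is nearly `e^x`. Hence `ψ √x` is at most of
    -- order `e^(-γ x / 2)`, which is at most `1 / √n` because `log n ≤ γ x`.
    · have hnp : Real.exp (1 * x) / x ^ (K + 1) ≤ m.np k / x ^ K := by
        rw [one_mul, hexp, Regime.n_mul_pTot k, pow_succ, div_le_div_iff₀ (by positivity)
          (by positivity)]
        have := hreg.np_pos k
        calc m.p k * m.np k * x ^ K ≤ x * m.np k * x ^ K := by gcongr
          _ = _ := by ring
      have h3 := h₂ x _ hx1 hnp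
      have h4 : Real.exp (-(γ * 1 / 2 * x)) ≤ (Real.sqrt m.n)⁻¹ := by
        rw [Real.sqrt_eq_rpow, ← Real.rpow_neg hn0.le, Real.rpow_def_of_pos hn0]
        exact Real.exp_le_exp.2 (by linarith)
      have h5 : ψ * Real.sqrt x ≤ ω ^ 2 * D₂ * (Real.sqrt m.n)⁻¹ := by
        rw [hψdef, hψe, mul_assoc, mul_assoc]
        exact mul_le_mul_of_nonneg_left (h3.trans (mul_le_mul_of_nonneg_left h4 hD₂.le))
          (sq_nonneg _)
      calc B * (ψ * (Real.sqrt x / Real.sqrt (m.p k)))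
          ≤ B * (ω ^ 2 * D₂ * (Real.sqrt m.n)⁻¹) :=
            mul_le_mul_of_nonneg_left ((mul_le_mul_of_nonneg_left hdiv hψ0.le).trans h5) hB
        _ = ω ^ 2 * D₂ * (B / Real.sqrt m.n) := by ring
        _ ≤ (K * ω ^ 2 + K * (ω ^ 2 * D₁) + ω ^ 2 * D₂) * (ψ + B / Real.sqrt m.n) := by
            gcongr
            · have : 0 ≤ K * ω ^ 2 + K * (ω ^ 2 * D₁) := by positivity
              linarith
            · linarith

include hε hε1 hω

/-- Each summand is matched with a term of the maximum; `M^(1-ε)` enters only through a positive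
lower bound. For independent series the bias is below `1 / √(n p₋ₖ)`; for random fields it is only
compared with `ψ`, which is present in the rate anyway. -/
theorem exists_lossRate_le (r : Fin K → ℕ) (s : DependenceSetting) (hc₁ : 0 < c₁) {C a : ℝ}
    (hC : 0 < C) (ha : 0 < a) :
    ∃ C' : ℝ, 0 < C' ∧ ∀ {Ω : Type*} [MeasurableSpace Ω]
      (m : TensorFactorModel K r Ω) (c₂ M : ℝ)
      (τ : Fin K → ℝ), m.Regime s ε ω c₁ c₂ τ → 1 ≤ a * M ^ (1 - ε) → ∀ k,
      m.lossRate s ε ω C τ k ≤ C' * m.firstIterationRate s ε ω M k := by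
  obtain ⟨D, hD, hsum⟩ := exists_sum_erase_le hε hε1 hω r hc₁ hC
  cases s with
  | independent =>
    obtain ⟨Cb, hCb, hb⟩ := exists_biasBound_le_inv_sqrt hε hω r hc₁
    refine ⟨a + Cb * a + 1 + C * (a + 1) + D * ((1 + C) * (a + 1)), by positivity,
      fun m c₂ M τ hreg hM k => ?_⟩
    have hs := hsum m .independent c₂ τ hreg k
    have hb' := hb m c₂ τ hreg k
    have hψ0 := hreg.psi_pos hω
    have hB := hreg.psiBarExcept_nonneg hω k
    have hpT := hreg.pTot_pos
    set y := M ^ (1 - ε) with hy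
    set ψ := m.psi .independent ε ω k with hψ
    set B := m.psiBarExcept .independent ε ω k with hBdef
    set Rt := m.firstIterationRate .independent ε ω M k with hRt
    have h1 : y / Real.sqrt (m.np k) ≤ Rt :=
      (le_max_left _ _).trans ((le_max_left _ _).trans (le_max_left _ _))
    have h2 : 1 / m.pTot ≤ Rt :=
      (le_max_right _ _).trans ((le_max_left _ _).trans (le_max_left _ _))
    have h3 : B * (ψ / Real.sqrt (m.p k) + y / Real.sqrt m.n) ≤ Rt :=
      (le_max_right _ _).trans (le_max_left _ _)
    have h4 : m.psiBar .independent ε ω / Real.sqrt m.pTot ≤ Rt := le_max_right _ _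
    have hψB : ψ / Real.sqrt m.pTot ≤ Rt := by
      refine le_trans ?_ h4
      gcongr
      exact Finset.single_le_sum (fun l _ => (hψ0 l).le) (Finset.mem_univ k)
    have hy0 : 0 < y := by
      by_contra hneg
      have := mul_nonpos_of_nonneg_of_nonpos ha.le (not_lt.1 hneg)
      linarith
    have hη : (Real.sqrt (m.np k))⁻¹ ≤ a * Rt := by
      calc (Real.sqrt (m.np k))⁻¹ ≤ a * y * (Real.sqrt (m.np k))⁻¹ :=
            le_mul_of_one_le_left (by positivity) hM
        _ = a * (y / Real.sqrt (m.np k)) := by ring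
        _ ≤ _ := by gcongr
    have hψk : 0 < ψ := hψ0 k
    have hprod : D * B * ((Real.sqrt m.n)⁻¹ + C * ((Real.sqrt m.n)⁻¹ + ψ / Real.sqrt (m.p k))) ≤
        D * ((1 + C) * (a + 1)) * Rt := by
      have e1 : (Real.sqrt m.n)⁻¹ ≤ (a + 1) * (y / Real.sqrt m.n) := by
        calc (Real.sqrt m.n)⁻¹ ≤ a * y * (Real.sqrt m.n)⁻¹ :=
              le_mul_of_one_le_left (by positivity) hM
          _ ≤ (a + 1) * y * (Real.sqrt m.n)⁻¹ := by gcongr; linarith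
          _ = _ := by ring
      have e2 : ψ / Real.sqrt (m.p k) ≤ (a + 1) * (ψ / Real.sqrt (m.p k)) :=
        le_mul_of_one_le_left (by positivity) (by linarith)
      have e3 : (Real.sqrt m.n)⁻¹ + C * ((Real.sqrt m.n)⁻¹ + ψ / Real.sqrt (m.p k)) ≤
          (1 + C) * (a + 1) * (ψ / Real.sqrt (m.p k) + y / Real.sqrt m.n) := by
        have : 0 ≤ ψ / Real.sqrt (m.p k) := by positivity
        calc _ ≤ (1 + C) * ((Real.sqrt m.n)⁻¹ + ψ / Real.sqrt (m.p k)) := by linarith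
          _ ≤ (1 + C) * ((a + 1) * (y / Real.sqrt m.n) + (a + 1) * (ψ / Real.sqrt (m.p k))) := by
            gcongr
          _ = _ := by ring
      calc _ ≤ D * B * ((1 + C) * (a + 1) * (ψ / Real.sqrt (m.p k) + y / Real.sqrt m.n)) := by
            gcongr
        _ = D * ((1 + C) * (a + 1)) * (B * (ψ / Real.sqrt (m.p k) + y / Real.sqrt m.n)) := by ring
        _ ≤ _ := by gcongr
    have hprod' := (mul_le_mul_of_nonneg_right hs (by positivity : 0 ≤ (Real.sqrt m.n)⁻¹ +
      C * ((Real.sqrt m.n)⁻¹ + ψ / Real.sqrt (m.p k)))).trans hprod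
    have hbb : biasBound ε ω (τ k) ≤ Cb * (a * Rt) := hb'.trans (by gcongr)
    have hφ : C * ((Real.sqrt (m.np k))⁻¹ + ψ / Real.sqrt m.pTot) ≤ C * (a * Rt + Rt) := by gcongr
    calc m.lossRate .independent ε ω C τ k
        ≤ a * Rt + Cb * (a * Rt) + Rt + C * (a * Rt + Rt) + D * ((1 + C) * (a + 1)) * Rt := by
          unfold lossRate
          exact add_le_add (add_le_add (add_le_add (add_le_add hη hbb) h2) hφ) hprod'
      _ = _ := by ring
  | randomField =>
    obtain ⟨Cb, hCb, hb⟩ := exists_biasBound_le_psi hε hω r hc₁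
    obtain ⟨E, hE, he⟩ := exists_psiBarExcept_mul_le (c₁ := c₁) hε r hω
    refine ⟨a + Cb + 1 + C + D * ((1 + C) * a + C * (E * (1 + a))), by positivity,
      fun m c₂ M τ hreg hM k => ?_⟩
    have hs := hsum m .randomField c₂ τ hreg k
    have hb' := hb m .randomField c₂ τ hreg k
    have he' := he m c₂ τ hreg k
    have hψ0 := hreg.psi_pos hω
    have hB := hreg.psiBarExcept_nonneg hω k
    set y := M ^ (1 - ε) with hy
    set ψ := m.psi .randomField ε ω k with hψ
    set B := m.psiBarExcept .randomField ε ω k with hBdef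
    set Rt := m.firstIterationRate .randomField ε ω M k with hRt
    set q := Real.sqrt (Real.log (m.n * m.pTot) / m.p k) with hq
    have hq0 : 0 ≤ q := Real.sqrt_nonneg _
    have h1 : y / Real.sqrt (m.np k) ≤ Rt :=
      (le_max_left _ _).trans ((le_max_left _ _).trans (le_max_left _ _))
    have h2 : 1 / m.pTot ≤ Rt :=
      (le_max_right _ _).trans ((le_max_left _ _).trans (le_max_left _ _))
    have h3 : ψ ≤ Rt := (le_max_right _ _).trans (le_max_left _ _)
    have h4 : y * B / Real.sqrt m.n ≤ Rt := le_max_right _ _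
    have hη : (Real.sqrt (m.np k))⁻¹ ≤ a * Rt := by
      calc (Real.sqrt (m.np k))⁻¹ ≤ a * y * (Real.sqrt (m.np k))⁻¹ :=
            le_mul_of_one_le_left (by positivity) hM
        _ = a * (y / Real.sqrt (m.np k)) := by ring
        _ ≤ _ := by gcongr
    have hBn : B / Real.sqrt m.n ≤ a * Rt := by
      calc B / Real.sqrt m.n ≤ a * y * (B / Real.sqrt m.n) :=
            le_mul_of_one_le_left (by positivity) hM
        _ = a * (y * B / Real.sqrt m.n) := by ring
        _ ≤ _ := by gcongr
    have hψk : 0 < ψ := hψ0 k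
    have hprod : D * B * ((Real.sqrt m.n)⁻¹ + C * ((Real.sqrt m.n)⁻¹ + ψ * q)) ≤
        D * ((1 + C) * a + C * (E * (1 + a))) * Rt := by
      calc _ = D * ((1 + C) * (B / Real.sqrt m.n) + C * (B * (ψ * q))) := by ring
        _ ≤ D * ((1 + C) * (a * Rt) + C * (E * (Rt + a * Rt))) :=
          mul_le_mul_of_nonneg_left (add_le_add (mul_le_mul_of_nonneg_left hBn (by positivity))
            (mul_le_mul_of_nonneg_left (he'.trans (mul_le_mul_of_nonneg_left
              (add_le_add h3 hBn) hE.le)) hC.le)) hD.le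
        _ = _ := by ring
    have hprod' := (mul_le_mul_of_nonneg_right hs (by positivity : 0 ≤ (Real.sqrt m.n)⁻¹ +
      C * ((Real.sqrt m.n)⁻¹ + ψ * q))).trans hprod
    have hbb : biasBound ε ω (τ k) ≤ Cb * Rt := hb'.trans (by gcongr)
    have hφ : C * ψ ≤ C * Rt := by gcongr
    calc m.lossRate .randomField ε ω C τ k
        ≤ a * Rt + Cb * Rt + Rt + C * Rt + D * ((1 + C) * a + C * (E * (1 + a))) * Rt := by
          unfold lossRate
          exact add_le_add (add_le_add (add_le_add (add_le_add hη hbb) h2) hφ) hprod'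
      _ = _ := by ring

end Constants

end

end TensorFactorModel

/-! ### Limits of the rates and validity of the regime. -/

namespace TensorFactorModel

noncomputable section

section Common

variable {K : ℕ} {r : Fin K → ℕ} {Ω : Type*} [MeasurableSpace Ω] {m : TensorFactorModel K r Ω}

theorem abs_entry_le_tensorNorm {d : Fin K → ℕ} (X : Tensor d) (j : ∀ k, Fin (d k)) :
    |X j| ≤ tensorNorm X := by
  refine Real.abs_le_sqrt ?_
  exact Finset.single_le_sum (f := fun j => X j ^ 2) (fun _ _ => sq_nonneg _) (Finset.mem_univ j)

/-- The common component is of the order of the factors. -/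
theorem abs_tucker_le {lam : ℝ} (hload : m.LoadingAssumption lam) (F : Tensor r) (x : m.Site) :
    |tucker F m.Λ x| ≤ Fintype.card (∀ k, Fin (r k)) * |lam| ^ K * tensorNorm F := by
  unfold tucker
  calc _ ≤ ∑ j : (∀ k, Fin (r k)), |F j * ∏ k, m.Λ k (x k) (j k)| := Finset.abs_sum_le_sum_abs _ _
    _ ≤ ∑ j : (∀ k, Fin (r k)), tensorNorm F * |lam| ^ K := by
        refine Finset.sum_le_sum fun j _ => ?_
        rw [abs_mul, Finset.abs_prod]
        refine mul_le_mul (abs_entry_le_tensorNorm F j) ?_ (by positivity) (Real.sqrt_nonneg _)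
        refine (Finset.prod_le_prod (fun _ _ => abs_nonneg _)
          fun k _ => ((hload k).2 (x k) (j k)).trans (le_abs_self lam)).trans (le_of_eq ?_)
        rw [Finset.prod_const, Finset.card_univ, Fintype.card_fin]
    _ = _ := by
        rw [Finset.sum_const, Finset.card_univ, nsmul_eq_mul]; ring

theorem DependenceAssumption.mixing {s : DependenceSetting} {ε ω c₀ cε : ℝ}
    (h : m.DependenceAssumption s ε ω c₀ cε) : m.Mixing s c₀ := by
  cases s with
  | independent => exact ⟨h.1, h.2.1⟩
  | randomField => exact h.1

end Common

section Asymptotic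

variable {ι : Type*} {l : Filter ι} {K : ℕ} {r : Fin K → ℕ}
  {Ω : ι → Type*} [∀ i, MeasurableSpace (Ω i)] {𝓜 : ∀ i, TensorFactorModel K r (Ω i)}
  {s : DependenceSetting} {ε ω : ℝ} {M : ι → ℝ} {τ : ι → Fin K → ℝ}

theorem eventually_p_pos (hp : ∀ k, Tendsto (fun i => (𝓜 i).p k) l atTop) :
    ∀ᶠ i in l, ∀ k, 0 < (𝓜 i).p k :=
  eventually_all.2 fun k => (hp k).eventually_gt_atTop 0

theorem tendsto_np (hn : Tendsto (fun i => (𝓜 i).n) l atTop)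
    (hp : ∀ k, Tendsto (fun i => (𝓜 i).p k) l atTop) (k : Fin K) :
    Tendsto (fun i => (𝓜 i).np k) l atTop := by
  refine tendsto_atTop_mono' l ?_ (tendsto_natCast_atTop_atTop.comp hn)
  filter_upwards [eventually_p_pos hp] with i hi
  refine le_mul_of_one_le_right (Nat.cast_nonneg _) ?_
  have : 0 < dimProdExcept (𝓜 i).p k := Finset.prod_pos fun l _ => hi l
  exact_mod_cast this

theorem tendsto_pTot (hp : ∀ k, Tendsto (fun i => (𝓜 i).p k) l atTop) (k : Fin K) :
    Tendsto (fun i => (𝓜 i).pTot) l atTop := by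
  refine tendsto_atTop_mono' l ?_ (tendsto_natCast_atTop_atTop.comp (hp k))
  filter_upwards [eventually_p_pos hp] with i hi
  rw [pTot_eq k]
  refine le_mul_of_one_le_right (Nat.cast_nonneg _) ?_
  have : 0 < dimProdExcept (𝓜 i).p k := Finset.prod_pos fun l _ => hi l
  exact_mod_cast this

theorem tendsto_inv_sqrt {f : ι → ℝ} (hf : Tendsto f l atTop) :
    Tendsto (fun i => (Real.sqrt (f i))⁻¹) l (𝓝 0) :=
  (Real.tendsto_sqrt_atTop.comp hf).inv_tendsto_atTop

theorem eventually_one_le_log (hn : Tendsto (fun i => (𝓜 i).n) l atTop)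
    (hp : ∀ k, Tendsto (fun i => (𝓜 i).p k) l atTop) :
    ∀ᶠ i in l, ∀ k, 1 ≤ Real.log ((𝓜 i).np k) :=
  eventually_all.2 fun k => (Real.tendsto_log_atTop.comp (tendsto_np hn hp k)).eventually_ge_atTop 1

variable (hn : Tendsto (fun i => (𝓜 i).n) l atTop)
  (hp : ∀ k, Tendsto (fun i => (𝓜 i).p k) l atTop)
include hn hp

theorem eventually_one_le_logFactor (s : DependenceSetting) :
    ∀ᶠ i in l, ∀ k, 1 ≤ (𝓜 i).logFactor s k := by
  cases s with
  | independent => exact eventually_one_le_log hn hp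
  | randomField =>
    filter_upwards [eventually_one_le_log hn hp, eventually_p_pos hp, hn.eventually_gt_atTop 0]
      with i hi hpi hni k
    have h1 : 0 < dimProdExcept (𝓜 i).p k := Finset.prod_pos fun l _ => hpi l
    have h2 : 0 < (𝓜 i).np k := by unfold np; positivity
    refine one_le_pow₀ ((hi k).trans (Real.log_le_log h2 ?_))
    rw [Regime.n_mul_pTot k]
    exact le_mul_of_one_le_left h2.le (by exact_mod_cast hpi k)

theorem eventually_ratio_pos (s : DependenceSetting) :
    ∀ᶠ i in l, ∀ k, 0 < (𝓜 i).np k / (𝓜 i).logFactor s k := by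
  filter_upwards [eventually_one_le_logFactor hn hp s,
    eventually_all.2 fun k => (tendsto_np hn hp k).eventually_gt_atTop 0] with i hi hi' k
  have := hi k
  have := hi' k
  positivity

variable (hM : ∀ k, Tendsto (fun i => M i * ((𝓜 i).tauScale s ε ω k)⁻¹ *
      Real.log ((𝓜 i).np k) ^ (1 / (2 * ε))) l (𝓝 0))
  (hMω : ∀ᶠ i in l, ω ≤ M i) (hε : 0 < ε) (hω : 0 < ω)
include hM hMω hε hω

/-- The bound on the factors is of smaller order than the truncation parameters. -/
theorem tendsto_bound_div_tauScale (k : Fin K) :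
    Tendsto (fun i => M i * ((𝓜 i).tauScale s ε ω k)⁻¹) l (𝓝 0) := by
  refine squeeze_zero' ?_ ?_ (hM k)
  · filter_upwards [eventually_ratio_pos hn hp s, hMω] with i hi hMi
    have := hi k
    have : 0 < M i := hω.trans_le hMi
    unfold tauScale
    positivity
  · filter_upwards [eventually_ratio_pos hn hp s, hMω, eventually_one_le_log hn hp] with i hi hMi hli
    have := hi k
    have : 0 < M i := hω.trans_le hMi
    refine le_mul_of_one_le_right (by unfold tauScale; positivity) ?_
    exact Real.one_le_rpow (hli k) (by positivity)

/-- Since `M ≥ ω`, the growth condition on `M` forces the truncation scale, hence `n p₋ₖ / L_k`, to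
infinity. For random fields this does not follow from the growth of the sizes alone, as `p_k` enters
`L_k` but not `n p₋ₖ`. -/
theorem tendsto_ratio_rpow (k : Fin K) :
    Tendsto (fun i => ((𝓜 i).np k / (𝓜 i).logFactor s k) ^ (-(1 / (2 + 2 * ε)))) l (𝓝 0) := by
  refine squeeze_zero' ?_ ?_ (tendsto_bound_div_tauScale hn hp hM hMω hε hω k)
  · filter_upwards [eventually_ratio_pos hn hp s] with i hi
    have := hi k
    positivity
  · filter_upwards [eventually_ratio_pos hn hp s, hMω] with i hi hMi
    have := hi k
    rw [Real.rpow_neg this.le, tauScale, mul_inv, ← mul_assoc]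
    refine le_mul_of_one_le_left (by positivity) ?_
    rw [← div_eq_mul_inv]
    exact (one_le_div hω).2 hMi

theorem eventually_one_le_ratio :
    ∀ᶠ i in l, ∀ k, 1 ≤ (𝓜 i).np k / (𝓜 i).logFactor s k := by
  filter_upwards [eventually_ratio_pos hn hp s, eventually_all.2 fun k =>
    (tendsto_ratio_rpow hn hp hM hMω hε hω k).eventually_lt_const one_pos] with i hi hi' k
  by_contra hlt
  have h1 := Real.one_le_rpow_of_pos_of_le_one_of_nonpos (hi k) (not_le.1 hlt).le
    (by have : 0 < 1 / (2 + 2 * ε) := by positivity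
        linarith : -(1 / (2 + 2 * ε)) ≤ 0)
  linarith [hi' k]

theorem tendsto_psi (k : Fin K) : Tendsto (fun i => (𝓜 i).psi s ε ω k) l (𝓝 0) := by
  have h1 := ((tendsto_ratio_rpow hn hp hM hMω hε hω k).rpow_const (p := 2 * ε)
    (Or.inr (by positivity))).const_mul (ω ^ 2)
  rw [Real.zero_rpow (by positivity), mul_zero] at h1
  refine h1.congr' ?_
  filter_upwards [eventually_ratio_pos hn hp s] with i hi
  have := hi k
  rw [psi, ← inv_div ((𝓜 i).np k), Real.inv_rpow this.le, ← Real.rpow_neg this.le, ← Real.rpow_mul this.le]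
  congr 2
  field_simp

theorem tendsto_psiBarExcept (k : Fin K) :
    Tendsto (fun i => (𝓜 i).psiBarExcept s ε ω k) l (𝓝 0) := by
  have := tendsto_finsetSum (Finset.univ.erase k)
    fun j _ => tendsto_psi hn hp hM hMω hε hω j
  rwa [Finset.sum_const_zero] at this

/-- The rate with `M` replaced by `1` still bounds the loss and tends to zero whatever the growth of
`M`. It serves for the near orthogonality of the rotation. -/
theorem tendsto_firstIterationRate_one (k : Fin K) :
    Tendsto (fun i => (𝓜 i).firstIterationRate s ε ω 1 k) l (𝓝 0) := by
  have hψ := tendsto_psi hn hp hM hMω hε hω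
  have hB := tendsto_psiBarExcept hn hp hM hMω hε hω k
  have h1 := tendsto_inv_sqrt (tendsto_np hn hp k)
  have h2 := (tendsto_pTot hp k).inv_tendsto_atTop
  have h3 := tendsto_inv_sqrt (tendsto_natCast_atTop_atTop (R := ℝ).comp hn)
  have h4 := tendsto_inv_sqrt (tendsto_natCast_atTop_atTop (R := ℝ).comp (hp k))
  have h5 := tendsto_inv_sqrt (tendsto_pTot hp k)
  cases s with
  | independent =>
    have h6 : Tendsto (fun i => (𝓜 i).psiBar .independent ε ω) l (𝓝 0) := by
      have := tendsto_finsetSum Finset.univ fun j _ => hψ j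
      rwa [Finset.sum_const_zero] at this
    have h7 := ((h1.max h2).max (hB.mul (((hψ k).mul h4).add h3))).max (h6.mul h5)
    simp only [mul_zero, add_zero, max_self] at h7
    refine h7.congr fun i => ?_
    simp [firstIterationRate, div_eq_mul_inv]
  | randomField =>
    have h7 := ((h1.max h2).max (hψ k)).max (hB.mul h3)
    simp only [mul_zero, max_self] at h7
    refine h7.congr fun i => ?_
    simp [firstIterationRate, div_eq_mul_inv]

variable (hτ₀ : ∀ i k, 0 < τ i k)
  (hτ : ∀ k, (fun i => τ i k) =Θ[l] (fun i => (𝓜 i).tauScale s ε ω k))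
include hτ₀ hτ

theorem exists_eventually_regime : ∃ c₁ c₂ : ℝ, 0 < c₁ ∧ 0 < c₂ ∧
    ∀ᶠ i in l, (𝓜 i).Regime s ε ω c₁ c₂ (τ i) := by
  choose a ha ha' using fun k => (hτ k).2.exists_pos
  choose b hb hb' using fun k => (hτ k).1.exists_pos
  refine ⟨1 + ∑ k, a k, 1 + ∑ k, b k, ?_, ?_, ?_⟩
  · have := Finset.sum_nonneg fun k (_ : k ∈ Finset.univ) => (ha k).le
    linarith
  · have := Finset.sum_nonneg fun k (_ : k ∈ Finset.univ) => (hb k).le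
    linarith
  filter_upwards [eventually_p_pos hp, hn.eventually_gt_atTop 0, eventually_one_le_log hn hp,
    eventually_ratio_pos hn hp s, eventually_one_le_ratio hn hp hM hMω hε hω,
    eventually_all.2 fun k => (ha' k).bound, eventually_all.2 fun k => (hb' k).bound]
    with i h1 h2 h3 h4 h5 h6 h7
  have hs : ∀ k, 0 < (𝓜 i).tauScale s ε ω k := fun k => by
    have := h4 k
    unfold tauScale
    positivity
  refine ⟨h1, h2, h3, fun k => ?_, fun k => ?_, h5⟩
  · have := h6 k
    rw [Real.norm_of_nonneg (hs k).le, Real.norm_of_nonneg (hτ₀ i k).le] at this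
    refine this.trans (mul_le_mul_of_nonneg_right ?_ (hτ₀ i k).le)
    have := Finset.single_le_sum (fun k (_ : k ∈ Finset.univ) => (ha k).le) (Finset.mem_univ k)
    linarith
  · have := h7 k
    rw [Real.norm_of_nonneg (hs k).le, Real.norm_of_nonneg (hτ₀ i k).le] at this
    refine this.trans (mul_le_mul_of_nonneg_right ?_ (hs k).le)
    have := Finset.single_le_sum (fun k (_ : k ∈ Finset.univ) => (hb k).le) (Finset.mem_univ k)
    linarith

/-- Bounded loadings make the common component at most a constant times `M`, and `M` is of smaller
order than `τ`, so eventually it stays below `τ / 2`. -/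
theorem eventually_noiseSetup {lam : ℝ} (hε₁ : ε < 1)
    (hload : ∀ᶠ i in l, (𝓜 i).LoadingAssumption lam)
    (hmom : ∀ᶠ i in l, (𝓜 i).MomentAssumption ε ω (M i)) :
    ∀ᶠ i in l, ∀ k, (𝓜 i).NoiseSetup ε ω (τ i k) := by
  obtain ⟨c₁, c₂, hc₁, hc₂, hreg⟩ := exists_eventually_regime hn hp hM hMω hε hω hτ₀ hτ
  set C : ℝ := Fintype.card (∀ k, Fin (r k)) * |lam| ^ K with hC
  have hC0 : 0 ≤ C := by positivity
  have hsm : ∀ k, ∀ᶠ i in l, M i * ((𝓜 i).tauScale s ε ω k)⁻¹ ≤ (2 * c₁ * (1 + C))⁻¹ := fun k =>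
    (tendsto_bound_div_tauScale hn hp hM hMω hε hω k).eventually_le_const (by positivity)
  filter_upwards [hreg, hload, hmom, eventually_ratio_pos hn hp s, eventually_all.2 hsm]
    with i hreg hload hmom hpos hsm k
  have hs : 0 < (𝓜 i).tauScale s ε ω k := by
    have := hpos k
    unfold tauScale
    positivity
  refine ⟨hε, hε₁, hω, hτ₀ i k, hmom.1, fun x t => ?_⟩
  have h1 := hreg.tau_ge k
  have h2 := hsm k
  rw [← div_eq_mul_inv, div_le_iff₀ hs] at h2
  have h3 : 0 ≤ M i := hω.le.trans hmom.2.2.2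
  calc _ ≤ C * tensorNorm ((𝓜 i).F t) := abs_tucker_le hload _ x
    _ ≤ C * M i := mul_le_mul_of_nonneg_left (hmom.2.2.1 t t.2) hC0
    _ ≤ (1 + C) * ((2 * c₁ * (1 + C))⁻¹ * (c₁ * τ i k)) :=
        mul_le_mul (by linarith) (h2.trans (by gcongr)) h3 (by positivity)
    _ = τ i k / 2 := by field_simp

end Asymptotic

end

end TensorFactorModel

/-! ### The stochastic bound on the loss. -/

namespace TensorFactorModel

noncomputable section

open scoped Matrix Matrix.Norms.Frobenius Kronecker

theorem exists_pos_le_all {K : ℕ} {r : Fin K → ℕ} {α : ∀ k, Fin (r k) → ℝ}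
    (hα : ∀ k j, 0 < α k j) : ∃ σ : ℝ, 0 < σ ∧ ∀ k j, σ ^ 2 ≤ α k j := by
  have hs : ∀ (k) (j : Fin (r k)), 0 ≤ (α k j)⁻¹ := fun k j => (inv_pos.2 (hα k j)).le
  set S : ℝ := ∑ k, ∑ j, (α k j)⁻¹ with hS
  have hS0 : 0 ≤ S := Finset.sum_nonneg fun k _ => Finset.sum_nonneg fun j _ => hs k j
  refine ⟨Real.sqrt (1 + S)⁻¹, Real.sqrt_pos.2 (by positivity), fun k j => ?_⟩
  rw [Real.sq_sqrt (by positivity)]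
  refine inv_le_of_inv_le₀ (hα k j) ?_
  have h1 : (α k j)⁻¹ ≤ ∑ j, (α k j)⁻¹ :=
    Finset.single_le_sum (fun j _ => hs k j) (Finset.mem_univ j)
  have h2 : ∑ j, (α k j)⁻¹ ≤ S :=
    Finset.single_le_sum (f := fun k => ∑ j, (α k j)⁻¹)
      (fun k _ => Finset.sum_nonneg fun j _ => hs k j) (Finset.mem_univ k)
  linarith

/-- Markov's inequality for a statistic with bounded mean. -/
theorem measure_le_of_integral_le {Ω : Type*} [MeasurableSpace Ω] {P : Measure Ω}
    [IsFiniteMeasure P] {Z : Ω → ℝ} (hZ : Integrable Z P) (hZ0 : ∀ w, 0 ≤ Z w) {B T δ : ℝ}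
    (hB : ∫ w, Z w ∂P ≤ B) (hT : 0 < T) (hδ : B ≤ δ * T) {A : Set Ω}
    (hA : ∀ w, Z w ≤ T → w ∉ A) : P A ≤ ENNReal.ofReal δ := by
  have h1 := mul_meas_ge_le_integral_of_nonneg (ae_of_all _ hZ0) hZ T
  have h2 : A ⊆ {w | T ≤ Z w} := fun w hw => by
    by_contra hlt
    exact hA w (not_le.1 hlt).le hw
  refine (measure_mono h2).trans ?_
  rw [← ofReal_measureReal]
  refine ENNReal.ofReal_le_ofReal ?_
  refine le_of_mul_le_mul_left ?_ hT
  linarith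

variable {ι : Type*} {l : Filter ι} {K : ℕ} {r : Fin K → ℕ}
  {Ω : ι → Type*} [∀ i, MeasurableSpace (Ω i)] {𝓜 : ∀ i, TensorFactorModel K r (Ω i)}
  {s : DependenceSetting} {ε ω lam c₀ cε : ℝ} {α β : ∀ k, Fin (r k) → ℝ}
  {M : ι → ℝ} {τ : ι → Fin K → ℝ}

set_option maxHeartbeats 1000000 in
/-- The loss of the first-iteration estimator is stochastically bounded by `lossRate`. -/
theorem exists_loss_isBigOP (hr : ∀ k, 0 < r k)
    (hε₀ : 0 < ε) (hε₁ : ε < 1) (hω : 0 < ω) (hc₀ : 0 < c₀) (hα : ∀ k j, 0 < α k j)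
    (hn : Tendsto (fun i => (𝓜 i).n) l atTop)
    (hp : ∀ k, Tendsto (fun i => (𝓜 i).p k) l atTop)
    (hload : ∀ᶠ i in l, (𝓜 i).LoadingAssumption lam)
    (hfac : ∀ᶠ i in l, (𝓜 i).FactorAssumption α β)
    (hmom : ∀ᶠ i in l, (𝓜 i).MomentAssumption ε ω (M i))
    (hdep : ∀ᶠ i in l, (𝓜 i).DependenceAssumption s ε ω c₀ cε)
    (hτ₀ : ∀ i k, 0 < τ i k)
    (hτ : ∀ k, (fun i => τ i k) =Θ[l] (fun i => (𝓜 i).tauScale s ε ω k))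
    (hM : ∀ k, Tendsto (fun i => M i * ((𝓜 i).tauScale s ε ω k)⁻¹ *
      Real.log ((𝓜 i).np k) ^ (1 / (2 * ε))) l (𝓝 0))
    {Ehat : ∀ i, Ω i → ∀ k, Matrix (Fin ((𝓜 i).p k)) (Fin (r k)) ℝ}
    (hEhat : ∀ᶠ i in l, ∀ w k,
      IsLeadingEigenvectors ((𝓜 i).gammaHat (τ i k) k w) (Ehat i w k))
    {k : Fin K}
    {Echeck : ∀ i, Ω i → Matrix (Fin ((𝓜 i).p k)) (Fin (r k)) ℝ}
    (hEcheck : ∀ᶠ i in l, ∀ w,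
      IsLeadingEigenvectors ((𝓜 i).gammaCheck (τ i k) k (Ehat i w) w) (Echeck i w)) :
    ∃ C : ℝ, 0 < C ∧ IsBigOP l (fun i => (𝓜 i).P)
      (fun i w => ‖(1 - (𝓜 i).loadMat k * ((𝓜 i).loadMat k)ᵀ) * Echeck i w‖)
      (fun i => (𝓜 i).lossRate s ε ω C (τ i) k) := by
  have hMω : ∀ᶠ i in l, ω ≤ M i := hmom.mono fun i h => h.2.2.2
  obtain ⟨c₁, c₂, hc₁, hc₂, hreg⟩ := exists_eventually_regime hn hp hM hMω hε₀ hω hτ₀ hτ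
  have hset := eventually_noiseSetup hn hp hM hMω hε₀ hω hτ₀ hτ hε₁ hload hmom
  obtain ⟨C₁, C, hC₁, hC, hbounds⟩ := exists_noiseBounds (c₁ := c₁) hε₀ hε₁ hω s r hc₀ hc₂
  obtain ⟨Cb, hCb, hbias⟩ := exists_biasBound_le_psi hε₀ hω r hc₁
  obtain ⟨σ, hσ, hσα⟩ := exists_pos_le_all hα
  refine ⟨C, hC, fun δ hδ => ?_⟩
  -- Markov's inequality for a statistic of mean at most `3K + 4` then gives exceptional probability
  -- at most `δ`. As `t` depends only on `δ` and `K`, the smallness conditions below hold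
  -- eventually.
  set t : ℝ := Real.sqrt ((3 * K + 4) / δ) with ht
  have hT0 : (0 : ℝ) < (3 * K + 4) / δ := by positivity
  have ht2 : t ^ 2 = (3 * K + 4) / δ := Real.sq_sqrt hT0.le
  have ht0 : 0 ≤ t := Real.sqrt_nonneg _
  set D : ℝ := Real.sqrt C₁ * ω with hD
  have hD0 : 0 ≤ D := by positivity
  -- the quantities that tend to zero
  have hψ := tendsto_psi hn hp hM hMω hε₀ hω
  have hb0 : ∀ j, Tendsto (fun i => Cb * (𝓜 i).psi s ε ω j) l (𝓝 0) := fun j => by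
    simpa using (hψ j).const_mul Cb
  have hν0 : ∀ j, Tendsto (fun i => C * (𝓜 i).psi s ε ω j) l (𝓝 0) := fun j => by
    simpa using (hψ j).const_mul C
  have hη0 : ∀ j, Tendsto (fun i => (Real.sqrt ((𝓜 i).np j))⁻¹) l (𝓝 0) := fun j =>
    tendsto_inv_sqrt (tendsto_np hn hp j)
  have hμ0 : ∀ j, Tendsto (fun i => C₁ / ((𝓜 i).p j : ℝ)) l (𝓝 0) := fun j =>
    (tendsto_natCast_atTop_atTop.comp (hp j)).const_div_atTop C₁
  have hbb : ∀ j, Tendsto (fun i => biasBound ε ω (τ i j)) l (𝓝 0) := fun j => by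
    refine squeeze_zero' ?_ ?_ (hb0 j)
    · filter_upwards with i
      have := hτ₀ i j
      unfold biasBound
      positivity
    · filter_upwards [hreg] with i hi using hbias (𝓜 i) s c₂ (τ i) hi j
  have hb1 : ∀ j, ∀ᶠ i in l, biasBound ε ω (τ i j) ≤ 1 := fun j =>
    (hbb j).eventually_le_const one_pos
  have hsmall : ∀ j, ∀ᶠ i in l, 2 * biasBound ε ω (τ i j) ^ 2 +
      2 * (t * (C * (𝓜 i).psi s ε ω j) + C₁ / ((𝓜 i).p j : ℝ)) ≤ (σ / 4) ^ 2 := fun j => by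
    have h1 := (((hbb j).pow 2).const_mul 2).add
      ((((hν0 j).const_mul t).add (hμ0 j)).const_mul 2)
    refine h1.eventually_le_const ?_
    simp only [ne_eq, OfNat.ofNat_ne_zero, not_false_eq_true, zero_pow, mul_zero, add_zero]
    positivity
  have hinit : ∀ᶠ i in l, ω * (2 * Fintype.card (OtherIndex r k) * ∑ j ∈ Finset.univ.erase k,
      initialLossBound (r j) σ ω D t (Real.sqrt ((𝓜 i).np j))⁻¹ (C * (𝓜 i).psi s ε ω j)
        (biasBound ε ω (τ i j)) (C₁ / ((𝓜 i).p j : ℝ))) ≤ σ / 4 := by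
    have h1 : ∀ j, Tendsto (fun i => initialLossBound (r j) σ ω D t (Real.sqrt ((𝓜 i).np j))⁻¹
        (C * (𝓜 i).psi s ε ω j) (biasBound ε ω (τ i j)) (C₁ / ((𝓜 i).p j : ℝ))) l (𝓝 0) :=
      fun j => by
        have h2 := (((((hη0 j).const_mul D).const_mul t).const_mul (r j : ℝ)).add
          ((((hν0 j).const_mul t).add (hμ0 j)).const_mul (r j : ℝ))).add
          ((hbb j).mul_const (r j * (ω + 1 + 2 * (t * (2 * ω)))))
        have h3 := h2.const_mul (σ ^ 2 / 4)⁻¹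
        simp only [mul_zero, zero_mul, add_zero] at h3
        exact h3
    have h2 := tendsto_finsetSum (Finset.univ.erase k) fun j _ => h1 j
    rw [Finset.sum_const_zero] at h2
    have h3 := (h2.const_mul (2 * (Fintype.card (OtherIndex r k) : ℝ))).const_mul ω
    rw [mul_zero, mul_zero] at h3
    exact h3.eventually_le_const (by positivity)
  refine ⟨max 1 (lossConst r k σ ω D C₁ t), by positivity, ?_⟩
  filter_upwards [hload, hfac, hmom, hdep, hreg, hset, hEhat, hEcheck, eventually_all.2 hb1,
    eventually_all.2 hsmall, hinit] with i hload hfac hmom hdep hreg hset hEhat hEcheck hb1 hsmall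
    hinit
  have hnb := fun j => hbounds (𝓜 i) (τ i) hreg hdep.mixing j (hset j)
  have hpi := hreg.p_pos
  have hU := loadMat_orthonormal hload
  have hG := frobenius_sq_factorMat_le hU hmom
  have hψi := hreg.psi_pos hω
  have := (𝓜 i).isProb
  obtain ⟨w₀⟩ : Nonempty (Ω i) := nonempty_of_isProbabilityMeasure (𝓜 i).P
  -- The deterministic comparison eigenvectors. They exist since `r j ≤ p j`, which is part of the
  -- definition of the estimator at any single sample point.
  have hE₀ : ∀ j, ∃ E : Matrix (Fin ((𝓜 i).p j)) (Fin (r j)) ℝ, IsLeadingEigenvectors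
      ((𝓜 i).loadMat j * (𝓜 i).factorMat j * ((𝓜 i).loadMat j * (𝓜 i).factorMat j)ᵀ +
        (𝓜 i).meanGram (τ i j) j 1) E := fun j => by
    obtain ⟨hrp, -⟩ := hEhat w₀ j
    refine exists_isLeadingEigenvectors ?_ hrp
    rw [Matrix.transpose_add, meanGram_transpose j Matrix.transpose_one, Matrix.transpose_mul,
      Matrix.transpose_transpose]
  choose E₀ hE₀ using hE₀
  have hfl : ∀ j, 0 < (𝓜 i).fluctRate s ε ω j := fun j => by
    have h1 := hψi j
    have h2 := hreg.np_pos j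
    have h3 := hreg.pTot_pos
    cases s with
    | independent => unfold fluctRate; positivity
    | randomField => exact h1
  have htr : ∀ j, 0 < (𝓜 i).totalRate s ε ω j := fun j => by
    have h1 := hψi j
    have h2 : (0 : ℝ) < (𝓜 i).n := Nat.cast_pos.2 hreg.n_pos
    cases s with
    | independent => unfold totalRate; positivity
    | randomField => unfold totalRate; positivity
  have hφ : ∀ j, 0 < C * (𝓜 i).fluctRate s ε ω j := fun j => mul_pos hC (hfl j)
  have hχ : ∀ j, 0 < C * (𝓜 i).totalRate s ε ω j := fun j => mul_pos hC (htr j)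
  have hν : ∀ j, 0 < C * (𝓜 i).psi s ε ω j := fun j => mul_pos hC (hψi j)
  obtain ⟨Z, hZi, hZ0, hZ, hev⟩ := exists_noiseStat (k := k) hC₁ hν (hφ k) (hχ k) hset hnb hpi
    hreg.n_pos hG (kronExcept_orthonormal k fun j => (hE₀ j).orthonormal)
  have hrate : 0 ≤ (𝓜 i).lossRate s ε ω C (τ i) k := by
    have hbp : ∀ j, 0 ≤ biasBound ε ω (τ i j) := fun j => by
      have := hτ₀ i j
      unfold biasBound
      positivity
    have h1 := hφ k
    have h2 := hχ k
    have h3 := hbp k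
    have h4 := hreg.pTot_pos
    have h5 : 0 ≤ ∑ j ∈ Finset.univ.erase k, ((Real.sqrt ((𝓜 i).np j))⁻¹ +
        C * (𝓜 i).psi s ε ω j + biasBound ε ω (τ i j)) := Finset.sum_nonneg fun j _ => by
      have := hν j
      have := hbp j
      positivity
    unfold lossRate
    positivity
  refine measure_le_of_integral_le hZi hZ0 hZ (T := t ^ 2) (by rw [ht2]; exact hT0)
    (by rw [ht2]; exact (mul_div_cancel₀ _ hδ.ne').ge) fun w hw => ?_
  rw [Set.mem_ofPred_eq, not_lt, abs_norm]
  refine (first_iteration_loss_le hr hset (fun j => (hnb j).corr) hC₁.le hpi hreg.n_pos hσ ht0 hD0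
    hU hG (factorMat_form_ge hU hfac hσα) (fun j => le_rfl) hb1 (fun j => (hν j).le) (hφ k).le
    (hχ k).le hsmall hinit hE₀ (hev t w ht0 hw) (hEhat w) (hEcheck w)).trans ?_
  exact mul_le_mul_of_nonneg_right (le_max_right _ _) hrate

end

end TensorFactorModel

/-! ### The rotation matrix, stochastic orders and the conclusion. -/

section Rotation

open scoped Matrix Matrix.Norms.Frobenius

theorem abs_entry_le_frobenius {m n : Type*} [Fintype m] [Fintype n] (A : Matrix m n ℝ) (a : m)
    (b : n) : |A a b| ≤ ‖A‖ := by
  refine abs_le_of_sq_le_sq ?_ (norm_nonneg _)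
  rw [frobenius_sq]
  exact (Finset.single_le_sum (f := fun j => A a j ^ 2) (fun _ _ => sq_nonneg _)
    (Finset.mem_univ b)).trans (Finset.single_le_sum (f := fun i => ∑ j, A i j ^ 2)
    (fun _ _ => Finset.sum_nonneg fun _ _ => sq_nonneg _) (Finset.mem_univ a))

/-- The rotation `Uᵀ E` of an orthonormal matrix `E` is almost orthogonal when the columns of `E`
are almost in the span of `U`. -/
theorem abs_rotation_sub_one_le {p r : ℕ} {U E : Matrix (Fin p) (Fin r) ℝ} (hE : Eᵀ * E = 1)
    (a b : Fin r) : |((Uᵀ * E)ᵀ * (Uᵀ * E) - 1 : Matrix (Fin r) (Fin r) ℝ) a b| ≤ r * ‖(1 - U * Uᵀ) * E‖ := by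
  have h1 : (Uᵀ * E)ᵀ * (Uᵀ * E) - 1 = -(Eᵀ * ((1 - U * Uᵀ) * E)) := by
    rw [Matrix.transpose_mul, Matrix.transpose_transpose, Matrix.sub_mul, Matrix.one_mul,
      Matrix.mul_sub, hE, neg_sub]
    simp only [Matrix.mul_assoc]
  rw [h1]
  refine (abs_entry_le_frobenius _ a b).trans ?_
  rw [norm_neg]
  refine (Matrix.frobenius_norm_mul _ _).trans ?_
  rw [Matrix.frobenius_norm_transpose]
  exact mul_le_mul_of_nonneg_right (frobenius_le_of_orthonormal hE) (norm_nonneg _)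

end Rotation

theorem IsBigOP.mono_rate {ι : Type*} {l : Filter ι} {Ω : ι → Type*} [∀ i, MeasurableSpace (Ω i)]
    {P : ∀ i, Measure (Ω i)} {Y Y' : ∀ i, Ω i → ℝ} {a a' : ι → ℝ} {c : ℝ} (hc : 0 < c)
    (h : IsBigOP l P Y a) (hY : ∀ᶠ i in l, ∀ w, |Y' i w| ≤ |Y i w|)
    (ha : ∀ᶠ i in l, a i ≤ c * a' i) : IsBigOP l P Y' a' := by
  intro δ hδ
  obtain ⟨C, hC, hP⟩ := h δ hδ
  refine ⟨C * c, by positivity, ?_⟩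
  filter_upwards [hP, hY, ha] with i hP hY ha
  refine (measure_mono fun w hw => ?_).trans hP
  have h1 : C * c * a' i < |Y' i w| := hw
  have h2 := mul_le_mul_of_nonneg_left ha hC.le
  have h3 := hY w
  change C * a i < |Y i w|
  linarith

theorem IsBigOP.isLittleOPOne {ι : Type*} {l : Filter ι} {Ω : ι → Type*}
    [∀ i, MeasurableSpace (Ω i)] {P : ∀ i, Measure (Ω i)} {Y Y' : ∀ i, Ω i → ℝ} {a : ι → ℝ} {c : ℝ}
    (h : IsBigOP l P Y a) (ha : Tendsto a l (𝓝 0)) (hc : 0 ≤ c)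
    (hY : ∀ᶠ i in l, ∀ w, |Y' i w| ≤ c * |Y i w|) : IsLittleOPOne l P Y' := by
  intro δ hδ
  rw [ENNReal.tendsto_nhds_zero]
  intro e he
  obtain ⟨x, hx0, hxe⟩ := ENNReal.lt_iff_exists_nnreal_btwn.1 he
  obtain ⟨C, hC, hP⟩ := h x (by exact_mod_cast hx0)
  have h0 : Tendsto (fun i => c * (C * a i)) l (𝓝 0) := by
    simpa using (ha.const_mul C).const_mul c
  filter_upwards [hP, hY, h0.eventually_le_const hδ] with i hP hY h0
  rw [ENNReal.ofReal_coe_nnreal] at hP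
  refine ((measure_mono fun w hw => ?_).trans hP).trans hxe.le
  change C * a i < |Y i w|
  have h1 : δ < |Y' i w| := hw
  have h2 := hY w
  by_contra hle
  have h3 := mul_le_mul_of_nonneg_left (not_lt.1 hle) hc
  linarith

namespace TensorFactorModel

noncomputable section

open scoped Matrix Matrix.Norms.Frobenius

variable {K : ℕ} {r : Fin K → ℕ} {Ω : Type*} [MeasurableSpace Ω]
  {m : TensorFactorModel K r Ω}

/-- For the rotation `Uᵀ E` the loading error is exactly `√p_k (1 - U Uᵀ) E`. -/
theorem scaled_loading_error_le (hp : ∀ k, 0 < m.p k) (k : Fin K)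
    (E : Matrix (Fin (m.p k)) (Fin (r k)) ℝ) :
    |1 / Real.sqrt (m.p k) *
      specNorm (Real.sqrt (m.p k) • E - m.Λ k * ((m.loadMat k)ᵀ * E))| ≤
      ‖(1 - m.loadMat k * (m.loadMat k)ᵀ) * E‖ := by
  have hs : 0 < Real.sqrt (m.p k) := Real.sqrt_pos.2 (Nat.cast_pos.2 (hp k))
  have h1 : Real.sqrt (m.p k) • E - m.Λ k * ((m.loadMat k)ᵀ * E) =
      Real.sqrt (m.p k) • ((1 - m.loadMat k * (m.loadMat k)ᵀ) * E) := by
    rw [← smul_loadMat hp k, Matrix.smul_mul, ← smul_sub, Matrix.sub_mul, Matrix.one_mul,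
      Matrix.mul_assoc, ← Matrix.mul_assoc]
  have h2 := specNorm_le_frobenius (Real.sqrt (m.p k) • ((1 - m.loadMat k * (m.loadMat k)ᵀ) * E))
  rw [norm_smul, Real.norm_of_nonneg hs.le] at h2
  have h3 : 0 ≤ specNorm (Real.sqrt (m.p k) • ((1 - m.loadMat k * (m.loadMat k)ᵀ) * E)) := by
    unfold specNorm
    exact @norm_nonneg _ (Matrix.instL2OpNormedAddCommGroup.toSeminormedAddCommGroup.toSeminormedAddGroup) _
  rw [h1, abs_of_nonneg (by positivity), one_div, inv_mul_le_iff₀ hs]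
  exact h2

end

end TensorFactorModel

/-- The index `i`, together with the filter `l`, runs through the sample sizes `(n, p₁, …, p_K)`
(for instance along a sequence, or through all of them), with `min(n, p₁, …, p_K) → ∞` along `l`;
each `𝓜 i` is a tensor factor model of that size and all constants are common to them. -/
theorem theorem2
    {ι : Type*} (l : Filter ι)
    {K : ℕ} {r : Fin K → ℕ} (hr : ∀ k, 0 < r k)
    {Ω : ι → Type*} [∀ i, MeasurableSpace (Ω i)]
    (𝓜 : ∀ i, TensorFactorModel K r (Ω i))
    (s : DependenceSetting)
    -- the constants
    (ε ω lam c₀ cε : ℝ) (hε₀ : 0 < ε) (hε₁ : ε < 1) (hω : 0 < ω) (hc₀ : 0 < c₀) (hcε : 0 < cε)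
    (α β : ∀ k, Fin (r k) → ℝ) (hα : ∀ k j, 0 < α k j)
    (hαβ : ∀ k (j j' : Fin (r k)), j < j' → β k j' < α k j)
    (M : ι → ℝ)
    -- `min(n, p₁, …, p_K) → ∞`
    (hn : Tendsto (fun i => (𝓜 i).n) l atTop)
    (hp : ∀ k, Tendsto (fun i => (𝓜 i).p k) l atTop)
    -- the assumptions on the model
    (hload : ∀ᶠ i in l, (𝓜 i).LoadingAssumption lam)
    (hfac : ∀ᶠ i in l, (𝓜 i).FactorAssumption α β)
    (hmom : ∀ᶠ i in l, (𝓜 i).MomentAssumption ε ω (M i))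
    (hdep : ∀ᶠ i in l, (𝓜 i).DependenceAssumption s ε ω c₀ cε)
    -- the truncation parameter of each mode, and the growth condition on `M`
    (τ : ι → Fin K → ℝ) (hτ₀ : ∀ i k, 0 < τ i k)
    (hτ : ∀ k, (fun i => τ i k) =Θ[l] (fun i => (𝓜 i).tauScale s ε ω k))
    (hM : ∀ k, Tendsto (fun i => M i * ((𝓜 i).tauScale s ε ω k)⁻¹ *
      Real.log ((𝓜 i).np k) ^ (1 / (2 * ε))) l (𝓝 0))
    -- the initial estimators of all modes (leading eigenvectors)
    (Ehat : ∀ i, Ω i → ∀ k, Matrix (Fin ((𝓜 i).p k)) (Fin (r k)) ℝ)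
    (hEhat_meas : ∀ i k a j, Measurable fun w => Ehat i w k a j)
    (hEhat : ∀ᶠ i in l, ∀ w k,
      IsLeadingEigenvectors ((𝓜 i).gammaHat (τ i k) k w) (Ehat i w k))
    -- the first-iteration estimator of mode `k` (leading eigenvectors after projection)
    (k : Fin K)
    (Echeck : ∀ i, Ω i → Matrix (Fin ((𝓜 i).p k)) (Fin (r k)) ℝ)
    (hEcheck_meas : ∀ i a j, Measurable fun w => Echeck i w a j)
    (hEcheck : ∀ᶠ i in l, ∀ w,
      IsLeadingEigenvectors ((𝓜 i).gammaCheck (τ i k) k (Ehat i w) w) (Echeck i w)) :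
    ∃ H : ∀ i, Ω i → Matrix (Fin (r k)) (Fin (r k)) ℝ,
      (∀ i a b, Measurable fun w => H i w a b) ∧
      (∀ a b, IsLittleOPOne l (fun i => (𝓜 i).P) fun i w =>
        ((H i w).transpose * H i w - 1) a b) ∧
      IsBigOP l (fun i => (𝓜 i).P)
        (fun i w => 1 / Real.sqrt ((𝓜 i).p k) *
          specNorm (Real.sqrt ((𝓜 i).p k) • Echeck i w - (𝓜 i).Λ k * H i w))
        (fun i => (𝓜 i).firstIterationRate s ε ω (M i) k) := by
  have hMω : ∀ᶠ i in l, ω ≤ M i := hmom.mono fun i h => h.2.2.2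
  obtain ⟨c₁, c₂, hc₁, -, hreg⟩ := TensorFactorModel.exists_eventually_regime hn hp hM hMω hε₀ hω
    hτ₀ hτ
  obtain ⟨C, hC, hloss⟩ := TensorFactorModel.exists_loss_isBigOP hr hε₀ hε₁ hω hc₀ hα hn hp hload
    hfac hmom hdep hτ₀ hτ hM hEhat hEcheck
  -- This value of `a` works because `M ≥ ω` and `1 - ε > 0`.
  obtain ⟨C', hC', hrate⟩ := TensorFactorModel.exists_lossRate_le (C := C)
    (a := (ω ^ (1 - ε))⁻¹) hε₀ hε₁ hω r s hc₁ hC (by positivity)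
  -- The same comparison at `M = 1`, giving a vanishing bound on the loss for the claim about `Hᵀ
  -- H`.
  obtain ⟨C'', hC'', hrate_one⟩ := TensorFactorModel.exists_lossRate_le (C := C) (a := 1)
    hε₀ hε₁ hω r s hc₁ hC one_pos
  have hone := hloss.mono_rate (a' := fun i => (𝓜 i).firstIterationRate s ε ω 1 k) hC''
    (Eventually.of_forall fun i w => le_rfl)
    (hreg.mono fun i h => hrate_one (𝓜 i) c₂ 1 (τ i) h (by simp) k)
  refine ⟨fun i w => ((𝓜 i).loadMat k).transpose * Echeck i w, fun i a b => ?_, fun a b => ?_, ?_⟩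
  · simp only [Matrix.mul_apply]
    exact Finset.measurable_sum _ fun j _ => (hEcheck_meas i j b).const_mul _
  · refine hone.isLittleOPOne (c := r k)
      (TensorFactorModel.tendsto_firstIterationRate_one hn hp hM hMω hε₀ hω k)
      (Nat.cast_nonneg _) ?_
    filter_upwards [hEcheck] with i hi w
    exact (abs_rotation_sub_one_le (hi w).orthonormal a b).trans
      (mul_le_mul_of_nonneg_left (le_abs_self _) (Nat.cast_nonneg _))
  · refine hloss.mono_rate hC' ?_ ?_
    · filter_upwards [hreg] with i hi w
      exact (TensorFactorModel.scaled_loading_error_le hi.p_pos k _).trans (le_abs_self _)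
    · filter_upwards [hreg, hMω] with i hi hMi
      refine hrate (𝓜 i) c₂ (M i) (τ i) hi ?_ k
      rw [inv_mul_eq_div, one_le_div (by positivity)]
      exact Real.rpow_le_rpow hω.le hMi (by linarith)
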